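/- **Setting.** Let $G$ be a Lie group with semisimple Lie algebra $\mathfrak g$ and Killing form $\langle\cdot,\cdot\rangle_{\mathfrak g}$, let $\pi:P\to M$ be a smooth principal $G$-bundle (second countable Hausdorff manifolds, a boundary is allowed) with a fixed principal connection $A$, exterior covariant derivative $D$ and curvature $F\in\Omega^2(M,\mathfrak g_P)$. Metrics may have any signature. For a metric $g$, $\mathrm{Ric}$, $\mathcal R(g)$ and $\nabla$ are the Ricci tensor, the scalar curvature and the covariant derivative of its Levi-Civita connection, $\delta_g=(-1)^{p}\ast_g^{-1}d\,\ast_g$ on $p$-forms, $\Delta_g\phi=-\delta_g d\phi$, $\langle\cdot,\cdot\rangle_g$ is the induced scalar product of forms ($\frac1{p!}\alpha_{i_1\dots i_p}\beta^{i_1\dots i_p}$), and $\langle\!\langle\cdot,\cdot\rangle\!\rangle$ is its combination with $\langle\cdot,\cdot\rangle_{\mathfrak g}$ on $\mathfrak g_P$-valued forms. A tuple of smooth fields is a *critical point* of an action $S=\int \mathcal L\,d\mathrm{vol}_g$ if for every compact subset $K$ of the interior of the manifold and all smooth variations of the fields that vanish outside $K$ one has $\frac{d}{d\epsilon}\big|_{\epsilon=0}\int_K\mathcal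 L\,d\mathrm{vol}_g=0$ along fields $+\,\epsilon\cdot$variations. **Theorem, part 1.** Let $H\in\Omega^3(P)$, $\Lambda\in\mathbb R$, let $g$ be a metric on $P$, $B\in\Omega^2(P)$, $\phi\in C^\infty(P)$, and put $H'=H+dB$. Then $(g,B,\phi)$ is a critical point of $$S[g,B,\phi]=\int_P e^{-2\phi}\{\mathcal R(g)-\tfrac12\langle H',H'\rangle_g+4\langle d\phi,d\phi\rangle_g-2\Lambda\}\,d\mathrm{vol}_g$$ if and only if $\beta_g=\beta_B=\beta_\phi=0$, where $$\beta_g(X,Y)=\mathrm{Ric}(X,Y)-\tfrac12\langle i_XH',i_YH'\rangle_g+(\nabla_Xd\phi)(Y)+(\nabla_Yd\phi)(X),$$ $$\beta_B=\tfrac12e^{2\phi}\delta_g(e^{-2\phi}H'),\qquad \beta_\phi=\mathcal R(g)-\tfrac12\langle H',H'\rangle_g+4\Delta_g\phi-4\langle d\phi,d\phi\rangle_g-2\Lambda.$$ **Part 2.** Let $H_0\in\Omega^3(M)$, $\Lambda_0\in\mathbb R$, let $g_0$ be a metric on $M$, $B_0\in\Omega^2(M)$, $\phi_0\in C^\infty(M)$,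 $\vartheta\in\Omega^1(M,\mathfrak g_P)$, and put $$F'=F+D\vartheta+\tfrac12[\vartheta\wedge\vartheta]_{\mathfrak g},\qquad H_0'=H_0+dB_0-\tfrac12\tilde C_3(\vartheta)-\langle F\wedge\vartheta\rangle_{\mathfrak g},$$ $$\tilde C_3(\vartheta)=\langle D\vartheta\wedge\vartheta\rangle_{\mathfrak g}+\tfrac13\langle[\vartheta\wedge\vartheta]_{\mathfrak g}\wedge\vartheta\rangle_{\mathfrak g}.$$ Then $(g_0,B_0,\phi_0,\vartheta)$ is a critical point of $$S_0=\int_M e^{-2\phi_0}\{\mathcal R(g_0)+\tfrac12\langle\!\langle F',F'\rangle\!\rangle-\tfrac12\langle H_0',H_0'\rangle_{g_0}+4\langle d\phi_0,d\phi_0\rangle_{g_0}-2\Lambda_0\}\,d\mathrm{vol}_{g_0}$$ if and only if $\beta'_{g_0}=\beta'_{B_0}=\beta'_{\phi_0}=\beta'_\vartheta=0$, where, with $\nabla^0$ and $\mathrm{Ric}_0$ those of $g_0$, $$\beta'_{g_0}(X,Y)=\mathrm{Ric}_0(X,Y)+\tfrac12\langle\!\langle i_XF',i_YF'\rangle\!\rangle-\tfrac12\langle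 i_XH_0',i_YH_0'\rangle_{g_0}+(\nabla^0_Xd\phi_0)(Y)+(\nabla^0_Yd\phi_0)(X),$$ $$\beta'_{\phi_0}=\mathcal R(g_0)+\tfrac12\langle\!\langle F',F'\rangle\!\rangle-\tfrac12\langle H_0',H_0'\rangle_{g_0}+4\Delta_{g_0}\phi_0-4\langle d\phi_0,d\phi_0\rangle_{g_0}-2\Lambda_0,$$ $$\beta'_{B_0}=\tfrac12e^{2\phi_0}\delta_{g_0}(e^{-2\phi_0}H_0'),\qquad \beta'_\vartheta=\tfrac12\big\{e^{2\phi_0}D'^{\dagger}(e^{-2\phi_0}F')+\langle i_{e_k}H_0',F'\rangle_{g_0}\,e^k\big\}.$$ Here $\{e_k\}$ is any local frame with dual coframe $\{e^k\}$, and $D'^\dagger=(-1)^{p}\ast_{g_0}^{-1}D'\ast_{g_0}$ on $\mathfrak g_P$-valued $p$-forms, for $D'\omega=D\omega+[\vartheta\wedge\omega]_{\mathfrak g}$. -/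

import Mathlib

open scoped Manifold ContDiff
open MeasureTheory

noncomputable section

namespace StringEOM

/-- `ℝⁿ` with its Euclidean structure (the model space of `n`-dimensional manifolds). -/
abbrev Euc (n : ℕ) : Type := EuclideanSpace ℝ (Fin n)

/-- The standard basis vectors of `ℝⁿ`. -/
abbrev ee {n : ℕ} (i : Fin n) : Euc n := EuclideanSpace.single i (1 : ℝ)

/-! ### Multilinear algebra on one tangent space -/

section Algebra

variable {n k : ℕ} {V W U : Type*} [NormedAddCommGroup V] [NormedSpace ℝ V]
  [NormedAddCommGroup W] [NormedSpace ℝ W] [NormedAddCommGroup U] [NormedSpace ℝ U]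

/-- The matrix `b_{ij} = b(e_i, e_j)` of a bilinear form. -/
def gram (b : Euc n →L[ℝ] Euc n →L[ℝ] ℝ) : Matrix (Fin n) (Fin n) ℝ :=
  Matrix.of fun i j => b (ee i) (ee j)

/-- The pullback of a bilinear form. -/
def pullBilin (b : Euc n →L[ℝ] Euc n →L[ℝ] ℝ) (f : Euc n →L[ℝ] Euc n) :
    Euc n →L[ℝ] Euc n →L[ℝ] ℝ :=
  b.bilinearComp f f

/-- The scalar product of `k`-forms induced by the metric `b`, combined with a bilinear pairing `κ`
of the values: `(1/k!) b^{i₁j₁} ⋯ b^{i_k j_k} κ(α_{i₁…i_k}, β_{j₁…j_k})`. -/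
def pairing (b : Euc n →L[ℝ] Euc n →L[ℝ] ℝ) (κ : V →ₗ[ℝ] W →ₗ[ℝ] U)
    (α : Euc n [⋀^Fin k]→L[ℝ] V) (β : Euc n [⋀^Fin k]→L[ℝ] W) : U :=
  (k.factorial : ℝ)⁻¹ • ∑ J : Fin k → Fin n, ∑ L : Fin k → Fin n,
    (∏ a, (gram b)⁻¹ (J a) (L a)) • κ (α fun a => ee (J a)) (β fun a => ee (L a))

/-- The scalar product `⟨α, β⟩_b` of real `k`-forms. -/
def formInner (b : Euc n →L[ℝ] Euc n →L[ℝ] ℝ) (α β : Euc n [⋀^Fin k]→L[ℝ] ℝ) : ℝ :=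
  pairing b (LinearMap.mul ℝ ℝ) α β

/-- A `1`-form as a linear map. -/
def toLin (α : Euc n [⋀^Fin 1]→L[ℝ] V) : Euc n →L[ℝ] V :=
  (ContinuousAlternatingMap.ofSubsingleton ℝ (Euc n) V (0 : Fin 1)).symm α

/-- A linear map as a `1`-form. -/
def ofLin (α : Euc n →L[ℝ] V) : Euc n [⋀^Fin 1]→L[ℝ] V :=
  ContinuousAlternatingMap.ofSubsingleton ℝ (Euc n) V (0 : Fin 1) α

/-- The map `u ↦ (w ↦ κ(α(u), β(w)))`, for a `1`-form `α` and a `k`-form `β`. -/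
def oneTensor (κ : V →L[ℝ] W →L[ℝ] U) (α : Euc n [⋀^Fin 1]→L[ℝ] V)
    (β : Euc n [⋀^Fin k]→L[ℝ] W) : Euc n →L[ℝ] Euc n [⋀^Fin k]→L[ℝ] U :=
  LinearMap.toContinuousLinearMap
    { toFun := fun u => (κ (toLin α u)).compContinuousAlternatingMap β
      map_add' := fun u v => by ext w; simp
      map_smul' := fun c u => by ext w; simp }

/-- The wedge product `κ(α ∧ β)` of a `1`-form `α` and a `k`-form `β` (values multiplied by `κ`):
`(u₀, …, u_k) ↦ ∑ₐ (-1)ᵃ κ(α(uₐ), β(u₀, …, ûₐ, …, u_k))`. -/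
def wedge (κ : V →L[ℝ] W →L[ℝ] U) (α : Euc n [⋀^Fin 1]→L[ℝ] V)
    (β : Euc n [⋀^Fin k]→L[ℝ] W) : Euc n [⋀^Fin (k + 1)]→L[ℝ] U :=
  ContinuousAlternatingMap.alternatizeUncurryFin (oneTensor κ α β)

/-- The vector `Γ(u, w)` with components `Γ^l_{ij} uⁱ wʲ`. -/
def gammaVec (Γ : Fin n → Fin n → Fin n → ℝ) (u w : Euc n) : Euc n :=
  WithLp.toLp 2 fun l => ∑ i, ∑ j, Γ l i j * u i * w j

/-- The covariant derivative
`(∇_u σ)(w₁, …, w_k) = (∂_u σ)(w₁, …, w_k) - ∑ₐ σ(w₁, …, Γ(u, wₐ), …, w_k)` of a `k`-form with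
value `σ` and first coordinate (or gauge covariant) derivatives `dσ` at the given point. -/
def covForm (Γ : Fin n → Fin n → Fin n → ℝ) (dσ : Euc n →L[ℝ] Euc n [⋀^Fin k]→L[ℝ] V)
    (σ : Euc n [⋀^Fin k]→L[ℝ] V) (u : Euc n) (w : Fin k → Euc n) : V :=
  dσ u w - ∑ a, σ (Function.update w a (gammaVec Γ u (w a)))

/-- Minus the divergence, `-b^{il} (∇_{e_i} σ)(e_l, w₁, …, w_k)`. -/
def negDiv (b : Euc n →L[ℝ] Euc n →L[ℝ] ℝ) (Γ : Fin n → Fin n → Fin n → ℝ)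
    (dσ : Euc n →L[ℝ] Euc n [⋀^Fin (k + 1)]→L[ℝ] V) (σ : Euc n [⋀^Fin (k + 1)]→L[ℝ] V)
    (w : Fin k → Euc n) : V :=
  -∑ i, ∑ l, (gram b)⁻¹ i l • covForm Γ dσ σ (ee i) (Fin.cons (ee l) w : Fin (k + 1) → Euc n)

end Algebra

/-! ### The Levi-Civita connection and its curvature in coordinates

`γ` is the metric in coordinates, `s` the set (the range of the model with corners; all of `ℝⁿ` for
manifolds without boundary) within which partial derivatives are taken. -/

section Coordinates

variable {n : ℕ}

/-- The partial derivative `∂_i f`. -/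
def pd (s : Set (Euc n)) (f : Euc n → ℝ) (i : Fin n) (y : Euc n) : ℝ :=
  fderivWithin ℝ f s y (ee i)

/-- The Christoffel symbols `Γ^l_{ij} = ½ γ^{lr} (∂_i γ_{jr} + ∂_j γ_{ir} - ∂_r γ_{ij})`. -/
def christoffel (s : Set (Euc n)) (γ : Euc n → Euc n →L[ℝ] Euc n →L[ℝ] ℝ) (l i j : Fin n)
    (y : Euc n) : ℝ :=
  (1 / 2) * ∑ r, (gram (γ y))⁻¹ l r *
    (pd s (fun z => γ z (ee j) (ee r)) i y + pd s (fun z => γ z (ee i) (ee r)) j y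
      - pd s (fun z => γ z (ee i) (ee j)) r y)

/-- The Ricci tensor
`Ric_{ij} = ∂_l Γ^l_{ij} - ∂_j Γ^l_{il} + Γ^l_{lr} Γ^r_{ij} - Γ^l_{jr} Γ^r_{il}`. -/
def ricciCoord (s : Set (Euc n)) (γ : Euc n → Euc n →L[ℝ] Euc n →L[ℝ] ℝ) (i j : Fin n)
    (y : Euc n) : ℝ :=
  ∑ l, (pd s (christoffel s γ l i j) l y - pd s (christoffel s γ l i l) j y) +
    ∑ l, ∑ r, (christoffel s γ l l r y * christoffel s γ r i j y
      - christoffel s γ l j r y * christoffel s γ r i l y)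

/-- The Ricci tensor as a bilinear form, `Ric(X, Y) = Ric_{ij} Xⁱ Yʲ`. -/
def ricciForm (s : Set (Euc n)) (γ : Euc n → Euc n →L[ℝ] Euc n →L[ℝ] ℝ) (y X Y : Euc n) : ℝ :=
  ∑ i, ∑ j, X i * Y j * ricciCoord s γ i j y

end Coordinates

/-! ### Tensor fields on a manifold -/

section Manifold

variable {n : ℕ} {H : Type*} [TopologicalSpace H] (I : ModelWithCorners ℝ (Euc n) H)
  (M : Type*) [TopologicalSpace M] [ChartedSpace H M]

/-- Fields of bilinear forms on the tangent spaces. -/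
abbrev Bilin : Type _ := ∀ x : M, TangentSpace I x →L[ℝ] TangentSpace I x →L[ℝ] ℝ

/-- Differential `k`-forms with values in a vector space `V` (smoothness is a separate
predicate). -/
abbrev Form (V : Type*) [NormedAddCommGroup V] [NormedSpace ℝ V] (k : ℕ) : Type _ :=
  ∀ x : M, TangentSpace I x [⋀^Fin k]→L[ℝ] V

variable {M} [IsManifold I 1 M] {k : ℕ} {V : Type*} [NormedAddCommGroup V] [NormedSpace ℝ V]

/-- The coordinate frame of the chart at `x₀`, at a point `x` of the chart domain: it sends the
`i`-th basis vector to the coordinate vector `∂_i`. At `x = x₀` it is the identity, because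
`TangentSpace I x₀` is by definition `ℝⁿ`, through the preferred chart at `x₀`. -/
def frame (x₀ x : M) : Euc n →L[ℝ] TangentSpace I x :=
  (trivializationAt (Euc n) (TangentSpace I) x₀).symmL ℝ x

variable {I}

/-- The components of a field of bilinear forms in the chart at `x₀`. -/
def locBilin (x₀ : M) (h : Bilin I M) (y : Euc n) : Euc n →L[ℝ] Euc n →L[ℝ] ℝ :=
  pullBilin (h ((extChartAt I x₀).symm y)) (frame I x₀ ((extChartAt I x₀).symm y))

/-- The components of a differential form in the chart at `x₀`. -/
def locForm (x₀ : M) (σ : Form I M V k) (y : Euc n) : Euc n [⋀^Fin k]→L[ℝ] V :=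
  (σ ((extChartAt I x₀).symm y)).compContinuousLinearMap (frame I x₀ ((extChartAt I x₀).symm y))

/-- Smoothness of a field of bilinear forms: its components are smooth in every chart. -/
def SmoothBilin (h : Bilin I M) : Prop :=
  ∀ x₀ : M, ContDiffOn ℝ ∞ (locBilin x₀ h) (extChartAt I x₀).target

/-- Smoothness of a differential form: its components are smooth in every chart. -/
def SmoothForm (σ : Form I M V k) : Prop :=
  ∀ x₀ : M, ContDiffOn ℝ ∞ (locForm x₀ σ) (extChartAt I x₀).target

/-- Symmetry of a field of bilinear forms. -/
def SymmBilin (h : Bilin I M) : Prop := ∀ (x : M) (X Y : TangentSpace I x), h x X Y = h x Y X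

/-- A (pseudo-Riemannian) metric of arbitrary signature. -/
structure IsMetric (g : Bilin I M) : Prop where
  smooth : SmoothBilin g
  symm : SymmBilin g
  nondegenerate : ∀ (x : M) (X : TangentSpace I x), (∀ Y, g x X Y = 0) → X = 0

/-- The exterior derivative. -/
def extD (σ : Form I M V k) : Form I M V (k + 1) := fun x =>
  extDerivWithin (locForm x σ) (Set.range I) (extChartAt I x x)

/-- The differential of a function, as a `1`-form. -/
def dFun (φ : M → ℝ) : Form I M ℝ 1 := fun x => ofLin (mfderiv I 𝓘(ℝ, ℝ) φ x)

/-- The Christoffel symbols of `g` at `x`, in the chart at `x`. -/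
def chris (g : Bilin I M) (x : M) (l i j : Fin n) : ℝ :=
  christoffel (Set.range I) (locBilin x g) l i j (extChartAt I x x)

/-- The Ricci tensor of the Levi-Civita connection of `g`. -/
def ricci (g : Bilin I M) (x : M) (X Y : TangentSpace I x) : ℝ :=
  ricciForm (Set.range I) (locBilin x g) (extChartAt I x x) X Y

/-- The scalar curvature of `g`. -/
def scalarCurv (g : Bilin I M) (x : M) : ℝ :=
  ∑ i, ∑ j, (gram (g x))⁻¹ i j * ricci g x (ee i : Euc n) (ee j : Euc n)

/-- The Levi-Civita covariant derivative `(∇_X σ)(X₁, …, X_k)` of a `k`-form. -/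
def nabla (g : Bilin I M) (σ : Form I M V k) (x : M) (X : TangentSpace I x)
    (w : Fin k → TangentSpace I x) : V :=
  covForm (chris g x) (fderivWithin ℝ (locForm x σ) (Set.range I) (extChartAt I x x)) (σ x) X w

/-- The codifferential `(δ_g σ)(X₁, …, X_k) = -g^{il} (∇_{e_i} σ)(e_l, X₁, …, X_k)`, that is
`(-1)^{|σ|} ⋆⁻¹ d ⋆ σ`. -/
def codiff (g : Bilin I M) (σ : Form I M V (k + 1)) (x : M) (w : Fin k → TangentSpace I x) : V :=
  negDiv (g x) (chris g x) (fderivWithin ℝ (locForm x σ) (Set.range I) (extChartAt I x x)) (σ x) w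

/-- The Laplace-Beltrami operator `Δ_g φ = -δ_g dφ` on functions. -/
def laplacian (g : Bilin I M) (φ : M → ℝ) (x : M) : ℝ :=
  -codiff g (dFun φ) x ![]

/-- The volume measure `√|det g_{ij}| dy¹ ⋯ dyⁿ` of `g` on the domain of the chart at `x₀`. -/
def chartVol [MeasurableSpace M] (g : Bilin I M) (x₀ : M) : Measure M :=
  ((((volume : Measure (Euc n)).restrict (extChartAt I x₀).target).withDensity fun y =>
    ENNReal.ofReal (Real.sqrt |(gram (locBilin x₀ g y)).det|))).map (extChartAt I x₀).symm

/-- The volume measure `dvol_g`: the smallest measure that dominates all the chart measures. As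
these agree on overlaps, it is the measure that restricts to each of them. -/
def vol [MeasurableSpace M] (g : Bilin I M) : Measure M := ⨆ x₀ : M, chartVol g x₀

/-! ### The action `S` and its beta functions -/

/-- `H' = H + dB`. -/
def fieldH (H : Form I M ℝ 3) (B : Form I M ℝ 2) : Form I M ℝ 3 := fun x => H x + extD B x

/-- The action `S`, integrated over the region `K`. -/
def actionS [MeasurableSpace M] (H : Form I M ℝ 3) (Λ : ℝ) (K : Set M) (g : Bilin I M) (B : Form I M ℝ 2)
    (φ : M → ℝ) : ℝ :=
  ∫ x in K, Real.exp (-2 * φ x) *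
    (scalarCurv g x - (1 / 2) * formInner (g x) (fieldH H B x) (fieldH H B x)
      + 4 * formInner (g x) (dFun (I := I) φ x) (dFun (I := I) φ x) - 2 * Λ) ∂(vol g)

/-- `(g, B, φ)` is a critical point of `S`: for every compact region `K` in the interior of the
manifold and all smooth variations `(h, C, ν)` of the fields that vanish outside of `K`, the action
over `K` is stationary. -/
def IsCriticalS [MeasurableSpace M] (H : Form I M ℝ 3) (Λ : ℝ) (g : Bilin I M) (B : Form I M ℝ 2) (φ : M → ℝ) :
    Prop :=
  ∀ K : Set M, IsCompact K → K ⊆ I.interior M →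
    ∀ (h : Bilin I M) (C : Form I M ℝ 2) (ν : M → ℝ),
      SmoothBilin h → SymmBilin h → SmoothForm C → ContMDiff I 𝓘(ℝ, ℝ) ∞ ν →
      (∀ x, x ∉ K → h x = 0 ∧ C x = 0 ∧ ν x = 0) →
      HasDerivAt (fun ε : ℝ => actionS H Λ K (fun x => g x + ε • h x) (fun x => B x + ε • C x)
        (fun x => φ x + ε * ν x)) 0 0

/-- `β(g)(X, Y) = Ric(X, Y) - ½ ⟨i_X H', i_Y H'⟩ + (∇_X dφ)(Y) + (∇_Y dφ)(X)`. -/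
def betaG (H : Form I M ℝ 3) (g : Bilin I M) (B : Form I M ℝ 2) (φ : M → ℝ) (x : M)
    (X Y : TangentSpace I x) : ℝ :=
  ricci g x X Y
    - (1 / 2) * formInner (g x) ((fieldH H B x).curryLeft X) ((fieldH H B x).curryLeft Y)
    + nabla g (dFun φ) x X ![Y] + nabla g (dFun φ) x Y ![X]

/-- `β(φ) = R(g) - ½ ⟨H', H'⟩ + 4 Δφ - 4 ⟨dφ, dφ⟩ - 2 Λ`. -/
def betaPhi (H : Form I M ℝ 3) (Λ : ℝ) (g : Bilin I M) (B : Form I M ℝ 2) (φ : M → ℝ) (x : M) : ℝ :=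
  scalarCurv g x - (1 / 2) * formInner (g x) (fieldH H B x) (fieldH H B x)
    + 4 * laplacian g φ x - 4 * formInner (g x) (dFun (I := I) φ x) (dFun (I := I) φ x) - 2 * Λ

/-- `β(B) = ½ e^{2φ} δ_g(e^{-2φ} H')`. -/
def betaB (H : Form I M ℝ 3) (g : Bilin I M) (B : Form I M ℝ 2) (φ : M → ℝ) (x : M)
    (X Y : TangentSpace I x) : ℝ :=
  (1 / 2) * Real.exp (2 * φ x) *
    codiff g (k := 2) (fun z => Real.exp (-2 * φ z) • fieldH H B z) x ![X, Y]

end Manifold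

/-! ### Lie groups and principal bundles -/

section Bundle

/-- A smooth Lie group has the regularity on which the bracket of its Lie algebra rests. -/
instance lieGroupThree {d : ℕ} (G : Type*) [TopologicalSpace G] [ChartedSpace (Euc d) G] [Group G]
    [h : LieGroup 𝓘(ℝ, Euc d) ∞ G] : LieGroup 𝓘(ℝ, Euc d) (minSmoothness ℝ 3) G :=
  LieGroup.of_le (n := ∞) (by rw [minSmoothness_of_isRCLikeNormedField]; exact ENat.LEInfty.out)

variable {d : ℕ} (G : Type*) [TopologicalSpace G] [ChartedSpace (Euc d) G] [Group G]

/-- The Lie algebra `𝔤 = T₁G` of `G`. -/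
abbrev LieAlg : Type := GroupLieAlgebra 𝓘(ℝ, Euc d) G

/-- The underlying vector space of `𝔤 = T₁G` is, by definition of the tangent space, `ℝᵈ` (through
the preferred chart at `1`). Lie algebra valued forms take their values in this normed space. -/
def toLie : Euc d ≃ₗ[ℝ] LieAlg (d := d) G := LinearEquiv.refl ℝ (Euc d)

/-- The Lie bracket of `𝔤`. -/
def lieBr [LieGroup 𝓘(ℝ, Euc d) ∞ G] : Euc d →L[ℝ] Euc d →L[ℝ] Euc d :=
  LinearMap.toContinuousBilinearMap
    (LinearMap.mk₂ ℝ (fun x y => (toLie G).symm ⁅toLie G x, toLie G y⁆)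
      (by intros; simp) (by intros; simp) (by intros; simp) (by intros; simp))

/-- The Killing form `⟨x, y⟩_𝔤 = tr(ad x ∘ ad y)` of `𝔤`. -/
def killing [LieGroup 𝓘(ℝ, Euc d) ∞ G] : Euc d →ₗ[ℝ] Euc d →ₗ[ℝ] ℝ :=
  (killingForm ℝ (LieAlg (d := d) G)).compl₁₂ (toLie G).toLinearMap (toLie G).toLinearMap

/-- The Killing form as a continuous bilinear map. -/
def killingCLM [LieGroup 𝓘(ℝ, Euc d) ∞ G] : Euc d →L[ℝ] Euc d →L[ℝ] ℝ := LinearMap.toContinuousBilinearMap (killing G)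

variable {G}

/-- The adjoint action `Ad_a` on `𝔤`, the derivative of `b ↦ a b a⁻¹` at `1`. -/
def Ad (a : G) : Euc d →L[ℝ] Euc d :=
  mfderiv 𝓘(ℝ, Euc d) 𝓘(ℝ, Euc d) (fun b : G => a * b * a⁻¹) 1

variable {m n : ℕ} {HP H : Type*} [TopologicalSpace HP] [TopologicalSpace H]
  (IP : ModelWithCorners ℝ (Euc m) HP) (I : ModelWithCorners ℝ (Euc n) H)
  (P M : Type*) [TopologicalSpace P] [ChartedSpace HP P] [TopologicalSpace M] [ChartedSpace H M]
  (G)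

/-- A smooth principal `G`-bundle `proj : P → M`, with its right action of `G`. -/
structure PrincipalBundle where
  /-- the bundle projection -/
  proj : P → M
  /-- the right action `(p, a) ↦ p · a` of the structure group -/
  act : P → G → P
  act_one : ∀ p, act p 1 = p
  act_mul : ∀ p a b, act p (a * b) = act (act p a) b
  proj_act : ∀ p a, proj (act p a) = proj p
  smooth_proj : ContMDiff IP I ∞ proj
  smooth_act : ContMDiff (IP.prod 𝓘(ℝ, Euc d)) IP ∞ (fun q : P × G => act q.1 q.2)
  /-- every point of the base lies in the domain of a smooth equivariant local trivialization -/
  locally_trivial : ∀ x : M, ∃ e : Bundle.Trivialization G proj, x ∈ e.baseSet ∧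
    ContMDiffOn IP (I.prod 𝓘(ℝ, Euc d)) ∞ e e.source ∧
    ContMDiffOn (I.prod 𝓘(ℝ, Euc d)) IP ∞ e.toOpenPartialHomeomorph.symm e.target ∧
    ∀ p ∈ e.source, ∀ a : G, (e (act p a)).2 = (e p).2 * a

namespace PrincipalBundle

variable {G IP I P M}
variable (𝓟 : PrincipalBundle (d := d) G IP I P M)

theorem proj_surjective : Function.Surjective 𝓟.proj := by
  intro x
  obtain ⟨e, hx, -⟩ := 𝓟.locally_trivial x
  exact ⟨e.toOpenPartialHomeomorph.symm (x, 1), e.proj_symm_apply' hx⟩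

/-- Some point of the fibre over `x`. -/
def pt (x : M) : P := Function.surjInv 𝓟.proj_surjective x

/-- Families, indexed by the points `p` of `P`, of `k`-forms at the base point `proj p` with values
in `V`. For `V = 𝔤`, the `k`-forms on `M` with values in the adjoint bundle `𝔤_P` are the smooth
`Ad`-equivariant ones among them, as sections of `𝔤_P` are `Ad`-equivariant functions on `P`. -/
abbrev PForm (V : Type*) [NormedAddCommGroup V] [NormedSpace ℝ V] (k : ℕ) : Type _ :=
  ∀ p : P, TangentSpace I (𝓟.proj p) [⋀^Fin k]→L[ℝ] V

/-- The form on `M` defined by a family that does not depend on the point of the fibre: its value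
at `x` is read off at some point over `x`. (The tangent spaces at `proj (pt x)` and at `x` are the
same, as these points are equal.) -/
def descend {V : Type*} [NormedAddCommGroup V] [NormedSpace ℝ V] {k : ℕ} (σ : 𝓟.PForm V k) :
    Form I M V k :=
  fun x => σ (𝓟.pt x)

variable [IsManifold IP 1 P] [IsManifold I 1 M] {k : ℕ}
  {V : Type*} [NormedAddCommGroup V] [NormedSpace ℝ V]

/-- The components of a family of forms in the chart of `M` at `x₀`. -/
def locP (x₀ : M) (σ : 𝓟.PForm V k) (p : P) : Euc n [⋀^Fin k]→L[ℝ] V :=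
  (σ p).compContinuousLinearMap (frame I x₀ (𝓟.proj p))

/-- `σ` is a smooth `k`-form on `M` with values in the adjoint bundle: it satisfies
`σ_{p · a} = Ad_{a⁻¹} ∘ σ_p`, and its components in every chart of `M` are smooth functions on
`P`. -/
structure IsAdForm (σ : 𝓟.PForm (Euc d) k) : Prop where
  equivariant : ∀ (p : P) (a : G) (w : Fin k → Euc n), σ (𝓟.act p a) w = Ad a⁻¹ (σ p w)
  smooth : ∀ x₀ : M, ContMDiffOn IP 𝓘(ℝ, Euc n [⋀^Fin k]→L[ℝ] Euc d) ∞ (𝓟.locP x₀ σ)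
    (𝓟.proj ⁻¹' (chartAt H x₀).source)

/-- A principal bundle connection `A`: a smooth `𝔤`-valued `1`-form on `P` that reproduces the
generators of the fundamental vector fields and is equivariant. -/
structure IsConnection (A : Form IP P (Euc d) 1) : Prop where
  smooth : SmoothForm A
  fundamental : ∀ (p : P) (ξ : LieAlg (d := d) G),
    A (𝓟.act p 1) ![mfderiv 𝓘(ℝ, Euc d) IP (𝓟.act p) 1 ξ] = (toLie G).symm ξ
  equivariant : ∀ (p : P) (a : G) (v : TangentSpace IP p),
    A (𝓟.act p a) ![mfderiv IP IP (fun q => 𝓟.act q a) p v] = Ad a⁻¹ (A p ![v])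

variable (A : Form IP P (Euc d) 1)

/-- The horizontal lift `T_{proj p} M → T_p P` of the connection `A`: the vector `v` with
`d proj(v) = u` and `A(v) = 0`. -/
def hlift (p : P) : TangentSpace I (𝓟.proj p) →L[ℝ] TangentSpace IP p :=
  ((mfderiv IP I 𝓟.proj p).prod (toLin (A p) : TangentSpace IP p →L[ℝ] Euc d)).inverse.comp
    (ContinuousLinearMap.inl ℝ (TangentSpace I (𝓟.proj p)) (Euc d))

/-- The gauge covariant derivatives `D_u` of the components, in the chart at `proj p`, of a
`𝔤_P`-valued form `σ`: the derivative along the horizontal lift of `u`. -/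
def covDer (σ : 𝓟.PForm (Euc d) k) (p : P) : Euc n →L[ℝ] Euc n [⋀^Fin k]→L[ℝ] Euc d :=
  (mfderiv IP 𝓘(ℝ, Euc n [⋀^Fin k]→L[ℝ] Euc d) (𝓟.locP (𝓟.proj p) σ) p :
    TangentSpace IP p →L[ℝ] Euc n [⋀^Fin k]→L[ℝ] Euc d).comp (𝓟.hlift A p)

/-- The exterior covariant derivative `D` of `A`. -/
def extCov (σ : 𝓟.PForm (Euc d) k) : 𝓟.PForm (Euc d) (k + 1) := fun p =>
  ContinuousAlternatingMap.alternatizeUncurryFin (𝓟.covDer A σ p)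

/-- The curvature `F(X, Y) = dA(Xʰ, Yʰ)` of `A`. -/
def curvature : 𝓟.PForm (Euc d) 2 := fun p =>
  (extD A p).compContinuousLinearMap (𝓟.hlift A p)

variable [LieGroup 𝓘(ℝ, Euc d) ∞ G]

/-- `[α ∧ σ]_𝔤` for a `1`-form `α`. -/
def wedgeLie (α : 𝓟.PForm (Euc d) 1) (σ : 𝓟.PForm (Euc d) k) : 𝓟.PForm (Euc d) (k + 1) :=
  fun p => wedge (lieBr G) (α p) (σ p)

/-- `⟨α ∧ σ⟩_𝔤` for a `1`-form `α`. -/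
def wedgeKilling (α : 𝓟.PForm (Euc d) 1) (σ : 𝓟.PForm (Euc d) k) : 𝓟.PForm ℝ (k + 1) :=
  fun p => wedge (killingCLM G) (α p) (σ p)

/-- `F' = F + Dϑ + ½ [ϑ ∧ ϑ]_𝔤`. -/
def fieldF (ϑ : 𝓟.PForm (Euc d) 1) : 𝓟.PForm (Euc d) 2 := fun p =>
  𝓟.curvature A p + 𝓟.extCov A ϑ p + (1 / 2 : ℝ) • 𝓟.wedgeLie ϑ ϑ p

/-- The Chern-Simons like form `C̃₃(ϑ) = ⟨Dϑ ∧ ϑ⟩_𝔤 + ⅓ ⟨[ϑ ∧ ϑ]_𝔤 ∧ ϑ⟩_𝔤` (a `1`-form and a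
`2`-form may be interchanged under the symmetric pairing). -/
def chernSimons (ϑ : 𝓟.PForm (Euc d) 1) : 𝓟.PForm ℝ 3 := fun p =>
  𝓟.wedgeKilling ϑ (𝓟.extCov A ϑ) p + (1 / 3 : ℝ) • 𝓟.wedgeKilling ϑ (𝓟.wedgeLie ϑ ϑ) p

/-- `H'₀ = H₀ + dB₀ - ½ C̃₃(ϑ) - ⟨F ∧ ϑ⟩_𝔤`. -/
def fieldH0 (H₀ : Form I M ℝ 3) (B₀ : Form I M ℝ 2) (ϑ : 𝓟.PForm (Euc d) 1) : Form I M ℝ 3 :=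
  fun x => H₀ x + extD B₀ x - (1 / 2 : ℝ) • 𝓟.descend (𝓟.chernSimons A ϑ) x
    - 𝓟.descend (𝓟.wedgeKilling ϑ (𝓟.curvature A)) x

/-- The scalar product `⟪α, β⟫` at `x` of `𝔤_P`-valued forms, induced by `g₀` and the Killing
form. -/
def adInner (g₀ : Bilin I M) (x : M) (α β : Euc n [⋀^Fin k]→L[ℝ] Euc d) : ℝ :=
  pairing (g₀ x) (killing G) α β

/-! ### The action `S₀` and its beta functions -/

/-- The action `S₀`, integrated over the region `K`. -/
def actionS0 [MeasurableSpace M] (H₀ : Form I M ℝ 3) (Λ₀ : ℝ) (K : Set M) (g₀ : Bilin I M)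
    (B₀ : Form I M ℝ 2) (φ₀ : M → ℝ) (ϑ : 𝓟.PForm (Euc d) 1) : ℝ :=
  ∫ x in K, Real.exp (-2 * φ₀ x) *
    (scalarCurv g₀ x
      + (1 / 2) * adInner (G := G) g₀ x (𝓟.descend (𝓟.fieldF A ϑ) x) (𝓟.descend (𝓟.fieldF A ϑ) x)
      - (1 / 2) * formInner (g₀ x) (𝓟.fieldH0 A H₀ B₀ ϑ x) (𝓟.fieldH0 A H₀ B₀ ϑ x)
      + 4 * formInner (g₀ x) (dFun (I := I) φ₀ x) (dFun (I := I) φ₀ x) - 2 * Λ₀) ∂(vol g₀)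

/-- `(g₀, B₀, φ₀, ϑ)` is a critical point of `S₀`: for every compact region `K` in the interior of
`M` and all smooth variations `(h, C, ν, η)` of the fields that vanish outside of `K`, the action
over `K` is stationary. -/
def IsCriticalS0 [MeasurableSpace M] (H₀ : Form I M ℝ 3) (Λ₀ : ℝ) (g₀ : Bilin I M)
    (B₀ : Form I M ℝ 2) (φ₀ : M → ℝ) (ϑ : 𝓟.PForm (Euc d) 1) : Prop :=
  ∀ K : Set M, IsCompact K → K ⊆ I.interior M →
    ∀ (h : Bilin I M) (C : Form I M ℝ 2) (ν : M → ℝ) (η : 𝓟.PForm (Euc d) 1),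
      SmoothBilin h → SymmBilin h → SmoothForm C → ContMDiff I 𝓘(ℝ, ℝ) ∞ ν → 𝓟.IsAdForm η →
      (∀ x, x ∉ K → h x = 0 ∧ C x = 0 ∧ ν x = 0) → (∀ p, 𝓟.proj p ∉ K → η p = 0) →
      HasDerivAt (fun ε : ℝ => 𝓟.actionS0 A H₀ Λ₀ K (fun x => g₀ x + ε • h x)
        (fun x => B₀ x + ε • C x) (fun x => φ₀ x + ε * ν x) (fun p => ϑ p + ε • η p)) 0 0

/-- `β'(g₀)(X, Y) = Ric₀(X, Y) + ½ ⟪i_X F', i_Y F'⟫ - ½ ⟨i_X H'₀, i_Y H'₀⟩ + (∇⁰_X dφ₀)(Y)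
+ (∇⁰_Y dφ₀)(X)`. -/
def betaG0 (H₀ : Form I M ℝ 3) (g₀ : Bilin I M) (B₀ : Form I M ℝ 2) (φ₀ : M → ℝ)
    (ϑ : 𝓟.PForm (Euc d) 1) (x : M) (X Y : TangentSpace I x) : ℝ :=
  ricci g₀ x X Y
    + (1 / 2) * adInner (G := G) g₀ x ((𝓟.descend (𝓟.fieldF A ϑ) x).curryLeft X)
        ((𝓟.descend (𝓟.fieldF A ϑ) x).curryLeft Y)
    - (1 / 2) * formInner (g₀ x) ((𝓟.fieldH0 A H₀ B₀ ϑ x).curryLeft X)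
        ((𝓟.fieldH0 A H₀ B₀ ϑ x).curryLeft Y)
    + nabla g₀ (dFun φ₀) x X ![Y] + nabla g₀ (dFun φ₀) x Y ![X]

/-- `β'(φ₀) = R(g₀) + ½ ⟪F', F'⟫ - ½ ⟨H'₀, H'₀⟩ + 4 Δφ₀ - 4 ⟨dφ₀, dφ₀⟩ - 2 Λ₀`. -/
def betaPhi0 (H₀ : Form I M ℝ 3) (Λ₀ : ℝ) (g₀ : Bilin I M) (B₀ : Form I M ℝ 2) (φ₀ : M → ℝ)
    (ϑ : 𝓟.PForm (Euc d) 1) (x : M) : ℝ :=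
  scalarCurv g₀ x
    + (1 / 2) * adInner (G := G) g₀ x (𝓟.descend (𝓟.fieldF A ϑ) x) (𝓟.descend (𝓟.fieldF A ϑ) x)
    - (1 / 2) * formInner (g₀ x) (𝓟.fieldH0 A H₀ B₀ ϑ x) (𝓟.fieldH0 A H₀ B₀ ϑ x)
    + 4 * laplacian g₀ φ₀ x - 4 * formInner (g₀ x) (dFun (I := I) φ₀ x) (dFun (I := I) φ₀ x) - 2 * Λ₀

/-- `β'(B₀) = ½ e^{2φ₀} δ(e^{-2φ₀} H'₀)`. -/
def betaB0 (H₀ : Form I M ℝ 3) (g₀ : Bilin I M) (B₀ : Form I M ℝ 2) (φ₀ : M → ℝ)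
    (ϑ : 𝓟.PForm (Euc d) 1) (x : M) (X Y : TangentSpace I x) : ℝ :=
  (1 / 2) * Real.exp (2 * φ₀ x) *
    codiff g₀ (k := 2) (fun z => Real.exp (-2 * φ₀ z) • 𝓟.fieldH0 A H₀ B₀ ϑ z) x ![X, Y]

/-- The covariant codifferential `D'^†` of the connection `A + ϑ`, whose covariant derivative is
`D'_u = D_u + [ϑ(u), ·]_𝔤`:
`(D'^† σ)(X₁, …, X_k) = -g₀^{il} (∇̂'_{e_i} σ)(e_l, X₁, …, X_k)`, where `∇̂'` combines `D'` with the
Levi-Civita connection of `g₀`. This is `(-1)^{|σ|} ⋆⁻¹ D' ⋆ σ`. -/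
def covCodiff (g₀ : Bilin I M) (ϑ : 𝓟.PForm (Euc d) 1) (σ : 𝓟.PForm (Euc d) (k + 1)) (p : P)
    (w : Fin k → TangentSpace I (𝓟.proj p)) : Euc d :=
  negDiv (g₀ (𝓟.proj p)) (chris g₀ (𝓟.proj p))
    (𝓟.covDer A σ p + oneTensor (lieBr G) (ϑ p) (σ p)) (σ p) w

/-- `β'_ϑ = ½ (e^{2φ₀} D'^†(e^{-2φ₀} F') + ⟨i_{e_k} H'₀, F'⟩_{g₀} eᵏ)`. -/
def betaTheta (H₀ : Form I M ℝ 3) (g₀ : Bilin I M) (B₀ : Form I M ℝ 2) (φ₀ : M → ℝ)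
    (ϑ : 𝓟.PForm (Euc d) 1) (p : P) (X : TangentSpace I (𝓟.proj p)) : Euc d :=
  (1 / 2 : ℝ) •
    (Real.exp (2 * φ₀ (𝓟.proj p)) •
        𝓟.covCodiff A g₀ ϑ (fun q => Real.exp (-2 * φ₀ (𝓟.proj q)) • 𝓟.fieldF A ϑ q) p ![X]
      + pairing (g₀ (𝓟.proj p)) (LinearMap.lsmul ℝ (Euc d))
          ((𝓟.fieldH0 A H₀ B₀ ϑ (𝓟.proj p)).curryLeft X) (𝓟.fieldF A ϑ p))

end PrincipalBundle

end Bundle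

end StringEOM

end

set_option linter.unusedSectionVars false

noncomputable section

namespace StringEOM

open Finset (sum_congr sum_comm mul_sum sum_mul sum_add_distrib sum_sub_distrib sum_neg_distrib
  smul_sum sum_eq_zero)
open ContinuousAlternatingMap (alternatizeUncurryFin alternatizeUncurryFin_add
  alternatizeUncurryFin_apply)
open ContinuousLinearMap (compContinuousAlternatingMapCLM)
open Function (uncurry update)
open Set (univ)
open Real (exp)

/-- Bilinear forms on `ℝⁿ`. -/
notation:max "Bil" n:max => Euc n →L[ℝ] Euc n →L[ℝ] ℝ

/-- Alternating `k`-forms on `ℝⁿ` with values in `V`. -/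
notation:max "Alt" n:max k:max V:max => Euc n [⋀^Fin k]→L[ℝ] V

/-- The chart at `z`, as a map to `ℝⁿ`. -/
notation:max "ch" I:max z:max => extChartAt I z

/-- The inverse of the chart at `z`. -/
notation:max "ich" I:max z:max => PartialEquiv.symm (extChartAt I z)

/-- The Christoffel symbols in the absence of a boundary. -/
notation:max "Chr" => christoffel univ

/-- The inverse of the matrix of a bilinear form. -/
notation:max "gi" b:max => (gram b)⁻¹

/-- The range, in the chart at `z`, of the part of the chart domain that lies in `U`. -/
notation:max "dom" I:max z:max U:max => PartialEquiv.target (extChartAt I z) ∩ ich I z ⁻¹' U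

notation:max "SmoothOn" => ContDiffOn ℝ ∞

notation:max "fd" => fderiv ℝ

notation:max "Lin" n:max => Euc n →L[ℝ] Euc n

notation:max "IE" d:max => modelWithCornersSelf ℝ (Euc d)

/-- The wedge product of `𝔤`-valued forms, with values paired by the Killing form. -/
notation:max "wK" G:max => wedge (killingCLM G)

lemma sum_ext {ι N : Type*} [Fintype ι] [AddCommMonoid N] {f g : ι → N} (h : ∀ i, f i = g i) :
    ∑ i, f i = ∑ i, g i :=
  Fintype.sum_congr f g h

/-! ### Multilinear algebra of the induced scalar products -/

section Algebra

variable {n k : ℕ} {V W U : Type*} [NormedAddCommGroup V] [NormedSpace ℝ V]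
  [NormedAddCommGroup W] [NormedSpace ℝ W] [NormedAddCommGroup U] [NormedSpace ℝ U]

/-- The scalar product of two arrays (functions of `k` vectors, of which only the values on basis
vectors matter) with respect to an inverse metric `G`, so that `pairing b = mPair gi b`. -/
def mPair (G : Matrix (Fin n) (Fin n) ℝ) (κ : V →ₗ[ℝ] W →ₗ[ℝ] U)
    (α : (Fin k → Euc n) → V) (β : (Fin k → Euc n) → W) : U :=
  (k.factorial : ℝ)⁻¹ • ∑ J : Fin k → Fin n, ∑ L : Fin k → Fin n,
    (∏ a, G (J a) (L a)) • κ (α fun a => ee (J a)) (β fun a => ee (L a))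

lemma pairing_eq_mPair (b : Bil n) (κ : V →ₗ[ℝ] W →ₗ[ℝ] U) (α : Alt n k V) (β : Alt n k W) :
    pairing b κ α β = mPair gi b κ α β := rfl

lemma sum_smul_ee (u : Euc n) : ∑ i, u i • (ee i : Euc n) = u := by
  have := (EuclideanSpace.basisFun (Fin n) ℝ).sum_repr u
  simpa using this

lemma clm_apply_eq_sum (f : Euc n →L[ℝ] V) (u : Euc n) : f u = ∑ i, u i • f (ee i) := by
  conv_lhs => rw [← sum_smul_ee u]
  simp

section mPair

variable (G : Matrix (Fin n) (Fin n) ℝ) (κ : V →ₗ[ℝ] W →ₗ[ℝ] U)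

lemma mPair_add_left (α α' : (Fin k → Euc n) → V) (β : (Fin k → Euc n) → W) :
    mPair G κ (fun v => α v + α' v) β = mPair G κ α β + mPair G κ α' β := by
  simp only [mPair, map_add, LinearMap.add_apply, smul_add, sum_add_distrib]

lemma mPair_add_right (α : (Fin k → Euc n) → V) (β β' : (Fin k → Euc n) → W) :
    mPair G κ α (fun v => β v + β' v) = mPair G κ α β + mPair G κ α β' := by
  simp only [mPair, map_add, smul_add, sum_add_distrib]

lemma mPair_smul_left (c : ℝ) (α : (Fin k → Euc n) → V) (β : (Fin k → Euc n) → W) :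
    mPair G κ (fun v => c • α v) β = c • mPair G κ α β := by
  simp only [mPair, map_smul, LinearMap.smul_apply, smul_sum, smul_comm c]

lemma mPair_smul_right (c : ℝ) (α : (Fin k → Euc n) → V) (β : (Fin k → Euc n) → W) :
    mPair G κ α (fun v => c • β v) = c • mPair G κ α β := by
  simp only [mPair, map_smul, smul_sum, smul_comm c]

lemma mPair_sum_left {ι : Type*} (s : Finset ι) (α : ι → (Fin k → Euc n) → V)
    (β : (Fin k → Euc n) → W) :
    mPair G κ (fun v => ∑ i ∈ s, α i v) β = ∑ i ∈ s, mPair G κ (α i) β := by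
  classical
  induction s using Finset.induction_on with
  | empty => simp [mPair]
  | insert a s ha ih => simp only [Finset.sum_insert ha, mPair_add_left, ih]

lemma mPair_sum_right {ι : Type*} (s : Finset ι) (α : (Fin k → Euc n) → V)
    (β : ι → (Fin k → Euc n) → W) :
    mPair G κ α (fun v => ∑ i ∈ s, β i v) = ∑ i ∈ s, mPair G κ α (β i) := by
  classical
  induction s using Finset.induction_on with
  | empty => simp [mPair]
  | insert a s ha ih => simp only [Finset.sum_insert ha, mPair_add_right, ih]

/-- Scalar products of `k + 1`-forms, one pair of indices split off at position `p`. -/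
lemma mPair_succ_insertNth (p : Fin (k + 1)) (α : (Fin (k + 1) → Euc n) → V)
    (β : (Fin (k + 1) → Euc n) → W) :
    mPair G κ α β = ((k : ℝ) + 1)⁻¹ • ∑ i, ∑ l, G i l •
      mPair G κ (fun w => α (p.insertNth (ee i) w)) (fun w => β (p.insertNth (ee l) w)) := by
  have key : ∀ (i : Fin n) (J : Fin k → Fin n),
      (fun a => ee ((p.insertNth i J : Fin (k + 1) → Fin n) a) : Fin (k + 1) → Euc n) =
        p.insertNth (ee i) (fun a => ee (J a)) := by
    intro i J
    refine Fin.eq_insertNth_iff.2 ⟨by simp, ?_⟩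
    ext a : 1
    simp [Fin.removeNth]
  simp only [mPair]
  rw [← (Fin.insertNthEquiv (fun _ => Fin n) p).sum_comp, Fintype.sum_prod_type]
  have h1 : ∀ (i : Fin n) (J : Fin k → Fin n),
      ∑ L : Fin (k + 1) → Fin n, (∏ a, G ((p.insertNth i J : Fin (k + 1) → Fin n) a) (L a)) •
        κ (α fun a => ee ((p.insertNth i J : Fin (k + 1) → Fin n) a)) (β fun a => ee (L a)) =
      ∑ l, ∑ L : Fin k → Fin n, (G i l * ∏ a, G (J a) (L a)) •
        κ (α (p.insertNth (ee i) fun a => ee (J a))) (β (p.insertNth (ee l) fun a => ee (L a))) := by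
    intro i J
    rw [← (Fin.insertNthEquiv (fun _ => Fin n) p).sum_comp, Fintype.sum_prod_type]
    refine sum_ext fun l => sum_ext fun L => ?_
    simp only [Fin.insertNthEquiv_apply]
    rw [key, key, Fin.prod_univ_succAbove _ p]
    simp
  simp only [Fin.insertNthEquiv_apply, h1, Nat.factorial_succ]
  simp only [smul_sum, smul_smul]
  refine sum_ext fun i => ?_
  rw [sum_comm]
  refine sum_ext fun l => sum_ext fun J => sum_ext fun L => ?_
  congr 1
  push_cast
  rw [mul_inv]
  ring

/-- Scalar products of `k + 1`-forms, the first pair of indices split off. -/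
lemma mPair_succ (α : (Fin (k + 1) → Euc n) → V) (β : (Fin (k + 1) → Euc n) → W) :
    mPair G κ α β = ((k : ℝ) + 1)⁻¹ • ∑ i, ∑ l, G i l •
      mPair G κ (fun w => α (Fin.cons (ee i) w)) (fun w => β (Fin.cons (ee l) w)) := by
  simpa only [Fin.insertNth_zero'] using mPair_succ_insertNth G κ 0 α β

/-- `⟨σ, ∑ₐ (-1)ᵃ T(uₐ)(…ûₐ…)⟩ = G^{il} ⟨i_{e_i} σ, T(e_l)⟩` for an alternating `σ`: every position
of the antisymmetrized slot contributes equally. -/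
lemma mPair_alternatize (σ : Alt n (k + 1) V) (T : Euc n →L[ℝ] Alt n k W) :
    mPair G κ σ (alternatizeUncurryFin T) =
      ∑ i, ∑ l, G i l • mPair G κ (fun w => σ (Fin.cons (ee i) w)) (T (ee l)) := by
  have h : ∀ p : Fin (k + 1), mPair G κ σ (fun v => (-1 : ℝ) ^ (p : ℕ) • T (v p) (p.removeNth v)) =
      ((k : ℝ) + 1)⁻¹ • ∑ i, ∑ l, G i l •
        mPair G κ (fun w => σ (Fin.cons (ee i) w)) (T (ee l)) := by
    intro p
    rw [mPair_succ_insertNth G κ p]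
    congr 1
    refine sum_ext fun i => sum_ext fun l => ?_
    congr 1
    have e1 : (fun w : Fin k → Euc n => σ (p.insertNth (ee i) w)) =
        fun w => (-1 : ℝ) ^ (p : ℕ) • σ (Fin.cons (ee i) w) := by
      funext w
      rw [ContinuousAlternatingMap.map_insertNth]
      rcases Nat.even_or_odd (p : ℕ) with hp | hp <;> simp [hp, Matrix.vecCons]
    have e2 : (fun w : Fin k → Euc n => (-1 : ℝ) ^ (p : ℕ) •
        T ((p.insertNth (ee l) w : Fin (k + 1) → Euc n) p)
          (p.removeNth (p.insertNth (ee l) w : Fin (k + 1) → Euc n))) =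
        fun w => (-1 : ℝ) ^ (p : ℕ) • T (ee l) w := by
      funext w; simp
    rw [e1, e2, mPair_smul_left, mPair_smul_right, smul_smul, ← mul_pow]
    simp
  have e : (alternatizeUncurryFin T : (Fin (k + 1) → Euc n) → W) =
      fun v => ∑ p : Fin (k + 1), (-1 : ℝ) ^ (p : ℕ) • T (v p) (p.removeNth v) := by
    funext v
    rw [alternatizeUncurryFin_apply]
    refine sum_ext fun p => ?_
    rcases Nat.even_or_odd (p : ℕ) with hp | hp <;> simp [hp]
  rw [e, mPair_sum_right]
  simp only [h, Finset.sum_const, Finset.card_univ, Fintype.card_fin, ← Nat.cast_smul_eq_nsmul ℝ,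
    smul_smul]
  push_cast
  rw [mul_inv_cancel₀ (by positivity), one_smul]

lemma compCLM_cons (f : Lin n) (α : Alt n (k + 1) V) (u : Euc n) :
    (fun w : Fin k → Euc n => α.compContinuousLinearMap f (Fin.cons u w)) =
      (α.curryLeft (f u)).compContinuousLinearMap f := by
  funext w
  simp only [ContinuousAlternatingMap.compContinuousLinearMap_apply,
    ContinuousAlternatingMap.curryLeft_apply_apply]
  congr 1
  funext a
  refine Fin.cases ?_ (fun a => ?_) a <;> simp [Matrix.vecCons]

lemma curryLeft_eq_sum (α : Alt n (k + 1) V) (u : Euc n) :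
    (α.curryLeft u : (Fin k → Euc n) → V) = fun w => ∑ r, u r • α (Fin.cons (ee r) w) := by
  funext w
  conv_lhs => rw [← sum_smul_ee u]
  simp [Matrix.vecCons]

/-- Invariance of scalar products under a linear change of frame. -/
lemma mPair_comp (f : Lin n) (G' : Matrix (Fin n) (Fin n) ℝ)
    (hG : ∀ r s, G r s = ∑ i, ∑ l, f (ee i) r * G' i l * f (ee l) s)
    (α : Alt n k V) (β : Alt n k W) :
    mPair G' κ (α.compContinuousLinearMap f) (β.compContinuousLinearMap f) = mPair G κ α β := by
  induction k with
  | zero =>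
    simp only [mPair, ContinuousAlternatingMap.compContinuousLinearMap_apply]
    refine congrArg _ (sum_ext fun J => sum_ext fun L => ?_)
    simp only [Finset.univ_eq_empty, Finset.prod_empty]
    congr 2
    · exact congrArg κ (congrArg α (Subsingleton.elim _ _))
    · exact congrArg β (Subsingleton.elim _ _)
  | succ k ih =>
    rw [mPair_succ, mPair_succ G]
    congr 1
    simp only [compCLM_cons, ih]
    simp only [curryLeft_eq_sum, mPair_sum_left, mPair_sum_right, mPair_smul_left,
      mPair_smul_right, hG, smul_sum, Finset.sum_smul, smul_smul]
    have c4 : ∀ F : Fin n → Fin n → Fin n → Fin n → U, ∑ i, ∑ l, ∑ r, ∑ s, F i l r s =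
        ∑ r, ∑ s, ∑ i, ∑ l, F i l r s := by
      intro F
      calc _ = ∑ i, ∑ r, ∑ l, ∑ s, F i l r s :=
            sum_ext fun i => sum_comm
        _ = ∑ r, ∑ i, ∑ l, ∑ s, F i l r s := sum_comm
        _ = ∑ r, ∑ i, ∑ s, ∑ l, F i l r s := sum_ext fun r => sum_ext fun i => sum_comm
        _ = _ := sum_ext fun r => sum_comm
    rw [c4, sum_comm]
    refine sum_ext fun r => sum_ext fun s => sum_ext fun i => sum_ext fun l => ?_
    congr 1
    ring

end mPair

end Algebra

section AlgebraDeriv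

variable {n k : ℕ} {V W : Type*} [NormedAddCommGroup V] [NormedSpace ℝ V]
  [NormedAddCommGroup W] [NormedSpace ℝ W]

lemma sum_update_swap {M : Type*} [AddCommMonoid M] (a : Fin k) (f : (Fin k → Fin n) → Fin n → M) :
    ∑ J, ∑ r, f J r = ∑ J, ∑ r, f (update J a r) (J a) := by
  have hinv : Function.Involutive
      (fun q : (Fin k → Fin n) × Fin n => (update q.1 a q.2, q.1 a)) := by
    rintro ⟨J, r⟩
    simp
  rw [← Fintype.sum_prod_type' (f := f), ← Fintype.sum_prod_type' (f := fun J r =>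
    f (update J a r) (J a))]
  exact (Equiv.sum_comp hinv.toPerm (fun q => f q.1 q.2)).symm

lemma ee_update (J : Fin k → Fin n) (a : Fin k) (r : Fin n) :
    (fun b => ee (update J a r b) : Fin k → Euc n) = update (fun b => ee (J b)) a (ee r) := by
  funext b
  by_cases hb : b = a
  · subst hb; simp
  · simp [Function.update_of_ne hb]

lemma map_update_eq_sum (α : Alt n k V) (v : Fin k → Euc n) (a : Fin k) (u : Euc n) :
    α (update v a u) = ∑ r, u r • α (update v a (ee r)) := by
  have := map_sum (α.toMultilinearMap.toLinearMap v a) (fun r => u r • (ee r : Euc n)) Finset.univ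
  rw [sum_smul_ee] at this
  simpa using this

/-- Moving a derivation `N` of the inverse metric onto the arguments of a form. -/
lemma sum_prod_erase_left (G : Matrix (Fin n) (Fin n) ℝ) (N : Lin n) (a : Fin k)
    (L : Fin k → Fin n) (ψ : V →ₗ[ℝ] ℝ) (α : Alt n k V) :
    ∑ J : Fin k → Fin n, (∏ b ∈ Finset.univ.erase a, G (J b) (L b)) *
        (∑ r, (N (ee r)) (J a) * G r (L a)) * ψ (α fun b => ee (J b)) =
      ∑ J : Fin k → Fin n, (∏ b, G (J b) (L b)) *
        ψ (α (update (fun b => ee (J b)) a (N (ee (J a))))) := by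
  have h : ∀ J : Fin k → Fin n, (∏ b, G (J b) (L b)) *
        ψ (α (update (fun b => ee (J b)) a (N (ee (J a))))) =
      ∑ r, (∏ b ∈ Finset.univ.erase a, G (J b) (L b)) * G (J a) (L a) * (N (ee (J a))) r *
        ψ (α fun b => ee (update J a r b)) := by
    intro J
    rw [map_update_eq_sum, map_sum, mul_sum, ← Finset.prod_erase_mul _ _ (Finset.mem_univ a)]
    refine sum_ext fun r => ?_
    rw [ee_update, map_smul, smul_eq_mul]
    ring
  simp only [h, mul_sum, sum_mul]
  rw [sum_update_swap a]
  refine sum_ext fun J => sum_ext fun r => ?_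
  have : ∏ b ∈ Finset.univ.erase a, G (update J a r b) (L b) =
      ∏ b ∈ Finset.univ.erase a, G (J b) (L b) :=
    Finset.prod_congr rfl fun b hb => by rw [Function.update_of_ne (Finset.ne_of_mem_erase hb)]
  simp only [this, Function.update_self]
  ring

/-- The action of an endomorphism `N` on the arguments of a form, as a derivation. -/
def slotDer (N : Lin n) (α : Alt n k V) (v : Fin k → Euc n) : V := ∑ a, α (update v a (N (v a)))

/-- Leibniz rule for the induced scalar products: if the inverse metric moves by
`-(N G + G Nᵀ)`, the derivative of `⟨α, β⟩` is `⟨∇α, β⟩ + ⟨α, ∇β⟩` with `∇α = α̇ - N · α`. With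
`N = Γ(u, ·)` this is the compatibility of the Levi-Civita connection with the metric, with
`N = ½ b⁻¹ h` it gives the variation of scalar products with the metric. -/
lemma hasDerivAt_mPair {κ : V →ₗ[ℝ] W →ₗ[ℝ] ℝ} {G : ℝ → Matrix (Fin n) (Fin n) ℝ}
    {N : Lin n} {t : ℝ}
    (hG : ∀ i j, HasDerivAt (fun s => G s i j)
      (-(∑ r, (N (ee r)) i * G t r j) - ∑ r, (N (ee r)) j * G t i r) t)
    {α : ℝ → Alt n k V} {β : ℝ → Alt n k W}
    {dα : (Fin k → Euc n) → V} {dβ : (Fin k → Euc n) → W}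
    (hK : ∀ J L : Fin k → Fin n,
      HasDerivAt (fun s => κ (α s fun a => ee (J a)) (β s fun a => ee (L a)))
        (κ (dα fun a => ee (J a)) (β t fun a => ee (L a)) +
          κ (α t fun a => ee (J a)) (dβ fun a => ee (L a))) t) :
    HasDerivAt (fun s => mPair (G s) κ (α s) (β s))
      (mPair (G t) κ (fun v => dα v - slotDer N (α t) v) (β t) +
        mPair (G t) κ (α t) (fun v => dβ v - slotDer N (β t) v)) t := by
  have h1 : HasDerivAt (fun s => mPair (G s) κ (α s) (β s))
      ((k.factorial : ℝ)⁻¹ • ∑ J : Fin k → Fin n, ∑ L : Fin k → Fin n,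
        ((∑ a, (∏ b ∈ Finset.univ.erase a, G t (J b) (L b)) •
          (-(∑ r, (N (ee r)) (J a) * G t r (L a)) - ∑ r, (N (ee r)) (L a) * G t (J a) r)) *
            κ (α t fun a => ee (J a)) (β t fun a => ee (L a)) +
          (∏ a, G t (J a) (L a)) * (κ (dα fun a => ee (J a)) (β t fun a => ee (L a)) +
          κ (α t fun a => ee (J a)) (dβ fun a => ee (L a))))) t := by
    unfold mPair
    refine HasDerivAt.const_smul ((k.factorial : ℝ)⁻¹) ?_
    refine HasDerivAt.fun_sum fun J _ => ?_
    refine HasDerivAt.fun_sum fun L _ => ?_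
    have hp : HasDerivAt (fun s => ∏ a, G s (J a) (L a)) _ t :=
      HasDerivAt.fun_finsetProd fun a _ => hG (J a) (L a)
    exact hp.mul (hK J L)
  convert! h1 using 1
  simp only [mPair, slotDer, ← smul_add, ← sum_add_distrib]
  congr 1
  have eL : ∀ L : Fin k → Fin n, ∑ J : Fin k → Fin n,
      ∑ a, (∏ b ∈ Finset.univ.erase a, G t (J b) (L b)) * (∑ r, (N (ee r)) (J a) * G t r (L a)) *
        κ (α t fun a => ee (J a)) (β t fun a => ee (L a)) =
      ∑ J : Fin k → Fin n, (∏ a, G t (J a) (L a)) *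
        κ (∑ a, α t (update (fun b => ee (J b)) a (N (ee (J a))))) (β t fun a => ee (L a)) := by
    intro L
    simp_rw [map_sum, LinearMap.sum_apply]
    conv_rhs => enter [2, J]; rw [mul_sum]
    refine Finset.sum_comm.trans (Eq.trans ?_ sum_comm)
    exact sum_ext fun a => sum_prod_erase_left (G t) N a L (κ.flip (β t fun a => ee (L a))) (α t)
  have eR : ∀ J : Fin k → Fin n, ∑ L : Fin k → Fin n,
      ∑ a, (∏ b ∈ Finset.univ.erase a, G t (J b) (L b)) * (∑ r, (N (ee r)) (L a) * G t (J a) r) *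
        κ (α t fun a => ee (J a)) (β t fun a => ee (L a)) =
      ∑ L : Fin k → Fin n, (∏ a, G t (J a) (L a)) * κ (α t fun a => ee (J a))
          (∑ a, β t (update (fun b => ee (L b)) a (N (ee (L a))))) := by
    intro J
    simp_rw [map_sum]
    conv_rhs => enter [2, L]; rw [mul_sum]
    refine Finset.sum_comm.trans (Eq.trans ?_ sum_comm)
    exact sum_ext fun a =>
      sum_prod_erase_left (G t).transpose N a J (κ (α t fun a => ee (J a))) (β t)
  have eL' := (Finset.sum_comm.trans (sum_congr
    (rfl : (Finset.univ : Finset (Fin k → Fin n)) = Finset.univ) fun L _ => eL L)).trans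
    sum_comm
  have eR' := sum_congr (rfl : (Finset.univ : Finset (Fin k → Fin n)) = Finset.univ) fun J _ => eR J
  simp only [smul_eq_mul, map_sub, LinearMap.sub_apply, mul_add, mul_sub, sum_mul,
    sum_add_distrib, sum_sub_distrib, mul_neg, neg_mul, sub_mul, sum_neg_distrib] at eL' eR' ⊢
  linarith

end AlgebraDeriv

section Gram

variable {n k : ℕ} {V W U : Type*} [NormedAddCommGroup V] [NormedSpace ℝ V]
  [NormedAddCommGroup W] [NormedSpace ℝ W] [NormedAddCommGroup U] [NormedSpace ℝ U]

lemma gram_apply (b : Bil n) (i j : Fin n) : gram b i j = b (ee i) (ee j) := rfl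

lemma bilin_apply_eq_sum (b : Bil n) (u v : Euc n) : b u v = ∑ i, ∑ j, u i * v j * gram b i j := by
  conv_lhs => rw [← sum_smul_ee u, ← sum_smul_ee v]
  simp only [map_sum, map_smul, sum_apply, smul_apply, smul_eq_mul, mul_sum, gram_apply]
  rw [sum_comm]
  refine sum_ext fun i => sum_ext fun j => ?_
  ring

/-- The matrix of an endomorphism of `ℝⁿ`. -/
def mat (f : Lin n) : Matrix (Fin n) (Fin n) ℝ := Matrix.of fun r i => f (ee i) r

lemma pullBilin_apply (b : Bil n) (f : Lin n) (u v : Euc n) :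
    pullBilin b f u v = b (f u) (f v) := rfl

lemma gram_pullBilin (b : Bil n) (f : Lin n) :
    gram (pullBilin b f) = (mat f).transpose * gram b * mat f := by
  ext i j
  rw [gram_apply, pullBilin_apply, bilin_apply_eq_sum]
  simp only [Matrix.mul_apply, Matrix.transpose_apply, mat, Matrix.of_apply, sum_mul]
  rw [sum_comm]
  refine sum_ext fun i => sum_ext fun j => ?_
  ring

lemma det_gram_pullBilin (b : Bil n) (f : Lin n) :
    (gram (pullBilin b f)).det = (mat f).det ^ 2 * (gram b).det := by
  rw [gram_pullBilin, Matrix.det_mul, Matrix.det_mul, Matrix.det_transpose]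
  ring

lemma mat_comp (f g : Lin n) : mat (f.comp g) = mat f * mat g := by
  ext i j
  simp only [mat, Matrix.of_apply, Matrix.mul_apply, ContinuousLinearMap.comp_apply]
  rw [clm_apply_eq_sum f (g (ee j))]
  simp [mul_comm]

lemma mat_id : mat (ContinuousLinearMap.id ℝ (Euc n)) = 1 := by
  ext i j
  simp [mat, Matrix.one_apply]

lemma det_mat_ne_zero {f g : Lin n} (h : f.comp g = ContinuousLinearMap.id ℝ _) :
    (mat f).det ≠ 0 := by
  intro h0
  have := congrArg Matrix.det (congrArg mat h)
  rw [mat_comp, mat_id, Matrix.det_mul, h0] at this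
  simp at this

lemma mat_eq_toMatrix (f : Lin n) :
    mat f = LinearMap.toMatrix (EuclideanSpace.basisFun (Fin n) ℝ).toBasis
      (EuclideanSpace.basisFun (Fin n) ℝ).toBasis f := by
  ext i j
  simp [mat, LinearMap.toMatrix_apply]

lemma det_mat (f : Lin n) : (mat f).det = f.det := by rw [mat_eq_toMatrix, LinearMap.det_toMatrix]

lemma gram_inv_pullBilin (b : Bil n) (f : Lin n) (hf : (mat f).det ≠ 0) :
    gi b = mat f * gi (pullBilin b f) * (mat f).transpose := by
  have hu : IsUnit (mat f).det := hf.isUnit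
  have hu' : IsUnit (mat f).transpose.det := by rwa [Matrix.det_transpose]
  rw [gram_pullBilin, Matrix.mul_inv_rev, Matrix.mul_inv_rev, ← mul_assoc,
    Matrix.mul_nonsing_inv _ hu, one_mul, mul_assoc, Matrix.nonsing_inv_mul _ hu', mul_one]

lemma gram_inv_pullBilin_apply (b : Bil n) (f : Lin n) (hf : (mat f).det ≠ 0) (r s : Fin n) :
    gi b r s = ∑ i, ∑ l, f (ee i) r * gi (pullBilin b f) i l * f (ee l) s := by
  rw [gram_inv_pullBilin b f hf]
  simp only [Matrix.mul_apply, Matrix.transpose_apply, sum_mul]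
  rw [sum_comm]
  rfl

lemma pairing_pullBilin (b : Bil n) (f : Lin n)
    (hf : (mat f).det ≠ 0) (κ : V →ₗ[ℝ] W →ₗ[ℝ] U) (α : Alt n k V)
    (β : Alt n k W) :
    pairing (pullBilin b f) κ (α.compContinuousLinearMap f) (β.compContinuousLinearMap f) =
      pairing b κ α β :=
  mPair_comp _ κ f _ (gram_inv_pullBilin_apply b f hf) α β

lemma gram_inv_symm {b : Bil n} (hb : ∀ u v, b u v = b v u) (i j : Fin n) :
    gi b i j = gi b j i := by
  have h : (gram b).IsSymm := by ext i j; exact hb _ _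
  exact (h.inv.apply i j).symm

lemma sum_gram_inv_mul {b : Bil n} (hd : (gram b).det ≠ 0) (i j : Fin n) :
    ∑ r, gi b i r * b (ee r) (ee j) = if i = j then 1 else 0 := by
  have := congrFun (congrFun (Matrix.nonsing_inv_mul (gram b) hd.isUnit) i) j
  rwa [Matrix.mul_apply, Matrix.one_apply] at this

lemma sum_mul_gram_inv {b : Bil n} (hd : (gram b).det ≠ 0) (i j : Fin n) :
    ∑ r, b (ee i) (ee r) * gi b r j = if i = j then 1 else 0 := by
  have := congrFun (congrFun (Matrix.mul_nonsing_inv (gram b) hd.isUnit) i) j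
  rwa [Matrix.mul_apply, Matrix.one_apply] at this

lemma det_gram_ne_zero {b : Bil n} (h : ∀ X, (∀ Y, b X Y = 0) → X = 0) : (gram b).det ≠ 0 := by
  intro h0
  obtain ⟨v, hv, hv0⟩ := Matrix.exists_vecMul_eq_zero_iff.2 h0
  refine hv ?_
  have := h (WithLp.toLp 2 v) fun Y => by
    rw [bilin_apply_eq_sum, sum_comm]
    refine sum_eq_zero fun j _ => ?_
    have := congrFun hv0 j
    simp only [Matrix.vecMul, dotProduct, Pi.zero_apply] at this
    calc ∑ i, v i * Y j * gram b i j = Y j * ∑ i, v i * gram b i j := by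
          rw [mul_sum]; exact sum_ext fun i => by ring
      _ = 0 := by rw [this, mul_zero]
  funext i
  simpa using congrArg (fun w : Euc n => w i) this

lemma bilin_nondegenerate {b : Bil n} (hd : (gram b).det ≠ 0) {X : Euc n}
    (h : ∀ i, b X (ee i) = 0) : X = 0 := by
  ext i
  have h2 : ∀ j, ∑ r, X r * b (ee r) (ee j) = 0 := by
    intro j
    rw [← h j, clm_apply_eq_sum b X]
    simp
  have : ∑ j, (∑ r, X r * b (ee r) (ee j)) * gi b j i = X i := by
    simp only [sum_mul]
    rw [sum_comm]
    simp only [mul_assoc, ← mul_sum, sum_mul_gram_inv hd]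
    simp
  rw [← this]
  simp [h2]

/-! ### Smooth families of matrices -/

section Matrices

variable {E : Type*} [NormedAddCommGroup E] [NormedSpace ℝ E] {ι : Type*} [Fintype ι]
  [DecidableEq ι] {r : WithTop ℕ∞} {x : E} {s : Set E}

lemma smoothAt_det {M : E → Matrix ι ι ℝ} (h : ∀ i j, ContDiffWithinAt ℝ r (fun y => M y i j) s x) :
    ContDiffWithinAt ℝ r (fun y => (M y).det) s x := by
  simp only [Matrix.det_apply]
  refine ContDiffWithinAt.sum fun σ _ => ?_
  exact ContDiffWithinAt.const_smul _ (contDiffWithinAt_prod fun i _ => h _ _)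

lemma smoothAt_matrix_inv {M : E → Matrix ι ι ℝ}
    (h : ∀ i j, ContDiffWithinAt ℝ r (fun y => M y i j) s x) (hd : (M x).det ≠ 0) (i j : ι) :
    ContDiffWithinAt ℝ r (fun y => (M y)⁻¹ i j) s x := by
  have e : (fun y => (M y)⁻¹ i j) = fun y => ((M y).det)⁻¹ * ((M y).updateRow j (Pi.single i 1)).det := by
    funext y
    rw [Matrix.inv_def, Matrix.smul_apply, Matrix.adjugate_apply, Ring.inverse_eq_inv', smul_eq_mul]
  rw [e]
  refine ((smoothAt_det h).inv hd).mul (smoothAt_det fun a c => ?_)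
  by_cases ha : a = j
  · subst ha
    simp only [Matrix.updateRow_self]
    exact contDiffWithinAt_const
  · simp only [Matrix.updateRow_ne ha]
    exact h _ _

/-- The matrices `M`, regarded as arrays, with the entries as coordinates. -/
lemma differentiableAt_det (m : ι → ι → ℝ) :
    DifferentiableAt ℝ (fun m : ι → ι → ℝ => (Matrix.of m).det) m := by
  have : ContDiffWithinAt ℝ 1 (fun m : ι → ι → ℝ => (Matrix.of m).det) univ m :=
    smoothAt_det fun i j => (contDiff_apply_apply ℝ ℝ i j).contDiffWithinAt
  exact (contDiffWithinAt_univ.1 this).differentiableAt one_ne_zero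

lemma hasDerivAt_det {M : ℝ → Matrix ι ι ℝ} {M' : Matrix ι ι ℝ} {t : ℝ}
    (h : ∀ i j, HasDerivAt (fun s => M s i j) (M' i j) t) (hd : (M t).det ≠ 0) :
    HasDerivAt (fun s => (M s).det) ((M t).det * ((M t)⁻¹ * M').trace) t := by
  have hD := (differentiableAt_det (fun i j => M t i j)).hasFDerivAt
  set L := fd (fun m : ι → ι → ℝ => (Matrix.of m).det) (fun i j => M t i j) with hL
  have hM : HasDerivAt (fun s => fun i j => M s i j) (fun i j => M' i j) t :=
    hasDerivAt_pi.2 fun i => hasDerivAt_pi.2 fun j => h i j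
  have h1 : HasDerivAt (fun s => (M s).det) (L fun i j => M' i j) t :=
    hD.comp_hasDerivAt_of_eq t hM rfl
  have hline : HasDerivAt (fun s : ℝ => fun i j => M t i j + s * M' i j) (fun i j => M' i j) 0 := by
    refine hasDerivAt_pi.2 fun i => hasDerivAt_pi.2 fun j => ?_
    simpa using ((hasDerivAt_id (0 : ℝ)).mul_const (M' i j)).const_add (M t i j)
  have h2 : HasDerivAt (fun s : ℝ => (M t + s • M').det) (L fun i j => M' i j) 0 := by
    have := hD.comp_hasDerivAt_of_eq (0 : ℝ) hline (by ext i j; simp)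
    exact this
  have h3 : HasDerivAt (fun s : ℝ => (M t + s • M').det) ((M t).det * ((M t)⁻¹ * M').trace) 0 := by
    have e : (fun s : ℝ => (M t + s • M').det) = fun s : ℝ => (M t).det *
        (1 + ((M t)⁻¹ * M').trace * s + ((1 + (Polynomial.X : Polynomial ℝ) •
          ((M t)⁻¹ * M').map Polynomial.C).det.divX.divX).eval s * s ^ 2) := by
      funext s
      rw [← Matrix.det_one_add_smul, ← Matrix.det_mul, mul_add, mul_one, Matrix.mul_smul,
        Matrix.mul_nonsing_inv_cancel_left _ _ hd.isUnit]
    rw [e]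
    refine HasDerivAt.const_mul _ ?_
    set q := ((1 + (Polynomial.X : Polynomial ℝ) • ((M t)⁻¹ * M').map Polynomial.C).det.divX.divX)
    have := (((hasDerivAt_id (0 : ℝ)).const_mul ((M t)⁻¹ * M').trace).const_add 1).add
      ((q.hasDerivAt 0).mul (hasDerivAt_pow 2 (0 : ℝ)))
    convert! this using 1
    simp
  rw [h2.unique h3] at h1
  exact h1

lemma hasDerivAt_matrix_inv {M : ℝ → Matrix ι ι ℝ} {M' : Matrix ι ι ℝ} {t : ℝ}
    (h : ∀ i j, HasDerivAt (fun s => M s i j) (M' i j) t)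
    (hd : (M t).det ≠ 0) (i j : ι) :
    HasDerivAt (fun s => (M s)⁻¹ i j) (-((M t)⁻¹ * M' * (M t)⁻¹) i j) t := by
  have hne : ∀ᶠ s in nhds t, (M s).det ≠ 0 := (hasDerivAt_det h hd).continuousAt.eventually_ne hd
  have hM : HasDerivAt (fun s => fun i j => M s i j) (fun i j => M' i j) t :=
    hasDerivAt_pi.2 fun i => hasDerivAt_pi.2 fun j => h i j
  have hG : ∀ i j, HasDerivAt (fun s => (M s)⁻¹ i j) (deriv (fun s => (M s)⁻¹ i j) t) t := by
    intro i j
    have : ContDiffWithinAt ℝ 1 (fun m : ι → ι → ℝ => (Matrix.of m)⁻¹ i j) univ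
        (fun i j => M t i j) :=
      smoothAt_matrix_inv (M := fun m : ι → ι → ℝ => Matrix.of m)
        (fun i j => (contDiff_apply_apply ℝ ℝ i j).contDiffWithinAt) hd i j
    have h2 := ((contDiffWithinAt_univ.1 this).differentiableAt one_ne_zero).comp t
      hM.differentiableAt
    exact DifferentiableAt.hasDerivAt h2
  set G' : Matrix ι ι ℝ := Matrix.of fun i j => deriv (fun s => (M s)⁻¹ i j) t with hG'
  have key : G' * M t + (M t)⁻¹ * M' = 0 := by
    ext a c
    have h1 : HasDerivAt (fun s => ((M s)⁻¹ * M s) a c) ((G' * M t + (M t)⁻¹ * M') a c) t := by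
      simp only [Matrix.mul_apply, Matrix.add_apply, ← sum_add_distrib]
      refine HasDerivAt.fun_sum fun r _ => ?_
      exact (hG a r).mul (h r c)
    have h2 : HasDerivAt (fun s => ((M s)⁻¹ * M s) a c) 0 t := by
      refine (hasDerivAt_const t ((1 : Matrix ι ι ℝ) a c)).congr_of_eventuallyEq ?_
      filter_upwards [hne] with s hs
      rw [Matrix.nonsing_inv_mul _ hs.isUnit]
    exact h1.unique h2
  have : G' = -((M t)⁻¹ * M' * (M t)⁻¹) := by
    have h3 : G' * M t = -((M t)⁻¹ * M') := eq_neg_of_add_eq_zero_left key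
    rw [← Matrix.mul_nonsing_inv_cancel_right (A := M t) G' hd.isUnit, h3, Matrix.neg_mul]
  have h4 := hG i j
  rw [← Matrix.neg_apply, ← this]
  exact h4

end Matrices

end Gram

section Christoffel

variable {n : ℕ}

lemma pd_univ (f : Euc n → ℝ) (i : Fin n) (y : Euc n) : pd univ f i y = fd f y (ee i) := by
  rw [pd, fderivWithin_univ]

/-- A metric of arbitrary signature on an open subset `Ω` of `ℝⁿ`. -/
structure IsLocMetric (Ω : Set (Euc n)) (γ : Euc n → Bil n) : Prop where
  isOpen : IsOpen Ω
  smooth : SmoothOn γ Ω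
  symm : ∀ y u v, γ y u v = γ y v u
  det_ne : ∀ y ∈ Ω, (gram (γ y)).det ≠ 0

lemma smooth_pd {Ω : Set (Euc n)} (hΩ : IsOpen Ω) {f : Euc n → ℝ}
    (hf : SmoothOn f Ω) (i : Fin n) : SmoothOn (pd univ f i) Ω := by
  have : SmoothOn (fd f) Ω := hf.fderiv_of_isOpen hΩ (by norm_num)
  have h2 : SmoothOn (fun y => fd f y (ee i)) Ω := this.clm_apply contDiffOn_const
  refine h2.congr fun y _ => pd_univ f i y

lemma hasDerivAt_line {V : Type*} [NormedAddCommGroup V] [NormedSpace ℝ V] {f : Euc n → V}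
    {y : Euc n} (hf : DifferentiableAt ℝ f y) (u : Euc n) :
    HasDerivAt (fun t : ℝ => f (y + t • u)) (fd f y u) 0 := by
  have h : HasDerivAt (fun t : ℝ => y + t • u) u 0 := by
    simpa using ((hasDerivAt_id (0 : ℝ)).smul_const u).const_add y
  exact hf.hasFDerivAt.comp_hasDerivAt_of_eq (0 : ℝ) h (by simp)

lemma christoffel_symm (s : Set (Euc n)) {γ : Euc n → Bil n}
    (hs : ∀ y u v, γ y u v = γ y v u) (l i j : Fin n) (y : Euc n) :
    christoffel s γ l i j y = christoffel s γ l j i y := by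
  unfold christoffel
  congr 1
  refine sum_ext fun r => ?_
  have : (fun z => γ z (ee i) (ee j)) = fun z => γ z (ee j) (ee i) := by funext z; exact hs z _ _
  rw [this]
  ring

/-- The matrix `(Γ_i)^l_j = Γ^l_{ij}`. -/
def chrMat (Γ : Fin n → Fin n → Fin n → ℝ) (i : Fin n) : Matrix (Fin n) (Fin n) ℝ :=
  Matrix.of fun l j => Γ l i j

/-- The bilinear map `(u, w) ↦ Γ(u, w)`. -/
def gammaCLM (Γ : Fin n → Fin n → Fin n → ℝ) : Euc n →L[ℝ] Lin n :=
  LinearMap.toContinuousBilinearMap (LinearMap.mk₂ ℝ (gammaVec Γ) (fun u v w => by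
      ext l; simp [gammaVec, mul_add, add_mul, sum_add_distrib])
    (fun c u w => by
      ext l
      simp only [gammaVec, PiLp.smul_apply, smul_eq_mul, mul_sum]
      exact sum_ext fun i => sum_ext fun j => by ring)
    (fun u v w => by ext l; simp [gammaVec, mul_add, sum_add_distrib])
    (fun c u w => by
      ext l
      simp only [gammaVec, PiLp.smul_apply, smul_eq_mul, mul_sum]
      exact sum_ext fun i => sum_ext fun j => by ring))

lemma gammaCLM_apply (Γ : Fin n → Fin n → Fin n → ℝ) (u w : Euc n) :
    gammaCLM Γ u w = gammaVec Γ u w := rfl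

lemma gammaVec_ee (Γ : Fin n → Fin n → Fin n → ℝ) (i j l : Fin n) :
    gammaVec Γ (ee i) (ee j) l = Γ l i j := by
  simp [gammaVec]

lemma gammaVec_apply (Γ : Fin n → Fin n → Fin n → ℝ) (u w : Euc n) (l : Fin n) :
    gammaVec Γ u w l = ∑ i, ∑ j, Γ l i j * u i * w j := rfl

lemma gammaVec_symm {Γ : Fin n → Fin n → Fin n → ℝ} (h : ∀ l i j, Γ l i j = Γ l j i)
    (u w : Euc n) : gammaVec Γ u w = gammaVec Γ w u := by
  ext l
  rw [gammaVec_apply, gammaVec_apply, sum_comm]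
  refine sum_ext fun i => sum_ext fun j => ?_
  rw [h l j i]; ring

/-- The density `√|det b_{ij}|`. -/
def sqrtDet (b : Bil n) : ℝ := Real.sqrt |(gram b).det|

lemma smoothAt_sqrtDet {E : Type*} [NormedAddCommGroup E] [NormedSpace ℝ E]
    {r : ℕ∞} {b : E → Bil n} {s : Set E} {x : E}
    (h : ∀ i j, ContDiffWithinAt ℝ r (fun y => b y (ee i) (ee j)) s x)
    (hd : (gram (b x)).det ≠ 0) : ContDiffWithinAt ℝ r (fun y => sqrtDet (b y)) s x := by
  have h1 : ContDiffWithinAt ℝ r (fun y => (gram (b y)).det) s x := smoothAt_det h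
  have h2 : ContDiffWithinAt ℝ r (fun y => |(gram (b y)).det|) s x :=
    ContDiffAt.comp_contDiffWithinAt (g := fun d : ℝ => |d|) x (contDiffAt_abs hd) h1
  exact h2.sqrt (abs_pos.2 hd).ne'

lemma hasDerivAt_sqrtDet {b : ℝ → Bil n} {M' : Matrix (Fin n) (Fin n) ℝ}
    {t : ℝ} (h : ∀ i j, HasDerivAt (fun s => gram (b s) i j) (M' i j) t)
    (hd : (gram (b t)).det ≠ 0) :
    HasDerivAt (fun s => sqrtDet (b s)) (1 / 2 * sqrtDet (b t) * (gi (b t) * M').trace) t := by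
  have h1 := hasDerivAt_det (M := fun s => gram (b s)) h hd
  have h2 : HasDerivAt (fun s => |(gram (b s)).det|) _ t :=
    HasDerivAt.comp (h₂ := fun d : ℝ => |d|) t (hasDerivAt_abs hd) h1
  refine (h2.sqrt (abs_pos.2 hd).ne').congr_deriv ?_
  set D := (gram (b t)).det with hD
  set q := (gi (b t) * M').trace
  have hs : Real.sqrt |D| * Real.sqrt |D| = |D| := Real.mul_self_sqrt (abs_nonneg _)
  have hpos : 0 < Real.sqrt |D| := Real.sqrt_pos.2 (abs_pos.2 hd)
  have hsign : (SignType.sign D : ℝ) * D = |D| := by rw [sign_mul_self]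
  simp only [sqrtDet, ← hD]
  field_simp
  rw [hsign, sq, hs, mul_comm]

namespace IsLocMetric

variable {Ω : Set (Euc n)} {γ : Euc n → Bil n} {y : Euc n} (h : IsLocMetric Ω γ)

include h

lemma smooth_apply (u v : Euc n) : SmoothOn (fun y => γ y u v) Ω :=
  (h.smooth.clm_apply contDiffOn_const).clm_apply contDiffOn_const

lemma smooth_inv (i j : Fin n) : SmoothOn (fun y => gi (γ y) i j) Ω :=
  fun y hy => smoothAt_matrix_inv (M := fun y => gram (γ y))
    (fun i j => h.smooth_apply (ee i) (ee j) y hy) (h.det_ne y hy) i j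

lemma smooth_christoffel (l i j : Fin n) : SmoothOn (Chr γ l i j) Ω := by
  unfold christoffel
  refine contDiffOn_const.mul (ContDiffOn.sum fun r _ => (h.smooth_inv l r).mul ?_)
  exact ((smooth_pd h.isOpen (h.smooth_apply _ _) _).add
    (smooth_pd h.isOpen (h.smooth_apply _ _) _)).sub
    (smooth_pd h.isOpen (h.smooth_apply _ _) _)

lemma smooth_gammaCLM : SmoothOn (fun y => gammaCLM fun l i j => Chr γ l i j y) Ω := by
  refine contDiffOn_clm_apply.2 fun u => contDiffOn_clm_apply.2 fun w => ?_
  refine (contDiffOn_piLp 2).2 fun l => ?_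
  simp only [gammaCLM_apply, gammaVec_apply]
  exact ContDiffOn.sum fun i _ => ContDiffOn.sum fun j _ =>
    ((h.smooth_christoffel l i j).mul contDiffOn_const).mul contDiffOn_const

lemma diffAt {V : Type*} [NormedAddCommGroup V] [NormedSpace ℝ V]
    {f : Euc n → V} (hf : SmoothOn f Ω) (hy : y ∈ Ω) :
    DifferentiableAt ℝ f y :=
  (hf.contDiffAt (h.isOpen.mem_nhds hy)).differentiableAt (by simp)

/-- The Christoffel symbols with lowered index. -/
lemma lower_christoffel (hy : y ∈ Ω) (i j k : Fin n) :
    ∑ l, γ y (ee k) (ee l) * Chr γ l i j y = 1 / 2 * (pd univ (fun z => γ z (ee j) (ee k)) i y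
        + pd univ (fun z => γ z (ee i) (ee k)) j y
        - pd univ (fun z => γ z (ee i) (ee j)) k y) := by
  set K : Fin n → ℝ := fun r => pd univ (fun z => γ z (ee j) (ee r)) i y
        + pd univ (fun z => γ z (ee i) (ee r)) j y
        - pd univ (fun z => γ z (ee i) (ee j)) r y with hK
  have e : ∀ l, γ y (ee k) (ee l) * Chr γ l i j y =
      ∑ r, 1 / 2 * (γ y (ee k) (ee l) * gi (γ y) l r * K r) := by
    intro l
    simp only [christoffel, mul_sum]
    refine sum_ext fun r => by simp only [hK]; ring
  simp only [e]
  rw [sum_comm]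
  simp only [← mul_sum, ← sum_mul, sum_mul_gram_inv (h.det_ne y hy)]
  simp [hK]

/-- Metric compatibility of the Levi-Civita connection. -/
lemma pd_metric (hy : y ∈ Ω) (i j k : Fin n) :
    pd univ (fun z => γ z (ee j) (ee k)) i y = ∑ l, γ y (ee k) (ee l) * Chr γ l i j y +
        ∑ l, γ y (ee j) (ee l) * Chr γ l i k y := by
  rw [h.lower_christoffel hy, h.lower_christoffel hy]
  have e1 : (fun z => γ z (ee k) (ee j)) = fun z => γ z (ee j) (ee k) := by
    funext z; exact h.symm z _ _
  rw [e1]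
  ring

lemma pd_metric_matrix (hy : y ∈ Ω) (i : Fin n) :
    (Matrix.of fun j k => pd univ (fun z => γ z (ee j) (ee k)) i y) =
      (chrMat (fun l i j => Chr γ l i j y) i).transpose * gram (γ y) +
      gram (γ y) * chrMat (fun l i j => Chr γ l i j y) i := by
  ext j k
  rw [Matrix.of_apply, h.pd_metric hy]
  simp only [Matrix.add_apply, Matrix.mul_apply, Matrix.transpose_apply, chrMat, Matrix.of_apply,
    gram_apply]
  congr 1
  refine sum_ext fun l => ?_
  rw [h.symm y (ee k)]; ring

lemma hasDerivAt_gram (hy : y ∈ Ω) (i a c : Fin n) :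
    HasDerivAt (fun t : ℝ => gram (γ (y + t • ee i)) a c)
      ((Matrix.of fun j k => pd univ (fun z => γ z (ee j) (ee k)) i y) a c) 0 := by
  rw [Matrix.of_apply, pd_univ]
  exact hasDerivAt_line (h.diffAt (h.smooth_apply (ee a) (ee c)) hy) (ee i)

lemma hasDerivAt_inv (hy : y ∈ Ω) (i j k : Fin n) :
    HasDerivAt (fun t : ℝ => gi (γ (y + t • ee i)) j k) (-(∑ r, Chr γ j i r y * gi (γ y) r k) -
        ∑ r, Chr γ k i r y * gi (γ y) j r) 0 := by
  have h0 : (gram (γ (y + (0 : ℝ) • ee i))).det ≠ 0 := by simpa using h.det_ne y hy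
  have := hasDerivAt_matrix_inv (M := fun t : ℝ => gram (γ (y + t • ee i)))
    (h.hasDerivAt_gram hy i) h0 j k
  convert! this using 1
  rw [h.pd_metric_matrix hy]
  simp only [zero_smul, add_zero]
  have hu := (h.det_ne y hy).isUnit
  rw [mul_add, add_mul, Matrix.nonsing_inv_mul_cancel_left _ _ hu, ← mul_assoc,
    Matrix.mul_nonsing_inv_cancel_right _ _ hu, Matrix.add_apply,
    Matrix.mul_apply, Matrix.mul_apply]
  simp only [chrMat, Matrix.transpose_apply, Matrix.of_apply, mul_comm (gi (γ y) j _)]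
  ring

/-- `∂_i g^{jk} = -Γ^j_{ir} g^{rk} - Γ^k_{ir} g^{jr}`. -/
lemma fderiv_inv (hy : y ∈ Ω) (i j k : Fin n) :
    fd (fun z => gi (γ z) j k) y (ee i) = -(∑ r, Chr γ j i r y * gi (γ y) r k) -
        ∑ r, Chr γ k i r y * gi (γ y) j r :=
  (hasDerivAt_line (h.diffAt (h.smooth_inv j k) hy) (ee i)).unique (h.hasDerivAt_inv hy i j k)

lemma sqrtDet_pos (hy : y ∈ Ω) : 0 < sqrtDet (γ y) := Real.sqrt_pos.2 (abs_pos.2 (h.det_ne y hy))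

lemma smooth_sqrtDet : SmoothOn (fun y => sqrtDet (γ y)) Ω := fun y hy =>
  smoothAt_sqrtDet (fun i j => h.smooth_apply (ee i) (ee j) y hy) (h.det_ne y hy)

/-- `∂_i √|g| = √|g| Γ^l_{il}`. -/
lemma fderiv_sqrtDet (hy : y ∈ Ω) (i : Fin n) :
    fd (fun z => sqrtDet (γ z)) y (ee i) = sqrtDet (γ y) * ∑ l, Chr γ l i l y := by
  have h0 : (gram (γ (y + (0 : ℝ) • ee i))).det ≠ 0 := by simpa using h.det_ne y hy
  have h1 := hasDerivAt_sqrtDet (b := fun t : ℝ => γ (y + t • ee i)) (h.hasDerivAt_gram hy i) h0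
  rw [(hasDerivAt_line (h.diffAt h.smooth_sqrtDet hy) (ee i)).unique h1, h.pd_metric_matrix hy]
  simp only [zero_smul, add_zero]
  have hu := (h.det_ne y hy).isUnit
  rw [mul_add, Matrix.nonsing_inv_mul_cancel_left _ _ hu, Matrix.trace_add, ← mul_assoc,
    Matrix.trace_mul_comm, ← mul_assoc, Matrix.mul_nonsing_inv _ hu, one_mul,
    Matrix.trace_transpose]
  have : (chrMat (fun l i j => Chr γ l i j y) i).trace = ∑ l, Chr γ l i l y := rfl
  rw [this]
  ring

/-- The divergence of a vector field, in terms of the Christoffel symbols. -/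
lemma sum_fderiv_sqrtDet_mul {X : Fin n → Euc n → ℝ} (hy : y ∈ Ω)
    (hX : ∀ i, DifferentiableAt ℝ (X i) y) :
    ∑ i, fd (fun z => sqrtDet (γ z) * X i z) y (ee i) =
      sqrtDet (γ y) * (∑ i, fd (X i) y (ee i) + ∑ i, ∑ l, Chr γ l i l y * X i y) := by
  rw [← sum_add_distrib, mul_sum]
  refine sum_ext fun i => ?_
  rw [fderiv_fun_mul (h.diffAt h.smooth_sqrtDet hy) (hX i)]
  simp only [add_apply, smul_apply, smul_eq_mul, h.fderiv_sqrtDet hy, ← sum_mul]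
  ring

/-- The Ricci tensor is symmetric, since `Γ^l_{il} = ∂_i log √|g|`. -/
lemma ricciCoord_symm (hy : y ∈ Ω) (i j : Fin n) :
    ricciCoord univ γ i j y = ricciCoord univ γ j i y := by
  have hlog : SmoothOn (fun z => Real.log (sqrtDet (γ z))) Ω :=
    h.smooth_sqrtDet.log fun z hz => (h.sqrtDet_pos hz).ne'
  have htr : ∀ i, ∀ z ∈ Ω, ∑ l, Chr γ l i l z =
      fd (fun z => Real.log (sqrtDet (γ z))) z (ee i) := by
    intro i z hz
    rw [fderiv.log (h.diffAt h.smooth_sqrtDet hz) (h.sqrtDet_pos hz).ne']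
    simp only [smul_apply, smul_eq_mul, h.fderiv_sqrtDet hz]
    rw [inv_mul_cancel_left₀ (h.sqrtDet_pos hz).ne']
  have hsum : ∀ i j, ∑ l, pd univ (Chr γ l i l) j y =
      fd (fd fun z => Real.log (sqrtDet (γ z))) y (ee j) (ee i) := by
    intro i j
    simp only [pd_univ]
    have e : fd (fun z => ∑ l, Chr γ l i l z) y = ∑ l, fd (Chr γ l i l) y :=
      fderiv_fun_sum fun l _ => h.diffAt (h.smooth_christoffel l i l) hy
    have e2 := congrArg (fun L : Euc n →L[ℝ] ℝ => L (ee j)) e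
    simp only [sum_apply] at e2
    rw [← e2]
    have e3 : (fun z => ∑ l, Chr γ l i l z) =ᶠ[nhds y]
        fun z => fd (fun z => Real.log (sqrtDet (γ z))) z (ee i) := by
      filter_upwards [h.isOpen.mem_nhds hy] with z hz using htr i z hz
    rw [e3.fderiv_eq]
    have hd : DifferentiableAt ℝ (fd fun z => Real.log (sqrtDet (γ z))) y :=
      h.diffAt (hlog.fderiv_of_isOpen h.isOpen (by norm_num)) hy
    rw [fderiv_clm_apply hd (differentiableAt_const _)]
    simp
  have hsymm : fd (fd fun z => Real.log (sqrtDet (γ z))) y (ee j) (ee i) =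
      fd (fd fun z => Real.log (sqrtDet (γ z))) y (ee i) (ee j) :=
    (hlog.contDiffAt (h.isOpen.mem_nhds hy)).isSymmSndFDerivAt
      (by simpa using (ENat.LEInfty.out : (2 : WithTop ℕ∞) ≤ ∞)) _ _
  simp only [ricciCoord, sum_sub_distrib, hsum, hsymm]
  have e1 : ∀ l, Chr γ l i j = Chr γ l j i := fun l =>
    funext fun z => christoffel_symm _ h.symm l i j z
  have e2 : ∑ l, ∑ r, Chr γ l j r y * Chr γ r i l y = ∑ l, ∑ r, Chr γ l i r y * Chr γ r j l y := by
    rw [sum_comm]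
    exact sum_ext fun l => sum_ext fun r => mul_comm _ _
  simp only [e1, e2]

end IsLocMetric

end Christoffel

section Curvature

variable {n : ℕ}

section

variable {E F G W : Type*} [NormedAddCommGroup E] [NormedSpace ℝ E] [NormedAddCommGroup F]
  [NormedSpace ℝ F] [NormedAddCommGroup G] [NormedSpace ℝ G] [NormedAddCommGroup W]
  [NormedSpace ℝ W]

lemma fderiv_bilin_apply {b : E → F →L[ℝ] G →L[ℝ] W} {v : E → F} {w : E → G} {y : E}
    (hb : DifferentiableAt ℝ b y) (hv : DifferentiableAt ℝ v y) (hw : DifferentiableAt ℝ w y)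
    (u : E) :
    fd (fun z => b z (v z) (w z)) y u =
      fd b y u (v y) (w y) + b y (fd v y u) (w y) + b y (v y) (fd w y u) := by
  rw [fderiv_clm_apply (hb.clm_apply hv) hw, fderiv_clm_apply hb hv]
  simp only [add_apply, ContinuousLinearMap.comp_apply, ContinuousLinearMap.flip_apply]
  abel

lemma fderiv_comp_apply {b : F → W} {ψ : E → F} {y : E} (hb : DifferentiableAt ℝ b (ψ y))
    (hψ : DifferentiableAt ℝ ψ y) (u : E) :
    fd (fun z => b (ψ z)) y u = fd b (ψ y) (fd ψ y u) := by
  have := (hb.hasFDerivAt.comp y hψ.hasFDerivAt).fderiv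
  exact congrArg (fun L : E →L[ℝ] W => L u) this

lemma fderiv_clm_apply_const {b : E → F →L[ℝ] W} {y : E} (hb : DifferentiableAt ℝ b y) (v : F)
    (u : E) : fd (fun z => b z v) y u = fd b y u v := by
  rw [fderiv_clm_apply hb (differentiableAt_const v)]
  simp

end

/-- The Christoffel symbols as a field of bilinear maps. -/
def chrCLM (γ : Euc n → Bil n) (y : Euc n) : Euc n →L[ℝ] Lin n :=
  gammaCLM fun l i j => Chr γ l i j y

lemma chrCLM_apply (γ : Euc n → Bil n) (y u v : Euc n) :
    chrCLM γ y u v = gammaVec (fun l i j => Chr γ l i j y) u v := rfl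

/-- The curvature `R(w, u) v` of a field `Γ` of bilinear maps, regarded as a connection. -/
def riem (Γ : Euc n → Euc n →L[ℝ] Lin n) (y w u v : Euc n) : Euc n :=
  fd Γ y w u v - fd Γ y u w v + Γ y w (Γ y u v) - Γ y u (Γ y w v)

/-- The scalar curvature in coordinates. -/
def scalarLoc (s : Set (Euc n)) (γ : Euc n → Bil n) (y : Euc n) : ℝ :=
  ∑ i, ∑ j, gi (γ y) i j * ricciCoord s γ i j y

/-- The endomorphism `w ↦ R(w, v) u`, whose trace is `Ric(u, v)`. -/
def riemEnd (Γ : Euc n → Euc n →L[ℝ] Lin n) (y u v : Euc n) : Lin n :=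
  LinearMap.toContinuousLinearMap
    { toFun := fun w => riem Γ y w v u
      map_add' := fun a b => by simp [riem]; abel
      map_smul' := fun c a => by simp [riem, smul_sub, smul_add] }

lemma riemEnd_apply (Γ : Euc n → Euc n →L[ℝ] Lin n) (y u v w : Euc n) :
    riemEnd Γ y u v w = riem Γ y w v u := rfl

lemma riemEnd_add_left (Γ : Euc n → Euc n →L[ℝ] Lin n) (y u u' v : Euc n) :
    riemEnd Γ y (u + u') v = riemEnd Γ y u v + riemEnd Γ y u' v := by
  ext1 w
  simp only [riemEnd_apply, add_apply, riem, map_add]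
  abel

lemma riemEnd_smul_left (Γ : Euc n → Euc n →L[ℝ] Lin n) (c : ℝ) (y u v : Euc n) :
    riemEnd Γ y (c • u) v = c • riemEnd Γ y u v := by
  ext1 w
  simp only [riemEnd_apply, smul_apply, riem, map_smul, smul_sub, smul_add]

lemma riemEnd_add_right (Γ : Euc n → Euc n →L[ℝ] Lin n) (y u v v' : Euc n) :
    riemEnd Γ y u (v + v') = riemEnd Γ y u v + riemEnd Γ y u v' := by
  ext1 w
  simp only [riemEnd_apply, add_apply, riem, map_add]
  abel

lemma riemEnd_smul_right (Γ : Euc n → Euc n →L[ℝ] Lin n) (c : ℝ) (y u v : Euc n) :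
    riemEnd Γ y u (c • v) = c • riemEnd Γ y u v := by
  ext1 w
  simp only [riemEnd_apply, smul_apply, riem, map_smul, smul_sub, smul_add]

/-- The Ricci tensor of `Γ`, the trace of `w ↦ R(w, v) u`, as a bilinear map. -/
def ricciTr (Γ : Euc n → Euc n →L[ℝ] Lin n) (y : Euc n) : Euc n →ₗ[ℝ] Euc n →ₗ[ℝ] ℝ :=
  LinearMap.mk₂ ℝ (fun u v => (mat (riemEnd Γ y u v)).trace)
    (fun u u' v => by simp [riemEnd_add_left, mat, Matrix.trace, sum_add_distrib])
    (fun c u v => by simp [riemEnd_smul_left, mat, Matrix.trace, mul_sum])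
    (fun u v v' => by simp [riemEnd_add_right, mat, Matrix.trace, sum_add_distrib])
    (fun c u v => by simp [riemEnd_smul_right, mat, Matrix.trace, mul_sum])

lemma ricciTr_apply (Γ : Euc n → Euc n →L[ℝ] Lin n) (y u v : Euc n) :
    ricciTr Γ y u v = (mat (riemEnd Γ y u v)).trace := rfl

lemma trilinear_eq_sum (T : Euc n →L[ℝ] Bil n) (u v w : Euc n) :
    T u v w = ∑ i, ∑ j, ∑ k, u i * v j * w k * T (ee i) (ee j) (ee k) := by
  have h1 : T u v w = ∑ i, u i * T (ee i) v w := by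
    conv_lhs => rw [← sum_smul_ee u]
    simp only [map_sum, map_smul, sum_apply, smul_apply, smul_eq_mul]
  rw [h1]
  refine sum_ext fun i => ?_
  have h2 : T (ee i) v w = ∑ j, v j * T (ee i) (ee j) w := by
    conv_lhs => rw [← sum_smul_ee v]
    simp only [map_sum, map_smul, sum_apply, smul_apply, smul_eq_mul]
  rw [h2, mul_sum]
  refine sum_ext fun j => ?_
  rw [clm_apply_eq_sum (T (ee i) (ee j)) w, mul_sum, mul_sum]
  exact sum_ext fun k => by rw [smul_eq_mul]; ring

namespace IsLocMetric

variable {Ω Ω' : Set (Euc n)} {γ γ' : Euc n → Bil n} {y : Euc n} (h : IsLocMetric Ω γ)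

include h

lemma fderiv_apply₂ (hy : y ∈ Ω) (u v w : Euc n) : fd (fun z => γ z v w) y u = fd γ y u v w := by
  have hd := h.diffAt h.smooth hy
  have h1 := (hd.hasFDerivAt.clm_apply (hasFDerivAt_const v y)).clm_apply (hasFDerivAt_const w y)
  rw [h1.fderiv]
  simp

lemma fderiv_chrCLM_apply (hy : y ∈ Ω) (u : Euc n) (i j l : Fin n) :
    fd (chrCLM γ) y u (ee i) (ee j) l = fd (Chr γ l i j) y u := by
  have hd := h.diffAt h.smooth_gammaCLM hy
  have h1 := (hd.hasFDerivAt.clm_apply (hasFDerivAt_const (ee i) y)).clm_apply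
    (hasFDerivAt_const (ee j) y)
  have h2 := (EuclideanSpace.proj l : Euc n →L[ℝ] ℝ).hasFDerivAt.comp y h1
  have e : ((EuclideanSpace.proj l : Euc n →L[ℝ] ℝ) ∘ fun z =>
      gammaCLM (fun l i j => Chr γ l i j z) (ee i) (ee j)) = Chr γ l i j := by
    funext z
    exact gammaVec_ee (fun l i j => Chr γ l i j z) i j l
  rw [e] at h2
  rw [h2.fderiv]
  simp
  rfl

lemma ricciCoord_eq (hy : y ∈ Ω) (i j : Fin n) :
    ricciCoord univ γ i j y = ricciTr (chrCLM γ) y (ee i) (ee j) := by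
  have hs : ∀ a b c, Chr γ a b c y = Chr γ a c b y := fun a b c => christoffel_symm _ h.symm a b c y
  have hquad : ∀ a b c l : Fin n, chrCLM γ y (ee a) (chrCLM γ y (ee b) (ee c)) l =
      ∑ r, Chr γ l a r y * Chr γ r b c y := by
    intro a b c l
    rw [clm_apply_eq_sum (chrCLM γ y (ee a))]
    simp only [WithLp.ofLp_sum, WithLp.ofLp_smul, Finset.sum_apply, Pi.smul_apply, smul_eq_mul,
      chrCLM_apply, gammaVec_ee]
    exact sum_ext fun r => mul_comm _ _
  simp only [ricciTr_apply, Matrix.trace, Matrix.diag_apply, mat, Matrix.of_apply, riemEnd_apply,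
    riem, PiLp.sub_apply, PiLp.add_apply, h.fderiv_chrCLM_apply hy, hquad]
  simp only [ricciCoord, pd_univ, sum_add_distrib, sum_sub_distrib]
  have e1 : ∀ l, Chr γ l j i = Chr γ l i j := fun l =>
    funext fun z => christoffel_symm _ h.symm l j i z
  have e2 : ∀ l, Chr γ l l i = Chr γ l i l := fun l =>
    funext fun z => christoffel_symm _ h.symm l l i z
  have e3 : ∀ l r, Chr γ r l i y = Chr γ r i l y := fun l r => hs r l i
  simp only [e1, e2, e3]
  ring

/-- The Koszul formula. -/
lemma koszul (hy : y ∈ Ω) (u v w : Euc n) :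
    γ y w (chrCLM γ y u v) = 1 / 2 * (fd γ y u v w + fd γ y v u w - fd γ y w u v) := by
  have e : ∀ i j k, γ y (ee k) (chrCLM γ y (ee i) (ee j)) =
      1 / 2 * (fd γ y (ee i) (ee j) (ee k) + fd γ y (ee j) (ee i) (ee k)
        - fd γ y (ee k) (ee i) (ee j)) := by
    intro i j k
    rw [clm_apply_eq_sum (γ y (ee k))]
    have := h.lower_christoffel hy i j k
    simp only [pd_univ, h.fderiv_apply₂ hy] at this
    rw [← this]
    refine sum_ext fun l => ?_
    rw [chrCLM_apply, gammaVec_ee, smul_eq_mul, mul_comm]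
  have h0 := trilinear_eq_sum
    (((ContinuousLinearMap.compL ℝ (Euc n) (Euc n) (Euc n →L[ℝ] ℝ)) (γ y).flip).comp (chrCLM γ y))
    u v w
  have h1 := trilinear_eq_sum (fd γ y) u v w
  have h2 := (trilinear_eq_sum (fd γ y) v u w).trans sum_comm
  have h3 := (trilinear_eq_sum (fd γ y) w u v).trans
    (Finset.sum_comm.trans (sum_ext fun _ => sum_comm))
  simp only [ContinuousLinearMap.comp_apply, ContinuousLinearMap.compL_apply,
    ContinuousLinearMap.flip_apply, e] at h0
  rw [h0, h1, h2, h3]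
  simp only [← sum_add_distrib, ← sum_sub_distrib, mul_sum]
  exact sum_ext fun i => sum_ext fun j => sum_ext fun k => by ring

/-- The derivative of the pullback of a metric. -/
lemma fderiv_pullback {ψ : Euc n → Euc n} {Ω' : Set (Euc n)} (hΩ' : IsOpen Ω')
    (hψ : SmoothOn ψ Ω') (hmaps : Set.MapsTo ψ Ω' Ω)
    (hγ' : ∀ y ∈ Ω', γ' y = pullBilin (γ (ψ y)) (fd ψ y)) (hy : y ∈ Ω')
    (u v w : Euc n) (hd' : DifferentiableAt ℝ γ' y) :
    fd γ' y u v w = fd γ (ψ y) (fd ψ y u) (fd ψ y v) (fd ψ y w) +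
      γ (ψ y) (fd (fd ψ) y u v) (fd ψ y w) + γ (ψ y) (fd ψ y v) (fd (fd ψ) y u w) := by
  have hψd : DifferentiableAt ℝ ψ y := (hψ.contDiffAt (hΩ'.mem_nhds hy)).differentiableAt (by simp)
  have hA : DifferentiableAt ℝ (fd ψ) y :=
    ((hψ.fderiv_of_isOpen (m := ∞) hΩ' (by norm_num)).contDiffAt
      (hΩ'.mem_nhds hy)).differentiableAt (by simp)
  have hγd : DifferentiableAt ℝ γ (ψ y) := h.diffAt h.smooth (hmaps hy)
  have hAc : ∀ v, DifferentiableAt ℝ (fun z => fd ψ z v) y := fun v =>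
    hA.clm_apply (differentiableAt_const v)
  have e : (fun z => γ' z v w) =ᶠ[nhds y] fun z => γ (ψ z) (fd ψ z v) (fd ψ z w) := by
    filter_upwards [hΩ'.mem_nhds hy] with z hz
    rw [hγ' z hz]; rfl
  have hγψ : DifferentiableAt ℝ (fun z => γ (ψ z)) y := DifferentiableAt.comp (g := γ) y hγd hψd
  have h2 : fd (fun z => γ' z v w) y u = fd γ' y u v w := by
    have := fderiv_bilin_apply hd' (differentiableAt_const v) (differentiableAt_const w) u
    simpa using this
  rw [← h2, e.fderiv_eq, fderiv_bilin_apply (b := fun z => γ (ψ z)) hγψ (hAc v) (hAc w),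
    fderiv_clm_apply_const hA, fderiv_clm_apply_const hA]
  have h3 : fd (fun z => γ (ψ z)) y u = fd γ (ψ y) (fd ψ y u) :=
    fderiv_comp_apply (b := γ) hγd hψd u
  rw [h3]

omit h in
/-- The endomorphism `dψ` is invertible if the pullback of a metric is nondegenerate. -/
lemma det_mat_ne_zero_of_pullBilin {b : Bil n} {f : Lin n}
    (hd : (gram (pullBilin b f)).det ≠ 0) : (mat f).det ≠ 0 := by
  intro h0
  rw [det_gram_pullBilin, h0] at hd
  simp at hd

/-- The transformation law of the Christoffel symbols. -/
lemma chrCLM_pullback {ψ : Euc n → Euc n} (h' : IsLocMetric Ω' γ')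
    (hψ : SmoothOn ψ Ω') (hmaps : Set.MapsTo ψ Ω' Ω)
    (hγ' : ∀ y ∈ Ω', γ' y = pullBilin (γ (ψ y)) (fd ψ y)) (hy : y ∈ Ω')
    (u v : Euc n) :
    fd ψ y (chrCLM γ' y u v) = chrCLM γ (ψ y) (fd ψ y u) (fd ψ y v) + fd (fd ψ) y u v := by
  have hsym : ∀ a b, fd (fd ψ) y a b = fd (fd ψ) y b a := fun a b =>
    (hψ.contDiffAt (h'.isOpen.mem_nhds hy)).isSymmSndFDerivAt
      (by simpa using (ENat.LEInfty.out : (2 : WithTop ℕ∞) ≤ ∞)) a b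
  have hd' := h'.diffAt h'.smooth hy
  have hdet : (gram (pullBilin (γ (ψ y)) (fd ψ y))).det ≠ 0 := by
    rw [← hγ' y hy]; exact h'.det_ne y hy
  have hsurj : ∀ X, ∃ X', fd ψ y X' = X := by
    have hu := (det_mat_ne_zero_of_pullBilin hdet)
    rw [det_mat] at hu
    exact ((Module.End.isUnit_iff _).1 ((LinearMap.isUnit_iff_isUnit_det _).2 hu.isUnit)).2
  rw [← sub_eq_zero]
  refine bilin_nondegenerate (h.det_ne _ (hmaps hy)) fun i => ?_
  obtain ⟨w, hw⟩ := hsurj (ee i)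
  rw [← hw, h.symm]
  simp only [map_sub, map_add]
  have k1 := h'.koszul hy u v w
  have e : γ' y w (chrCLM γ' y u v) =
      γ (ψ y) (fd ψ y w) (fd ψ y (chrCLM γ' y u v)) := by rw [hγ' y hy]; rfl
  rw [← e, k1, h.koszul (hmaps hy)]
  simp only [h.fderiv_pullback h'.isOpen hψ hmaps hγ' hy _ _ _ hd']
  rw [hsym w u, hsym w v, hsym v u, h.symm _ (fd ψ y w) (fd (fd ψ) y u v),
    h.symm _ (fd ψ y v) (fd (fd ψ) y u w)]
  ring

/-- Covariance of the curvature tensor. -/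
lemma riem_pullback {ψ : Euc n → Euc n} (h' : IsLocMetric Ω' γ')
    (hψ : SmoothOn ψ Ω') (hmaps : Set.MapsTo ψ Ω' Ω)
    (hγ' : ∀ y ∈ Ω', γ' y = pullBilin (γ (ψ y)) (fd ψ y)) (hy : y ∈ Ω')
    (w u v : Euc n) :
    fd ψ y (riem (chrCLM γ') y w u v) = riem (chrCLM γ) (ψ y) (fd ψ y w) (fd ψ y u) (fd ψ y v) := by
  have hle : minSmoothness ℝ 2 ≤ (∞ : WithTop ℕ∞) := by
    simpa using (ENat.LEInfty.out : (2 : WithTop ℕ∞) ≤ ∞)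
  have hA' : SmoothOn (fd ψ) Ω' := hψ.fderiv_of_isOpen h'.isOpen (by norm_num)
  have hB' : SmoothOn (fd (fd ψ)) Ω' := hA'.fderiv_of_isOpen h'.isOpen (by norm_num)
  have hψd := (h'.diffAt hψ hy)
  have hA := (h'.diffAt hA' hy)
  have hB := (h'.diffAt hB' hy)
  have hG' := (h'.diffAt h'.smooth_gammaCLM hy)
  have hG := (h.diffAt h.smooth_gammaCLM (hmaps hy))
  change DifferentiableAt ℝ (chrCLM γ') y at hG'
  change DifferentiableAt ℝ (chrCLM γ) (ψ y) at hG
  have hsym : ∀ a b, fd (fd ψ) y a b = fd (fd ψ) y b a := fun a b =>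
    (hψ.contDiffAt (h'.isOpen.mem_nhds hy)).isSymmSndFDerivAt hle a b
  have hsym3 : ∀ a b c, fd (fd (fd ψ)) y a b c = fd (fd (fd ψ)) y b a c := fun a b c => by
    rw [(hA'.contDiffAt (h'.isOpen.mem_nhds hy)).isSymmSndFDerivAt hle a b]
  have law := fun a b => h.chrCLM_pullback h' hψ hmaps hγ' hy a b
  have dlaw : ∀ w u v, fd (fd ψ) y w (chrCLM γ' y u v) + fd ψ y (fd (chrCLM γ') y w u v) =
      fd (chrCLM γ) (ψ y) (fd ψ y w) (fd ψ y u) (fd ψ y v) +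
      chrCLM γ (ψ y) (fd (fd ψ) y w u) (fd ψ y v) + chrCLM γ (ψ y) (fd ψ y u) (fd (fd ψ) y w v) +
      fd (fd (fd ψ)) y w u v := by
    intro w u v
    have hAc : ∀ v, DifferentiableAt ℝ (fun z => fd ψ z v) y := fun v =>
      hA.clm_apply (differentiableAt_const v)
    have e : (fun z => fd ψ z (chrCLM γ' z u v)) =ᶠ[nhds y] fun z =>
        chrCLM γ (ψ z) (fd ψ z u) (fd ψ z v) + fd (fd ψ) z u v := by
      filter_upwards [h'.isOpen.mem_nhds hy] with z hz
      exact h.chrCLM_pullback h' hψ hmaps hγ' hz u v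
    have hGu : DifferentiableAt ℝ (fun z => chrCLM γ' z u v) y :=
      (hG'.clm_apply (differentiableAt_const u)).clm_apply (differentiableAt_const v)
    have hBu : DifferentiableAt ℝ (fun z => fd (fd ψ) z u v) y :=
      (hB.clm_apply (differentiableAt_const u)).clm_apply (differentiableAt_const v)
    have hGψ : DifferentiableAt ℝ (fun z => chrCLM γ (ψ z)) y :=
      DifferentiableAt.comp (g := chrCLM γ) y hG hψd
    have hR : DifferentiableAt ℝ (fun z => chrCLM γ (ψ z) (fd ψ z u) (fd ψ z v)) y :=
      (hGψ.clm_apply (hAc u)).clm_apply (hAc v)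
    have h3 := congrArg (fun L : Lin n => L w) e.fderiv_eq
    have h4 : fd (fun z => chrCLM γ (ψ z)) y w = fd (chrCLM γ) (ψ y) (fd ψ y w) :=
      fderiv_comp_apply (b := chrCLM γ) hG hψd w
    have h5 : fd (fun z => chrCLM γ' z u v) y w = fd (chrCLM γ') y w u v := by
      rw [fderiv_clm_apply_const (hG'.clm_apply (differentiableAt_const u)),
        fderiv_clm_apply_const hG']
    have h6 : fd (fun z => fd (fd ψ) z u v) y w = fd (fd (fd ψ)) y w u v := by
      rw [fderiv_clm_apply_const (hB.clm_apply (differentiableAt_const u)),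
        fderiv_clm_apply_const hB]
    rw [fderiv_clm_apply hA hGu, fderiv_fun_add hR hBu, add_apply, add_apply,
      fderiv_bilin_apply hGψ (hAc u) (hAc v), ContinuousLinearMap.comp_apply,
      ContinuousLinearMap.flip_apply, h4, h5, h6, fderiv_clm_apply_const hA,
      fderiv_clm_apply_const hA] at h3
    rw [add_comm, h3]
  have d1 := dlaw w u v
  have d2 := dlaw u w v
  rw [hsym u w, hsym3 u w v] at d2
  simp only [riem, map_add, map_sub, law]
  rw [← sub_eq_zero] at d1 d2 ⊢
  rw [← sub_eq_zero.2 (d1.trans d2.symm)]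
  abel

lemma ricciTr_pullback {ψ : Euc n → Euc n} (h' : IsLocMetric Ω' γ')
    (hψ : SmoothOn ψ Ω') (hmaps : Set.MapsTo ψ Ω' Ω)
    (hγ' : ∀ y ∈ Ω', γ' y = pullBilin (γ (ψ y)) (fd ψ y)) (hy : y ∈ Ω')
    (u v : Euc n) :
    ricciTr (chrCLM γ') y u v = ricciTr (chrCLM γ) (ψ y) (fd ψ y u) (fd ψ y v) := by
  have hdet : (mat (fd ψ y)).det ≠ 0 := det_mat_ne_zero_of_pullBilin (b := γ (ψ y)) (by
    rw [← hγ' y hy]; exact h'.det_ne y hy)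
  have hc : (fd ψ y).comp (riemEnd (chrCLM γ') y u v) =
      (riemEnd (chrCLM γ) (ψ y) (fd ψ y u) (fd ψ y v)).comp (fd ψ y) := by
    ext1 w
    exact h.riem_pullback h' hψ hmaps hγ' hy w v u
  have hm := congrArg mat hc
  rw [mat_comp, mat_comp] at hm
  rw [ricciTr_apply, ricciTr_apply,
    ← Matrix.nonsing_inv_mul_cancel_left _ (mat (riemEnd (chrCLM γ') y u v)) hdet.isUnit, hm,
    Matrix.trace_mul_comm, Matrix.mul_assoc, Matrix.mul_nonsing_inv _ hdet.isUnit, mul_one]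

/-- The scalar curvature does not depend on the coordinates. -/
lemma scalarLoc_pullback {ψ : Euc n → Euc n} (h' : IsLocMetric Ω' γ')
    (hψ : SmoothOn ψ Ω') (hmaps : Set.MapsTo ψ Ω' Ω)
    (hγ' : ∀ y ∈ Ω', γ' y = pullBilin (γ (ψ y)) (fd ψ y)) (hy : y ∈ Ω') :
    scalarLoc univ γ' y = scalarLoc univ γ (ψ y) := by
  have hdet : (mat (fd ψ y)).det ≠ 0 := det_mat_ne_zero_of_pullBilin (b := γ (ψ y)) (by
    rw [← hγ' y hy]; exact h'.det_ne y hy)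
  simp only [scalarLoc, h.ricciCoord_eq (hmaps hy), h'.ricciCoord_eq hy,
    gram_inv_pullBilin_apply (γ (ψ y)) _ hdet, ← hγ' y hy]
  simp only [h.ricciTr_pullback h' hψ hmaps hγ' hy]
  have e : ∀ i, fd ψ y (ee i) = ∑ r, fd ψ y (ee i) r • (ee r : Euc n) := fun i =>
    (sum_smul_ee _).symm
  have e2 : ∀ i j, ricciTr (chrCLM γ) (ψ y) (fd ψ y (ee i)) (fd ψ y (ee j)) =
      ∑ r, ∑ s, fd ψ y (ee i) r * fd ψ y (ee j) s * ricciTr (chrCLM γ) (ψ y) (ee r) (ee s) := by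
    intro i j
    conv_lhs => rw [e i, e j]
    simp only [map_sum, map_smul, LinearMap.sum_apply, LinearMap.smul_apply, smul_eq_mul, mul_sum]
    rw [sum_comm]
    exact sum_ext fun r => sum_ext fun s => by ring
  simp only [e2, mul_sum, sum_mul]
  have c4 : ∀ F : Fin n → Fin n → Fin n → Fin n → ℝ, ∑ i, ∑ l, ∑ r, ∑ s, F i l r s =
      ∑ r, ∑ s, ∑ i, ∑ l, F i l r s := by
    intro F
    calc _ = ∑ i, ∑ r, ∑ l, ∑ s, F i l r s :=
          sum_ext fun i => sum_comm
      _ = ∑ r, ∑ i, ∑ l, ∑ s, F i l r s := sum_comm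
      _ = ∑ r, ∑ i, ∑ s, ∑ l, F i l r s := sum_ext fun r => sum_ext fun i => sum_comm
      _ = _ := sum_ext fun r => sum_comm
  rw [c4]
  exact sum_ext fun r => sum_ext fun s => sum_ext fun i => sum_ext fun l => by ring

end IsLocMetric

end Curvature

section Adjoint

variable {n k : ℕ} {V W : Type*} [NormedAddCommGroup V] [NormedSpace ℝ V]
  [NormedAddCommGroup W] [NormedSpace ℝ W]

/-- `⟨σ, dτ⟩ = G^{il} ⟨i_{e_l} σ, ∇_{e_i} τ⟩`: a torsion-free connection computes the exterior
derivative. -/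
lemma mPair_alternatize_cov {Γ : Fin n → Fin n → Fin n → ℝ} (hΓ : ∀ l i j, Γ l i j = Γ l j i)
    {G : Matrix (Fin n) (Fin n) ℝ} (hG : ∀ i j, G i j = G j i) (κ : V →ₗ[ℝ] W →ₗ[ℝ] ℝ)
    (σ : Alt n (k + 1) V) (τ : Alt n k W)
    (dτ : Euc n →L[ℝ] Alt n k W) :
    mPair G κ σ (alternatizeUncurryFin dτ) = ∑ i, ∑ l, G i l • mPair G κ (σ.curryLeft (ee l))
        (fun w => dτ (ee i) w - slotDer (gammaCLM Γ (ee i)) τ w) := by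
  set S : Euc n →L[ℝ] Alt n k W :=
    τ.fderivCompContinuousLinearMap (ContinuousLinearMap.id ℝ (Euc n)) ∘L gammaCLM Γ with hS
  have hS0 : alternatizeUncurryFin S = 0 :=
    ContinuousAlternatingMap.alternatizeUncurryFin_fderivCompContinuousLinearMap_eq_zero τ _
      fun u v => gammaVec_symm hΓ u v
  have hSv : ∀ u w, S u w = slotDer (gammaCLM Γ u) τ w := by
    intro u w
    simp only [hS, ContinuousLinearMap.comp_apply,
      ContinuousAlternatingMap.fderivCompContinuousLinearMap_apply, slotDer]
    refine sum_ext fun a => congrArg τ ?_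
    funext b
    by_cases hb : b = a
    · subst hb; simp
    · simp [Function.update_of_ne hb]
  have h1 : alternatizeUncurryFin dτ = alternatizeUncurryFin (dτ - S) := by
    have := alternatizeUncurryFin_add (dτ - S) S
    rw [sub_add_cancel, hS0, add_zero] at this
    exact this
  rw [h1, mPair_alternatize, sum_comm]
  refine sum_ext fun i => sum_ext fun l => ?_
  rw [hG]
  congr 2
  funext w
  simp [hSv]

/-- The divergence of the vector field `G^{il} ⟨i_{e_l} σ, τ⟩`: minus the divergence is the formal
adjoint of the exterior derivative. The hypothesis is the Leibniz rule for the derivatives `dσ`,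
`dτ`, which may be gauge covariant ones. -/
lemma IsLocMetric.divergence_pairing {Ω : Set (Euc n)} {γ : Euc n → Bil n}
    (h : IsLocMetric Ω γ) {κ : V →ₗ[ℝ] W →ₗ[ℝ] ℝ} {σ : Euc n → Alt n (k + 1) V}
    {τ : Euc n → Alt n k W} {dσ : Euc n →L[ℝ] Alt n (k + 1) V}
    {dτ : Euc n →L[ℝ] Alt n k W} {y : Euc n} (hy : y ∈ Ω)
    (hL : ∀ i v v', HasDerivAt (fun t : ℝ => κ (σ (y + t • ee i) v) (τ (y + t • ee i) v'))
      (κ (dσ (ee i) v) (τ y v') + κ (σ y v) (dτ (ee i) v')) 0)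
    (hX : ∀ i, DifferentiableAt ℝ
      (fun z => ∑ l, gi (γ z) i l * mPair gi (γ z) κ ((σ z).curryLeft (ee l)) (τ z)) y) :
    ∑ i, fd (fun z => sqrtDet (γ z) * ∑ l, gi (γ z) i l *
        mPair gi (γ z) κ ((σ z).curryLeft (ee l)) (τ z)) y (ee i) =
      sqrtDet (γ y) * (mPair gi (γ y) κ (σ y) (alternatizeUncurryFin dτ) - mPair gi (γ y) κ
          (negDiv (γ y) (fun l i j => Chr γ l i j y) dσ (σ y)) (τ y)) := by
  set Γ : Fin n → Fin n → Fin n → ℝ := fun l i j => Chr γ l i j y with hΓd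
  set G := gi (γ y) with hGd
  have hΓ : ∀ l i j, Γ l i j = Γ l j i := fun l i j => christoffel_symm _ h.symm l i j y
  have hG : ∀ i j, G i j = G j i := gram_inv_symm (h.symm y)
  rw [h.sum_fderiv_sqrtDet_mul hy hX, mPair_alternatize_cov hΓ hG]
  congr 1
  set P : Fin n → ℝ := fun l => mPair G κ ((σ y).curryLeft (ee l)) (τ y) with hP
  -- the derivative of `X^i` along `e_i`
  have hD : ∀ i, fd (fun z => ∑ l, gi (γ z) i l *
        mPair gi (γ z) κ ((σ z).curryLeft (ee l)) (τ z)) y (ee i) =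
      ∑ l, ((-(∑ r, Γ i i r * G r l) - ∑ r, Γ l i r * G i r) * P l +
        G i l * (mPair G κ (fun w => dσ (ee i) (Fin.cons (ee l) w) -
            slotDer (gammaCLM Γ (ee i)) ((σ y).curryLeft (ee l)) w) (τ y) +
          mPair G κ ((σ y).curryLeft (ee l))
            (fun w => dτ (ee i) w - slotDer (gammaCLM Γ (ee i)) (τ y) w))) := by
    intro i
    refine (hasDerivAt_line (hX i) (ee i)).unique ?_
    refine HasDerivAt.fun_sum fun l _ => ?_
    have hinv := h.hasDerivAt_inv hy i
    have hG' : ∀ j k, HasDerivAt (fun t : ℝ => gi (γ (y + t • ee i)) j k)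
        (-(∑ r, (gammaCLM Γ (ee i) (ee r)) j * (gram (γ (y + (0 : ℝ) • ee i)))⁻¹ r k) -
          ∑ r, (gammaCLM Γ (ee i) (ee r)) k * (gram (γ (y + (0 : ℝ) • ee i)))⁻¹ j r) 0 := by
      intro j k
      simpa only [gammaCLM_apply, gammaVec_ee, zero_smul, add_zero] using hinv j k
    have h2 := hasDerivAt_mPair (κ := κ) (t := (0 : ℝ)) (G := fun t => gi (γ (y + t • ee i))) hG'
      (α := fun t => (σ (y + t • ee i)).curryLeft (ee l)) (β := fun t => τ (y + t • ee i))
      (dα := fun w => dσ (ee i) (Fin.cons (ee l) w)) (dβ := fun w => dτ (ee i) w)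
      (fun J L => by
        have h5 := hL i (Fin.cons (ee l) fun a => ee (J a)) fun a => ee (L a)
        simp only [zero_smul, add_zero]
        exact h5)
    have h3 := (hinv i l).fun_mul h2
    simp only [zero_smul, add_zero] at h3
    exact h3
  have hN : mPair G κ (negDiv (γ y) Γ dσ (σ y)) (τ y) =
      -∑ i, ∑ l, G i l * (mPair G κ (fun w => dσ (ee i) (Fin.cons (ee l) w) -
            slotDer (gammaCLM Γ (ee i)) ((σ y).curryLeft (ee l)) w) (τ y) -
          ∑ r, Γ r i l * P r) := by
    have e : (negDiv (γ y) Γ dσ (σ y) : (Fin k → Euc n) → V) = fun w => (-1 : ℝ) • ∑ i, ∑ l, G i l •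
        ((dσ (ee i) (Fin.cons (ee l) w) - slotDer (gammaCLM Γ (ee i)) ((σ y).curryLeft (ee l)) w) +
          (-1 : ℝ) • ∑ r, Γ r i l • (σ y).curryLeft (ee r) w) := by
      funext w
      simp only [negDiv, neg_smul, one_smul]
      congr 1
      refine sum_ext fun i => sum_ext fun l => ?_
      congr 1
      rw [covForm, Fin.sum_univ_succ]
      have e1 : σ y (update (Fin.cons (ee l) w : Fin (k + 1) → Euc n) 0
          (gammaVec Γ (ee i) ((Fin.cons (ee l) w : Fin (k + 1) → Euc n) 0))) =
          ∑ r, Γ r i l • (σ y).curryLeft (ee r) w := by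
        have : update (Fin.cons (ee l) w : Fin (k + 1) → Euc n) 0
          (gammaVec Γ (ee i) ((Fin.cons (ee l) w : Fin (k + 1) → Euc n) 0)) =
          Fin.cons (gammaVec Γ (ee i) (ee l)) w := by simp
        rw [this]
        have h4 := congrFun (curryLeft_eq_sum (σ y) (gammaVec Γ (ee i) (ee l))) w
        simp only [gammaVec_ee] at h4
        exact h4
      rw [e1, ← sub_sub, sub_right_comm, ← sub_eq_add_neg]
      congr 2
      simp only [slotDer]
      refine sum_ext fun a => ?_
      rw [← Fin.cons_update]
      rfl
    rw [e, mPair_smul_left, mPair_sum_left, neg_smul, one_smul]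
    congr 1
    refine sum_ext fun i => ?_
    rw [mPair_sum_left]
    refine sum_ext fun l => ?_
    rw [mPair_smul_left, mPair_add_left, mPair_smul_left, mPair_sum_left, smul_eq_mul]
    simp only [mPair_smul_left, smul_eq_mul, hP]
    ring
  rw [hN]
  simp only [hD, ← hGd, sum_add_distrib, mul_add, mul_sub, sub_mul, neg_mul,
    sum_sub_distrib, sum_neg_distrib, smul_eq_mul]
  have t1 : ∑ i, ∑ l, (∑ r, Γ i i r * G r l) * P l = ∑ i, ∑ l, Γ l i l * ∑ r, G i r * P r := by
    simp only [sum_mul, mul_sum]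
    calc ∑ i, ∑ l, ∑ r, Γ i i r * G r l * P l = ∑ i, ∑ r, ∑ l, Γ i i r * G r l * P l :=
          sum_ext fun i => sum_comm
      _ = ∑ r, ∑ i, ∑ l, Γ i i r * G r l * P l := sum_comm
      _ = _ := sum_ext fun r => sum_ext fun i => sum_ext fun l => by rw [hΓ i i r, mul_assoc]
  have t2 : ∑ i, ∑ l, (∑ r, Γ l i r * G i r) * P l = ∑ i, ∑ l, G i l * ∑ r, Γ r i l * P r := by
    simp only [sum_mul, mul_sum]
    refine sum_ext fun i => ?_
    rw [sum_comm]
    exact sum_ext fun l => sum_ext fun r => by ring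
  rw [t1, t2]
  ring

end Adjoint

/-! ### Dependence on parameters -/

section Parameters

variable {n : ℕ} {E : Type*} [NormedAddCommGroup E] [NormedSpace ℝ E]

/-- Derivatives in a parameter and in the point commute. -/
lemma hasDerivAt_fderiv_param {f : ℝ → E → ℝ} {f' : E → ℝ} {y : E}
    (hf : ContDiffAt ℝ ∞ (uncurry f) (0, y))
    (hf' : ∀ᶠ z in nhds y, HasDerivAt (fun ε => f ε z) (f' z) 0) (v : E) :
    HasDerivAt (fun ε => fd (f ε) y v) (fd f' y v) 0 := by
  have h2 : ContDiffAt ℝ 2 (uncurry f) (0, y) := hf.of_le ENat.LEInfty.out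
  have hev : ∀ᶠ q in nhds ((0 : ℝ), y), DifferentiableAt ℝ (uncurry f) q :=
    (h2.eventually (by simp)).mono fun q hq => hq.differentiableAt (by simp)
  have hD : DifferentiableAt ℝ (fd (uncurry f)) (0, y) :=
    (h2.fderiv_right (m := 1) (by norm_num)).differentiableAt one_ne_zero
  have hsymm : IsSymmSndFDerivAt ℝ (uncurry f) (0, y) := h2.isSymmSndFDerivAt (by simp)
  have c1 : ∀ᶠ ε in nhds (0 : ℝ), fd (f ε) y v = fd (uncurry f) (ε, y) (0, v) := by
    have : Filter.Tendsto (fun ε : ℝ => (ε, y)) (nhds 0) (nhds (0, y)) :=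
      (Continuous.prodMk_left y).tendsto 0
    filter_upwards [this.eventually hev] with ε hε
    have h3 : HasFDerivAt (fun z : E => (ε, z)) (ContinuousLinearMap.inr ℝ ℝ E) y :=
      hasFDerivAt_prodMk_right ε y
    have h4 := (hε.hasFDerivAt.comp y h3).fderiv
    have h5 : (uncurry f) ∘ (fun z : E => (ε, z)) = f ε := rfl
    rw [h5] at h4
    rw [h4]; rfl
  have c2 : ∀ᶠ z in nhds y, f' z = fd (uncurry f) (0, z) (1, 0) := by
    have : Filter.Tendsto (fun z : E => ((0 : ℝ), z)) (nhds y) (nhds (0, y)) :=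
      (Continuous.prodMk_right 0).tendsto y
    filter_upwards [this.eventually hev, hf'] with z hz hz'
    have h3 : HasFDerivAt (fun ε : ℝ => (ε, z)) (ContinuousLinearMap.inl ℝ ℝ E) 0 :=
      hasFDerivAt_prodMk_left 0 z
    have h4 := (hz.hasFDerivAt.comp (0 : ℝ) h3).hasDerivAt
    exact hz'.unique h4
  have d1 : HasDerivAt (fun ε : ℝ => fd (uncurry f) (ε, y) (0, v))
      (fd (fd (uncurry f)) (0, y) (1, 0) (0, v)) 0 := by
    have h3 : HasFDerivAt (fun ε : ℝ => (ε, y)) (ContinuousLinearMap.inl ℝ ℝ E) 0 :=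
      hasFDerivAt_prodMk_left 0 y
    have h4 := (hD.hasFDerivAt.comp (0 : ℝ) h3).hasDerivAt
    have h5 := h4.clm_apply (hasDerivAt_const (0 : ℝ) ((0 : ℝ), v))
    simpa using h5
  have d2 : fd f' y v = fd (fd (uncurry f)) (0, y) (0, v) (1, 0) := by
    have c2' : f' =ᶠ[nhds y] fun z => fd (uncurry f) (0, z) (1, 0) := c2
    rw [c2'.fderiv_eq]
    have h3 : HasFDerivAt (fun z : E => ((0 : ℝ), z)) (ContinuousLinearMap.inr ℝ ℝ E) y :=
      hasFDerivAt_prodMk_right 0 y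
    have h4 := (hD.hasFDerivAt.comp y h3).clm_apply (hasFDerivAt_const ((1 : ℝ), (0 : E)) y)
    have h5 : fd (fun z => fd (uncurry f) (0, z) (1, 0)) y = _ := h4.fderiv
    rw [h5]
    simp
  rw [d2, ← hsymm (1, 0) (0, v)]
  exact d1.congr_of_eventuallyEq c1

lemma contDiffAt_add_smul {V : Type*} [NormedAddCommGroup V] [NormedSpace ℝ V] {f h : E → V}
    {y : E} (hf : ContDiffAt ℝ ∞ f y) (hh : ContDiffAt ℝ ∞ h y) (ε : ℝ) :
    ContDiffAt ℝ ∞ (uncurry fun (ε : ℝ) z => f z + ε • h z) (ε, y) :=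
  (ContDiffAt.comp (g := f) (ε, y) hf contDiffAt_snd).add
    (contDiffAt_fst.smul (ContDiffAt.comp (g := h) (ε, y) hh contDiffAt_snd))

lemma sum_mul_mul_apply {ι : Type*} [Fintype ι] (A B C : Matrix ι ι ℝ) (K : ι → ℝ) (l : ι) :
    ∑ r, (A * B * C) l r * K r = ∑ r, A l r * ∑ t, B r t * ∑ s, C t s * K s := by
  have h : (A * B * C).mulVec K = A.mulVec (B.mulVec (C.mulVec K)) := by
    simp only [Matrix.mulVec_mulVec, mul_assoc]
  exact congrFun h l

lemma add_zero_bilin (b h : Bil n) : b + (0 : ℝ) • h = b := by ext u v; simp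

lemma contDiffAt_pd_param {f : E → Euc n → ℝ} {p : E × Euc n}
    (hf : ContDiffAt ℝ ∞ (uncurry f) p) (i : Fin n) :
    ContDiffAt ℝ ∞ (fun q : E × Euc n => pd univ (f q.1) i q.2) p := by
  simp only [pd_univ]
  have h1 : ContDiffAt ℝ ∞ (fun q : E × Euc n => fd (f q.1) q.2) p := by
    refine ContDiffAt.fderiv (f := fun q : E × Euc n => f q.1) (g := fun q => q.2) (n := ∞) ?_
      contDiffAt_snd (by norm_num)
    have : ContDiffAt ℝ ∞ (fun r : (E × Euc n) × Euc n => (r.1.1, r.2)) (p, p.2) :=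
      (contDiffAt_fst.comp _ contDiffAt_fst).prodMk contDiffAt_snd
    exact ContDiffAt.comp (g := uncurry f) (p, p.2) hf this
  exact h1.clm_apply contDiffAt_const

variable {γ : E → Euc n → Bil n} {p : E × Euc n}
  (hγ : ContDiffAt ℝ ∞ (uncurry γ) p) (hd : (gram (γ p.1 p.2)).det ≠ 0)

include hγ

lemma contDiffAt_metric_param (u v : Euc n) :
    ContDiffAt ℝ ∞ (fun q : E × Euc n => γ q.1 q.2 u v) p :=
  (hγ.clm_apply contDiffAt_const).clm_apply contDiffAt_const

include hd

lemma contDiffAt_inv_param (i j : Fin n) :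
    ContDiffAt ℝ ∞ (fun q : E × Euc n => gi (γ q.1 q.2) i j) p :=
  contDiffWithinAt_univ.1 <| smoothAt_matrix_inv (M := fun q : E × Euc n => gram (γ q.1 q.2))
    (fun i j => (contDiffAt_metric_param hγ (ee i) (ee j)).contDiffWithinAt) hd i j

lemma contDiffAt_sqrtDet_param : ContDiffAt ℝ ∞ (fun q : E × Euc n => sqrtDet (γ q.1 q.2)) p :=
  contDiffWithinAt_univ.1 <| smoothAt_sqrtDet (b := fun q : E × Euc n => γ q.1 q.2)
    (fun i j => (contDiffAt_metric_param hγ (ee i) (ee j)).contDiffWithinAt) hd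

lemma contDiffAt_christoffel_param (l i j : Fin n) :
    ContDiffAt ℝ ∞ (fun q : E × Euc n => Chr (γ q.1) l i j q.2) p := by
  unfold christoffel
  have hp : ∀ a b c, ContDiffAt ℝ ∞ (fun q : E × Euc n =>
      pd univ (fun z => γ q.1 z (ee a) (ee b)) c q.2) p := fun a b c =>
    contDiffAt_pd_param (f := fun x z => γ x z (ee a) (ee b)) (contDiffAt_metric_param hγ _ _) c
  exact contDiffAt_const.mul (ContDiffAt.sum fun r _ => (contDiffAt_inv_param hγ hd l r).mul
    (((hp _ _ _).add (hp _ _ _)).sub (hp _ _ _)))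

lemma contDiffAt_ricciCoord_param (i j : Fin n) :
    ContDiffAt ℝ ∞ (fun q : E × Euc n => ricciCoord univ (γ q.1) i j q.2) p := by
  unfold ricciCoord
  have hc := contDiffAt_christoffel_param hγ hd
  have hp : ∀ a b c e, ContDiffAt ℝ ∞ (fun q : E × Euc n =>
      pd univ (Chr (γ q.1) a b c) e q.2) p := fun a b c e =>
    contDiffAt_pd_param (f := fun x => Chr (γ x) a b c) (hc a b c) e
  exact (ContDiffAt.sum fun l _ => (hp _ _ _ _).sub (hp _ _ _ _)).add
    (ContDiffAt.sum fun l _ => ContDiffAt.sum fun r _ =>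
      ((hc _ _ _).mul (hc _ _ _)).sub ((hc _ _ _).mul (hc _ _ _)))

lemma contDiffAt_scalarLoc_param :
    ContDiffAt ℝ ∞ (fun q : E × Euc n => scalarLoc univ (γ q.1) q.2) p :=
  ContDiffAt.sum fun i _ => ContDiffAt.sum fun j _ =>
    (contDiffAt_inv_param hγ hd i j).mul (contDiffAt_ricciCoord_param hγ hd i j)

end Parameters

/-! ### Variation of the curvature -/

section Variation

variable {n : ℕ}

/-- The components `(∇_i h)_{js}` of the covariant derivative of a bilinear form. -/
def covBilin (γ h : Euc n → Bil n) (i j s : Fin n) (y : Euc n) : ℝ :=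
  pd univ (fun z => h z (ee j) (ee s)) i y - ∑ r, Chr γ r i j y * h y (ee r) (ee s) -
    ∑ r, Chr γ r i s y * h y (ee j) (ee r)

/-- The variation `C^l_{ij} = ½ γ^{lr} (∇_i h_{jr} + ∇_j h_{ir} - ∇_r h_{ij})` of the Christoffel
symbols when the metric `γ` varies by `h`. -/
def varChr (γ h : Euc n → Bil n) (l i j : Fin n) (y : Euc n) : ℝ := (1 / 2) * ∑ r, gi (γ y) l r *
    (covBilin γ h i j r y + covBilin γ h j i r y - covBilin γ h r i j y)

namespace IsLocMetric

variable {Ω : Set (Euc n)} {γ : Euc n → Bil n} {y : Euc n} (hγ : IsLocMetric Ω γ)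
  {h : Euc n → Bil n}

include hγ

lemma hasDerivAt_inv_variation (hy : y ∈ Ω) (i j : Fin n) :
    HasDerivAt (fun ε : ℝ => gi (γ y + ε • h y) i j)
      (-(gi (γ y) * gram (h y) * gi (γ y)) i j) 0 := by
  have h1 := hasDerivAt_matrix_inv (M := fun ε : ℝ => gram (γ y + ε • h y)) (M' := gram (h y))
    (t := 0) (fun i j => by
      simp only [gram_apply, add_apply, smul_apply, smul_eq_mul]
      simpa using ((hasDerivAt_id' (0 : ℝ)).mul_const (h y (ee i) (ee j))).const_add
        (γ y (ee i) (ee j)))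
    (by rw [add_zero_bilin]; exact hγ.det_ne y hy) i j
  simpa only [add_zero_bilin] using h1

variable (hh : SmoothOn h Ω) (hs : ∀ y u v, h y u v = h y v u)

include hh

lemma pd_variation (hy : y ∈ Ω) (ε : ℝ) (u v : Euc n) (i : Fin n) :
    pd univ (fun z => (γ z + ε • h z) u v) i y =
      pd univ (fun z => γ z u v) i y + ε * pd univ (fun z => h z u v) i y := by
  have h1 := hγ.diffAt (hγ.smooth_apply u v) hy
  have h2 := hγ.diffAt ((hh.clm_apply contDiffOn_const).clm_apply (contDiffOn_const (c := v)) :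
      SmoothOn (fun z => h z u v) Ω) hy
  simp only [pd_univ, add_apply, smul_apply]
  have h3 : fd (fun z => γ z u v + ε • h z u v) y = _ :=
    (h1.hasFDerivAt.add (h2.hasFDerivAt.const_smul ε)).fderiv
  rw [h3]
  simp

include hs

lemma hasDerivAt_christoffel (hy : y ∈ Ω) (l i j : Fin n) :
    HasDerivAt (fun ε : ℝ => Chr (fun z => γ z + ε • h z) l i j y) (varChr γ h l i j y) 0 := by
  set G := gi (γ y) with hG
  set K : Fin n → ℝ := fun r => pd univ (fun z => γ z (ee j) (ee r)) i y
        + pd univ (fun z => γ z (ee i) (ee r)) j y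
        - pd univ (fun z => γ z (ee i) (ee j)) r y with hK
  set k : Fin n → ℝ := fun r => pd univ (fun z => h z (ee j) (ee r)) i y
        + pd univ (fun z => h z (ee i) (ee r)) j y
        - pd univ (fun z => h z (ee i) (ee j)) r y with hk
  have h1 : HasDerivAt (fun ε : ℝ => (1 / 2) * ∑ r, gi (γ y + ε • h y) l r *
      (K r + ε * k r)) ((1 / 2) * ∑ r, (-(G * gram (h y) * G) l r * K r + G l r * k r)) 0 := by
    refine HasDerivAt.const_mul _ (HasDerivAt.fun_sum fun r _ => ?_)
    have h2 : HasDerivAt (fun ε : ℝ => K r + ε * k r) (k r) 0 := by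
      simpa using ((hasDerivAt_id' (0 : ℝ)).mul_const (k r)).const_add (K r)
    have h3 := (hγ.hasDerivAt_inv_variation (h := h) hy l r).fun_mul h2
    simpa only [zero_mul, add_zero, add_zero_bilin] using h3
  have e1 : (fun ε : ℝ => Chr (fun z => γ z + ε • h z) l i j y) =
      fun ε : ℝ => (1 / 2) * ∑ r, gi (γ y + ε • h y) l r * (K r + ε * k r) := by
    funext ε
    simp only [christoffel, hγ.pd_variation hh hy, hK, hk]
    congr 1
    refine sum_ext fun r => by ring
  rw [e1]
  refine h1.congr_deriv ?_
  have e2 : ∑ r, (G * gram (h y) * G) l r * K r =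
      ∑ r, G l r * (2 * ∑ t, Chr γ t i j y * h y (ee r) (ee t)) := by
    rw [sum_mul_mul_apply]
    refine sum_ext fun r => ?_
    refine congrArg (G l r * ·) ?_
    rw [mul_sum]
    refine sum_ext fun t => ?_
    have e4 : Chr γ t i j y = (1 / 2) * ∑ s, G t s * K s := rfl
    rw [e4, gram_apply]
    ring
  have e3 : ∀ r, covBilin γ h i j r y + covBilin γ h j i r y - covBilin γ h r i j y =
      k r - 2 * ∑ t, Chr γ t i j y * h y (ee r) (ee t) := by
    intro r
    have c1 : ∑ t, Chr γ t j i y * h y (ee t) (ee r) = ∑ t, Chr γ t i j y * h y (ee r) (ee t) :=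
      sum_ext fun t => by rw [christoffel_symm _ hγ.symm t j i, hs]
    have c2 : ∑ t, Chr γ t i j y * h y (ee t) (ee r) = ∑ t, Chr γ t i j y * h y (ee r) (ee t) :=
      sum_ext fun t => by rw [hs]
    have c3 : ∑ t, Chr γ t i r y * h y (ee j) (ee t) = ∑ t, Chr γ t r i y * h y (ee t) (ee j) :=
      sum_ext fun t => by rw [christoffel_symm _ hγ.symm t i r, hs]
    have c4 : ∑ t, Chr γ t j r y * h y (ee i) (ee t) = ∑ t, Chr γ t r j y * h y (ee i) (ee t) :=
      sum_ext fun t => by rw [christoffel_symm _ hγ.symm t j r]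
    simp only [covBilin, c1, c2, c3, c4, hk]
    ring
  simp only [varChr, e3, sum_add_distrib, mul_sub, sum_sub_distrib, neg_mul,
    sum_neg_distrib, e2, ← hG]
  ring

omit hs in
lemma smooth_covBilin (i j s : Fin n) : SmoothOn (covBilin γ h i j s) Ω := by
  have hap : ∀ u v, SmoothOn (fun z => h z u v) Ω := fun u v =>
    (hh.clm_apply contDiffOn_const).clm_apply contDiffOn_const
  exact ((smooth_pd hγ.isOpen (hap _ _) _).sub
    (ContDiffOn.sum fun _ _ => (hγ.smooth_christoffel _ _ _).mul (hap _ _))).sub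
    (ContDiffOn.sum fun _ _ => (hγ.smooth_christoffel _ _ _).mul (hap _ _))

omit hs in
lemma smooth_varChr (l i j : Fin n) : SmoothOn (varChr γ h l i j) Ω :=
  contDiffOn_const.mul (ContDiffOn.sum fun _ _ => (hγ.smooth_inv _ _).mul
    (((hγ.smooth_covBilin hh _ _ _).add (hγ.smooth_covBilin hh _ _ _)).sub
      (hγ.smooth_covBilin hh _ _ _)))

omit hs in
lemma contDiffAt_variation (hy : y ∈ Ω) (ε : ℝ) :
    ContDiffAt ℝ ∞ (uncurry fun (ε : ℝ) z => γ z + ε • h z) (ε, y) := by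
  exact contDiffAt_add_smul (hγ.smooth.contDiffAt (hγ.isOpen.mem_nhds hy))
    (hh.contDiffAt (hγ.isOpen.mem_nhds hy)) ε

/-- The variation of the Ricci tensor. -/
lemma hasDerivAt_ricciCoord (hy : y ∈ Ω) (i j : Fin n) :
    HasDerivAt (fun ε : ℝ => ricciCoord univ (fun z => γ z + ε • h z) i j y)
      (∑ l, (pd univ (varChr γ h l i j) l y - pd univ (varChr γ h l i l) j y) +
        ∑ l, ∑ r, ((varChr γ h l l r y * Chr γ r i j y + Chr γ l l r y * varChr γ h r i j y) -
          (varChr γ h l j r y * Chr γ r i l y + Chr γ l j r y * varChr γ h r i l y))) 0 := by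
  have hc : ∀ a b c, HasDerivAt
      (fun ε : ℝ => Chr (fun z => γ z + ε • h z) a b c y) (varChr γ h a b c y) 0 :=
    hγ.hasDerivAt_christoffel hh hs hy
  have hp : ∀ a b c e, HasDerivAt (fun ε : ℝ => pd univ (Chr (fun z => γ z + ε • h z) a b c) e y)
      (pd univ (varChr γ h a b c) e y) 0 := by
    intro a b c e
    simp only [pd_univ]
    refine hasDerivAt_fderiv_param
      (f := fun ε : ℝ => Chr (fun z => γ z + ε • h z) a b c) ?_ ?_ (ee e)
    · exact contDiffAt_christoffel_param (γ := fun (ε : ℝ) z => γ z + ε • h z)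
        (hγ.contDiffAt_variation hh hy 0)
        (by rw [add_zero_bilin]; exact hγ.det_ne y hy) a b c
    · filter_upwards [hγ.isOpen.mem_nhds hy] with z hz
      exact hγ.hasDerivAt_christoffel hh hs hz a b c
  have e0 : (fun z => γ z + (0 : ℝ) • h z) = γ :=  funext fun z => add_zero_bilin _ _
  have hm : ∀ a b c a' b' c', HasDerivAt (fun ε : ℝ => Chr (fun z => γ z + ε • h z) a b c y *
        Chr (fun z => γ z + ε • h z) a' b' c' y)
      (varChr γ h a b c y * Chr γ a' b' c' y + Chr γ a b c y * varChr γ h a' b' c' y) 0 := by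
    intro a b c a' b' c'
    have := (hc a b c).fun_mul (hc a' b' c')
    simpa only [e0] using this
  unfold ricciCoord
  exact (HasDerivAt.fun_sum fun l _ => (hp _ _ _ _).sub (hp _ _ _ _)).add
    (HasDerivAt.fun_sum fun l _ => HasDerivAt.fun_sum fun _ _ => (hm _ _ _ _ _ _).sub
      (hm _ _ _ _ _ _))

end IsLocMetric

end Variation

/-! ### The Palatini identity -/

section Palatini

variable {ι : Type*} [Fintype ι]

lemma sum4_swap12 (f : ι → ι → ι → ι → ℝ) :
    ∑ a, ∑ b, ∑ c, ∑ d, f a b c d = ∑ a, ∑ b, ∑ c, ∑ d, f b a c d := sum_comm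

lemma sum4_swap23 (f : ι → ι → ι → ι → ℝ) :
    ∑ a, ∑ b, ∑ c, ∑ d, f a b c d = ∑ a, ∑ b, ∑ c, ∑ d, f a c b d :=
  sum_ext fun _ => sum_comm

lemma sum4_swap34 (f : ι → ι → ι → ι → ℝ) :
    ∑ a, ∑ b, ∑ c, ∑ d, f a b c d = ∑ a, ∑ b, ∑ c, ∑ d, f a b d c :=
  sum_ext fun _ => sum_ext fun _ => sum_comm

lemma sum4_congr {f g : ι → ι → ι → ι → ℝ} (h : ∀ a b c d, f a b c d = g a b c d) :
    ∑ a, ∑ b, ∑ c, ∑ d, f a b c d = ∑ a, ∑ b, ∑ c, ∑ d, g a b c d := by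
  simp only [h]

/-- The algebra behind the Palatini identity `g^{ij} δRic_{ij} = ∇_l V^l`, where
`V^l = g^{ij} C^l_{ij} - g^{il} C^r_{ir}` and `C = δΓ`. -/
lemma palatini_algebra (G : ι → ι → ℝ) (Γ C : ι → ι → ι → ℝ) (dC : ι → ι → ι → ι → ℝ)
    (hΓ : ∀ l i j, Γ l i j = Γ l j i) (hC : ∀ l i j, C l i j = C l j i) :
    ∑ i, ∑ j, G i j * (∑ l, (dC l i j l - dC l i l j) +
      ∑ l, ∑ r, ((C l l r * Γ r i j + Γ l l r * C r i j) -
        (C l j r * Γ r i l + Γ l j r * C r i l))) =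
    ∑ l, (∑ i, ∑ j, ((-(∑ r, Γ i l r * G r j) - ∑ r, Γ j l r * G i r) * C l i j
        + G i j * dC l i j l) -
      ∑ i, ((-(∑ r, Γ i l r * G r l) - ∑ r, Γ l l r * G i r) * (∑ r, C r i r)
        + G i l * ∑ r, dC r i r l)) +
    ∑ l, ∑ s, Γ s l s * (∑ i, ∑ j, G i j * C l i j - ∑ i, G i l * ∑ r, C r i r) := by
  simp only [mul_add, mul_sub, sub_mul, neg_mul, sum_add_distrib,
    sum_sub_distrib, sum_neg_distrib, mul_sum, sum_mul]
  have a1 : ∑ l, ∑ i, ∑ j, G i j * dC l i j l = ∑ i, ∑ j, ∑ l, G i j * dC l i j l := by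
    rw [sum_comm]
    exact sum_ext fun _ => sum_comm
  have a2 : ∑ l, ∑ i, ∑ r, G i l * dC r i r l = ∑ i, ∑ j, ∑ l, G i j * dC l i l j := sum_comm
  have r1 : ∑ l, ∑ i, ∑ j, ∑ r, Γ i l r * G r j * C l i j =
      ∑ i, ∑ j, ∑ l, ∑ r, G i j * (C l j r * Γ r i l) := by
    -- (l, i, j, r) ↦ (l, r, j, i)
    refine (sum4_swap34 _).trans <| (sum4_swap23 _).trans <| (sum4_swap12 _).trans <|
      (sum4_swap34 _).trans <| (sum4_swap23 _).trans <| sum4_congr fun i j l r => ?_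
    rw [hΓ r i l, hC l j r]; ring
  have r2 : ∑ l, ∑ i, ∑ j, ∑ r, Γ j l r * G i r * C l i j =
      ∑ i, ∑ j, ∑ l, ∑ r, G i j * (Γ l j r * C r i l) := by
    refine (sum4_swap12 _).trans <| (sum4_swap23 _).trans <| (sum4_swap34 _).trans <|
      (sum4_swap23 _).trans <| (sum4_swap34 _).trans <| (sum4_swap34 _).trans <|
      sum4_congr fun i j l r => ?_
    rw [hΓ l j r]; ring
  have r3 : ∑ l, ∑ i, ∑ r, ∑ s, Γ i l s * G s l * C r i r =
      ∑ i, ∑ j, ∑ l, ∑ r, G i j * (C l l r * Γ r i j) := by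
    refine (sum4_swap34 _).trans <| (sum4_swap23 _).trans <| (sum4_swap12 _).trans <|
      (sum4_swap34 _).trans <| sum4_congr fun i j l r => ?_
    rw [hΓ r j i, hC l r l]; ring
  have r5 : ∑ l, ∑ s, ∑ i, ∑ j, Γ s l s * (G i j * C l i j) =
      ∑ i, ∑ j, ∑ l, ∑ r, G i j * (Γ l l r * C r i j) := by
    refine (sum4_swap12 _).trans <| (sum4_swap23 _).trans <| (sum4_swap12 _).trans <|
      (sum4_swap34 _).trans <| (sum4_swap23 _).trans <| sum4_congr fun i j l r => ?_
    rw [hΓ l r l]; ring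
  have r46 : ∑ l, ∑ i, ∑ r, ∑ s, Γ l l s * G i s * C r i r =
      ∑ l, ∑ s, ∑ i, ∑ r, Γ s l s * (G i l * C r i r) := by
    refine (sum4_swap34 _).trans <| (sum4_swap23 _).trans <| (sum4_swap12 _).trans <|
      sum4_congr fun l s i r => ?_
    rw [hΓ s l s]; ring
  rw [a1, a2, r1, r2, r3, r5, r46]
  ring

end Palatini

section ScalarVariation

variable {n : ℕ}

/-- The trace `γ^{ij} h_{ij}`. -/
def trBilin (γ h : Euc n → Bil n) (y : Euc n) : ℝ := ∑ i, ∑ j, gi (γ y) i j * h y (ee i) (ee j)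

/-- The components `h^{ij}` with raised indices. -/
def raise (γ h : Euc n → Bil n) (y : Euc n) : Matrix (Fin n) (Fin n) ℝ :=
  gi (γ y) * gram (h y) * gi (γ y)

/-- The components of the gradient of `φ`. -/
def grad (γ : Euc n → Bil n) (φ : Euc n → ℝ) (i : Fin n) (y : Euc n) : ℝ :=
  ∑ l, gi (γ y) i l * pd univ φ l y

/-- The Hessian `(∇_i dφ)_j`. -/
def hess (γ : Euc n → Bil n) (φ : Euc n → ℝ) (i j : Fin n) (y : Euc n) : ℝ :=
  pd univ (pd univ φ j) i y - ∑ r, Chr γ r i j y * pd univ φ r y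

/-- The Palatini vector field `V^l = γ^{ij} C^l_{ij} - γ^{il} C^r_{ir}`. -/
def palatiniVec (γ h : Euc n → Bil n) (l : Fin n) (y : Euc n) : ℝ :=
  ∑ i, ∑ j, gi (γ y) i j * varChr γ h l i j y - ∑ i, gi (γ y) i l * ∑ r, varChr γ h r i r y

/-- The contraction `γ^{ij} (∇_i h)_{js} ∂^s φ`. -/
def divContract (γ h : Euc n → Bil n) (φ : Euc n → ℝ) (y : Euc n) : ℝ :=
  ∑ i, ∑ j, gi (γ y) i j * ∑ s, covBilin γ h i j s y * grad γ φ s y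

namespace IsLocMetric

variable {Ω : Set (Euc n)} {γ : Euc n → Bil n} {y : Euc n} (hγ : IsLocMetric Ω γ)
  {h : Euc n → Bil n} (hh : SmoothOn h Ω) (hs : ∀ y u v, h y u v = h y v u)
  {φ : Euc n → ℝ} (hφ : SmoothOn φ Ω)

include hγ

/-- The divergence `∇_i X^i` of a vector field with a lowered index. -/
lemma div_raise {Y : Fin n → Euc n → ℝ} (hy : y ∈ Ω) (hY : ∀ j, DifferentiableAt ℝ (Y j) y) :
    ∑ i, fd (fun z => ∑ j, gi (γ z) i j * Y j z) y (ee i) +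
      ∑ i, ∑ l, Chr γ l i l y * ∑ j, gi (γ y) i j * Y j y =
    ∑ i, ∑ j, gi (γ y) i j * (fd (Y j) y (ee i) - ∑ r, Chr γ r i j y * Y r y) := by
  have e1 : ∀ i, fd (fun z => ∑ j, gi (γ z) i j * Y j z) y (ee i) =
      ∑ j, ((-(∑ r, Chr γ i i r y * gi (γ y) r j) - ∑ r, Chr γ j i r y * gi (γ y) i r) * Y j y +
        gi (γ y) i j * fd (Y j) y (ee i)) := by
    intro i
    have hG : ∀ j, DifferentiableAt ℝ (fun z => gi (γ z) i j) y := fun j =>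
      hγ.diffAt (hγ.smooth_inv i j) hy
    rw [fderiv_fun_sum fun j _ => (hG j).fun_mul (hY j), sum_apply]
    refine sum_ext fun j => ?_
    rw [fderiv_fun_mul (hG j) (hY j)]
    simp only [add_apply, smul_apply, smul_eq_mul, hγ.fderiv_inv hy]
    ring
  simp only [e1, sum_add_distrib, mul_sub, sub_mul, neg_mul, sum_sub_distrib, sum_neg_distrib]
  have t1 : ∑ i, ∑ j, (∑ r, Chr γ i i r y * gi (γ y) r j) * Y j y =
      ∑ i, ∑ l, Chr γ l i l y * ∑ j, gi (γ y) i j * Y j y := by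
    simp only [sum_mul, mul_sum]
    calc ∑ i, ∑ l, ∑ r, Chr γ i i r y * gi (γ y) r l * Y l y
        = ∑ i, ∑ r, ∑ l, Chr γ i i r y * gi (γ y) r l * Y l y := sum_ext fun i => sum_comm
      _ = ∑ r, ∑ i, ∑ l, Chr γ i i r y * gi (γ y) r l * Y l y := sum_comm
      _ = _ := sum_ext fun r => sum_ext fun i =>
          sum_ext fun l => by rw [christoffel_symm _ hγ.symm i i r, mul_assoc]
  have t2 : ∑ i, ∑ j, (∑ r, Chr γ j i r y * gi (γ y) i r) * Y j y =
      ∑ i, ∑ j, gi (γ y) i j * ∑ r, Chr γ r i j y * Y r y := by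
    simp only [sum_mul, mul_sum]
    refine sum_ext fun i => ?_
    rw [sum_comm]
    exact sum_ext fun l => sum_ext fun r => by ring
  rw [t1, t2]
  ring

include hh in
omit hγ in
lemma smooth_bilin_apply (u v : Euc n) : SmoothOn (fun z => h z u v) Ω :=
  (hh.clm_apply contDiffOn_const).clm_apply contDiffOn_const

include hh in
lemma smooth_trBilin : SmoothOn (trBilin γ h) Ω :=
  ContDiffOn.sum fun _ _ => ContDiffOn.sum fun _ _ =>
    (hγ.smooth_inv _ _).mul (smooth_bilin_apply hh _ _)

include hφ in
lemma smooth_grad (i : Fin n) : SmoothOn (grad γ φ i) Ω :=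
  ContDiffOn.sum fun _ _ => (hγ.smooth_inv _ _).mul (smooth_pd hγ.isOpen hφ _)

include hh in
lemma smooth_palatiniVec (l : Fin n) : SmoothOn (palatiniVec γ h l) Ω :=
  (ContDiffOn.sum fun _ _ => ContDiffOn.sum fun _ _ =>
    (hγ.smooth_inv _ _).mul (hγ.smooth_varChr hh _ _ _)).sub
  (ContDiffOn.sum fun _ _ => (hγ.smooth_inv _ _).mul
    (ContDiffOn.sum fun _ _ => hγ.smooth_varChr hh _ _ _))

include hφ in
lemma fderiv_grad (hy : y ∈ Ω) (i s : Fin n) :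
    fd (grad γ φ s) y (ee i) = ∑ l, gi (γ y) s l * hess γ φ i l y -
      ∑ r, Chr γ s i r y * grad γ φ r y := by
  have hG : ∀ j, DifferentiableAt ℝ (fun z => gi (γ z) s j) y := fun j =>
    hγ.diffAt (hγ.smooth_inv s j) hy
  have hp : ∀ j, DifferentiableAt ℝ (pd univ φ j) y := fun j =>
    hγ.diffAt (smooth_pd hγ.isOpen hφ j) hy
  have e1 : fd (grad γ φ s) y (ee i) = ∑ j, ((-(∑ r, Chr γ s i r y * gi (γ y) r j) -
        ∑ r, Chr γ j i r y * gi (γ y) s r) * pd univ φ j y +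
        gi (γ y) s j * pd univ (pd univ φ j) i y) := by
    have e0 : grad γ φ s = fun z => ∑ j, gi (γ z) s j * pd univ φ j z := rfl
    rw [e0, fderiv_fun_sum fun j _ => (hG j).fun_mul (hp j), sum_apply]
    refine sum_ext fun j => ?_
    rw [fderiv_fun_mul (hG j) (hp j), pd_univ (pd univ φ j)]
    simp only [add_apply, smul_apply, smul_eq_mul, hγ.fderiv_inv hy]
    ring
  rw [e1]
  simp only [hess, grad, sum_add_distrib, mul_sub, sub_mul, neg_mul,
    sum_sub_distrib, sum_neg_distrib]
  have t1 : ∑ j, (∑ r, Chr γ s i r y * gi (γ y) r j) * pd univ φ j y =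
      ∑ r, Chr γ s i r y * ∑ l, gi (γ y) r l * pd univ φ l y := by
    simp only [sum_mul, mul_sum]
    rw [sum_comm]
    exact sum_ext fun _ => sum_ext fun _ => by ring
  have t2 : ∑ j, (∑ r, Chr γ j i r y * gi (γ y) s r) * pd univ φ j y =
      ∑ l, gi (γ y) s l * ∑ r, Chr γ r i l y * pd univ φ r y := by
    simp only [sum_mul, mul_sum]
    rw [sum_comm]
    exact sum_ext fun _ => sum_ext fun _ => by ring
  rw [t1, t2]
  ring

include hφ in
/-- `Δφ = γ^{ij} (∇_i dφ)_j` is the divergence of the gradient. -/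
lemma div_grad (hy : y ∈ Ω) : ∑ i, fd (grad γ φ i) y (ee i) +
      ∑ i, ∑ l, Chr γ l i l y * grad γ φ i y =
    ∑ i, ∑ j, gi (γ y) i j * hess γ φ i j y := by
  have hp : ∀ j, DifferentiableAt ℝ (pd univ φ j) y := fun j =>
    hγ.diffAt (smooth_pd hγ.isOpen hφ j) hy
  refine (hγ.div_raise hy hp).trans ?_
  refine sum_ext fun i => sum_ext fun j => ?_
  rw [hess, pd_univ (pd univ φ j)]

omit hγ in
/-- The vector field `h^{il} ∂_l φ` as a lowered vector field. -/
lemma raise_mulVec (y : Euc n) (i : Fin n) : ∑ l, raise γ h y i l * pd univ φ l y =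
      ∑ j, gi (γ y) i j * ∑ s, h y (ee j) (ee s) * grad γ φ s y := by
  simp only [raise, sum_mul_mul_apply, gram_apply, grad]

include hh hφ in
/-- The divergence of `h^{il} ∂_l φ`. -/
lemma div_raise_bilin (hy : y ∈ Ω) :
    ∑ i, fd (fun z => ∑ l, raise γ h z i l * pd univ φ l z) y (ee i) +
      ∑ i, ∑ l, Chr γ l i l y * ∑ l, raise γ h y i l * pd univ φ l y =
    divContract γ h φ y + ∑ i, ∑ l, raise γ h y i l * hess γ φ i l y := by
  have hg : ∀ s, DifferentiableAt ℝ (grad γ φ s) y := fun s => hγ.diffAt (hγ.smooth_grad hφ s) hy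
  have hb : ∀ j s, DifferentiableAt ℝ (fun z => h z (ee j) (ee s)) y := fun j s =>
    hγ.diffAt (smooth_bilin_apply hh _ _) hy
  simp only [raise_mulVec]
  rw [hγ.div_raise hy fun j => DifferentiableAt.fun_sum fun s _ => (hb j s).fun_mul (hg s)]
  have e1 : ∀ i j, fd (fun z => ∑ s, h z (ee j) (ee s) * grad γ φ s z) y (ee i) -
      ∑ r, Chr γ r i j y * ∑ s, h y (ee r) (ee s) * grad γ φ s y =
      ∑ s, covBilin γ h i j s y * grad γ φ s y +
        ∑ s, h y (ee j) (ee s) * ∑ l, gi (γ y) s l * hess γ φ i l y := by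
    intro i j
    rw [fderiv_fun_sum fun s _ => (hb j s).fun_mul (hg s), sum_apply]
    have : ∀ s, fd (fun z => h z (ee j) (ee s) * grad γ φ s z) y (ee i) =
        pd univ (fun z => h z (ee j) (ee s)) i y * grad γ φ s y +
        h y (ee j) (ee s) * (∑ l, gi (γ y) s l * hess γ φ i l y -
          ∑ r, Chr γ s i r y * grad γ φ r y) := by
      intro s
      rw [fderiv_fun_mul (hb j s) (hg s), pd_univ]
      simp only [add_apply, smul_apply, smul_eq_mul, hγ.fderiv_grad hφ hy]
      ring
    simp only [this, covBilin, sub_mul, mul_sub, sum_add_distrib, sum_sub_distrib]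
    have t1 : ∑ s, h y (ee j) (ee s) * ∑ r, Chr γ s i r y * grad γ φ r y =
        ∑ s, (∑ r, Chr γ r i s y * h y (ee j) (ee r)) * grad γ φ s y := by
      simp only [sum_mul, mul_sum]
      rw [sum_comm]
      exact sum_ext fun _ => sum_ext fun _ => by ring
    have t2 : ∑ r, Chr γ r i j y * ∑ s, h y (ee r) (ee s) * grad γ φ s y =
        ∑ s, (∑ r, Chr γ r i j y * h y (ee r) (ee s)) * grad γ φ s y := by
      simp only [sum_mul, mul_sum]
      rw [sum_comm]
      exact sum_ext fun _ => sum_ext fun _ => by ring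
    rw [t1, t2]
    ring
  simp only [e1, mul_add, sum_add_distrib, divContract]
  congr 1
  refine sum_ext fun i => ?_
  rw [raise, sum_mul_mul_apply]
  simp only [gram_apply]

include hh in
lemma fderiv_trBilin (hy : y ∈ Ω) (i : Fin n) :
    fd (trBilin γ h) y (ee i) = ∑ j, ∑ s, gi (γ y) j s * covBilin γ h i j s y := by
  have hG : ∀ j s, DifferentiableAt ℝ (fun z => gi (γ z) j s) y := fun j s =>
    hγ.diffAt (hγ.smooth_inv j s) hy
  have hb : ∀ j s, DifferentiableAt ℝ (fun z => h z (ee j) (ee s)) y := fun j s =>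
    hγ.diffAt (smooth_bilin_apply hh _ _) hy
  have e0 : trBilin γ h = fun z => ∑ j, ∑ s, gi (γ z) j s * h z (ee j) (ee s) := rfl
  have e1 : ∀ j s, fd (fun z => gi (γ z) j s * h z (ee j) (ee s)) y (ee i) =
      (-(∑ r, Chr γ j i r y * gi (γ y) r s) -
        ∑ r, Chr γ s i r y * gi (γ y) j r) * h y (ee j) (ee s) +
      gi (γ y) j s * pd univ (fun z => h z (ee j) (ee s)) i y := by
    intro j s
    rw [fderiv_fun_mul (hG j s) (hb j s), pd_univ]
    simp only [add_apply, smul_apply, smul_eq_mul, hγ.fderiv_inv hy]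
    ring
  rw [e0, fderiv_fun_sum fun j _ => DifferentiableAt.fun_sum fun s _ => (hG j s).fun_mul (hb j s),
    sum_apply]
  have e2 : ∀ j, fd (fun z => ∑ s, gi (γ z) j s * h z (ee j) (ee s)) y (ee i) =
      ∑ s, fd (fun z => gi (γ z) j s * h z (ee j) (ee s)) y (ee i) := by
    intro j
    rw [fderiv_fun_sum fun s _ => (hG j s).fun_mul (hb j s), sum_apply]
  simp only [e2, e1, covBilin, mul_sub, sub_mul, neg_mul, sum_add_distrib,
    sum_sub_distrib, sum_neg_distrib]
  have t1 : ∑ j, ∑ s, (∑ r, Chr γ j i r y * gi (γ y) r s) * h y (ee j) (ee s)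
      = ∑ j, ∑ s, gi (γ y) j s * ∑ r, Chr γ r i j y * h y (ee r) (ee s) := by
    simp only [sum_mul, mul_sum]
    calc _ = ∑ j, ∑ r, ∑ s, Chr γ j i r y * gi (γ y) r s * h y (ee j) (ee s) :=
          sum_ext fun j => sum_comm
      _ = ∑ r, ∑ j, ∑ s, Chr γ j i r y * gi (γ y) r s * h y (ee j) (ee s) := sum_comm
      _ = _ := sum_ext fun r => by
          rw [sum_comm]
          exact sum_ext fun _ => sum_ext fun _ => by ring
  have t2 : ∑ j, ∑ s, (∑ r, Chr γ s i r y * gi (γ y) j r) * h y (ee j) (ee s)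
      = ∑ j, ∑ s, gi (γ y) j s * ∑ r, Chr γ r i s y * h y (ee j) (ee r) := by
    simp only [sum_mul, mul_sum]
    refine sum_ext fun j => ?_
    rw [sum_comm]
    exact sum_ext fun _ => sum_ext fun _ => by ring
  rw [t1, t2]
  ring

include hh hs in
/-- The trace of the variation of the Christoffel symbols is half the differential of the trace. -/
lemma sum_varChr (hy : y ∈ Ω) (i : Fin n) :
    ∑ r, varChr γ h r i r y = (1 / 2) * fd (trBilin γ h) y (ee i) := by
  rw [hγ.fderiv_trBilin hh hy]
  simp only [varChr, ← mul_sum]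
  congr 1
  have hsym : ∀ a b c, covBilin γ h a b c y = covBilin γ h a c b y := by
    intro a b c
    have e : (fun z => h z (ee b) (ee c)) = fun z => h z (ee c) (ee b) := funext fun z => hs z _ _
    simp only [covBilin, e, hs y _ (ee c), hs y (ee b)]
    ring
  have t1 : ∑ r, ∑ s, gi (γ y) r s * covBilin γ h r i s y =
      ∑ r, ∑ s, gi (γ y) r s * covBilin γ h s i r y := by
    rw [sum_comm]
    exact sum_ext fun _ => sum_ext fun _ => by rw [gram_inv_symm (hγ.symm y)]
  simp only [mul_add, mul_sub, sum_add_distrib, sum_sub_distrib, t1]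
  ring

include hh hs in
/-- `∂_l φ V^l` for the Palatini vector field `V`. -/
lemma sum_pd_mul_palatiniVec (hy : y ∈ Ω) : ∑ l, pd univ φ l y * palatiniVec γ h l y =
      divContract γ h φ y - ∑ i, grad γ φ i y * fd (trBilin γ h) y (ee i) := by
  have hG := gram_inv_symm (hγ.symm y)
  have t1 : ∑ l, pd univ φ l y * ∑ i, gi (γ y) i l * ∑ r, varChr γ h r i r y =
      (1 / 2) * ∑ i, grad γ φ i y * fd (trBilin γ h) y (ee i) := by
    simp only [hγ.sum_varChr hh hs hy, grad, sum_mul, mul_sum]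
    rw [sum_comm]
    exact sum_ext fun _ => sum_ext fun _ => by ring
  have t2 : ∑ l, pd univ φ l y * ∑ i, ∑ j, gi (γ y) i j * varChr γ h l i j y =
      ∑ i, ∑ j, gi (γ y) i j * ((1 / 2) * ∑ s, grad γ φ s y *
        (covBilin γ h i j s y + covBilin γ h j i s y - covBilin γ h s i j y)) := by
    have : ∀ i j, (1 / 2) * ∑ s, grad γ φ s y *
        (covBilin γ h i j s y + covBilin γ h j i s y - covBilin γ h s i j y) =
        ∑ l, pd univ φ l y * varChr γ h l i j y := by
      intro i j
      simp only [grad, varChr, sum_mul, mul_sum]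
      rw [sum_comm]
      refine sum_ext fun l => sum_ext fun s => ?_
      rw [hG s l]; ring
    simp only [this, mul_sum]
    rw [sum_comm]
    refine sum_ext fun i => ?_
    rw [sum_comm]
    exact sum_ext fun _ => sum_ext fun _ => by ring
  have t3 : ∑ i, ∑ j, gi (γ y) i j * ∑ s, grad γ φ s y * covBilin γ h j i s y =
      ∑ i, ∑ j, gi (γ y) i j * ∑ s, grad γ φ s y * covBilin γ h i j s y := by
    rw [sum_comm]
    exact sum_ext fun _ => sum_ext fun _ => by rw [hG]
  have t4 : ∑ i, ∑ j, gi (γ y) i j * ∑ s, grad γ φ s y * covBilin γ h s i j y =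
      ∑ s, grad γ φ s y * fd (trBilin γ h) y (ee s) := by
    simp only [hγ.fderiv_trBilin hh hy, mul_sum]
    calc _ = ∑ i, ∑ s, ∑ j, gi (γ y) i j * (grad γ φ s y * covBilin γ h s i j y) :=
          sum_ext fun _ => sum_comm
      _ = ∑ s, ∑ i, ∑ j, gi (γ y) i j * (grad γ φ s y * covBilin γ h s i j y) := sum_comm
      _ = _ := sum_ext fun _ => sum_ext fun _ => sum_ext fun _ => by ring
  have t5 : divContract γ h φ y =
      ∑ i, ∑ j, gi (γ y) i j * ∑ s, grad γ φ s y * covBilin γ h i j s y := by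
    simp only [divContract, mul_comm (covBilin γ h _ _ _ y)]
  have t7 : ∑ l, pd univ φ l y * palatiniVec γ h l y =
      ∑ l, pd univ φ l y * ∑ i, ∑ j, gi (γ y) i j * varChr γ h l i j y -
      ∑ l, pd univ φ l y * ∑ i, gi (γ y) i l * ∑ r, varChr γ h r i r y := by
    simp only [palatiniVec, mul_sub, sum_sub_distrib]
  have t6 : ∀ i j, gi (γ y) i j * ((1 / 2) * ∑ s, grad γ φ s y *
        (covBilin γ h i j s y + covBilin γ h j i s y - covBilin γ h s i j y)) =
      (1 / 2) * (gi (γ y) i j * ∑ s, grad γ φ s y * covBilin γ h i j s y) +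
      (1 / 2) * (gi (γ y) i j * ∑ s, grad γ φ s y * covBilin γ h j i s y) -
      (1 / 2) * (gi (γ y) i j * ∑ s, grad γ φ s y * covBilin γ h s i j y) := by
    intro i j
    simp only [mul_add, mul_sub, sum_add_distrib, sum_sub_distrib]
    ring
  rw [t7, t1, t2, sum_ext fun i => sum_ext fun j => t6 i j]
  simp only [sum_add_distrib, sum_sub_distrib, ← mul_sum, t3, t4, t5]
  ring

include hh hs in
/-- The variation of the scalar curvature: `-h^{ij} Ric_{ij}` and a divergence. -/
lemma hasDerivAt_scalarLoc (hy : y ∈ Ω) :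
    HasDerivAt (fun ε : ℝ => scalarLoc univ (fun z => γ z + ε • h z) y)
      (-(∑ i, ∑ j, raise γ h y i j * ricciCoord univ γ i j y) +
        (∑ l, fd (palatiniVec γ h l) y (ee l) +
          ∑ l, ∑ s, Chr γ s l s y * palatiniVec γ h l y)) 0 := by
  have h1 : HasDerivAt (fun ε : ℝ => scalarLoc univ (fun z => γ z + ε • h z) y)
      (∑ i, ∑ j, (-(raise γ h y i j) * ricciCoord univ γ i j y + gi (γ y) i j *
        (∑ l, (pd univ (varChr γ h l i j) l y - pd univ (varChr γ h l i l) j y) +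
        ∑ l, ∑ r, ((varChr γ h l l r y * Chr γ r i j y + Chr γ l l r y * varChr γ h r i j y) -
          (varChr γ h l j r y * Chr γ r i l y + Chr γ l j r y * varChr γ h r i l y))))) 0 := by
    refine HasDerivAt.fun_sum fun i _ => HasDerivAt.fun_sum fun j _ => ?_
    have h2 := (hγ.hasDerivAt_inv_variation (h := h) hy i j).fun_mul
      (hγ.hasDerivAt_ricciCoord hh hs hy i j)
    simp only [add_zero_bilin] at h2
    exact h2
  refine h1.congr_deriv ?_
  have hC : ∀ l i j, varChr γ h l i j y = varChr γ h l j i y := by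
    intro l i j
    simp only [varChr]
    congr 1
    refine sum_ext fun r => ?_
    have : covBilin γ h r i j y = covBilin γ h r j i y := by
      have e : (fun z => h z (ee i) (ee j)) = fun z => h z (ee j) (ee i) := funext fun z => hs z _ _
      simp only [covBilin, e, hs y _ (ee j), hs y (ee i)]
      ring
    rw [this]; ring
  simp only [sum_add_distrib, neg_mul, sum_neg_distrib]
  congr 1
  have hG := gram_inv_symm (hγ.symm y)
  refine (palatini_algebra (fun i j => gi (γ y) i j)
    (fun l i j => Chr γ l i j y) (fun l i j => varChr γ h l i j y)
    (fun l i j m => pd univ (varChr γ h l i j) m y)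
    (fun l i j => christoffel_symm _ hγ.symm l i j y) hC).trans ?_
  congr 1
  refine sum_ext fun l => ?_
  have dG : ∀ a b, DifferentiableAt ℝ (fun z => gi (γ z) a b) y := fun a b =>
    hγ.diffAt (hγ.smooth_inv a b) hy
  have dC : ∀ a b c, DifferentiableAt ℝ (varChr γ h a b c) y := fun a b c =>
    hγ.diffAt (hγ.smooth_varChr hh a b c) hy
  have dS : ∀ i, DifferentiableAt ℝ (fun z => ∑ r, varChr γ h r i r z) y := fun i =>
    DifferentiableAt.fun_sum fun r _ => dC r i r
  have e0 : palatiniVec γ h l = fun z => ∑ i, ∑ j, gi (γ z) i j * varChr γ h l i j z -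
    ∑ i, gi (γ z) i l * ∑ r, varChr γ h r i r z := rfl
  rw [e0, fderiv_fun_sub (DifferentiableAt.fun_sum fun i _ => DifferentiableAt.fun_sum fun j _ =>
    (dG i j).fun_mul (dC l i j)) (DifferentiableAt.fun_sum fun i _ => (dG i l).fun_mul (dS i)),
    fderiv_fun_sum fun i _ => DifferentiableAt.fun_sum fun j _ => (dG i j).fun_mul (dC l i j),
    fderiv_fun_sum fun i _ => (dG i l).fun_mul (dS i), sub_apply, sum_apply, sum_apply]
  congr 1
  · refine sum_ext fun i => ?_
    rw [fderiv_fun_sum fun j _ => (dG i j).fun_mul (dC l i j), sum_apply]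
    refine sum_ext fun j => ?_
    rw [fderiv_fun_mul (dG i j) (dC l i j), pd_univ]
    simp only [add_apply, smul_apply, smul_eq_mul, hγ.fderiv_inv hy]
    ring
  · refine sum_ext fun i => ?_
    rw [fderiv_fun_mul (dG i l) (dS i), fderiv_fun_sum fun r _ => dC r i r]
    simp only [add_apply, smul_apply, sum_apply, smul_eq_mul, hγ.fderiv_inv hy, pd_univ]
    ring

end IsLocMetric

end ScalarVariation

/-! ### Variation of scalar products of forms -/

section PairingVariation

variable {n k : ℕ} {V W : Type*} [NormedAddCommGroup V] [NormedSpace ℝ V]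
  [NormedAddCommGroup W] [NormedSpace ℝ W]

/-- The endomorphism of `ℝⁿ` with the given matrix. -/
def endOf (M : Matrix (Fin n) (Fin n) ℝ) : Lin n :=
  LinearMap.toContinuousLinearMap (Matrix.toEuclideanLin M)

lemma endOf_ee (M : Matrix (Fin n) (Fin n) ℝ) (r i : Fin n) : endOf M (ee r) i = M i r := by
  simp [endOf, Matrix.toLpLin_apply]

lemma slotDer_eq_alternatize (N : Lin n) (α : Alt n (k + 1) V) :
    slotDer N α = alternatizeUncurryFin (α.curryLeft.comp N) := by
  funext w
  rw [alternatizeUncurryFin_apply, slotDer]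
  refine sum_ext fun a => ?_
  rw [← Fin.insertNth_removeNth, ContinuousAlternatingMap.map_insertNth]
  rfl

lemma mPair_comm {G : Matrix (Fin n) (Fin n) ℝ} (hG : ∀ i j, G i j = G j i)
    {κ : V →ₗ[ℝ] V →ₗ[ℝ] ℝ} (hκ : ∀ u v, κ u v = κ v u) (α β : (Fin k → Euc n) → V) :
    mPair G κ α β = mPair G κ β α := by
  simp only [mPair]
  congr 1
  rw [sum_comm]
  refine sum_ext fun J => sum_ext fun L => ?_
  rw [hκ, Finset.prod_congr rfl fun a _ => hG (L a) (J a)]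

lemma mPair_slotDer {G h : Matrix (Fin n) (Fin n) ℝ} (hG : ∀ i j, G i j = G j i)
    (κ : V →ₗ[ℝ] V →ₗ[ℝ] ℝ) (α β : Alt n (k + 1) V) :
    mPair G κ α (slotDer (endOf ((1 / 2 : ℝ) • (G * h))) β) =
      (1 / 2) * ∑ i, ∑ r, (G * h.transpose * G) i r *
        mPair G κ (α.curryLeft (ee i)) (β.curryLeft (ee r)) := by
  rw [slotDer_eq_alternatize, mPair_alternatize, mul_sum]
  refine sum_ext fun i => ?_
  have e : ∀ l, mPair G κ (fun w => α (Fin.cons (ee i) w))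
      ((β.curryLeft.comp (endOf ((1 / 2 : ℝ) • (G * h)))) (ee l)) =
      ∑ r, ((1 / 2 : ℝ) * (G * h) r l) * mPair G κ (α.curryLeft (ee i)) (β.curryLeft (ee r)) := by
    intro l
    have e1 := curryLeft_eq_sum β (endOf ((1 / 2 : ℝ) • (G * h)) (ee l))
    have e2 : ((β.curryLeft.comp (endOf ((1 / 2 : ℝ) • (G * h)))) (ee l) : (Fin k → Euc n) → V) =
        fun w => ∑ r, ((1 / 2 : ℝ) * (G * h) r l) • (β.curryLeft (ee r)) w := by
      rw [ContinuousLinearMap.comp_apply, e1]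
      simp only [endOf_ee, Matrix.smul_apply, smul_eq_mul]
      rfl
    rw [e2, mPair_sum_right]
    simp only [mPair_smul_right, smul_eq_mul]
    rfl
  simp only [e, smul_eq_mul, mul_sum]
  rw [sum_comm]
  refine sum_ext fun r => ?_
  have e3 : (G * h.transpose * G) i r = ∑ l, G i l * (G * h) r l := by
    rw [Matrix.mul_assoc, Matrix.mul_apply]
    refine sum_ext fun l => ?_
    congr 1
    rw [Matrix.mul_apply, Matrix.mul_apply]
    refine sum_ext fun s => ?_
    rw [Matrix.transpose_apply, hG s r, mul_comm]
  rw [e3, sum_mul, mul_sum]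
  exact sum_ext fun l => by ring

/-- The variation of the norm of a form with the metric and with the form. -/
lemma hasDerivAt_pairing {b h : Bil n} (hb : ∀ u v, b u v = b v u)
    (hs : ∀ u v, h u v = h v u) (hd : (gram b).det ≠ 0) {κ : V →ₗ[ℝ] V →ₗ[ℝ] ℝ}
    (κc : V →L[ℝ] V →L[ℝ] ℝ) (hκc : ∀ u v, κ u v = κc u v) (hκ : ∀ u v, κ u v = κ v u)
    {α : ℝ → Alt n (k + 1) V} {α' : (Fin (k + 1) → Euc n) → V}
    (hα : ∀ w, HasDerivAt (fun ε => α ε w) (α' w) 0) :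
    HasDerivAt (fun ε : ℝ => pairing (b + ε • h) κ (α ε) (α ε))
      (2 * mPair gi b κ (α 0) α' - ∑ i, ∑ r, (gi b * gram h * gi b) i r *
        mPair gi b κ ((α 0).curryLeft (ee i)) ((α 0).curryLeft (ee r))) 0 := by
  have hG := gram_inv_symm hb
  have hT : (gram h).transpose = gram h := by
    ext i j; rw [Matrix.transpose_apply, gram_apply, gram_apply, hs]
  have hinv : ∀ i j, HasDerivAt (fun ε : ℝ => gi (b + ε • h) i j)
      (-(∑ r, (endOf ((1 / 2 : ℝ) • (gi b * gram h)) (ee r)) i * gi (b + (0 : ℝ) • h) r j) -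
        ∑ r, (endOf ((1 / 2 : ℝ) • (gi b * gram h)) (ee r)) j * gi (b + (0 : ℝ) • h) i r) 0 := by
    intro i j
    have h1 := hasDerivAt_matrix_inv (M := fun ε : ℝ => gram (b + ε • h)) (M' := gram h)
      (t := 0) (fun i j => by
        simp only [gram_apply, add_apply, smul_apply, smul_eq_mul]
        simpa using ((hasDerivAt_id' (0 : ℝ)).mul_const (h (ee i) (ee j))).const_add
          (b (ee i) (ee j)))
      (by rw [add_zero_bilin]; exact hd) i j
    refine h1.congr_deriv ?_
    simp only [add_zero_bilin, endOf_ee, Matrix.smul_apply, smul_eq_mul]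
    have e1 : ∑ r, 1 / 2 * (gi b * gram h) i r * gi b r j = 1 / 2 * (gi b * gram h * gi b) i j := by
      rw [Matrix.mul_apply (M := gi b * gram h), mul_sum]
      exact sum_ext fun _ => by ring
    have e2 : ∑ r, 1 / 2 * (gi b * gram h) j r * gi b i r = 1 / 2 * (gi b * gram h * gi b) i j := by
      have e3 : (gi b * gram h * gi b) i j = (gi b * gram h * gi b) j i := by
        have hGT : (gi b).transpose = gi b := by ext a c; exact hG c a
        conv_lhs => rw [← Matrix.transpose_apply (gi b * gram h * gi b) j i]
        rw [Matrix.transpose_mul, Matrix.transpose_mul, hT, hGT, Matrix.mul_assoc]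
      rw [e3, Matrix.mul_apply (M := gi b * gram h), mul_sum]
      exact sum_ext fun r => by rw [hG i r]; ring
    rw [e1, e2]; ring
  have hK : ∀ J L : Fin (k + 1) → Fin n,
      HasDerivAt (fun s => κ (α s fun a => ee (J a)) (α s fun a => ee (L a)))
        (κ (α' fun a => ee (J a)) (α 0 fun a => ee (L a)) +
          κ (α 0 fun a => ee (J a)) (α' fun a => ee (L a))) 0 := by
    intro J L
    simp only [hκc]
    exact (κc.hasFDerivAt.comp_hasDerivAt (0 : ℝ) (hα _)).clm_apply (hα _)
  have h2 := hasDerivAt_mPair (κ := κ) (G := fun ε : ℝ => gi (b + ε • h)) hinv hK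
  refine h2.congr_deriv ?_
  rw [add_zero_bilin, mPair_comm hG hκ _ (α 0)]
  have e : (fun v => α' v - slotDer (endOf ((1 / 2 : ℝ) • (gi b * gram h))) (α 0) v) =
      fun v => α' v + (-1 : ℝ) • slotDer (endOf ((1 / 2 : ℝ) • (gi b * gram h))) (α 0) v := by
    funext v; rw [neg_one_smul, sub_eq_add_neg]
  rw [e, mPair_add_right, mPair_smul_right, mPair_slotDer hG, hT, smul_eq_mul]
  ring

lemma mPair_one (G : Matrix (Fin n) (Fin n) ℝ) (κ : V →ₗ[ℝ] W →ₗ[ℝ] ℝ)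
    (α : (Fin 1 → Euc n) → V) (β : (Fin 1 → Euc n) → W) :
    mPair G κ α β = ∑ i, ∑ l, G i l * κ (α ![ee i]) (β ![ee l]) := by
  rw [mPair_succ]
  simp [mPair, Matrix.vecCons, Subsingleton.elim _ (Fin.elim0 : Fin 0 → Euc n)]

end PairingVariation

/-! ### The Lagrangian and its first variation -/

section Lagrangian

variable {n : ℕ} {V : Type*} [NormedAddCommGroup V] [NormedSpace ℝ V]

/-- The differential of a function in coordinates, as a `1`-form. -/
def dForm (s : Set (Euc n)) (φ : Euc n → ℝ) (y : Euc n) : Alt n 1 ℝ := ofLin (fderivWithin ℝ φ s y)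

/-- The Lagrangian in coordinates, for the values `F`, `H` of the gauge and three-form fields. -/
def lagr (s : Set (Euc n)) (γ : Euc n → Bil n) (κ : V →ₗ[ℝ] V →ₗ[ℝ] ℝ)
    (φ : Euc n → ℝ) (F : Alt n 2 V) (H : Alt n 3 ℝ) (Λ : ℝ)
    (y : Euc n) : ℝ :=
  exp (-2 * φ y) * (scalarLoc s γ y + (1 / 2) * pairing (γ y) κ F F
    - (1 / 2) * formInner (γ y) H H + 4 * formInner (γ y) (dForm s φ y) (dForm s φ y) - 2 * Λ)

/-- The Hessian `(∇_u dφ)(v)`. -/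
def hessForm (s : Set (Euc n)) (γ : Euc n → Bil n) (φ : Euc n → ℝ) (y u v : Euc n) : ℝ :=
  covForm (fun l i j => christoffel s γ l i j y) (fderivWithin ℝ (dForm s φ) s y) (dForm s φ y)
    u ![v]

/-- The beta function of the metric in coordinates. -/
def betaGLoc (s : Set (Euc n)) (γ : Euc n → Bil n) (κ : V →ₗ[ℝ] V →ₗ[ℝ] ℝ)
    (φ : Euc n → ℝ) (F : Alt n 2 V) (H : Alt n 3 ℝ) (y X Y : Euc n) : ℝ :=
  ricciForm s γ y X Y + (1 / 2) * pairing (γ y) κ (F.curryLeft X) (F.curryLeft Y)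
    - (1 / 2) * formInner (γ y) (H.curryLeft X) (H.curryLeft Y)
    + hessForm s γ φ y X Y + hessForm s γ φ y Y X

/-- The beta function of the dilaton in coordinates. -/
def betaPhiLoc (s : Set (Euc n)) (γ : Euc n → Bil n) (κ : V →ₗ[ℝ] V →ₗ[ℝ] ℝ)
    (φ : Euc n → ℝ) (F : Alt n 2 V) (H : Alt n 3 ℝ) (Λ : ℝ)
    (y : Euc n) : ℝ :=
  scalarLoc s γ y + (1 / 2) * pairing (γ y) κ F F - (1 / 2) * formInner (γ y) H H
    + 4 * -(negDiv (γ y) (fun l i j => christoffel s γ l i j y)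
        (fderivWithin ℝ (dForm s φ) s y) (dForm s φ y) ![])
    - 4 * formInner (γ y) (dForm s φ y) (dForm s φ y) - 2 * Λ

lemma dForm_apply (φ : Euc n → ℝ) (y : Euc n) (w : Fin 1 → Euc n) :
    dForm univ φ y w = fd φ y (w 0) := by
  simp [dForm, ofLin]

lemma ofLin_apply (α : Euc n →L[ℝ] V) (w : Fin 1 → Euc n) : ofLin α w = α (w 0) := by simp [ofLin]

lemma formInner_ofLin (b : Bil n) (α β : Euc n →L[ℝ] ℝ) :
    formInner b (ofLin α) (ofLin β) = ∑ i, ∑ l, gi b i l * (α (ee i) * β (ee l)) := by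
  rw [formInner, pairing_eq_mPair, mPair_one]
  simp [ofLin_apply]

lemma formInner_dForm (γ : Euc n → Bil n) (φ : Euc n → ℝ) (y : Euc n) :
    formInner (γ y) (dForm univ φ y) (dForm univ φ y) = ∑ i, pd univ φ i y * grad γ φ i y := by
  rw [dForm, formInner_ofLin]
  simp only [grad, mul_sum, pd]
  exact sum_ext fun _ => sum_ext fun _ => by ring

/-- `ofLin` as a continuous linear map. -/
def ofLinCLM : (Euc n →L[ℝ] V) →L[ℝ] Alt n 1 V :=
  (ContinuousAlternatingMap.ofSubsingletonLIE (𝕜 := ℝ) (E := Euc n) (F := V)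
    (0 : Fin 1)).toContinuousLinearEquiv.toContinuousLinearMap

lemma ofLinCLM_apply (α : Euc n →L[ℝ] V) : ofLinCLM α = ofLin α := rfl

namespace IsLocMetric

variable {Ω : Set (Euc n)} {γ : Euc n → Bil n} {y : Euc n} (hγ : IsLocMetric Ω γ)
  {h : Euc n → Bil n} (hh : SmoothOn h Ω) (hs : ∀ y u v, h y u v = h y v u)
  {φ ν : Euc n → ℝ} (hφ : SmoothOn φ Ω) (hν : SmoothOn ν Ω)

include hγ

include hφ in
lemma hessForm_ee (hy : y ∈ Ω) (i j : Fin n) :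
    hessForm univ γ φ y (ee i) (ee j) = hess γ φ i j y := by
  have hd : DifferentiableAt ℝ (fd φ) y :=
    hγ.diffAt (hφ.fderiv_of_isOpen hγ.isOpen (by norm_num)) hy
  have e : dForm univ φ = fun z => ofLinCLM (fd φ z) := by
    funext z; rw [dForm, fderivWithin_univ, ofLinCLM_apply]
  have e1 : fd (dForm univ φ) y (ee i) = ofLin (fd (fd φ) y (ee i)) := by
    rw [e]
    have := (ofLinCLM.hasFDerivAt.comp y hd.hasFDerivAt).fderiv
    rw [show (fun z => ofLinCLM (fd φ z)) = ofLinCLM ∘ fd φ from rfl, this]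
    rfl
  have e2 : pd univ (pd univ φ j) i y = fd (fd φ) y (ee i) (ee j) := by
    rw [pd_univ, ← fderiv_clm_apply_const hd]
    congr 2
    funext z; exact pd_univ φ j z
  rw [hessForm, covForm, fderivWithin_univ, e1, ofLin_apply, hess, e2]
  simp only [Finset.univ_unique, Fin.default_eq_zero, Finset.sum_singleton, dForm_apply]
  congr 1
  simp only [Function.update_self, Matrix.cons_val_zero]
  rw [clm_apply_eq_sum]
  simp only [gammaVec_ee, smul_eq_mul, pd_univ]

include hφ in
lemma negDiv_dForm (hy : y ∈ Ω) : negDiv (γ y) (fun l i j => Chr γ l i j y)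
        (fderivWithin ℝ (dForm univ φ) univ y) (dForm univ φ y) ![] =
      -∑ i, ∑ j, gi (γ y) i j * hess γ φ i j y := by
  rw [negDiv]
  congr 1
  refine sum_ext fun i => sum_ext fun j => ?_
  rw [← hγ.hessForm_ee hφ hy, smul_eq_mul, hessForm]
  rfl

/-- The vector field whose divergence is dropped in the variation of the gravitational part of the
action. -/
def gravVec (γ h : Euc n → Bil n) (φ ν : Euc n → ℝ) (i : Fin n) (y : Euc n) : ℝ :=
  palatiniVec γ h i y + 2 * ∑ l, raise γ h y i l * pd univ φ l y -
    4 * (((1 / 2) * trBilin γ h y - 2 * ν y) * grad γ φ i y)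

include hh in
lemma smooth_raise (i j : Fin n) : SmoothOn (fun y => raise γ h y i j) Ω := by
  simp only [raise, Matrix.mul_apply, gram_apply]
  exact ContDiffOn.sum fun _ _ => (ContDiffOn.sum fun _ _ => (hγ.smooth_inv _ _).mul
    (smooth_bilin_apply hh _ _)).mul (hγ.smooth_inv _ _)

include hh hφ hν in
lemma smooth_gravVec (i : Fin n) : SmoothOn (gravVec γ h φ ν i) Ω :=
  ((hγ.smooth_palatiniVec hh i).add (contDiffOn_const.mul (ContDiffOn.sum fun _ _ =>
    (hγ.smooth_raise hh _ _).mul (smooth_pd hγ.isOpen hφ _)))).sub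
  (contDiffOn_const.mul (((contDiffOn_const.mul (hγ.smooth_trBilin hh)).sub
    (contDiffOn_const.mul hν)).mul (hγ.smooth_grad hφ i)))

/-- The divergence of a vector field with the density `e^{-2φ} √|g|`. -/
lemma sum_fderiv_density_mul (hφ : SmoothOn φ Ω) {X : Fin n → Euc n → ℝ}
    (hy : y ∈ Ω) (hX : ∀ i, DifferentiableAt ℝ (X i) y) :
    ∑ i, fd (fun z => sqrtDet (γ z) * (exp (-2 * φ z) * X i z)) y (ee i) =
      exp (-2 * φ y) * sqrtDet (γ y) * (∑ i, fd (X i) y (ee i) +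
        ∑ i, ∑ l, Chr γ l i l y * X i y - 2 * ∑ i, pd univ φ i y * X i y) := by
  have hφd := hγ.diffAt hφ hy
  have hE : HasFDerivAt (fun z => exp (-2 * φ z)) (exp (-2 * φ y) • ((-2 : ℝ) • fd φ y)) y := by
    exact (hφd.hasFDerivAt.const_mul (-2)).exp
  rw [hγ.sum_fderiv_sqrtDet_mul (X := fun i z => exp (-2 * φ z) * X i z) hy fun i =>
    hE.differentiableAt.fun_mul (hX i)]
  have e : ∀ i, fd (fun z => exp (-2 * φ z) * X i z) y (ee i) =
      exp (-2 * φ y) * (fd (X i) y (ee i) - 2 * (pd univ φ i y * X i y)) := by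
    intro i
    rw [(hE.fun_mul (hX i).hasFDerivAt).fderiv, pd_univ]
    simp only [add_apply, smul_apply, smul_eq_mul]
    ring
  simp only [e, ← mul_sum, sum_sub_distrib]
  have e2 : ∑ i, ∑ l, Chr γ l i l y * (exp (-2 * φ y) * X i y) =
      exp (-2 * φ y) * ∑ i, ∑ l, Chr γ l i l y * X i y := by
    simp only [mul_sum]
    exact sum_ext fun _ => sum_ext fun _ => by ring
  simp only [mul_sum] at e2 ⊢
  rw [e2]
  simp only [← mul_sum]
  ring

include hh hs hφ hν in
/-- The divergence of `e^{-2φ}` times the vector field `gravVec`. -/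
lemma sum_fderiv_gravVec (hy : y ∈ Ω) :
    ∑ i, fd (fun z => sqrtDet (γ z) * (exp (-2 * φ z) * gravVec γ h φ ν i z)) y (ee i) =
      exp (-2 * φ y) * sqrtDet (γ y) * ((∑ l, fd (palatiniVec γ h l) y (ee l) +
          ∑ l, ∑ s, Chr γ s l s y * palatiniVec γ h l y)
        - 4 * ∑ i, pd univ φ i y * ∑ l, raise γ h y i l * pd univ φ l y
        + 8 * ∑ i, pd univ ν i y * grad γ φ i y
        + 8 * ((1 / 2) * trBilin γ h y - 2 * ν y) * ∑ i, pd univ φ i y * grad γ φ i y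
        + 2 * ∑ i, ∑ l, raise γ h y i l * hess γ φ i l y
        - 4 * ((1 / 2) * trBilin γ h y - 2 * ν y) * ∑ i, ∑ j, gi (γ y) i j * hess γ φ i j y) := by
  have hP : ∀ i, DifferentiableAt ℝ (palatiniVec γ h i) y := fun i =>
    hγ.diffAt (hγ.smooth_palatiniVec hh i) hy
  have hX : ∀ i, DifferentiableAt ℝ (fun z => ∑ l, raise γ h z i l * pd univ φ l z) y :=
    fun i => hγ.diffAt (ContDiffOn.sum fun _ _ =>
      (hγ.smooth_raise hh _ _).mul (smooth_pd hγ.isOpen hφ _)) hy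
  have hg : ∀ i, DifferentiableAt ℝ (grad γ φ i) y := fun i => hγ.diffAt (hγ.smooth_grad hφ i) hy
  have hνd := hγ.diffAt hν hy
  have ht := hγ.diffAt (hγ.smooth_trBilin hh) hy
  have hf : HasFDerivAt (fun z => (1 / 2) * trBilin γ h z - 2 * ν z)
      ((1 / 2 : ℝ) • fd (trBilin γ h) y - (2 : ℝ) • fd ν y) y :=
    (ht.hasFDerivAt.const_mul (1 / 2)).fun_sub (hνd.hasFDerivAt.const_mul 2)
  rw [hγ.sum_fderiv_density_mul hφ hy fun i => hγ.diffAt (hγ.smooth_gravVec hh hφ hν i) hy]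
  congr 1
  have e1 : ∀ i, fd (gravVec γ h φ ν i) y (ee i) = fd (palatiniVec γ h i) y (ee i) +
      2 * fd (fun z => ∑ l, raise γ h z i l * pd univ φ l z) y (ee i) -
      4 * (((1 / 2) * trBilin γ h y - 2 * ν y) * fd (grad γ φ i) y (ee i) +
        ((1 / 2) * fd (trBilin γ h) y (ee i) - 2 * pd univ ν i y) * grad γ φ i y) := by
    intro i
    have : HasFDerivAt (gravVec γ h φ ν i) _ y :=
      ((hP i).hasFDerivAt.fun_add ((hX i).hasFDerivAt.const_mul 2)).fun_sub
        ((hf.fun_mul (hg i).hasFDerivAt).const_mul 4)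
    rw [this.fderiv, pd_univ ν]
    simp only [add_apply, sub_apply, smul_apply, smul_eq_mul]
    ring
  have e2 : ∀ i, ∑ l, Chr γ l i l y * gravVec γ h φ ν i y =
      ∑ l, Chr γ l i l y * palatiniVec γ h i y +
      2 * ∑ l, Chr γ l i l y * (∑ l, raise γ h y i l * pd univ φ l y) -
      4 * ((1 / 2) * trBilin γ h y - 2 * ν y) * ∑ l, Chr γ l i l y * grad γ φ i y := by
    intro i
    simp only [← sum_mul, gravVec]
    ring
  have e3 : ∀ i, pd univ φ i y * gravVec γ h φ ν i y = pd univ φ i y * palatiniVec γ h i y +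
      2 * (pd univ φ i y * ∑ l, raise γ h y i l * pd univ φ l y) -
      4 * ((1 / 2) * trBilin γ h y - 2 * ν y) * (pd univ φ i y * grad γ φ i y) := by
    intro i
    simp only [gravVec]
    ring
  have e4 : ∀ i, ((1 / 2) * fd (trBilin γ h) y (ee i) - 2 * pd univ ν i y) * grad γ φ i y
      = (1 / 2) * (grad γ φ i y * fd (trBilin γ h) y (ee i)) -
        2 * (pd univ ν i y * grad γ φ i y) := fun i => by ring
  have s1 := hγ.div_raise_bilin hh hφ hy
  have s2 := hγ.div_grad hφ hy
  have s3 := hγ.sum_pd_mul_palatiniVec hh hs (φ := φ) hy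
  simp only [e1, e2, e3, e4, sum_add_distrib, sum_sub_distrib, ← mul_sum, s3]
  linear_combination 2 * s1 - 4 * ((1 / 2) * trBilin γ h y - 2 * ν y) * s2

include hφ hν in
lemma hasDerivAt_formInner_dForm (hs' : ∀ u v, h y u v = h y v u) (hy : y ∈ Ω) :
    HasDerivAt (fun ε : ℝ => formInner (γ y + ε • h y) (dForm univ (fun z => φ z + ε * ν z) y)
        (dForm univ (fun z => φ z + ε * ν z) y))
      (2 * ∑ i, pd univ ν i y * grad γ φ i y -
        ∑ i, pd univ φ i y * ∑ l, raise γ h y i l * pd univ φ l y) 0 := by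
  have hφd := hγ.diffAt hφ hy
  have hνd := hγ.diffAt hν hy
  have hα : ∀ (ε : ℝ) (w : Fin 1 → Euc n), dForm univ (fun z => φ z + ε * ν z) y w =
      fd φ y (w 0) + ε * fd ν y (w 0) := by
    intro ε w
    rw [dForm_apply, (hφd.hasFDerivAt.fun_add (hνd.hasFDerivAt.const_mul ε)).fderiv]
    simp
  have h1 := hasDerivAt_pairing (hγ.symm y) hs' (hγ.det_ne y hy) (κ := LinearMap.mul ℝ ℝ)
    (ContinuousLinearMap.mul ℝ ℝ) (fun _ _ => rfl) (fun u v => mul_comm u v)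
    (α := fun ε => dForm univ (fun z => φ z + ε * ν z) y)
    (α' := fun w => fd ν y (w 0)) (fun w => by
      simp only [hα]
      simpa using ((hasDerivAt_id' (0 : ℝ)).mul_const (fd ν y (w 0))).const_add (fd φ y (w 0)))
  refine h1.congr_deriv ?_
  have e0 : (fun z => φ z + (0 : ℝ) * ν z) = φ := by funext z; simp
  simp only [e0]
  congr 1
  · rw [mPair_one]
    congr 1
    have e5 : ∀ l : Fin n, dForm univ φ y ![ee l] = fd φ y (ee l) := fun l => dForm_apply φ y _
    simp only [e5, Matrix.cons_val_zero, LinearMap.mul_apply', grad, mul_sum, pd_univ]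
    rw [sum_comm]
    refine sum_ext fun _ => sum_ext fun _ => ?_
    rw [gram_inv_symm (hγ.symm y)]; ring
  · refine sum_ext fun i => ?_
    rw [mul_sum]
    refine sum_ext fun l => ?_
    have e1 : ∀ (j : Fin n) (w : Fin 0 → Euc n),
        (dForm univ φ y).curryLeft (ee j) w = pd univ φ j y := by
      intro j w
      rw [ContinuousAlternatingMap.curryLeft_apply_apply, dForm_apply, pd_univ]
      rfl
    simp only [mPair, e1, LinearMap.mul_apply', raise]
    simp
    ring

include hh hs hφ hν in
/-- The first variation of the Lagrangian density: the metric and the dilaton contribute their beta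
functions up to a divergence. -/
lemma hasDerivAt_lagr (hy : y ∈ Ω) {κ : V →ₗ[ℝ] V →ₗ[ℝ] ℝ}
    (κc : V →L[ℝ] V →L[ℝ] ℝ) (hκc : ∀ u v, κ u v = κc u v) (hκ : ∀ u v, κ u v = κ v u)
    {F : ℝ → Alt n 2 V} {F' : (Fin 2 → Euc n) → V}
    (hF : ∀ w, HasDerivAt (fun ε => F ε w) (F' w) 0)
    {H : ℝ → Alt n 3 ℝ} {H' : (Fin 3 → Euc n) → ℝ}
    (hH : ∀ w, HasDerivAt (fun ε => H ε w) (H' w) 0) (Λ : ℝ) :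
    HasDerivAt (fun ε : ℝ => lagr univ (fun z => γ z + ε • h z) κ (fun z => φ z + ε * ν z)
        (F ε) (H ε) Λ y * sqrtDet (γ y + ε • h y))
      (exp (-2 * φ y) * sqrtDet (γ y) *
        (-(∑ i, ∑ j, raise γ h y i j * betaGLoc univ γ κ φ (F 0) (H 0) y (ee i) (ee j)) +
          ((1 / 2) * trBilin γ h y - 2 * ν y) * betaPhiLoc univ γ κ φ (F 0) (H 0) Λ y +
          mPair gi (γ y) κ (F 0) F' - mPair gi (γ y) (LinearMap.mul ℝ ℝ) (H 0) H') +
        ∑ i, fd (fun z => sqrtDet (γ z) * (exp (-2 * φ z) * gravVec γ h φ ν i z)) y (ee i)) 0 := by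
  have dE : HasDerivAt (fun ε : ℝ => exp (-2 * (φ y + ε * ν y)))
      (exp (-2 * φ y) * (-2 * ν y)) 0 := by
    have := ((((hasDerivAt_id' (0 : ℝ)).mul_const (ν y)).const_add (φ y)).const_mul (-2)).exp
    simpa using this
  have dS := hγ.hasDerivAt_scalarLoc hh hs hy
  have dF := hasDerivAt_pairing (hγ.symm y) (hs y) (hγ.det_ne y hy) κc hκc hκ hF
  have dH := hasDerivAt_pairing (hγ.symm y) (hs y) (hγ.det_ne y hy) (κ := LinearMap.mul ℝ ℝ)
    (ContinuousLinearMap.mul ℝ ℝ) (fun _ _ => rfl) (fun u v => mul_comm u v) hH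
  have dD := hγ.hasDerivAt_formInner_dForm hφ hν (hs y) hy
  have dV : HasDerivAt (fun ε : ℝ => sqrtDet (γ y + ε • h y))
      ((1 / 2) * sqrtDet (γ y) * trBilin γ h y) 0 := by
    have h1 := hasDerivAt_sqrtDet (b := fun ε : ℝ => γ y + ε • h y) (M' := gram (h y)) (t := 0)
      (fun i j => by
        simp only [gram_apply, add_apply, smul_apply, smul_eq_mul]
        simpa using ((hasDerivAt_id' (0 : ℝ)).mul_const (h y (ee i) (ee j))).const_add
          (γ y (ee i) (ee j)))
      (by rw [add_zero_bilin]; exact hγ.det_ne y hy)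
    refine h1.congr_deriv ?_
    rw [add_zero_bilin]
    have : (gi (γ y) * gram (h y)).trace = trBilin γ h y := by
      simp only [Matrix.trace, Matrix.diag_apply, Matrix.mul_apply, trBilin, gram_apply]
      exact sum_ext fun i => sum_ext fun j => by rw [hs]
    rw [this]
  have hmain := (dE.fun_mul (((((dS.fun_add (dF.const_mul (1 / 2))).fun_sub (dH.const_mul (1 / 2))).fun_add
    (dD.const_mul 4)).sub_const (2 * Λ)))).fun_mul dV
  refine (hmain.congr_deriv ?_)
  have e0 : (fun z => φ z + (0 : ℝ) * ν z) = φ := by funext z; simp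
  have e2 : (φ y + (0 : ℝ) * ν y) = φ y := by simp
  have hric : ∀ i j, ricciForm univ γ y (ee i) (ee j) = ricciCoord univ γ i j y := by
    intro i j
    rw [ricciForm, Finset.sum_eq_single i, Finset.sum_eq_single j] <;> simp +contextual
  have hsymH : ∀ i j, hess γ φ i j y = hess γ φ j i y := by
    have hd : ContDiffAt ℝ 2 φ y := (hφ.contDiffAt (hγ.isOpen.mem_nhds hy)).of_le ENat.LEInfty.out
    have hd' : DifferentiableAt ℝ (fd φ) y :=
      (hd.fderiv_right (m := 1) (by norm_num)).differentiableAt one_ne_zero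
    have e3 : ∀ i j, pd univ (pd univ φ j) i y = fd (fd φ) y (ee i) (ee j) := by
      intro i j
      rw [pd_univ, ← fderiv_clm_apply_const hd']
      congr 2
      funext z; exact pd_univ φ j z
    intro i j
    have := (hd.isSymmSndFDerivAt (by simp)) (ee i) (ee j)
    simp only [hess, e3, christoffel_symm _ hγ.symm _ i j, this]
  have hb : ∑ i, ∑ j, raise γ h y i j * betaGLoc univ γ κ φ (F 0) (H 0) y (ee i) (ee j) =
      ∑ i, ∑ j, raise γ h y i j * ricciCoord univ γ i j y +
      (1 / 2) * ∑ i, ∑ j, raise γ h y i j * mPair gi (γ y) κ ((F 0).curryLeft (ee i))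
        ((F 0).curryLeft (ee j)) -
      (1 / 2) * ∑ i, ∑ j, raise γ h y i j * mPair gi (γ y) (LinearMap.mul ℝ ℝ)
        ((H 0).curryLeft (ee i)) ((H 0).curryLeft (ee j)) +
      2 * ∑ i, ∑ j, raise γ h y i j * hess γ φ i j y := by
    simp only [mul_sum, ← sum_add_distrib, ← sum_sub_distrib]
    refine sum_ext fun i => sum_ext fun j => ?_
    rw [betaGLoc, hric, hγ.hessForm_ee hφ hy, hγ.hessForm_ee hφ hy, hsymH j i, formInner,
      pairing_eq_mPair, pairing_eq_mPair]
    ring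
  rw [hγ.sum_fderiv_gravVec hh hs hφ hν hy, hb, betaPhiLoc, hγ.negDiv_dForm hφ hy]
  have hr : gi (γ y) * gram (h y) * gi (γ y) = raise γ h y := rfl
  have hdf : pairing (γ y) (LinearMap.mul ℝ ℝ) (dForm univ φ y) (dForm univ φ y) = _ :=
    formInner_dForm γ φ y
  simp only [e0, e2, add_zero_bilin, formInner, hr, hdf]
  ring

end IsLocMetric

end Lagrangian

section FirstVariation

variable {n : ℕ} {V : Type*} [NormedAddCommGroup V] [NormedSpace ℝ V]

lemma toLin_apply (α : Alt n 1 V) (u : Euc n) : toLin α u = α ![u] := by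
  have : (![u] : Fin 1 → Euc n) = fun _ => u := by funext j; rw [Subsingleton.elim j 0]; rfl
  rw [this]
  simp [toLin]

lemma smoothAt_form_apply {E : Type*} [NormedAddCommGroup E] [NormedSpace ℝ E] {k : ℕ}
    {r : WithTop ℕ∞} {σ : E → Alt n k V} {s : Set E} {x : E}
    (hσ : ContDiffWithinAt ℝ r σ s x) (w : Fin k → Euc n) :
    ContDiffWithinAt ℝ r (fun y => σ y w) s x :=
  (ContinuousAlternatingMap.apply ℝ (Euc n) V w).contDiff.contDiffAt.comp_contDiffWithinAt x hσ

lemma smoothAt_mPair {E : Type*} [NormedAddCommGroup E] [NormedSpace ℝ E] {k : ℕ}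
    {W U : Type*} [NormedAddCommGroup W] [NormedSpace ℝ W] [NormedAddCommGroup U] [NormedSpace ℝ U]
    {r : WithTop ℕ∞} {G : E → Matrix (Fin n) (Fin n) ℝ} {κ : V →ₗ[ℝ] W →ₗ[ℝ] U}
    (κc : V →L[ℝ] W →L[ℝ] U) (hκc : ∀ u v, κ u v = κc u v) {α : E → (Fin k → Euc n) → V}
    {β : E → (Fin k → Euc n) → W} {s : Set E} {x : E}
    (hG : ∀ i j, ContDiffWithinAt ℝ r (fun y => G y i j) s x)
    (hα : ∀ w, ContDiffWithinAt ℝ r (fun y => α y w) s x)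
    (hβ : ∀ w, ContDiffWithinAt ℝ r (fun y => β y w) s x) :
    ContDiffWithinAt ℝ r (fun y => mPair (G y) κ (α y) (β y)) s x := by
  simp only [mPair, hκc]
  refine contDiffWithinAt_const.smul (ContDiffWithinAt.sum fun J _ => ContDiffWithinAt.sum
    fun L _ => ?_)
  exact (contDiffWithinAt_prod fun a _ => hG _ _).smul
    ((κc.contDiff.contDiffAt.comp_contDiffWithinAt x (hα _)).clm_apply (hβ _))

lemma smoothAt_formInner {E : Type*} [NormedAddCommGroup E] [NormedSpace ℝ E] {k : ℕ}
    {r : WithTop ℕ∞} {G : E → Matrix (Fin n) (Fin n) ℝ}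
    {α β : E → (Fin k → Euc n) → ℝ} {s : Set E} {x : E}
    (hG : ∀ i j, ContDiffWithinAt ℝ r (fun y => G y i j) s x)
    (hα : ∀ w, ContDiffWithinAt ℝ r (fun y => α y w) s x)
    (hβ : ∀ w, ContDiffWithinAt ℝ r (fun y => β y w) s x) :
    ContDiffWithinAt ℝ r (fun y => mPair (G y) (LinearMap.mul ℝ ℝ) (α y) (β y)) s x :=
  smoothAt_mPair (ContinuousLinearMap.mul ℝ ℝ) (fun _ _ => rfl) hG hα hβ

lemma mPair_linear_comp {k : ℕ} (G : Matrix (Fin n) (Fin n) ℝ) (f : V →ₗ[ℝ] ℝ)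
    (a : (Fin k → Euc n) → ℝ) (β : (Fin k → Euc n) → V) :
    mPair G (LinearMap.mul ℝ ℝ) a (fun w => f (β w)) = f (mPair G (LinearMap.lsmul ℝ V) a β) := by
  simp only [mPair, map_smul, map_sum, smul_eq_mul, LinearMap.mul_apply', LinearMap.lsmul_apply]

/-- The beta function of the two-form field in coordinates. -/
def betaBLoc (s : Set (Euc n)) (γ : Euc n → Bil n) (φ : Euc n → ℝ)
    (H : Euc n → Alt n 3 ℝ) (y : Euc n) (w : Fin 2 → Euc n) : ℝ :=
  (1 / 2) * exp (2 * φ y) * negDiv (γ y) (fun l i j => christoffel s γ l i j y)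
    (fderivWithin ℝ (fun z => exp (-2 * φ z) • H z) s y) (exp (-2 * φ y) • H y) w

/-- The beta function of the gauge field in coordinates; `dF` are the gauge covariant derivatives
of `e^{-2φ} F`. -/
def betaTLoc (s : Set (Euc n)) (γ : Euc n → Bil n) (φ : Euc n → ℝ) (F : Alt n 2 V) (H : Alt n 3 ℝ)
    (dF : Euc n →L[ℝ] Alt n 2 V) (y : Euc n) (w : Fin 1 → Euc n) : V :=
  (1 / 2 : ℝ) • (exp (2 * φ y) • negDiv (γ y) (fun l i j => christoffel s γ l i j y) dF
      (exp (-2 * φ y) • F) w +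
    pairing (γ y) (LinearMap.lsmul ℝ V) (H.curryLeft (w 0)) F)

/-- The vector field `γ^{il} ⟨i_l σ, τ⟩`. -/
def contractVec (γ : Euc n → Bil n) {k : ℕ} {W : Type*} [NormedAddCommGroup W]
    [NormedSpace ℝ W] (κ : V →ₗ[ℝ] W →ₗ[ℝ] ℝ) (σ : Euc n → Alt n (k + 1) V)
    (τ : Euc n → Alt n k W) (i : Fin n) (z : Euc n) : ℝ :=
  ∑ l, gi (γ z) i l * mPair gi (γ z) κ ((σ z).curryLeft (ee l)) (τ z)

/-- The vector density whose divergence is the difference between the first variation of the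
Lagrangian density and the contraction of the beta functions with the variations. -/
def boundaryVec (γ h : Euc n → Bil n) (κ : V →ₗ[ℝ] V →ₗ[ℝ] ℝ) (φ ν : Euc n → ℝ)
    (F : Euc n → Alt n 2 V) (η : Euc n → Alt n 1 V)
    (H : Euc n → Alt n 3 ℝ) (C : Euc n → Alt n 2 ℝ) (i : Fin n)
    (z : Euc n) : ℝ :=
  sqrtDet (γ z) * (exp (-2 * φ z) * IsLocMetric.gravVec γ h φ ν i z) +
  sqrtDet (γ z) * contractVec γ κ (fun z => exp (-2 * φ z) • F z) η i z -
  sqrtDet (γ z) * contractVec γ (LinearMap.mul ℝ ℝ) (fun z => exp (-2 * φ z) • H z) C i z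

/-- The contraction of the beta functions with a variation of the fields. -/
def eulerLagrange (γ h : Euc n → Bil n) (κ : V →ₗ[ℝ] V →ₗ[ℝ] ℝ) (φ ν : Euc n → ℝ)
    (F : Euc n → Alt n 2 V) (η : Euc n → Alt n 1 V)
    (H : Euc n → Alt n 3 ℝ) (C : Euc n → Alt n 2 ℝ)
    (dF : Euc n → Euc n →L[ℝ] Alt n 2 V) (Λ : ℝ) (y : Euc n) : ℝ :=
  exp (-2 * φ y) * (-(∑ i, ∑ j, raise γ h y i j * betaGLoc univ γ κ φ (F y) (H y) y (ee i) (ee j)) +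
      ((1 / 2) * trBilin γ h y - 2 * ν y) * betaPhiLoc univ γ κ φ (F y) (H y) Λ y -
      2 * mPair gi (γ y) (LinearMap.mul ℝ ℝ) (betaBLoc univ γ φ H y) (C y) +
      2 * mPair gi (γ y) κ (betaTLoc univ γ φ (F y) (H y) (dF y) y) (η y))

namespace IsLocMetric

variable {Ω : Set (Euc n)} {γ : Euc n → Bil n} (hγ : IsLocMetric Ω γ)
  {h : Euc n → Bil n} (hh : SmoothOn h Ω) (hs : ∀ y u v, h y u v = h y v u)
  {φ ν : Euc n → ℝ} (hφ : SmoothOn φ Ω) (hν : SmoothOn ν Ω)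
  {F : Euc n → Alt n 2 V} {η : Euc n → Alt n 1 V}
  {H : Euc n → Alt n 3 ℝ} {C : Euc n → Alt n 2 ℝ}
  (hF : SmoothOn F Ω) (hη : SmoothOn η Ω) (hH : SmoothOn H Ω)
  (hC : SmoothOn C Ω) {κ : V →ₗ[ℝ] V →ₗ[ℝ] ℝ} (κc : V →L[ℝ] V →L[ℝ] ℝ)
  (hκc : ∀ u v, κ u v = κc u v) (hκ : ∀ u v, κ u v = κ v u)

include hγ

lemma smooth_contractVec {k : ℕ} {W : Type*} [NormedAddCommGroup W]
    [NormedSpace ℝ W] {κ : V →ₗ[ℝ] W →ₗ[ℝ] ℝ} (κc : V →L[ℝ] W →L[ℝ] ℝ)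
    (hκc : ∀ u v, κ u v = κc u v) {σ : Euc n → Alt n (k + 1) V}
    {τ : Euc n → Alt n k W} (hσ : SmoothOn σ Ω) (hτ : SmoothOn τ Ω)
    (i : Fin n) : SmoothOn (contractVec γ κ σ τ i) Ω := fun y hy =>
  ContDiffWithinAt.sum fun l _ => (hγ.smooth_inv i l y hy).mul
    (smoothAt_mPair κc hκc (fun i j => hγ.smooth_inv i j y hy)
      (fun w => smoothAt_form_apply (hσ y hy) (Fin.cons (ee l) w))
      (fun w => smoothAt_form_apply (hτ y hy) w))

include hφ in
omit hγ in
lemma smooth_exp_smul {U : Type*} [NormedAddCommGroup U] [NormedSpace ℝ U] {f : Euc n → U}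
    (hf : SmoothOn f Ω) : SmoothOn (fun z => exp (-2 * φ z) • f z) Ω :=
  (contDiffOn_const.mul hφ).exp.smul hf

include hh hφ hν hF hη hH hC hκc in
lemma smooth_boundaryVec (i : Fin n) : SmoothOn (boundaryVec γ h κ φ ν F η H C i) Ω :=
  ((hγ.smooth_sqrtDet.mul ((contDiffOn_const.mul hφ).exp.mul (hγ.smooth_gravVec hh hφ hν i))).add
    (hγ.smooth_sqrtDet.mul (hγ.smooth_contractVec κc hκc (smooth_exp_smul hφ hF) hη i))).sub
    (hγ.smooth_sqrtDet.mul (hγ.smooth_contractVec (ContinuousLinearMap.mul ℝ ℝ)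
      (fun _ _ => rfl) (smooth_exp_smul hφ hH) hC i))

include hh hs hφ hν hF hη hH hC hκc hκ in
/-- The first variation of the Lagrangian density is the contraction of the beta functions with the
variation of the fields, up to a divergence. The variations of the gauge and three-form fields are
`Dη` and `dC - κ(η ∧ F)`; the gauge covariant derivatives `dη`, `dF` of `η` and `e^{-2φ} F` enter
through the Leibniz rule `hL` only. -/
lemma first_variation {y : Euc n} (hy : y ∈ Ω) {dη : Euc n →L[ℝ] Alt n 1 V}
    {dF : Euc n → Euc n →L[ℝ] Alt n 2 V}
    (hL : ∀ i v v', HasDerivAt (fun t : ℝ =>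
        κ (exp (-2 * φ (y + t • ee i)) • F (y + t • ee i) v) (η (y + t • ee i) v'))
      (κ (dF y (ee i) v) (η y v') + κ (exp (-2 * φ y) • F y v) (dη (ee i) v')) 0)
    {Fε : ℝ → Alt n 2 V} (hF0 : Fε 0 = F y)
    (hFε : ∀ w, HasDerivAt (fun ε => Fε ε w) (alternatizeUncurryFin dη w) 0)
    {Hε : ℝ → Alt n 3 ℝ} (hH0 : Hε 0 = H y)
    (hHε : ∀ w, HasDerivAt (fun ε => Hε ε w)
      ((alternatizeUncurryFin (fd C y) - wedge κc (η y) (F y)) w) 0)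
    (Λ : ℝ) :
    HasDerivAt (fun ε : ℝ => lagr univ (fun z => γ z + ε • h z) κ (fun z => φ z + ε * ν z)
        (Fε ε) (Hε ε) Λ y * sqrtDet (γ y + ε • h y))
      (eulerLagrange γ h κ φ ν F η H C dF Λ y * sqrtDet (γ y) +
        ∑ i, fd (boundaryVec γ h κ φ ν F η H C i) y (ee i)) 0 := by
  have hmain := hγ.hasDerivAt_lagr hh hs hφ hν hy κc hκc hκ hFε hHε Λ
  refine hmain.congr_deriv ?_
  rw [hF0, hH0]
  have cF := hγ.smooth_contractVec κc hκc (smooth_exp_smul hφ hF) hη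
  have cH := hγ.smooth_contractVec (κ := LinearMap.mul ℝ ℝ) (ContinuousLinearMap.mul ℝ ℝ)
    (fun _ _ => rfl) (smooth_exp_smul hφ hH) hC
  have sd := hγ.smooth_sqrtDet
  have d1 : ∀ i, DifferentiableAt ℝ
      (fun z => sqrtDet (γ z) * (exp (-2 * φ z) * gravVec γ h φ ν i z)) y := fun i =>
    hγ.diffAt (sd.mul ((contDiffOn_const.mul hφ).exp.mul (hγ.smooth_gravVec hh hφ hν i))) hy
  have d2 : ∀ i, DifferentiableAt ℝ (fun z => sqrtDet (γ z) *
      contractVec γ κ (fun z => exp (-2 * φ z) • F z) η i z) y := fun i =>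
    hγ.diffAt (sd.mul (cF i)) hy
  have d3 : ∀ i, DifferentiableAt ℝ (fun z => sqrtDet (γ z) *
      contractVec γ (LinearMap.mul ℝ ℝ) (fun z => exp (-2 * φ z) • H z) C i z) y := fun i =>
    hγ.diffAt (sd.mul (cH i)) hy
  have hsum : ∑ i, fd (boundaryVec γ h κ φ ν F η H C i) y (ee i) =
      ∑ i, fd (fun z => sqrtDet (γ z) * (exp (-2 * φ z) * gravVec γ h φ ν i z)) y (ee i) +
      ∑ i, fd (fun z => sqrtDet (γ z) *
        contractVec γ κ (fun z => exp (-2 * φ z) • F z) η i z) y (ee i) -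
      ∑ i, fd (fun z => sqrtDet (γ z) *
        contractVec γ (LinearMap.mul ℝ ℝ) (fun z => exp (-2 * φ z) • H z) C i z) y (ee i) := by
    rw [← sum_add_distrib, ← sum_sub_distrib]
    refine sum_ext fun i => ?_
    have : HasFDerivAt (boundaryVec γ h κ φ ν F η H C i) _ y :=
      ((d1 i).hasFDerivAt.fun_add (d2 i).hasFDerivAt).fun_sub (d3 i).hasFDerivAt
    rw [this.fderiv]
    rfl
  have e2 := hγ.divergence_pairing (κ := κ) (σ := fun z => exp (-2 * φ z) • F z) (τ := η)
    (dσ := dF y) (dτ := dη) hy hL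
    fun i => hγ.diffAt (cF i) hy
  have hdH := hγ.diffAt (smooth_exp_smul hφ hH) hy
  have hdC := hγ.diffAt hC hy
  have e3 := hγ.divergence_pairing (κ := LinearMap.mul ℝ ℝ)
    (σ := fun z => exp (-2 * φ z) • H z) (τ := C)
    (dσ := fd (fun z => exp (-2 * φ z) • H z) y) (dτ := fd C y) hy
    (fun i v v' => by
      have a1 : HasDerivAt (fun t : ℝ => (exp (-2 * φ (y + t • ee i)) • H (y + t • ee i)) v) _ 0 :=
        (ContinuousAlternatingMap.apply ℝ (Euc n) ℝ v).hasFDerivAt.comp_hasDerivAt (0 : ℝ)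
          (hasDerivAt_line hdH (ee i))
      have a2 : HasDerivAt (fun t : ℝ => C (y + t • ee i) v') _ 0 :=
        (ContinuousAlternatingMap.apply ℝ (Euc n) ℝ v').hasFDerivAt.comp_hasDerivAt (0 : ℝ)
          (hasDerivAt_line hdC (ee i))
      have a3 := a1.fun_mul a2
      simp only [zero_smul, add_zero] at a3
      exact a3)
    fun i => hγ.diffAt (cH i) hy
  simp only [contractVec] at hsum
  rw [hsum, e2, e3]
  set G := gi (γ y) with hG
  have hGs : ∀ i j, G i j = G j i := gram_inv_symm (hγ.symm y)
  -- the wedge product in the variation of the three-form field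
  have w1 : mPair G (LinearMap.mul ℝ ℝ) (H y) (wedge κc (η y) (F y)) =
      mPair G κ (fun w => pairing (γ y) (LinearMap.lsmul ℝ V) ((H y).curryLeft (w 0)) (F y))
        (η y) := by
    rw [wedge, mPair_alternatize, mPair_one]
    refine sum_ext fun i => sum_ext fun l => ?_
    rw [smul_eq_mul, hκ]
    have e4 : (oneTensor κc (η y) (F y) (ee l) : (Fin 2 → Euc n) → ℝ) =
        fun w => κ (η y ![ee l]) (F y w) := by
      funext w
      rw [hκc]
      rw [← toLin_apply]
      rfl
    rw [e4, mPair_linear_comp G (κ (η y ![ee l]))]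
    rfl
  have w2 : mPair G κ (betaTLoc univ γ φ (F y) (H y) (dF y) y) (η y) =
      (1 / 2) * (exp (2 * φ y) * mPair G κ (negDiv (γ y)
        (fun l i j => Chr γ l i j y) (dF y) (exp (-2 * φ y) • F y)) (η y) +
      mPair G (LinearMap.mul ℝ ℝ) (H y) (wedge κc (η y) (F y))) := by
    have : betaTLoc univ γ φ (F y) (H y) (dF y) y = fun w => (1 / 2 : ℝ) •
      (exp (2 * φ y) • negDiv (γ y) (fun l i j => Chr γ l i j y) (dF y)
      (exp (-2 * φ y) • F y) w +
      pairing (γ y) (LinearMap.lsmul ℝ V) ((H y).curryLeft (w 0)) (F y)) := rfl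
    rw [this, mPair_smul_left, mPair_add_left, mPair_smul_left, w1, smul_eq_mul, smul_eq_mul]
  have w3 : mPair G (LinearMap.mul ℝ ℝ) (betaBLoc univ γ φ H y) (C y) =
      (1 / 2) * exp (2 * φ y) * mPair G (LinearMap.mul ℝ ℝ) (negDiv (γ y)
        (fun l i j => Chr γ l i j y)
        (fd (fun z => exp (-2 * φ z) • H z) y) (exp (-2 * φ y) • H y)) (C y) := by
    have : betaBLoc univ γ φ H y = fun w => ((1 / 2) * exp (2 * φ y)) • negDiv (γ y)
        (fun l i j => Chr γ l i j y)
        (fd (fun z => exp (-2 * φ z) • H z) y) (exp (-2 * φ y) • H y) w := by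
      funext w
      rw [betaBLoc, fderivWithin_univ, smul_eq_mul]
    rw [this, mPair_smul_left, smul_eq_mul]
  have w4 : mPair G (LinearMap.mul ℝ ℝ) (H y)
      (alternatizeUncurryFin (fd C y) - wedge κc (η y) (F y) : Alt n 3 ℝ) =
      mPair G (LinearMap.mul ℝ ℝ) (H y) (alternatizeUncurryFin (fd C y)) -
      mPair G (LinearMap.mul ℝ ℝ) (H y) (wedge κc (η y) (F y)) := by
    have : ((alternatizeUncurryFin (fd C y) -
        wedge κc (η y) (F y) : Alt n 3 ℝ) : (Fin 3 → Euc n) → ℝ) =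
        fun w => alternatizeUncurryFin (fd C y) w + (-1 : ℝ) • wedge κc (η y) (F y) w := by
      funext w; simp [sub_eq_add_neg]
    rw [this, mPair_add_right, mPair_smul_right]
    simp [sub_eq_add_neg]
  have w5 : mPair G κ (exp (-2 * φ y) • F y : Alt n 2 V)
      (alternatizeUncurryFin dη) = exp (-2 * φ y) *
      mPair G κ (F y) (alternatizeUncurryFin dη) := mPair_smul_left ..
  have w6 : mPair G (LinearMap.mul ℝ ℝ) (exp (-2 * φ y) • H y : Alt n 3 ℝ)
      (alternatizeUncurryFin (fd C y)) = exp (-2 * φ y) * mPair G (LinearMap.mul ℝ ℝ) (H y)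
        (alternatizeUncurryFin (fd C y)) := mPair_smul_left ..
  have hexp : exp (-2 * φ y) * exp (2 * φ y) = 1 := by rw [← Real.exp_add]; simp
  rw [eulerLagrange, w2, w3, w4, w5, w6]
  linear_combination sqrtDet (γ y) * (mPair G κ (negDiv (γ y)
        (fun l i j => Chr γ l i j y) (dF y) (exp (-2 * φ y) • F y)) (η y) -
    mPair G (LinearMap.mul ℝ ℝ) (negDiv (γ y) (fun l i j => Chr γ l i j y)
        (fd (fun z => exp (-2 * φ z) • H z) y) (exp (-2 * φ y) • H y)) (C y)) * (-hexp)

end IsLocMetric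

end FirstVariation

/-! ### Integrals over compact sets in Euclidean space -/

section Integrals

open Filter Topology

variable {n : ℕ}

/-- Differentiation under the integral sign over a subset of a compact set. -/
lemma hasDerivAt_setIntegral {C S : Set (Euc n)} (hC : IsCompact C) (hS : MeasurableSet S)
    (hSC : S ⊆ C) {f : ℝ → Euc n → ℝ} {f' : Euc n → ℝ}
    (hf : ∀ y ∈ C, ContDiffAt ℝ 1 (uncurry f) (0, y))
    (hf' : ∀ y ∈ C, HasDerivAt (fun ε => f ε y) (f' y) 0) :
    (∀ᶠ ε in 𝓝 (0 : ℝ), IntegrableOn (f ε) S) ∧ IntegrableOn f' S ∧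
      HasDerivAt (fun ε => ∫ y in S, f ε y) (∫ y in S, f' y) 0 := by
  have h1 : ∀ᶠ ε in 𝓝 (0 : ℝ), ∀ y ∈ C, ContDiffAt ℝ 1 (uncurry f) (ε, y) := by
    refine hC.eventually_forall_of_forall_eventually fun y hy => ?_
    exact (hf y hy).eventually (by simp)
  obtain ⟨δ, hδ, h2⟩ := Metric.eventually_nhds_iff.1 h1
  have h3 : ∀ ε ∈ Set.Icc (-(δ / 2)) (δ / 2), ∀ y ∈ C, ContDiffAt ℝ 1 (uncurry f) (ε, y) := by
    intro ε hε y hy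
    refine h2 ?_ y hy
    rw [Real.dist_eq, sub_zero]
    exact (abs_le.2 hε).trans_lt (by linarith)
  set D : ℝ × Euc n → ℝ := fun p => fd (uncurry f) p (1, 0) with hD
  have hDc : ContinuousOn D (Set.Icc (-(δ / 2)) (δ / 2) ×ˢ C) := by
    rintro ⟨ε, y⟩ ⟨hε, hy⟩
    have := (h3 ε hε y hy).continuousAt_fderiv (by simp)
    exact (this.clm_apply continuousAt_const).continuousWithinAt
  obtain ⟨B, hB⟩ := ((isCompact_Icc.prod hC).exists_bound_of_continuousOn hDc)
  have hder : ∀ ε ∈ Set.Icc (-(δ / 2)) (δ / 2), ∀ y ∈ C,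
      HasDerivAt (fun t => f t y) (D (ε, y)) ε := by
    intro ε hε y hy
    have h := ((h3 ε hε y hy).differentiableAt (by simp)).hasFDerivAt
    have h' : HasDerivAt (fun t : ℝ => (t, y)) ((1 : ℝ), (0 : Euc n)) ε :=
      (hasDerivAt_id ε).prodMk (hasDerivAt_const _ _)
    exact h.comp_hasDerivAt ε h'
  have hf'D : ∀ y ∈ C, f' y = D (0, y) := fun y hy =>
    (hf' y hy).unique (hder 0 ⟨by linarith, by linarith⟩ y hy)
  have hcont : ∀ ε ∈ Set.Icc (-(δ / 2)) (δ / 2), ContinuousOn (f ε) C := by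
    intro ε hε y hy
    have : ContinuousAt (uncurry f) (ε, y) := (h3 ε hε y hy).continuousAt
    exact (this.comp (f := fun y => (ε, y)) (by fun_prop)).continuousWithinAt
  have hint : ∀ ε ∈ Set.Icc (-(δ / 2)) (δ / 2), IntegrableOn (f ε) S := fun ε hε =>
    ((hcont ε hε).integrableOn_compact hC).mono_set hSC
  have hcf' : ContinuousOn f' C := by
    refine ContinuousOn.congr ?_ hf'D
    refine hDc.comp (f := fun y => ((0 : ℝ), y)) (by fun_prop) fun y hy => ⟨⟨?_, ?_⟩, hy⟩ <;>
      dsimp only <;> linarith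
  have hnb : Set.Icc (-(δ / 2)) (δ / 2) ∈ 𝓝 (0 : ℝ) := Icc_mem_nhds (by linarith) (by linarith)
  refine ⟨Filter.eventually_of_mem hnb hint, (hcf'.integrableOn_compact hC).mono_set hSC, ?_⟩
  have hfin : IsFiniteMeasure ((volume : Measure (Euc n)).restrict S) := ⟨by
      rw [Measure.restrict_apply_univ]
      exact (measure_mono hSC).trans_lt hC.measure_lt_top⟩
  refine (hasDerivAt_integral_of_dominated_loc_of_deriv_le (F := f) (bound := fun _ => B)
    (F' := fun ε y => D (ε, y)) (x₀ := (0 : ℝ)) (s := Set.Icc (-(δ / 2)) (δ / 2)) hnb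
    (Filter.eventually_of_mem hnb fun ε hε => (hint ε hε).aestronglyMeasurable)
    (hint 0 (mem_of_mem_nhds hnb)) ?_ ?_ (integrable_const B) ?_).2.congr_deriv ?_
  · refine ((hDc.comp (f := fun y => ((0 : ℝ), y)) (by fun_prop)
      fun y hy => ⟨mem_of_mem_nhds hnb, hy⟩).integrableOn_compact hC).mono_set hSC
      |>.aestronglyMeasurable
  · refine (ae_restrict_mem hS).mono fun y hy ε hε => hB (ε, y) ⟨hε, hSC hy⟩
  · exact (ae_restrict_mem hS).mono fun y hy ε hε => hder ε hε y (hSC hy)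
  · exact setIntegral_congr_fun hS fun y hy => (hf'D y (hSC hy)).symm

/-- The integral of a derivative of a compactly supported function vanishes. -/
lemma integral_fderiv_eq_zero_of_compact {Ω L : Set (Euc n)} (hΩ : IsOpen Ω) (hL : IsCompact L)
    (hLΩ : L ⊆ Ω) {W : Euc n → ℝ} (hW : ContDiffOn ℝ 1 W Ω) (h0 : ∀ y ∈ Ω, y ∉ L → W y = 0)
    (v : Euc n) : IntegrableOn (fun y => fd W y v) Ω ∧ ∫ y in Ω, fd W y v = 0 := by
  classical
  set W' : Euc n → ℝ := Ω.indicator W with hW'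
  have hz : ∀ y ∉ L, W' y = 0 := by
    intro y hy
    by_cases h : y ∈ Ω
    · rw [hW', Set.indicator_of_mem h, h0 y h hy]
    · rw [hW', Set.indicator_of_notMem h]
  have heq : ∀ y ∈ Ω, W' =ᶠ[𝓝 y] W := fun y hy =>
    Filter.eventually_of_mem (hΩ.mem_nhds hy) fun z hz => Set.indicator_of_mem hz W
  have hsm : ContDiff ℝ 1 W' := by
    rw [contDiff_iff_contDiffAt]
    intro y
    by_cases h : y ∈ Ω
    · exact (hW.contDiffAt (hΩ.mem_nhds h)).congr_of_eventuallyEq (heq y h)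
    · have : W' =ᶠ[𝓝 y] fun _ => 0 :=
        Filter.eventually_of_mem (hL.isClosed.isOpen_compl.mem_nhds fun h' => h (hLΩ h')) hz
      exact contDiffAt_const.congr_of_eventuallyEq this
  have hcs : HasCompactSupport W' := HasCompactSupport.intro hL hz
  have hfc : Continuous fun y => fd W' y v :=
    (hsm.continuous_fderiv (by simp)).clm_apply continuous_const
  have hfs : HasCompactSupport fun y => fd W' y v := hcs.fderiv_apply (𝕜 := ℝ) v
  have hint : Integrable fun y => fd W' y v := hfc.integrable_of_hasCompactSupport hfs
  have hfd : ∀ y ∈ Ω, fd W' y v = fd W y v := fun y hy => by rw [(heq y hy).fderiv_eq]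
  have h1 : ∫ y, fd W' y v = 0 := by
    have := integral_mul_fderiv_eq_neg_fderiv_mul_of_integrable (𝕜 := ℝ) (μ := volume) (v := v)
      (f := fun _ : Euc n => (1 : ℝ)) (g := W') (by simp) (by simpa using hint)
      (by simpa using hsm.continuous.integrable_of_hasCompactSupport hcs)
      (fun _ _ => differentiableAt_const _) (fun y _ => hsm.differentiable (by simp) y)
    simpa using this
  refine ⟨(hint.integrableOn).congr_fun hfd hΩ.measurableSet, ?_⟩
  rw [← setIntegral_congr_fun hΩ.measurableSet hfd, ← h1]
  refine setIntegral_eq_integral_of_forall_compl_eq_zero fun y hy => ?_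
  have : W' =ᶠ[𝓝 y] fun _ => 0 :=
    Filter.eventually_of_mem (hL.isClosed.isOpen_compl.mem_nhds fun h' => hy (hLΩ h')) hz
  rw [this.fderiv_eq]
  simp

end Integrals

/-! ### Coordinate frames and changes of charts -/

section Frames

open Set Filter Topology

variable {n : ℕ} {H : Type*} [TopologicalSpace H] {I : ModelWithCorners ℝ (Euc n) H}
  {M : Type*} [TopologicalSpace M] [ChartedSpace H M] [IsManifold I ∞ M] {y : Euc n}

lemma frame_eq {x₀ x : M} (hx : x ∈ (chartAt H x₀).source) :
    (frame I x₀ x : Lin n) = tangentCoordChange I x₀ x x :=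
  TangentBundle.symmL_trivializationAt_eq_core hx

/-- The coordinate coframe of the chart at `x₀`, the inverse of `frame`. -/
def coframe (I : ModelWithCorners ℝ (Euc n) H) [IsManifold I ∞ M] (x₀ x : M) : Lin n :=
  tangentCoordChange I x x₀ x

lemma frame_coframe {x₀ x : M} (hx : x ∈ (chartAt H x₀).source) (v : Euc n) :
    (frame I x₀ x : Lin n) (coframe I x₀ x v) = v := by
  rw [frame_eq hx, coframe]
  refine (tangentCoordChange_comp (I := I) ⟨⟨?_, ?_⟩, ?_⟩).trans (tangentCoordChange_self ?_) <;>
    simp [hx]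

lemma coframe_frame {x₀ x : M} (hx : x ∈ (chartAt H x₀).source) (v : Euc n) :
    coframe I x₀ x ((frame I x₀ x : Lin n) v) = v := by
  rw [frame_eq hx, coframe]
  refine (tangentCoordChange_comp (I := I) ⟨⟨?_, ?_⟩, ?_⟩).trans (tangentCoordChange_self ?_) <;>
    simp [hx]

lemma frame_self (x : M) : (frame I x x : Lin n) = ContinuousLinearMap.id ℝ (Euc n) := by
  refine ContinuousLinearMap.ext fun v => ?_
  rw [frame_eq (mem_chart_source H x)]
  exact tangentCoordChange_self (E := Euc n) (by simp)

lemma coframe_self (x : M) : coframe I x x = ContinuousLinearMap.id ℝ (Euc n) := by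
  refine ContinuousLinearMap.ext fun v => ?_
  exact tangentCoordChange_self (by simp)

lemma frame_comp_tangentCoordChange {x₀ z x : M} (hx : x ∈ (chartAt H x₀).source)
    (hz : x ∈ (chartAt H z).source) :
    (frame I z x : Lin n).comp (tangentCoordChange I x₀ z x) = frame I x₀ x := by
  ext1 v
  rw [frame_eq hx, frame_eq hz]
  refine (tangentCoordChange_comp (I := I) ⟨⟨?_, ?_⟩, ?_⟩) <;> simp [hx, hz]

lemma coframe_comp_frame {x₀ z x : M} (hx : x ∈ (chartAt H x₀).source)
    (hz : x ∈ (chartAt H z).source) :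
    (coframe I z x).comp (frame I x₀ x : Lin n) = tangentCoordChange I x₀ z x := by
  ext1 v
  rw [frame_eq hx, coframe]
  refine (tangentCoordChange_comp (I := I) ⟨⟨?_, ?_⟩, ?_⟩) <;> simp [hx, hz]

lemma mat_frame_det_ne_zero {x₀ x : M} (hx : x ∈ (chartAt H x₀).source) :
    (mat (frame I x₀ x : Lin n)).det ≠ 0 :=
  det_mat_ne_zero (g := coframe I x₀ x) (by ext1 v; exact frame_coframe hx v)

/-- The change of coordinates from the chart at `x₀` to the chart at `z`. -/
def chartTrans (I : ModelWithCorners ℝ (Euc n) H) (x₀ z : M) : Euc n → Euc n := ch I z ∘ ich I x₀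

/-- The domain of the change of coordinates. -/
def transDom (I : ModelWithCorners ℝ (Euc n) H) (x₀ z : M) : Set (Euc n) :=
  (ch I x₀).target ∩ ich I x₀ ⁻¹' (chartAt H z).source

lemma dom_mem_nhds {x₀ : M} (hy : y ∈ (ch I x₀).target)
    {U : Set M} (hU : IsOpen U) (hyU : ich I x₀ y ∈ U) :
    dom I x₀ U ∈ 𝓝[range I] y := by
  refine inter_mem (extChartAt_target_mem_nhdsWithin_of_mem hy) ?_
  have h1 := (continuousOn_extChartAt_symm (I := I) x₀ y hy).preimage_mem_nhdsWithin
    (hU.mem_nhds hyU)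
  rwa [← nhdsWithin_extChartAt_target_eq_of_mem hy]

lemma transDom_mem_nhds {x₀ z : M} (hy : y ∈ transDom I x₀ z) : transDom I x₀ z ∈ 𝓝[range I] y :=
  dom_mem_nhds hy.1 (chartAt H z).open_source hy.2

lemma smoothAt_chartTrans {x₀ z : M} (hy : y ∈ transDom I x₀ z) :
    ContDiffWithinAt ℝ ∞ (chartTrans I x₀ z) (range I) y := by
  refine contDiffWithinAt_ext_coord_change z x₀ ?_
  rw [PartialEquiv.trans_source, PartialEquiv.symm_source]
  exact ⟨hy.1, by simpa using hy.2⟩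

lemma smooth_chartTrans (x₀ z : M) : SmoothOn (chartTrans I x₀ z) (transDom I x₀ z) := fun _ hy =>
  (smoothAt_chartTrans hy).mono (inter_subset_left.trans (extChartAt_target_subset_range x₀))

lemma tangentCoordChange_eq_fderivWithin {x₀ z : M} (hy : y ∈ transDom I x₀ z) :
    tangentCoordChange I x₀ z (ich I x₀ y) = fderivWithin ℝ (chartTrans I x₀ z) (range I) y := by
  rw [tangentCoordChange_def, (ch I x₀).right_inv hy.1]
  rfl

lemma chartTrans_symm {x₀ z : M} (hy : y ∈ transDom I x₀ z) :
    ich I z (chartTrans I x₀ z y) = ich I x₀ y :=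
  (ch I z).left_inv (by simpa using hy.2)

lemma chartTrans_mem {x₀ z : M} (hy : y ∈ transDom I x₀ z) :
    chartTrans I x₀ z y ∈ (ch I z).target :=
  (ch I z).map_source (by simpa using hy.2)

lemma symm_mem_source {x₀ : M} (hy : y ∈ (ch I x₀).target) :
    ich I x₀ y ∈ (chartAt H x₀).source := by
  simpa using (ch I x₀).map_target hy

lemma chartTrans_chartTrans {x₀ z : M} (hy : y ∈ transDom I x₀ z) :
    chartTrans I z x₀ (chartTrans I x₀ z y) = y := by
  have : chartTrans I z x₀ (chartTrans I x₀ z y) = ch I x₀ (ich I z (chartTrans I x₀ z y)) := rfl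
  rw [this, chartTrans_symm hy, (ch I x₀).right_inv hy.1]

lemma smooth_fderivWithin_chartTrans (x₀ z : M) :
    SmoothOn (fderivWithin ℝ (chartTrans I x₀ z) (range I)) (transDom I x₀ z) := fun y hy =>
  ((smoothAt_chartTrans hy).fderivWithin_right I.uniqueDiffOn (by simp)
    (extChartAt_target_subset_range x₀ hy.1)).mono
      (inter_subset_left.trans (extChartAt_target_subset_range x₀))

lemma frame_comp_fderivWithin {x₀ z : M} (hy : y ∈ transDom I x₀ z) :
    (frame I z (ich I x₀ y) : Lin n).comp
      (fderivWithin ℝ (chartTrans I x₀ z) (range I) y) = frame I x₀ (ich I x₀ y) := by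
  rw [← tangentCoordChange_eq_fderivWithin hy]
  exact frame_comp_tangentCoordChange (symm_mem_source hy.1) hy.2

/-- The frame at `x` of the chart at `x₀` is the derivative of the change of coordinates. -/
lemma frame_eq_fderivWithin {x₀ : M} (hy : y ∈ (ch I x₀).target) :
    (frame I x₀ (ich I x₀ y) : Lin n) =
      fderivWithin ℝ (chartTrans I x₀ (ich I x₀ y)) (range I) y := by
  rw [← frame_comp_fderivWithin (z := ich I x₀ y) ⟨hy, mem_chart_source _ _⟩, frame_self]
  rfl

section Transition

variable {V : Type*} [NormedAddCommGroup V] [NormedSpace ℝ V] {k : ℕ}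

lemma locForm_eq_comp (σ : Form I M V k) {x₀ z : M} (hy : y ∈ transDom I x₀ z) :
    locForm x₀ σ y = (locForm z σ (chartTrans I x₀ z y)).compContinuousLinearMap
      (fderivWithin ℝ (chartTrans I x₀ z) (range I) y) := by
  unfold locForm
  rw [chartTrans_symm hy, ← frame_comp_fderivWithin hy]
  rfl

lemma locBilin_eq_pullBilin (h : Bilin I M) {x₀ z : M} (hy : y ∈ transDom I x₀ z) :
    locBilin x₀ h y = pullBilin (locBilin z h (chartTrans I x₀ z y))
      (fderivWithin ℝ (chartTrans I x₀ z) (range I) y) := by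
  unfold locBilin
  rw [chartTrans_symm hy, ← frame_comp_fderivWithin hy]
  rfl

lemma locForm_self (σ : Form I M V k) (x : M) : locForm x σ (ch I x x) = σ x := by
  have : ∀ z, z = x → (σ z).compContinuousLinearMap (frame I x z) = σ x := by
    rintro z rfl
    rw [frame_self]
    rfl
  exact this _ (extChartAt_to_inv x)

lemma locBilin_self (h : Bilin I M) (x : M) : locBilin x h (ch I x x) = h x := by
  have : ∀ z, z = x → pullBilin (h z) (frame I x z) = h x := by
    rintro z rfl
    rw [frame_self]
    rfl
  exact this _ (extChartAt_to_inv x)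

end Transition

/-- Naturality of the exterior derivative on sets that need not be open, for a pullback that is only
known near the point. -/
lemma extDerivWithin_eq_comp {E F V : Type*} [NormedAddCommGroup E] [NormedSpace ℝ E]
    [NormedAddCommGroup F] [NormedSpace ℝ F] [NormedAddCommGroup V] [NormedSpace ℝ V] {k : ℕ}
    {R : Set E} {R' : Set F} {f : E → F} {x : E} {α : F → F [⋀^Fin k]→L[ℝ] V}
    {σ : E → E [⋀^Fin k]→L[ℝ] V} (hR : UniqueDiffOn ℝ R) (hRc : R ⊆ closure (interior R))
    (hx : x ∈ R) (hα : DifferentiableWithinAt ℝ α R' (f x)) (hf : ContDiffWithinAt ℝ ∞ f R x)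
    (hR' : ∀ᶠ z in 𝓝[R] x, f z ∈ R')
    (hσ : ∀ᶠ z in 𝓝[R] x, σ z = (α (f z)).compContinuousLinearMap (fderivWithin ℝ f R z)) :
    extDerivWithin σ R x =
      (extDerivWithin α R' (f x)).compContinuousLinearMap (fderivWithin ℝ f R x) := by
  obtain ⟨O, hO, hxO, hOs⟩ := mem_nhdsWithin.1 (hR'.and hσ)
  have hfd : ∀ z ∈ O, fderivWithin ℝ f (R ∩ O) z = fderivWithin ℝ f R z := fun z hz =>
    fderivWithin_inter (hO.mem_nhds hz)
  have hs : UniqueDiffOn ℝ (R ∩ O) := hR.inter hO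
  have h := extDerivWithin_pullback (s := R ∩ O) (t := R') (r := ∞) hα (hf.mono inter_subset_left)
    (by simp [minSmoothness_of_isRCLikeNormedField]; exact ENat.LEInfty.out) hs ?_ ⟨hx, hxO⟩
    (fun z hz => (hOs ⟨hz.2, hz.1⟩).1)
  · rw [hfd x hxO] at h
    rw [← h]
    have e1 : extDerivWithin σ (R ∩ O) x = extDerivWithin σ R x := by
      unfold extDerivWithin
      rw [fderivWithin_inter (hO.mem_nhds hxO)]
    rw [← e1]
    refine extDerivWithin_congr (fun z hz => ?_) ?_
    · rw [hfd z hz.2]; exact (hOs ⟨hz.2, hz.1⟩).2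
    · rw [hfd x hxO]; exact (hOs ⟨hxO, hx⟩).2
  · rw [interior_inter, hO.interior_eq, inter_comm]
    exact hO.inter_closure ⟨hxO, hRc hx⟩

section ExteriorDerivative

variable {V : Type*} [NormedAddCommGroup V] [NormedSpace ℝ V] {k : ℕ}

lemma SmoothForm.differentiableWithinAt {σ : Form I M V k} (hσ : SmoothForm σ) {x₀ : M} (hy : y ∈ (ch I x₀).target) :
    DifferentiableWithinAt ℝ (locForm x₀ σ) (range I) y :=
  ((hσ x₀ y hy).differentiableWithinAt (by simp)).mono_of_mem_nhdsWithin
    (extChartAt_target_mem_nhdsWithin_of_mem hy)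

/-- The exterior derivative may be computed in any chart. -/
lemma locForm_extD {σ : Form I M V k} (hσ : SmoothForm σ) {x₀ : M} (hy : y ∈ (ch I x₀).target) :
    locForm x₀ (extD σ) y = extDerivWithin (locForm x₀ σ) (range I) y := by
  set x := ich I x₀ y with hx
  have hd : y ∈ transDom I x₀ x := ⟨hy, mem_chart_source _ _⟩
  have e : ch I x x = chartTrans I x₀ x y := rfl
  have h := extDerivWithin_eq_comp (R := range I) (R' := range I) (f := chartTrans I x₀ x)
    (x := y) (α := locForm x σ) (σ := locForm x₀ σ) I.uniqueDiffOn I.range_subset_closure_interior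
    (extChartAt_target_subset_range x₀ hy)
    (hσ.differentiableWithinAt (chartTrans_mem hd)) (smoothAt_chartTrans hd)
    (eventually_of_mem (transDom_mem_nhds hd) fun z hz =>
      extChartAt_target_subset_range x (chartTrans_mem hz))
    (eventually_of_mem (transDom_mem_nhds hd) fun z hz => locForm_eq_comp σ hz)
  rw [h]
  unfold locForm extD
  rw [frame_eq_fderivWithin hy]
  rfl

lemma contDiff_alternatizeUncurryFin {r : WithTop ℕ∞} :
    ContDiff ℝ r fun f : Euc n →L[ℝ] Alt n k V => alternatizeUncurryFin f :=
  ContinuousLinearMap.contDiff (𝕜 := ℝ) (E := Euc n →L[ℝ] Alt n k V) (F := Alt n (k + 1) V)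
    (ContinuousAlternatingMap.alternatizeUncurryFinCLM ℝ (Euc n) V)

lemma smooth_extDerivWithin {U : Set M} (hU : IsOpen U) {x₀ : M} {α : Euc n → Alt n k V}
    (hα : SmoothOn α (dom I x₀ U)) :
    SmoothOn (extDerivWithin α (range I)) (dom I x₀ U) := by
  intro y hy
  have h1 : ContDiffWithinAt ℝ ∞ (fderivWithin ℝ α (range I)) (range I) y := by
    refine ((hα y hy).mono_of_mem_nhdsWithin
      (dom_mem_nhds hy.1 hU hy.2)).fderivWithin_right I.uniqueDiffOn (by simp)
      (extChartAt_target_subset_range x₀ hy.1)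
  have h2 : ContDiffWithinAt ℝ ∞ (extDerivWithin α (range I)) (range I) y :=
    contDiff_alternatizeUncurryFin.comp_contDiffWithinAt h1
  exact h2.mono (inter_subset_left.trans (extChartAt_target_subset_range x₀))

lemma SmoothForm.extD {σ : Form I M V k} (hσ : SmoothForm σ) : SmoothForm (extD σ) := by
  intro x₀
  have h := smooth_extDerivWithin (I := I) (M := M) (x₀ := x₀) isOpen_univ
    (α := locForm x₀ σ) (by simpa using hσ x₀)
  rw [preimage_univ, inter_univ] at h
  exact h.congr fun y hy => locForm_extD hσ hy

end ExteriorDerivative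

/-! ### The volume measure in a chart -/

section Volume

lemma sqrtDet_pullBilin (b : Bil n) (f : Lin n) :
    sqrtDet (pullBilin b f) = |f.det| * sqrtDet b := by
  unfold sqrtDet
  rw [det_gram_pullBilin, abs_mul, abs_pow, Real.sqrt_mul (by positivity),
    Real.sqrt_sq (abs_nonneg _), det_mat]

variable [MeasurableSpace M] [BorelSpace M]

lemma measurable_target (x₀ : M) : MeasurableSet (ch I x₀).target := by
  rw [extChartAt_target]
  exact ((chartAt H x₀).open_target.preimage I.continuous_symm).measurableSet.inter
    I.isClosed_range.measurableSet

lemma measurable_dom (x₀ : M) {S : Set M} (hS : MeasurableSet S) : MeasurableSet (dom I x₀ S) := by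
  have h1 : Measurable ((ch I x₀).target.domRestrict ich I x₀) :=
    (continuousOn_iff_continuous_domRestrict.1 (continuousOn_extChartAt_symm (I := I) x₀)).measurable
  have h2 := (MeasurableEmbedding.subtype_coe (measurable_target (I := I) x₀)).measurableSet_image.2
    (h1 hS)
  convert! h2 using 1
  ext y
  simp [and_comm]

lemma aemeasurable_symm (x₀ : M) (μ : Measure (Euc n)) :
    AEMeasurable ich I x₀ (μ.restrict (ch I x₀).target) :=
  (continuousOn_extChartAt_symm (I := I) x₀).aemeasurable (measurable_target x₀)

/-- The measure on the coordinate domain whose image is `chartVol`. -/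
def coordVol (g : Bilin I M) (x₀ : M) : Measure (Euc n) :=
  ((volume : Measure (Euc n)).restrict (ch I x₀).target).withDensity fun y =>
    ENNReal.ofReal (sqrtDet (locBilin x₀ g y))

lemma aemeasurable_symm_coordVol (g : Bilin I M) (x₀ : M) : AEMeasurable ich I x₀ (coordVol g x₀) :=
  (aemeasurable_symm x₀ volume).mono_ac (withDensity_absolutelyContinuous _ _)

lemma chartVol_apply (g : Bilin I M) (x₀ : M) {S : Set M} (hS : MeasurableSet S) :
    chartVol g x₀ S = ∫⁻ y in dom I x₀ S, ENNReal.ofReal (sqrtDet (locBilin x₀ g y)) := by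
  have h1 : chartVol g x₀ S = coordVol g x₀ (ich I x₀ ⁻¹' S) :=
    Measure.map_apply_of_aemeasurable (aemeasurable_symm_coordVol g x₀) hS
  have hT := measurable_target (I := I) x₀
  have h3 : coordVol g x₀ (ch I x₀).targetᶜ = 0 := by
    refine withDensity_absolutelyContinuous _ _ ?_
    rw [Measure.restrict_apply hT.compl]
    simp
  have h2 : coordVol g x₀ (ich I x₀ ⁻¹' S) = coordVol g x₀ (dom I x₀ S) := by
    refine le_antisymm ?_ (measure_mono inter_subset_right)
    calc coordVol g x₀ (ich I x₀ ⁻¹' S)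
        ≤ coordVol g x₀ ((dom I x₀ S) ∪ (ch I x₀).targetᶜ) := by
          refine measure_mono fun y hy => ?_
          by_cases h : y ∈ (ch I x₀).target
          · exact Or.inl ⟨h, hy⟩
          · exact Or.inr h
      _ ≤ _ := (measure_union_le _ _).trans (by rw [h3, add_zero])
  rw [h1, h2, coordVol, withDensity_apply _ (measurable_dom x₀ hS),
    Measure.restrict_restrict (measurable_dom x₀ hS), inter_right_comm, inter_self]

/-- The chart measures agree on overlaps. -/
lemma chartVol_eq_chartVol (g : Bilin I M) (x₀ z : M) {S : Set M} (hS : MeasurableSet S)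
    (h0 : S ⊆ (chartAt H x₀).source) (hz : S ⊆ (chartAt H z).source) :
    chartVol g x₀ S = chartVol g z S := by
  rw [chartVol_apply g x₀ hS, chartVol_apply g z hS]
  set A := dom I x₀ S with hA
  have hAd : A ⊆ transDom I x₀ z := fun y hy => ⟨hy.1, hz hy.2⟩
  have himg : dom I z S = chartTrans I x₀ z '' A := by
    ext y
    constructor
    · rintro ⟨hy, hyS⟩
      have hyd : y ∈ transDom I z x₀ := ⟨hy, h0 hyS⟩
      refine ⟨chartTrans I z x₀ y, ⟨chartTrans_mem hyd, ?_⟩, chartTrans_chartTrans hyd⟩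
      rw [mem_preimage, chartTrans_symm hyd]
      exact hyS
    · rintro ⟨y, hy, rfl⟩
      refine ⟨chartTrans_mem (hAd hy), ?_⟩
      rw [mem_preimage, chartTrans_symm (hAd hy)]
      exact hy.2
  rw [himg, lintegral_image_eq_lintegral_abs_det_fderiv_mul volume (measurable_dom x₀ hS)
    (f' := fun y => fderivWithin ℝ (chartTrans I x₀ z) (range I) y)
    (fun y hy => ((smoothAt_chartTrans (hAd hy)).differentiableWithinAt
      (by simp)).hasFDerivWithinAt.mono
      (inter_subset_left.trans (extChartAt_target_subset_range x₀)))
    (fun y hy y' hy' hyy => by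
      rw [← chartTrans_chartTrans (hAd hy), ← chartTrans_chartTrans (hAd hy'), hyy])]
  refine setLIntegral_congr_fun (measurable_dom x₀ hS) fun y hy => ?_
  rw [locBilin_eq_pullBilin g (hAd hy), sqrtDet_pullBilin, ENNReal.ofReal_mul (abs_nonneg _)]

lemma chartVol_compl_source (g : Bilin I M) (x₀ : M) {S : Set M} (hS : MeasurableSet S) :
    chartVol g x₀ S = chartVol g x₀ (S ∩ (chartAt H x₀).source) := by
  rw [chartVol_apply g x₀ hS,
    chartVol_apply g x₀ (hS.inter (chartAt H x₀).open_source.measurableSet)]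
  congr 2
  ext y
  constructor
  · rintro ⟨h1, h2⟩
    exact ⟨h1, h2, symm_mem_source h1⟩
  · rintro ⟨h1, h2⟩
    exact ⟨h1, h2.1⟩

/-- On the domain of a chart, the volume measure is the chart measure. -/
lemma vol_restrict (g : Bilin I M) (z : M) {S : Set M} (hS : MeasurableSet S)
    (hz : S ⊆ (chartAt H z).source) : (vol g).restrict S = (chartVol g z).restrict S := by
  have hW : MeasurableSet (chartAt H z).source := (chartAt H z).open_source.measurableSet
  have hle : vol g ≤ (chartVol g z).restrict (chartAt H z).source +
      (vol g).restrict (chartAt H z).sourceᶜ := by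
    refine iSup_le fun x₀ => ?_
    rw [← Measure.restrict_add_restrict_compl (μ := chartVol g x₀) hW]
    refine add_le_add ?_ (Measure.restrict_mono le_rfl (le_iSup (fun x => chartVol g x) x₀))
    refine Measure.le_iff.2 fun T hT => ?_
    rw [Measure.restrict_apply hT, Measure.restrict_apply hT,
      chartVol_compl_source g x₀ (hT.inter hW),
      chartVol_eq_chartVol g x₀ z ((hT.inter hW).inter (chartAt H x₀).open_source.measurableSet)
        inter_subset_right (inter_subset_left.trans inter_subset_right)]
    exact measure_mono inter_subset_left
  refine le_antisymm ?_ (Measure.restrict_mono le_rfl (le_iSup (fun x => chartVol g x) z))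
  refine Measure.le_iff.2 fun T hT => ?_
  rw [Measure.restrict_apply hT, Measure.restrict_apply hT]
  refine (hle _).trans ?_
  rw [Measure.add_apply, Measure.restrict_apply (hT.inter hS), Measure.restrict_apply (hT.inter hS)]
  have e : (T ∩ S) ∩ (chartAt H z).sourceᶜ = ∅ := by
    rw [← disjoint_iff_inter_eq_empty]
    exact disjoint_compl_right_iff_subset.2 (inter_subset_right.trans hz)
  rw [e, measure_empty, add_zero]
  exact measure_mono inter_subset_left

end Volume

end Frames

/-! ### Derivatives of maps and functions in charts -/

section MapsInCharts

open Set Filter Topology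

variable {n m : ℕ} {H HP : Type*} [TopologicalSpace H] {I : ModelWithCorners ℝ (Euc n) H}
  {M : Type*} [TopologicalSpace M] [ChartedSpace H M] [IsManifold I ∞ M] {y : Euc n}
  [TopologicalSpace HP] {IP : ModelWithCorners ℝ (Euc m) HP}
  {P : Type*} [TopologicalSpace P] [ChartedSpace HP P] [IsManifold IP ∞ P]

lemma hasFDerivWithinAt_chartTrans_frame {x₀ : M} (hy : y ∈ (ch I x₀).target) :
    HasFDerivWithinAt (chartTrans I x₀ (ich I x₀ y))
      (frame I x₀ (ich I x₀ y) : Lin n) (range I) y := by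
  rw [frame_eq_fderivWithin hy]
  exact ((smoothAt_chartTrans ⟨hy, mem_chart_source _ _⟩).differentiableWithinAt
    (by simp)).hasFDerivWithinAt

lemma hasFDerivWithinAt_comp_symm {E : Type*} [NormedAddCommGroup E] [NormedSpace ℝ E]
    {f : M → E} {x₀ : M} (hy : y ∈ (ch I x₀).target)
    (hf : MDifferentiableAt I 𝓘(ℝ, E) f (ich I x₀ y)) :
    HasFDerivWithinAt (fun z => f (ich I x₀ z))
      ((mfderiv I 𝓘(ℝ, E) f (ich I x₀ y) : Euc n →L[ℝ] E).comp
        (frame I x₀ (ich I x₀ y))) (range I) y := by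
  set x := ich I x₀ y with hx
  have hd : y ∈ transDom I x₀ x := ⟨hy, mem_chart_source _ _⟩
  have h1 : HasFDerivWithinAt (f ∘ ich I x) (mfderiv I 𝓘(ℝ, E) f x : Euc n →L[ℝ] E)
      (range I) (chartTrans I x₀ x y) :=
    hf.hasMFDerivAt.2
  have h2 := h1.comp_of_tendsto y (hasFDerivWithinAt_chartTrans_frame hy)
    (tendsto_nhdsWithin_iff.2 ⟨(smoothAt_chartTrans hd).continuousWithinAt,
      eventually_of_mem (transDom_mem_nhds hd) fun z hz =>
        extChartAt_target_subset_range x (chartTrans_mem hz)⟩)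
  refine h2.congr_of_eventuallyEq ?_ ?_
  · exact eventually_of_mem (transDom_mem_nhds hd) fun z hz => by
      simp only [Function.comp_apply, chartTrans_symm hz]
  · simp only [Function.comp_apply, chartTrans_symm hd]

lemma fderivWithin_comp_symm {E : Type*} [NormedAddCommGroup E] [NormedSpace ℝ E]
    {f : M → E} {x₀ : M} (hy : y ∈ (ch I x₀).target)
    (hf : MDifferentiableAt I 𝓘(ℝ, E) f (ich I x₀ y)) :
    fderivWithin ℝ (fun z => f (ich I x₀ z)) (range I) y =
      (mfderiv I 𝓘(ℝ, E) f (ich I x₀ y) : Euc n →L[ℝ] E).comp (frame I x₀ (ich I x₀ y)) :=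
  HasFDerivWithinAt.fderivWithin (F := E) (hasFDerivWithinAt_comp_symm hy hf)
    (I.uniqueDiffOn y (extChartAt_target_subset_range x₀ hy))

/-- The derivative of a map in arbitrary charts of the source and of the target. -/
lemma hasFDerivWithinAt_in_charts {f : M → P} {x₀ : M} {p₀ : P} (hy : y ∈ (ch I x₀).target)
    (hf : MDifferentiableAt I IP f (ich I x₀ y))
    (hp : f (ich I x₀ y) ∈ (chartAt HP p₀).source) :
    HasFDerivWithinAt (fun z => ch IP p₀ (f (ich I x₀ z))) ((coframe IP p₀ (f (ich I x₀ y))).comp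
        ((mfderiv I IP f (ich I x₀ y) : Euc n →L[ℝ] Euc m).comp
        (frame I x₀ (ich I x₀ y)))) (range I) y := by
  set x := ich I x₀ y with hx
  have hd : y ∈ transDom I x₀ x := ⟨hy, mem_chart_source _ _⟩
  have h1 : HasFDerivWithinAt (ch IP (f x) ∘ f ∘ ich I x)
      (mfderiv I IP f x : Euc n →L[ℝ] Euc m) (range I) (chartTrans I x₀ x y) :=
    hf.hasMFDerivAt.2
  have htend := (tendsto_nhdsWithin_iff.2 ⟨(smoothAt_chartTrans hd).continuousWithinAt,
      eventually_of_mem (transDom_mem_nhds hd) fun z hz =>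
        extChartAt_target_subset_range x (chartTrans_mem hz)⟩ :
        Tendsto (chartTrans I x₀ x) (𝓝[range I] y) (𝓝[range I] (chartTrans I x₀ x y)))
  have h2 := h1.comp_of_tendsto y (hasFDerivWithinAt_chartTrans_frame hy) htend
  have e2 : (ch IP (f x) ∘ f ∘ ich I x) (chartTrans I x₀ x y) = ch IP (f x) (f x) := by
    simp only [Function.comp_apply, chartTrans_symm hd]
    rfl
  have hdP : ch IP (f x) (f x) ∈ transDom IP (f x) p₀ := ⟨mem_extChartAt_target (f x), by
      rw [mem_preimage, extChartAt_to_inv]; exact hp⟩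
  have h3 : HasFDerivWithinAt (chartTrans IP (f x) p₀) (coframe IP p₀ (f x)) (range IP)
      ((ch IP (f x) ∘ f ∘ ich I x) (chartTrans I x₀ x y)) := by
    rw [e2]
    have := ((smoothAt_chartTrans hdP).differentiableWithinAt (by simp)).hasFDerivWithinAt
    rwa [← tangentCoordChange_eq_fderivWithin hdP, extChartAt_to_inv] at this
  have h4 := h3.comp_of_tendsto y h2 (tendsto_nhdsWithin_iff.2 ⟨h2.continuousWithinAt,
    Eventually.of_forall fun z => by
      simp only [Function.comp_apply]
      rw [extChartAt_coe]
      exact mem_range_self _⟩)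
  refine h4.congr_of_eventuallyEq ?_ ?_
  · have hc : ContinuousWithinAt (fun z => f (ich I x₀ z)) (range I) y := by
      have := (continuousOn_extChartAt_symm (I := I) x₀ y hy)
      refine (ContinuousAt.comp_continuousWithinAt (g := f) (f := ich I x₀)
        hf.continuousAt this).mono_of_mem_nhdsWithin ?_
      exact extChartAt_target_mem_nhdsWithin_of_mem hy
    have hs := hc.preimage_mem_nhdsWithin
      ((chartAt HP (f x)).open_source.mem_nhds (mem_chart_source HP (f x)))
    filter_upwards [transDom_mem_nhds hd, hs] with z hz hz'
    simp only [Function.comp_apply, chartTrans_symm hz]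
    rw [chartTrans, Function.comp_apply, (ch IP (f x)).left_inv (by simpa using hz')]
  · simp only [Function.comp_apply, chartTrans_symm hd]
    rw [chartTrans, Function.comp_apply, extChartAt_to_inv]

lemma mem_source_of_mem_preimage {x₀ x : M} {U : Set M} (hU : U ⊆ (chartAt H x₀).source)
    (hx : x ∈ U) : ch I x₀ x ∈ dom I x₀ U :=
  ⟨(ch I x₀).map_source (by simpa using hU hx), by
    rwa [mem_preimage, (ch I x₀).left_inv (by simpa using hU hx)]⟩

lemma smooth_comp_symm {E : Type*} [NormedAddCommGroup E] [NormedSpace ℝ E] {f : M → E}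
    {U : Set M} (hf : ContMDiffOn I 𝓘(ℝ, E) ∞ f U) (x₀ : M) :
    SmoothOn (fun z => f (ich I x₀ z)) (dom I x₀ U) := by
  rw [← contMDiffOn_iff_contDiffOn]
  exact hf.comp ((contMDiffOn_extChartAt_symm x₀).mono inter_subset_left) inter_subset_right

/-- The differential of a function in a chart. -/
lemma locForm_dFun {φ : M → ℝ} {x₀ : M} (hy : y ∈ (ch I x₀).target)
    (hφ : MDifferentiableAt I 𝓘(ℝ, ℝ) φ (ich I x₀ y)) :
    locForm x₀ (dFun (I := I) φ) y = dForm (range I) (fun z => φ (ich I x₀ z)) y := by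
  unfold dForm
  rw [fderivWithin_comp_symm hy hφ]
  exact ContinuousAlternatingMap.ext fun w => (ofLin_apply (V := ℝ)
    (mfderiv I 𝓘(ℝ, ℝ) φ (ich I x₀ y) : Euc n →L[ℝ] ℝ)
    fun i => (frame I x₀ (ich I x₀ y) : Lin n) (w i)).trans
      (ofLin_apply (V := ℝ) ((mfderiv I 𝓘(ℝ, ℝ) φ (ich I x₀ y) : Euc n →L[ℝ] ℝ).comp
        (frame I x₀ (ich I x₀ y))) w).symm

end MapsInCharts

/-! ### The scalar curvature in a chart -/

section InteriorCoordinates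

open Set Filter Topology

variable {n : ℕ} {y : Euc n}

lemma pd_eq_univ {s : Set (Euc n)} (hy : y ∈ interior s) (f : Euc n → ℝ) (i : Fin n) :
    pd s f i y = pd univ f i y := by
  rw [pd, pd, fderivWithin_univ, fderivWithin_of_mem_nhds (mem_interior_iff_mem_nhds.1 hy)]

lemma christoffel_eq_univ {s : Set (Euc n)} (hy : y ∈ interior s)
    (γ : Euc n → Bil n) (l i j : Fin n) :
    christoffel s γ l i j y = christoffel univ γ l i j y := by
  simp only [christoffel, pd_eq_univ hy]

lemma pd_christoffel_eq_univ {s : Set (Euc n)} (hy : y ∈ interior s)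
    (γ : Euc n → Bil n) (l i j r : Fin n) :
    pd s (christoffel s γ l i j) r y = pd univ (christoffel univ γ l i j) r y := by
  rw [pd_eq_univ hy, pd, pd, fderivWithin_univ, fderivWithin_univ]
  have : christoffel s γ l i j =ᶠ[𝓝 y] christoffel univ γ l i j :=
    eventually_of_mem (isOpen_interior.mem_nhds hy) fun z hz => christoffel_eq_univ hz γ l i j
  rw [this.fderiv_eq]

lemma ricciCoord_eq_univ {s : Set (Euc n)} (hy : y ∈ interior s) (γ : Euc n → Bil n) (i j : Fin n) :
    ricciCoord s γ i j y = ricciCoord univ γ i j y := by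
  simp only [ricciCoord, pd_christoffel_eq_univ hy, christoffel_eq_univ hy]

lemma scalarLoc_eq_univ {s : Set (Euc n)} (hy : y ∈ interior s)
    (γ : Euc n → Bil n) : scalarLoc s γ y = scalarLoc univ γ y := by
  simp only [scalarLoc, ricciCoord_eq_univ hy]

lemma dForm_eq_univ {s : Set (Euc n)} (hy : y ∈ interior s) (φ : Euc n → ℝ) :
    dForm s φ y = dForm univ φ y := by
  rw [dForm, dForm, fderivWithin_univ, fderivWithin_of_mem_nhds (mem_interior_iff_mem_nhds.1 hy)]

lemma fderivWithin_dForm_eq_univ {s : Set (Euc n)} (hy : y ∈ interior s) (φ : Euc n → ℝ) :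
    fderivWithin ℝ (dForm s φ) s y = fderivWithin ℝ (dForm univ φ) univ y := by
  have : dForm s φ =ᶠ[𝓝 y] dForm univ φ :=
    eventually_of_mem (isOpen_interior.mem_nhds hy) fun z hz => dForm_eq_univ hz φ
  rw [fderivWithin_univ, fderivWithin_of_mem_nhds (mem_interior_iff_mem_nhds.1 hy), this.fderiv_eq]

lemma ricciForm_ee (s : Set (Euc n)) (γ : Euc n → Bil n) (y : Euc n)
    (i j : Fin n) : ricciForm s γ y (ee i) (ee j) = ricciCoord s γ i j y := by
  simp [ricciForm]

variable {H : Type*} [TopologicalSpace H] {I : ModelWithCorners ℝ (Euc n) H}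
  {M : Type*} [TopologicalSpace M] [ChartedSpace H M] [IsManifold I ∞ M]

lemma scalarCurv_eq_scalarLoc (g : Bilin I M) (x : M) :
    scalarCurv g x = scalarLoc (range I) (locBilin x g) (ch I x x) := by
  unfold scalarCurv scalarLoc ricci
  rw [locBilin_self]
  simp only [ricciForm_ee]

lemma mem_interior_range {x z : M} (hx : x ∈ I.interior M) (hz : x ∈ (chartAt H z).source) :
    ch I z x ∈ interior (ch I z).target :=
  (ModelWithCorners.isInteriorPoint_iff_of_mem_atlas (n := ∞) (by simp) (chart_mem_atlas H z)
    hz).1 hx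

/-- The coordinates of the interior points in an open subset of the domain of a chart. -/
def coordDom (I : ModelWithCorners ℝ (Euc n) H) (z : M) (U : Set M) : Set (Euc n) :=
  interior (ch I z).target ∩ ich I z ⁻¹' U

lemma isOpen_coordDom (z : M) {U : Set M} (hU : IsOpen U) : IsOpen (coordDom I z U) :=
  ((continuousOn_extChartAt_symm (I := I) z).mono interior_subset).isOpen_inter_preimage
    isOpen_interior hU

lemma coordDom_subset (z : M) (U : Set M) : coordDom I z U ⊆ dom I z U :=
  inter_subset_inter_left _ interior_subset

lemma mem_coordDom {x z : M} {U : Set M} (hx : x ∈ I.interior M) (hxU : x ∈ U)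
    (hz : x ∈ (chartAt H z).source) : ch I z x ∈ coordDom I z U :=
  ⟨mem_interior_range hx hz, by rwa [mem_preimage, (ch I z).left_inv (by simpa using hz)]⟩

lemma symm_mem_interior {z : M} {U : Set M} (hy : y ∈ coordDom I z U) :
    ich I z y ∈ I.interior M := by
  refine (ModelWithCorners.isInteriorPoint_iff_of_mem_atlas (n := ∞) (by simp) (chart_mem_atlas H z)
    (symm_mem_source (interior_subset hy.1))).2 ?_
  have := (ch I z).right_inv (interior_subset hy.1)
  change ch I z _ ∈ interior (ch I z).target
  rw [this]
  exact hy.1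

lemma coordDom_interior (z : M) (U : Set M) : coordDom I z U ⊆ interior (range I) := fun _ hy =>
  interior_mono (extChartAt_target_subset_range z) hy.1

lemma isLocMetric_locBilin {g : Bilin I M} {z : M} {U : Set M} (hU : IsOpen U)
    (hs : SmoothBilin g) (hsym : SymmBilin g)
    (hd : ∀ x ∈ U ∩ I.interior M, (gram (g x : Bil n)).det ≠ 0) :
    IsLocMetric (coordDom I z U) (locBilin z g) where
  isOpen := isOpen_coordDom z hU
  smooth := (hs z).mono fun _ hy => interior_subset hy.1
  symm := fun _ _ _ => hsym _ _ _
  det_ne := fun y hy => (det_gram_pullBilin (g (ich I z y)) (frame I z (ich I z y))).trans_ne <|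
      mul_ne_zero (pow_ne_zero 2 (mat_frame_det_ne_zero
      (symm_mem_source (interior_subset hy.1)))) (hd _ ⟨hy.2, symm_mem_interior hy⟩)

/-- The scalar curvature may be computed in any chart. -/
lemma scalarCurv_eq_scalarLoc_univ {g : Bilin I M} {z : M} {U : Set M} (hU : IsOpen U)
    (hs : SmoothBilin g) (hsym : SymmBilin g)
    (hd : ∀ x ∈ U ∩ I.interior M, (gram (g x : Bil n)).det ≠ 0)
    (hy : y ∈ coordDom I z U) :
    scalarCurv g (ich I z y) = scalarLoc univ (locBilin z g) y := by
  set x := ich I z y with hx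
  have hyt := interior_subset hy.1
  set W := U ∩ ((chartAt H x).source ∩ (chartAt H z).source) with hW
  have hWo : IsOpen W := hU.inter ((chartAt H x).open_source.inter (chartAt H z).open_source)
  have hWd : ∀ x ∈ W ∩ I.interior M, (gram (g x : Bil n)).det ≠ 0 := fun x hx => hd x ⟨hx.1.1, hx.2⟩
  have hxI : x ∈ I.interior M := symm_mem_interior hy
  have hxW : x ∈ W := ⟨hy.2, mem_chart_source H x, symm_mem_source hyt⟩
  have h1 := isLocMetric_locBilin (z := x) hWo hs hsym hWd
  have h2 := isLocMetric_locBilin (z := z) hWo hs hsym hWd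
  have hyW : y ∈ coordDom I z W := ⟨hy.1, hxW⟩
  have hsub : coordDom I z W ⊆ transDom I z x := fun w hw => ⟨interior_subset hw.1, hw.2.2.1⟩
  have e : ch I x x = chartTrans I z x y := rfl
  rw [scalarCurv_eq_scalarLoc, scalarLoc_eq_univ (interior_mono
    (extChartAt_target_subset_range x) (mem_interior_range hxI (mem_chart_source H x))), e]
  refine (h1.scalarLoc_pullback h2 ((smooth_chartTrans z x).mono hsub) ?_ ?_ hyW).symm
  · intro w hw
    have hwt := hsub hw
    have := mem_coordDom (z := x) (symm_mem_interior hw) hw.2 hw.2.2.1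
    exact this
  · intro w hw
    rw [locBilin_eq_pullBilin g (hsub hw), fderivWithin_of_mem_nhds
      (mem_interior_iff_mem_nhds.1 (coordDom_interior z W hw))]

end InteriorCoordinates

/-! ### The adjoint representation -/

section Adjoint

open Set Filter Topology VectorField

variable {d : ℕ} {G : Type*} [TopologicalSpace G] [ChartedSpace (Euc d) G] [Group G]
  [LieGroup IE d ∞ G]

/-- Conjugation by `a`. -/
def conj (a b : G) : G := a * b * a⁻¹

lemma conj_one (a : G) : conj a (1 : G) = 1 := by simp [conj]

lemma contMDiff_conj (a : G) : ContMDiff IE d IE d ∞ (conj a) :=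
  (contMDiff_const.mul contMDiff_id).mul contMDiff_const

lemma mdiff_conj (a b : G) : MDifferentiableAt IE d IE d (conj a) b :=
  (contMDiff_conj a).mdifferentiableAt (by simp)

lemma mfderiv_conj_of_eq_one (a : G) {c : G} (hc : c = 1) :
    (mfderiv IE d IE d (conj a) c : Lin d) = Ad a := by
  subst hc; rfl

lemma Ad_one : Ad (1 : G) = ContinuousLinearMap.id ℝ (Euc d) := by
  have : (fun b : G => 1 * b * 1⁻¹) = id := by funext b; simp
  unfold Ad
  rw [this]
  exact mfderiv_id

lemma Ad_mul (a b : G) : (Ad (a * b) : Lin d) = (Ad a).comp (Ad b) := by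
  have h1 : (fun c : G => a * b * c * (a * b)⁻¹) = conj a ∘ conj b := by
    funext c; simp [conj, mul_assoc]
  have h2 := mfderiv_comp (1 : G) (mdiff_conj (d := d) a (conj b 1)) (mdiff_conj (d := d) b 1)
  have h3 : (mfderiv IE d IE d (conj a) (conj b 1) : Lin d) = Ad a :=
    mfderiv_conj_of_eq_one a (conj_one b)
  unfold Ad
  rw [h1]
  refine h2.trans ?_
  exact congrArg (fun f : Lin d => f.comp (Ad b)) h3

lemma Ad_inv_apply (a : G) (v : Euc d) : Ad a⁻¹ (Ad a v) = v := by
  rw [← ContinuousLinearMap.comp_apply, ← Ad_mul, inv_mul_cancel, Ad_one]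
  rfl

lemma Ad_apply_inv (a : G) (v : Euc d) : Ad a (Ad a⁻¹ v) = v := by
  rw [← ContinuousLinearMap.comp_apply, ← Ad_mul, mul_inv_cancel, Ad_one]
  rfl

lemma mfderiv_conj_mulInvariantVectorField (a g : G) (v : LieAlg (d := d) G) :
    mfderiv IE d IE d (conj a) g (mulInvariantVectorField v g) =
      mulInvariantVectorField (I := IE d) (G := G) (Ad a v : Euc d) (conj a g) := by
  have hl : ∀ c b : G, MDifferentiableAt IE d IE d (fun x : G => c * x) b :=
    fun c b => (contMDiff_mul_left (n := ∞)).mdifferentiableAt (by simp)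
  have e : conj a ∘ (fun b : G => g * b) = (fun b : G => conj a g * b) ∘ conj a := by
    funext b; simp [conj, mul_assoc]
  have h1 := mfderiv_comp (I' := IE d) (1 : G) (mdiff_conj a (g * 1)) (hl g 1)
  have h2 := mfderiv_comp (I' := IE d) (1 : G) (hl (conj a g) (conj a 1)) (mdiff_conj a 1)
  rw [e, h2] at h1
  have h3 := DFunLike.congr_fun h1 v
  have e1 : ∀ c : G, c = 1 → ∀ w : Euc d,
      (mfderiv IE d IE d (fun x : G => conj a g * x) c : Lin d) w =
      (mfderiv IE d IE d (fun x : G => conj a g * x) 1 : Lin d) w := by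
    rintro c rfl w; rfl
  have e2 : ∀ c : G, c = g → ∀ w : Euc d, (mfderiv IE d IE d (conj a) c : Lin d) w =
      (mfderiv IE d IE d (conj a) g : Lin d) w := by
    rintro c rfl w; rfl
  exact ((e2 _ (mul_one g) _).symm.trans h3.symm).trans (e1 _ (conj_one a) _)

/-- Conjugation preserves left invariant vector fields. -/
lemma mpullback_conj (a : G) (v : LieAlg (d := d) G) : mpullback IE d IE d (conj a)
      (mulInvariantVectorField (I := IE d) (G := G) (Ad a v : Euc d)) =
      mulInvariantVectorField v := by
  funext g
  rw [mpullback_apply, ← mfderiv_conj_mulInvariantVectorField]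
  have e1 : conj a⁻¹ ∘ conj a = (id : G → G) := by funext b; simp [conj, mul_assoc]
  have e2 : conj a ∘ conj a⁻¹ = (id : G → G) := by funext b; simp [conj, mul_assoc]
  have h1 := mfderiv_comp (I' := IE d) g (mdiff_conj a⁻¹ (conj a g)) (mdiff_conj a g)
  have hg : conj a⁻¹ (conj a g) = g := congrFun e1 g
  have h2 := mfderiv_comp (I' := IE d) (conj a g)
    (mdiff_conj a (conj a⁻¹ (conj a g))) (mdiff_conj a⁻¹ (conj a g))
  rw [e1, mfderiv_id] at h1
  rw [e2, mfderiv_id] at h2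
  have h2' : ContinuousLinearMap.id ℝ (Euc d) = (mfderiv IE d IE d (conj a) g : Lin d).comp
        (mfderiv IE d IE d (conj a⁻¹) (conj a g)) := by
    refine h2.trans ?_
    have : ∀ c : G, c = g → (mfderiv IE d IE d (conj a) c : Lin d) =
        mfderiv IE d IE d (conj a) g := by rintro c rfl; rfl
    exact congrArg (fun f : Lin d => f.comp
      (mfderiv IE d IE d (conj a⁻¹) (conj a g) : Lin d)) (this _ hg)
  have h3 := ContinuousLinearMap.inverse_eq (M := Euc d) (M₂ := Euc d) h2'.symm h1.symm
  exact (congrArg (fun f : Lin d => f ((mfderiv IE d IE d (conj a) g : Lin d)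
      (mulInvariantVectorField v g))) h3).trans
    (congrArg (fun f : Lin d => f (mulInvariantVectorField v g)) h1).symm

lemma Ad_lieBr (a : G) (x y : Euc d) : Ad a (lieBr G x y) = lieBr G (Ad a x) (Ad a y) := by
  have h := mpullback_mlieBracket (I := IE d) (I' := IE d) (n := ∞) (f := conj a) (x₀ := (1 : G))
    (V := mulInvariantVectorField (I := IE d) (G := G) (Ad a x : Euc d))
    (W := mulInvariantVectorField (I := IE d) (G := G) (Ad a y : Euc d))
    (mdifferentiableAt_mulInvariantVectorField _) (mdifferentiableAt_mulInvariantVectorField _)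
    (contMDiff_conj a).contMDiffAt
    (by rw [minSmoothness_of_isRCLikeNormedField]; exact ENat.LEInfty.out)
  have h0 := h.trans (congrArg₂ (fun V W => mlieBracket IE d V W (1 : G))
    (mpullback_conj a x) (mpullback_conj a y))
  have e : ∀ c : G, c = 1 → (mlieBracket IE d
      (mulInvariantVectorField (I := IE d) (G := G) (Ad a x : Euc d))
      (mulInvariantVectorField (I := IE d) (G := G) (Ad a y : Euc d)) c : Euc d) =
      lieBr G (Ad a x) (Ad a y) := by
    rintro c rfl; rfl
  have hinv : (mfderiv IE d IE d (conj a) (1 : G)).inverse = (Ad a⁻¹ : Lin d) := by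
    refine ContinuousLinearMap.inverse_eq (M := Euc d) (M₂ := Euc d) ?_ ?_
    · rw [mfderiv_conj_of_eq_one a rfl]
      exact (Ad_mul a a⁻¹).symm.trans ((congrArg Ad (mul_inv_cancel a)).trans Ad_one)
    · rw [mfderiv_conj_of_eq_one a rfl]
      exact (Ad_mul a⁻¹ a).symm.trans ((congrArg Ad (inv_mul_cancel a)).trans Ad_one)
  have h' : Ad a⁻¹ (lieBr G (Ad a x) (Ad a y)) = lieBr G x y := by
    rw [← e _ (conj_one a)]
    exact (DFunLike.congr_fun hinv _).symm.trans h0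
  rw [← h', Ad_apply_inv]

variable (d) in
/-- The adjoint action as an automorphism of the Lie algebra. -/
def AdEquiv (a : G) : LieAlg (d := d) G ≃ₗ⁅ℝ⁆ LieAlg (d := d) G where
  toFun v := Ad a (v : Euc d)
  map_add' u v := map_add (Ad a) (u : Euc d) (v : Euc d)
  map_smul' c u := map_smul (Ad a) c (u : Euc d)
  map_lie' {x y} := Ad_lieBr a x y
  invFun v := Ad a⁻¹ (v : Euc d)
  left_inv v := Ad_inv_apply a v
  right_inv v := Ad_apply_inv a v

lemma killing_Ad (a : G) (x y : Euc d) : killing G (Ad a x) (Ad a y) = killing G x y :=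
  LieAlgebra.killingForm_of_equiv_apply (AdEquiv d a) (toLie G x) (toLie G y)

lemma killing_comm (x y : Euc d) : killing G x y = killing G y x :=
  LieModule.traceForm_comm ℝ (LieAlg (d := d) G) (LieAlg (d := d) G) (toLie G x) (toLie G y)

lemma killing_lieBr (x y z : Euc d) : killing G (lieBr G x y) z = killing G x (lieBr G y z) :=
  LieModule.traceForm_apply_lie_apply ℝ (LieAlg (d := d) G) (LieAlg (d := d) G) (toLie G x)
    (toLie G y) (toLie G z)

lemma lieBr_skew (x y : Euc d) : lieBr G x y = -lieBr G y x :=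
  (lie_skew (toLie G x) (toLie G y)).symm

lemma killing_nondegenerate [LieAlgebra.IsSemisimple ℝ (LieAlg (d := d) G)] {x : Euc d}
    (h : ∀ y, killing G x y = 0) : x = 0 := by
  have : FiniteDimensional ℝ (LieAlg (d := d) G) := inferInstanceAs (FiniteDimensional ℝ (Euc d))
  have h1 := LieAlgebra.IsKilling.killingForm_nondegenerate ℝ (LieAlg (d := d) G)
  exact h1.1 (toLie G x) fun y => h ((toLie G).symm y)

lemma killingCLM_apply (x y : Euc d) : killing G x y = killingCLM G x y := rfl

/-- The adjoint representation is smooth. -/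
lemma contMDiff_Ad : ContMDiff IE d 𝓘(ℝ, Lin d) ∞ (Ad : G → Lin d) := by
  intro a₀
  have hf : ContMDiffAt ((IE d).prod IE d) IE d ∞ (uncurry fun a b : G => conj a b) (a₀, 1) :=
    ((contMDiff_fst.mul contMDiff_snd).mul contMDiff_fst.inv).contMDiffAt
  have h := ContMDiffAt.mfderiv (m := ∞) (fun a b : G => conj a b) (fun _ : G => (1 : G)) hf
    contMDiffAt_const (by simp)
  refine h.congr_of_eventuallyEq (Eventually.of_forall fun a => ?_)
  have hs : conj a (1 : G) ∈ (chartAt (Euc d) (conj a₀ (1 : G))).source := by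
    rw [conj_one, conj_one]; exact mem_chart_source _ _
  refine Eq.symm ((inTangentCoordinates_eq (fun _ : G => (1 : G)) (fun x : G => conj x 1) _
    (mem_chart_source _ _) hs).trans ?_)
  refine ContinuousLinearMap.ext fun v => ?_
  have e1 : tangentCoordChange IE d (1 : G) 1 1 (v : Euc d) = v := tangentCoordChange_self (by simp)
  have e2 : ∀ b c : G, b = 1 → c = 1 → ∀ w : Euc d, tangentCoordChange IE d b c b w = w := by
    rintro b c rfl rfl w; exact tangentCoordChange_self (by simp)
  refine (e2 _ _ (conj_one a) (conj_one a₀) _).trans ?_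
  exact congrArg (Ad a) e1

/-- The derivative at `1` of the representation `a ↦ Ad_{a⁻¹}`, up to sign: the adjoint
representation of the Lie algebra. -/
def adRep (G : Type*) [TopologicalSpace G] [ChartedSpace (Euc d) G] [Group G] : Euc d →L[ℝ] Lin d :=
  -(mfderiv IE d 𝓘(ℝ, Lin d) (fun a : G => (Ad a⁻¹ : Lin d)) 1 : Euc d →L[ℝ] Lin d)

lemma mdifferentiableAt_Ad_inv (a : G) : MDifferentiableAt IE d 𝓘(ℝ, Lin d)
    (fun a : G => (Ad a⁻¹ : Lin d)) a :=
  (contMDiff_Ad.comp (contMDiff_inv IE d ∞)).mdifferentiableAt (by simp)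

lemma hasMFDerivAt_Ad_inv : HasMFDerivAt IE d 𝓘(ℝ, Lin d)
    (fun a : G => (Ad a⁻¹ : Lin d)) 1 (-adRep G : Euc d →L[ℝ] Lin d) := by
  have := (mdifferentiableAt_Ad_inv (d := d) (1 : G)).hasMFDerivAt
  refine this.congr_mfderiv (Eq.symm ?_)
  exact neg_neg (G := Euc d →L[ℝ] Lin d) _

lemma hasFDerivAt_Ad_inv : HasFDerivAt
    (fun t : Euc d => (Ad ((extChartAt IE d (1 : G)).symm t)⁻¹ : Lin d))
    (-adRep G : Euc d →L[ℝ] Lin d) (extChartAt IE d (1 : G) 1) := by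
  have h : HasFDerivWithinAt (fun t : Euc d => (Ad ((extChartAt IE d (1 : G)).symm t)⁻¹ : Lin d))
    (-adRep G : Euc d →L[ℝ] Lin d) (range IE d)
    (extChartAt IE d (1 : G) 1) := (hasMFDerivAt_Ad_inv (G := G) (d := d)).2
  rw [ModelWithCorners.range_eq_univ, hasFDerivWithinAt_univ] at h
  exact h

/-- The Killing form is invariant under the adjoint representation. -/
lemma killing_adRep (ξ x y : Euc d) :
    killing G (adRep G ξ x) y + killing G x (adRep G ξ y) = 0 := by
  have h := hasFDerivAt_Ad_inv (G := G) (d := d)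
  have hx := h.clm_apply (hasFDerivAt_const x _)
  have hy := h.clm_apply (hasFDerivAt_const y _)
  have hk := (killingCLM G).isBoundedBilinearMap.hasFDerivAt (Ad ((extChartAt IE d (1 : G)).symm
    (extChartAt IE d (1 : G) 1))⁻¹ x, Ad ((extChartAt IE d (1 : G)).symm
    (extChartAt IE d (1 : G) 1))⁻¹ y)
  have h2 := hk.comp (extChartAt IE d (1 : G) 1) (hx.prodMk hy)
  have h3 : HasFDerivAt (fun _ : Euc d => killingCLM G x y) (0 : Euc d →L[ℝ] ℝ)
      (extChartAt IE d (1 : G) 1) := hasFDerivAt_const _ _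
  have h4 := DFunLike.congr_fun (h2.unique (h3.congr_of_eventuallyEq
    (Eventually.of_forall fun t => killing_Ad _ x y))) ξ
  rw [extChartAt_to_inv, inv_one, Ad_one] at h4
  simp [IsBoundedBilinearMap.deriv] at h4
  have h5 : -(killing G x (adRep G ξ y)) - killing G (adRep G ξ x) y = 0 := by
    simpa [killingCLM_apply, sub_eq_add_neg] using h4
  linarith

end Adjoint

/-! ### Smooth families of alternating forms -/

section SmoothForms

variable {E F V W : Type*} [NormedAddCommGroup E] [NormedSpace ℝ E] [NormedAddCommGroup F]
  [NormedSpace ℝ F] [NormedAddCommGroup V] [NormedSpace ℝ V] [NormedAddCommGroup W]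
  [NormedSpace ℝ W] {k : ℕ}

variable (E V k) in
/-- Antisymmetrization of multilinear maps as a continuous linear map. -/
def alternatizationCLM :
    ContinuousMultilinearMap ℝ (fun _ : Fin k => E) V →L[ℝ] E [⋀^Fin k]→L[ℝ] V :=
  LinearMap.mkContinuous
    { toFun := fun f => ContinuousMultilinearMap.alternatization f
      map_add' := fun f g => map_add _ f g
      map_smul' := fun c f => by
        ext v
        simp [ContinuousMultilinearMap.alternatization_apply_apply, smul_sum, smul_comm c] }
    (k.factorial : ℝ) fun f => by
      refine ContinuousAlternatingMap.opNorm_le_bound _ (by positivity) fun v => ?_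
      change ‖ContinuousMultilinearMap.alternatization f v‖ ≤ _
      rw [ContinuousMultilinearMap.alternatization_apply_apply]
      refine (norm_sum_le _ _).trans ?_
      have : ∀ σ : Equiv.Perm (Fin k), ‖Equiv.Perm.sign σ • f (v ∘ σ)‖ ≤ ‖f‖ * ∏ i, ‖v i‖ := by
        intro σ
        have h1 : ‖Equiv.Perm.sign σ • f (v ∘ σ)‖ = ‖f (v ∘ σ)‖ := by
          rcases Int.units_eq_one_or (Equiv.Perm.sign σ) with h | h <;> simp [h]
        rw [h1]
        refine (f.le_opNorm _).trans_eq ?_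
        congr 1
        exact Equiv.prod_comp σ fun i => ‖v i‖
      refine (Finset.sum_le_sum fun σ _ => this σ).trans_eq ?_
      simp [Fintype.card_perm, mul_assoc]

lemma alternatizationCLM_toContinuousMultilinearMap (α : E [⋀^Fin k]→L[ℝ] V) :
    alternatizationCLM E V k α.toContinuousMultilinearMap = (k.factorial : ℝ) • α := by
  ext v
  change ContinuousMultilinearMap.alternatization α.toContinuousMultilinearMap v = _
  rw [ContinuousMultilinearMap.alternatization_apply_apply]
  have : ∀ σ : Equiv.Perm (Fin k), Equiv.Perm.sign σ • α (v ∘ σ) = α v := by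
    intro σ
    have h : α (v ∘ σ) = Equiv.Perm.sign σ • α v := α.toAlternatingMap.map_perm v σ
    rw [h, smul_smul, Int.units_mul_self, one_smul]
  simp only [ContinuousAlternatingMap.coe_toContinuousMultilinearMap, this]
  simp [Fintype.card_perm, ← Nat.cast_smul_eq_nsmul ℝ]

lemma ContDiffWithinAt.form_comp {X : Type*} [NormedAddCommGroup X] [NormedSpace ℝ X]
    {r : WithTop ℕ∞} {α : X → F [⋀^Fin k]→L[ℝ] V} {f : X → E →L[ℝ] F} {s : Set X} {x : X}
    (hα : ContDiffWithinAt ℝ r α s x) (hf : ContDiffWithinAt ℝ r f s x) :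
    ContDiffWithinAt ℝ r (fun y => (α y).compContinuousLinearMap (f y)) s x := by
  have h1 : ContDiffWithinAt ℝ r (fun y =>
      ContinuousMultilinearMap.compContinuousLinearMapContinuousMultilinear ℝ
        (fun _ : Fin k => E) (fun _ => F) V (fun _ => f y)) s x :=
    (ContinuousMultilinearMap.contDiff _).contDiffAt.comp_contDiffWithinAt x
      (contDiffWithinAt_pi.2 fun _ => hf)
  have h2 : ContDiffWithinAt ℝ r (fun y => (α y).toContinuousMultilinearMap) s x :=
    (ContinuousAlternatingMap.toContinuousMultilinearMapCLM (R := ℝ) (𝕜 := ℝ) (E := F) (F := V)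
      (ι := Fin k)).contDiff.contDiffAt.comp_contDiffWithinAt x hα
  have h3 := ((alternatizationCLM E V k).contDiff.contDiffAt.comp_contDiffWithinAt x
    (h1.clm_apply h2)).const_smul ((k.factorial : ℝ)⁻¹)
  refine h3.congr_of_eventuallyEq (Filter.Eventually.of_forall fun y => ?_) ?_ <;>
  · have e := alternatizationCLM_toContinuousMultilinearMap
      ((α ‹X›).compContinuousLinearMap (f ‹X›))
    have h0 : (k.factorial : ℝ) ≠ 0 := Nat.cast_ne_zero.2 k.factorial_ne_zero
    have h := congrArg (fun β => (k.factorial : ℝ)⁻¹ • β) e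
    simp only [smul_smul, inv_mul_cancel₀ h0, one_smul] at h
    exact h.symm

end SmoothForms

section Wedge

variable {n k : ℕ} {V W U X : Type*} [NormedAddCommGroup V] [NormedSpace ℝ V]
  [NormedAddCommGroup W] [NormedSpace ℝ W] [NormedAddCommGroup U] [NormedSpace ℝ U]
  [NormedAddCommGroup X] [NormedSpace ℝ X] (κ : V →L[ℝ] W →L[ℝ] U)

lemma oneTensor_apply (α : Alt n 1 V) (β : Alt n k W) (u : Euc n)
    (w : Fin k → Euc n) : oneTensor κ α β u w = κ (α ![u]) (β w) := by
  rw [← toLin_apply]; rfl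

lemma wedge_apply (α : Alt n 1 V) (β : Alt n k W) (w : Fin (k + 1) → Euc n) :
    wedge κ α β w = ∑ a : Fin (k + 1), (-1 : ℤ) ^ (a : ℕ) • κ (α ![w a]) (β (a.removeNth w)) := by
  unfold wedge
  rw [alternatizeUncurryFin_apply]
  simp only [oneTensor_apply]

lemma wedge_comp (α : Alt n 1 V) (β : Alt n k W) (f : Lin n) :
    (wedge κ α β).compContinuousLinearMap f =
      wedge κ (α.compContinuousLinearMap f) (β.compContinuousLinearMap f) := by
  ext w
  rw [ContinuousAlternatingMap.compContinuousLinearMap_apply, wedge_apply, wedge_apply]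
  refine sum_ext fun a => ?_
  have h : (f ∘ ![w a]) = ![f (w a)] := by funext j; rw [Subsingleton.elim j 0]; rfl
  simp only [ContinuousAlternatingMap.compContinuousLinearMap_apply, h]
  rfl

variable {s : Set X}

lemma smooth_toLin {r : WithTop ℕ∞} {α : X → Alt n 1 V}
    (hα : ContDiffOn ℝ r α s) : ContDiffOn ℝ r (fun y => toLin (α y)) s := by
  refine contDiffOn_clm_apply.2 fun u => ?_
  simp only [toLin_apply]
  exact fun y hy => smoothAt_form_apply (hα y hy) _

lemma smooth_oneTensor {r : WithTop ℕ∞} {α : X → Alt n 1 V}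
    {β : X → Alt n k W} (hα : ContDiffOn ℝ r α s) (hβ : ContDiffOn ℝ r β s) :
    ContDiffOn ℝ r (fun y => oneTensor κ (α y) (β y)) s := by
  refine contDiffOn_clm_apply.2 fun u => ?_
  have h1 : ContDiffOn ℝ r (fun y => κ (toLin (α y) u)) s :=
    κ.contDiff.comp_contDiffOn ((smooth_toLin hα).clm_apply contDiffOn_const)
  have h2 : ContDiffOn ℝ r (fun y => compContinuousAlternatingMapCLM ℝ (Euc n)
      W U (Fin k) (κ (toLin (α y) u))) s :=
    (ContinuousLinearMap.contDiff _).comp_contDiffOn h1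
  exact h2.clm_apply hβ

lemma smooth_wedge {r : WithTop ℕ∞} {α : X → Alt n 1 V}
    {β : X → Alt n k W} (hα : ContDiffOn ℝ r α s) (hβ : ContDiffOn ℝ r β s) :
    ContDiffOn ℝ r (fun y => wedge κ (α y) (β y)) s :=
  contDiff_alternatizeUncurryFin.comp_contDiffOn (smooth_oneTensor κ hα hβ)

lemma smooth_ofLin {r : WithTop ℕ∞} {α : X → Euc n →L[ℝ] V}
    (hα : ContDiffOn ℝ r α s) : ContDiffOn ℝ r (fun y => ofLin (α y)) s :=
  (ContinuousLinearMap.contDiff (ofLinCLM (n := n) (V := V))).comp_contDiffOn hα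

end Wedge

/-! ### Adjoint forms along a section -/

section Frame

variable {n : ℕ} {H M : Type*} [TopologicalSpace H] {I : ModelWithCorners ℝ (Euc n) H}
  [TopologicalSpace M] [ChartedSpace H M] [IsManifold I ∞ M]

/-- The coordinate frame as an endomorphism of the model space. -/
def fr (I : ModelWithCorners ℝ (Euc n) H) [IsManifold I ∞ M] (x₀ x : M) : Lin n := frame I x₀ x

lemma fr_self (x : M) : fr I x x = ContinuousLinearMap.id ℝ (Euc n) := frame_self x

lemma coframe_fr {x₀ x : M} (hx : x ∈ (chartAt H x₀).source) (v : Euc n) :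
    coframe I x₀ x (fr I x₀ x v) = v := coframe_frame hx v

lemma fr_coframe {x₀ x : M} (hx : x ∈ (chartAt H x₀).source) (v : Euc n) :
    fr I x₀ x (coframe I x₀ x v) = v := frame_coframe hx v

end Frame

lemma alternatizeUncurryFin_clm {E V W : Type*} [NormedAddCommGroup E] [NormedSpace ℝ E]
    [NormedAddCommGroup V] [NormedSpace ℝ V] [NormedAddCommGroup W] [NormedSpace ℝ W] {k : ℕ}
    (g : V →L[ℝ] W) (f : E →L[ℝ] E [⋀^Fin k]→L[ℝ] V) :
    alternatizeUncurryFin ((compContinuousAlternatingMapCLM ℝ E V W (Fin k) g).comp f) =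
      g.compContinuousAlternatingMap (alternatizeUncurryFin f) := by
  ext w
  rw [alternatizeUncurryFin_apply,
    ContinuousLinearMap.compContinuousAlternatingMap_coe, Function.comp_apply,
    alternatizeUncurryFin_apply, map_sum]
  refine sum_ext fun a => ?_
  rw [map_zsmul]
  rfl

/-! ### Algebra of the Chern-Simons form -/

section WedgeAlgebra

variable {n k : ℕ} {V W U : Type*} [NormedAddCommGroup V] [NormedSpace ℝ V]
  [NormedAddCommGroup W] [NormedSpace ℝ W] [NormedAddCommGroup U] [NormedSpace ℝ U]
  (κ : V →L[ℝ] W →L[ℝ] U)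

lemma removeNth_zero_two {E : Type*} (w : Fin 2 → E) : (0 : Fin 2).removeNth w = ![w 1] := by
  funext j; fin_cases j; rfl

lemma removeNth_one_two {E : Type*} (w : Fin 2 → E) : (1 : Fin 2).removeNth w = ![w 0] := by
  funext j; fin_cases j; rfl

lemma removeNth_zero_three {E : Type*} (w : Fin 3 → E) : (0 : Fin 3).removeNth w = ![w 1, w 2] := by
  funext j; fin_cases j <;> rfl

lemma removeNth_one_three {E : Type*} (w : Fin 3 → E) : (1 : Fin 3).removeNth w = ![w 0, w 2] := by
  funext j; fin_cases j <;> rfl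

lemma removeNth_two_three {E : Type*} (w : Fin 3 → E) : (2 : Fin 3).removeNth w = ![w 0, w 1] := by
  funext j; fin_cases j <;> rfl

lemma wedge_apply_two (α : Alt n 1 V) (β : Alt n 1 W) (w : Fin 2 → Euc n) :
    wedge κ α β w = κ (α ![w 0]) (β ![w 1]) - κ (α ![w 1]) (β ![w 0]) := by
  rw [wedge_apply, Fin.sum_univ_two, removeNth_zero_two, removeNth_one_two]
  simp [sub_eq_add_neg]

lemma wedge_apply_three (α : Alt n 1 V) (β : Alt n 2 W) (w : Fin 3 → Euc n) :
    wedge κ α β w = κ (α ![w 0]) (β ![w 1, w 2]) - κ (α ![w 1]) (β ![w 0, w 2])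
      + κ (α ![w 2]) (β ![w 0, w 1]) := by
  rw [wedge_apply, Fin.sum_univ_three, removeNth_zero_three, removeNth_one_three,
    removeNth_two_three]
  simp [sub_eq_add_neg]

lemma alternatize_apply_two (D : Euc n →L[ℝ] Alt n 1 V) (w : Fin 2 → Euc n) :
    alternatizeUncurryFin D w = D (w 0) ![w 1] - D (w 1) ![w 0] := by
  rw [alternatizeUncurryFin_apply, Fin.sum_univ_two, removeNth_zero_two, removeNth_one_two]
  simp [sub_eq_add_neg]

lemma wedge_add_smul_left (α α' : Alt n 1 V) (β : Alt n k W) (ε : ℝ) :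
    wedge κ (α + ε • α') β = wedge κ α β + ε • wedge κ α' β := by
  ext w
  simp only [wedge_apply, ContinuousAlternatingMap.add_apply, ContinuousAlternatingMap.smul_apply,
    map_add, map_smul, add_apply, smul_apply, smul_sum, smul_add, sum_add_distrib]
  refine congrArg₂ (· + ·) rfl (sum_ext fun i => smul_comm _ _ _)

lemma wedge_add_smul_right (α : Alt n 1 V) (β β' : Alt n k W) (ε : ℝ) :
    wedge κ α (β + ε • β') = wedge κ α β + ε • wedge κ α β' := by
  ext w
  simp only [wedge_apply, ContinuousAlternatingMap.add_apply, ContinuousAlternatingMap.smul_apply,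
    map_add, map_smul, smul_sum, smul_add, sum_add_distrib]
  refine congrArg₂ (· + ·) rfl (sum_ext fun i => smul_comm _ _ _)

/-- The Leibniz rule for `κ(η ∧ ϑ)`, for first derivatives `Dη`, `Dϑ`. -/
lemma sum_wedge_derivatives {κ : V →L[ℝ] V →L[ℝ] ℝ} (hκ : ∀ x y, κ x y = κ y x)
    (η ϑ : Alt n 1 V) (Dη Dϑ : Euc n →L[ℝ] Alt n 1 V) (w : Fin 3 → Euc n) :
    ∑ i : Fin 3, (-1 : ℝ) ^ (i : ℕ) • (wedge κ (Dη (w i)) ϑ (i.removeNth w) +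
      wedge κ η (Dϑ (w i)) (i.removeNth w)) =
    wedge κ ϑ (alternatizeUncurryFin Dη) w - wedge κ η (alternatizeUncurryFin Dϑ) w := by
  rw [Fin.sum_univ_three, removeNth_zero_three, removeNth_one_three, removeNth_two_three,
    wedge_apply_three, wedge_apply_three]
  simp only [wedge_apply_two, alternatize_apply_two, map_sub, hκ (ϑ _)]
  simp
  ring

lemma wedge_comm_of_skew {b : V →L[ℝ] V →L[ℝ] V} (hb : ∀ x y, b x y = -b y x)
    (α β : Alt n 1 V) : wedge b α β = wedge b β α := by
  ext w
  rw [wedge_apply_two, wedge_apply_two, hb (α ![w 0]), hb (α ![w 1])]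
  abel

lemma wedge_wedge_swap {κ : V →L[ℝ] V →L[ℝ] ℝ} {b : V →L[ℝ] V →L[ℝ] V}
    (hκ : ∀ x y, κ x y = κ y x) (hb : ∀ x y, b x y = -b y x)
    (hκb : ∀ x y z, κ (b x y) z = κ x (b y z)) (ϑ η : Alt n 1 V) :
    wedge κ ϑ (wedge b ϑ η) = wedge κ η (wedge b ϑ ϑ) := by
  have c : ∀ x y z, κ x (b y z) = κ z (b x y) := fun x y z => by rw [← hκb, hκ]
  have s : ∀ x y z, κ x (b y z) = -κ x (b z y) := fun x y z => by rw [hb y z, map_neg]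
  ext w
  simp only [wedge_apply_three, wedge_apply_two, map_sub, Matrix.cons_val_zero, Matrix.cons_val_one]
  set t0 := ϑ ![w 0]
  set t1 := ϑ ![w 1]
  set t2 := ϑ ![w 2]
  set h0 := η ![w 0]
  set h1 := η ![w 1]
  set h2 := η ![w 2]
  linear_combination c t0 t1 h2 - c t0 t2 h1 - c t1 t0 h2 + c t1 t2 h0 + c t2 t0 h1 - c t2 t1 h0

lemma hasDerivAt_cubic (a b c e : ℝ) :
    HasDerivAt (fun ε : ℝ => a + ε * b + ε ^ 2 * c + ε ^ 3 * e) b 0 := by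
  have h := (((hasDerivAt_id (0 : ℝ)).mul_const b).const_add a).add
    (((hasDerivAt_pow 2 (0 : ℝ)).mul_const c)) |>.add ((hasDerivAt_pow 3 (0 : ℝ)).mul_const e)
  simp at h
  exact h

end WedgeAlgebra

lemma killingCLM_comm {d : ℕ} {G : Type*} [TopologicalSpace G] [ChartedSpace (Euc d) G] [Group G]
    [LieGroup IE d ∞ G] (x y : Euc d) : killingCLM G x y = killingCLM G y x :=
  killing_comm x y

/-! ### Extraction of the beta functions -/

section Extraction

open Set Filter Topology ContinuousAlternatingMap

variable {n k : ℕ} {V : Type*} [NormedAddCommGroup V] [NormedSpace ℝ V]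

/-- A covariant derivative of an alternating form is alternating. -/
lemma exists_covForm_eq (Γ : Fin n → Fin n → Fin n → ℝ)
    (dσ : Euc n →L[ℝ] Alt n (k + 1) V) (σ : Alt n (k + 1) V) (u : Euc n) :
    ∃ B : Alt n (k + 1) V, ∀ w, covForm Γ dσ σ u w = B w := by
  let N : Lin n := LinearMap.toContinuousLinearMap
    { toFun := gammaVec Γ u
      map_add' := fun v w => by ext l; simp [gammaVec_apply, mul_add, sum_add_distrib]
      map_smul' := fun c w => by
        ext l
        simp only [gammaVec_apply, PiLp.smul_apply, smul_eq_mul, mul_sum, RingHom.id_apply]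
        exact sum_ext fun i => sum_ext fun j => by ring }
  refine ⟨dσ u - alternatizeUncurryFin (σ.curryLeft.comp N), fun w => ?_⟩
  exact congrArg (dσ u w - ·) (congrFun (slotDer_eq_alternatize N σ) w)

lemma exists_negDiv_eq (b : Bil n) (Γ : Fin n → Fin n → Fin n → ℝ)
    (dσ : Euc n →L[ℝ] Alt n (k + 1) V) (σ : Alt n (k + 1) V) :
    ∃ N : Alt n k V, ∀ w, negDiv b Γ dσ σ w = N w := by
  choose B hB using exists_covForm_eq Γ dσ σ
  refine ⟨-∑ i, ∑ l, gi b i l • (B (ee i)).curryLeft (ee l), fun w => ?_⟩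
  simp only [negDiv, hB]
  simp [ContinuousAlternatingMap.sum_apply, Matrix.vecCons]

lemma covForm_eq_sum (Γ : Fin n → Fin n → Fin n → ℝ) (dσ : Euc n →L[ℝ] Alt n k V)
    (σ : Alt n k V) (u : Euc n) (w : Fin k → Euc n) :
    covForm Γ dσ σ u w = dσ u w - ∑ a, ∑ l, (∑ i, ∑ j, Γ l i j * u i * w a j) •
      σ (update w a (ee l)) := by
  refine congrArg (dσ u w - ·) (sum_ext fun a => ?_)
  have h := sum_smul_ee (gammaVec Γ u (w a))
  have h2 := σ.toMultilinearMap.map_update_sum Finset.univ a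
    (fun l => gammaVec Γ u (w a) l • (ee l : Euc n)) w
  rw [h] at h2
  refine h2.trans (sum_ext fun l => ?_)
  exact (σ.toMultilinearMap.map_update_smul ..).trans (by rw [gammaVec_apply]; rfl)

variable {γ : Euc n → Bil n} {Ω : Set (Euc n)} {y : Euc n}
  {κ : V →ₗ[ℝ] V →ₗ[ℝ] ℝ} {φ : Euc n → ℝ} {F : Euc n → Alt n 2 V}
  {H : Euc n → Alt n 3 ℝ} {dF : Euc n → Euc n →L[ℝ] Alt n 2 V} {Λ : ℝ}

/-- All beta functions vanish at a point. -/
def BetasVanish (s : Set (Euc n)) (γ : Euc n → Bil n) (κ : V →ₗ[ℝ] V →ₗ[ℝ] ℝ)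
    (φ : Euc n → ℝ) (F : Euc n → Alt n 2 V) (H : Euc n → Alt n 3 ℝ)
    (dF : Euc n → Euc n →L[ℝ] Alt n 2 V) (Λ : ℝ) (y : Euc n) : Prop :=
  (∀ X Y, betaGLoc s γ κ φ (F y) (H y) y X Y = 0) ∧ betaPhiLoc s γ κ φ (F y) (H y) Λ y = 0 ∧
    (∀ w, betaBLoc s γ φ H y w = 0) ∧ ∀ w, betaTLoc s γ φ (F y) (H y) (dF y) y w = 0

lemma hessForm_eq (s : Set (Euc n)) (X Y : Euc n) : hessForm s γ φ y X Y =
    fderivWithin ℝ (dForm s φ) s y X ![Y] - toLin (dForm s φ y)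
      (gammaVec (fun l i j => christoffel s γ l i j y) X Y) := by
  rw [hessForm, covForm, toLin_apply]
  simp only [Finset.univ_unique, Finset.sum_singleton]
  congr 2
  funext a
  rw [Subsingleton.elim a 0]
  simp

lemma isLinearMap_pairing_curryLeft {W U : Type*} [NormedAddCommGroup W] [NormedSpace ℝ W]
    [NormedAddCommGroup U] [NormedSpace ℝ U] (b : Bil n)
    (κ : V →ₗ[ℝ] W →ₗ[ℝ] U) (σ : Alt n (k + 1) V) (τ : Alt n k W) :
    IsLinearMap ℝ fun X : Euc n => pairing b κ (σ.curryLeft X) τ :=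
  ⟨fun X X' => by simp [pairing, sum_add_distrib],
    fun c X => by simp [pairing, smul_sum, smul_comm c]⟩

lemma betaGLoc_symm {s : Set (Euc n)} (hκ : ∀ u v, κ u v = κ v u)
    (hs : ∀ y u v, γ y u v = γ y v u) (hr : ∀ i j, ricciCoord s γ i j y = ricciCoord s γ j i y)
    (X Y : Euc n) :
    betaGLoc s γ κ φ (F y) (H y) y X Y = betaGLoc s γ κ φ (F y) (H y) y Y X := by
  have hG := gram_inv_symm (hs y)
  have h1 : ricciForm s γ y X Y = ricciForm s γ y Y X := by
    rw [ricciForm, ricciForm, sum_comm]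
    exact sum_ext fun i => sum_ext fun j => by rw [hr, mul_comm (X j)]
  rw [betaGLoc, betaGLoc, h1, pairing_eq_mPair, mPair_comm hG hκ, formInner, pairing_eq_mPair,
    mPair_comm hG (κ := LinearMap.mul ℝ ℝ) fun u v => mul_comm u v, add_right_comm]
  rfl

lemma betaGLoc_eq_zero_of_basis {s : Set (Euc n)} (hκ : ∀ u v, κ u v = κ v u)
    (hs : ∀ y u v, γ y u v = γ y v u) (hr : ∀ i j, ricciCoord s γ i j y = ricciCoord s γ j i y)
    (h : ∀ i j, betaGLoc s γ κ φ (F y) (H y) y (ee i) (ee j) = 0) (X Y : Euc n) :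
    betaGLoc s γ κ φ (F y) (H y) y X Y = 0 := by
  have hl : ∀ Y, IsLinearMap ℝ fun X => betaGLoc s γ κ φ (F y) (H y) y X Y := by
    intro Y
    have p1 := isLinearMap_pairing_curryLeft (γ y) κ (F y) ((F y).curryLeft Y)
    have p2 := isLinearMap_pairing_curryLeft (γ y) (LinearMap.mul ℝ ℝ) (H y) ((H y).curryLeft Y)
    have p3 : IsLinearMap ℝ fun X => ricciForm s γ y X Y :=
      ⟨fun X X' => by simp [ricciForm, add_mul, sum_add_distrib],
        fun c X => by simp [ricciForm, mul_sum, mul_assoc]⟩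
    have g1 : ∀ X X' Z : Euc n, gammaVec (fun l i j => christoffel s γ l i j y) (X + X') Z =
        gammaVec (fun l i j => christoffel s γ l i j y) X Z +
          gammaVec (fun l i j => christoffel s γ l i j y) X' Z := fun X X' Z => by
      ext l; simp [gammaVec_apply, mul_add, add_mul, sum_add_distrib]
    have g2 : ∀ X X' Z : Euc n, gammaVec (fun l i j => christoffel s γ l i j y) Z (X + X') =
        gammaVec (fun l i j => christoffel s γ l i j y) Z X +
          gammaVec (fun l i j => christoffel s γ l i j y) Z X' := fun X X' Z => by
      ext l; simp [gammaVec_apply, mul_add, sum_add_distrib]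
    have g3 : ∀ (c : ℝ) (X Z : Euc n), gammaVec (fun l i j => christoffel s γ l i j y) (c • X) Z =
        c • gammaVec (fun l i j => christoffel s γ l i j y) X Z := fun c X Z => by
      ext l; simp [gammaVec_apply, mul_left_comm _ c, mul_sum, mul_assoc]
    have g4 : ∀ (c : ℝ) (X Z : Euc n), gammaVec (fun l i j => christoffel s γ l i j y) Z (c • X) =
        c • gammaVec (fun l i j => christoffel s γ l i j y) Z X := fun c X Z => by
      ext l; simp [gammaVec_apply, mul_left_comm _ c, mul_sum]
    constructor
    · intro X X'
      simp only [betaGLoc, formInner, p1.map_add, p2.map_add, p3.map_add, hessForm_eq, g1, g2]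
      simp only [map_add, ← toLin_apply]
      simp only [toLin_apply, ContinuousAlternatingMap.add_apply]
      ring
    · intro c X
      simp only [betaGLoc, formInner, p1.map_smul, p2.map_smul, p3.map_smul, hessForm_eq, g3, g4]
      simp only [map_smul, ← toLin_apply, smul_eq_mul]
      simp only [toLin_apply, ContinuousAlternatingMap.smul_apply, smul_eq_mul]
      ring
  have h0 : ∀ Y, (∀ j, betaGLoc s γ κ φ (F y) (H y) y (ee j) Y = 0) →
      ∀ X, betaGLoc s γ κ φ (F y) (H y) y X Y = 0 := by
    intro Y hY X
    have := clm_apply_eq_sum (LinearMap.toContinuousLinearMap (hl Y).mk') X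
    exact this.trans (sum_eq_zero fun i _ => by
      rw [show LinearMap.toContinuousLinearMap (hl Y).mk' (ee i) = 0 from hY i, smul_zero])
  exact h0 Y (fun j => (betaGLoc_symm hκ hs hr _ _).trans (h0 _ (fun i => h i j) Y)) X

section

variable (hγ : IsLocMetric Ω γ) (hy : y ∈ Ω)

include hγ hy

lemma IsLocMetric.sum_inv_mul (X : Euc n) (i : Fin n) : ∑ a, gi (γ y) i a * γ y X (ee a) = X i := by
  have h : ∀ a, γ y X (ee a) = ∑ j, X j * γ y (ee a) (ee j) := fun a => by
    rw [hγ.symm, clm_apply_eq_sum (γ y (ee a)) X]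
    simp only [smul_eq_mul]
  simp only [h, mul_sum, mul_left_comm _ (X _)]
  rw [sum_comm]
  simp only [← mul_sum, sum_gram_inv_mul (hγ.det_ne y hy)]
  simp

lemma IsLocMetric.mPair_lower_one (N : Alt n 1 V) (X : Euc n) (v : V) :
    mPair gi (γ y) κ N (ofLin ((γ y X).smulRight v)) = κ (N ![X]) v := by
  have h : ∀ i a, gi (γ y) i a * κ (N ![ee i]) (ofLin ((γ y X).smulRight v) ![ee a]) =
      gi (γ y) i a * γ y X (ee a) * κ (N ![ee i]) v := fun i a => by
    rw [ofLin_apply]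
    simp [mul_assoc]
  have h2 := clm_apply_eq_sum (toLin N) X
  simp only [toLin_apply] at h2
  rw [mPair_one]
  simp only [h, ← sum_mul, hγ.sum_inv_mul hy]
  rw [h2]
  simp

lemma IsLocMetric.mPair_lower_two (N : Alt n 2 ℝ) (X Y : Euc n) :
    mPair gi (γ y) (LinearMap.mul ℝ ℝ) N
      (wedge (ContinuousLinearMap.mul ℝ ℝ) (ofLin (γ y X)) (ofLin (γ y Y))) = N ![X, Y] := by
  have h1 : mPair gi (γ y) (LinearMap.mul ℝ ℝ) N
      (wedge (ContinuousLinearMap.mul ℝ ℝ) (ofLin (γ y X)) (ofLin (γ y Y))) =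
      ∑ i, (∑ a, gi (γ y) i a * γ y X (ee a)) * N ![ee i, Y] := by
    rw [wedge, mPair_alternatize]
    refine sum_ext fun i => ?_
    rw [sum_mul]
    refine sum_ext fun a => ?_
    have := hγ.mPair_lower_one hy (κ := LinearMap.mul ℝ ℝ) (N.curryLeft (ee i)) Y (γ y X (ee a))
    rw [smul_eq_mul, mul_assoc]
    congr 1
    refine (Eq.trans ?_ this).trans (mul_comm _ _)
    refine congrArg (mPair _ _ _) (funext fun w => ?_)
    rw [oneTensor_apply, ofLin_apply, ofLin_apply, ofLin_apply]
    simp [mul_comm]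
  rw [h1]
  simp only [hγ.sum_inv_mul hy]
  have := clm_apply_eq_sum ((ContinuousAlternatingMap.apply ℝ (Euc n) ℝ ![Y]).comp N.curryLeft) X
  exact this.symm

/-- The beta functions vanish if their contractions with all variations vanish. -/
lemma IsLocMetric.betasVanish (hκ : ∀ u v, κ u v = κ v u) (hκ' : ∀ u, (∀ v, κ u v = 0) → u = 0)
    (h : ∀ (b : Bil n) (c : ℝ) (ξ : Alt n 1 V)
      (α : Alt n 2 ℝ), (∀ u v, b u v = b v u) → eulerLagrange γ (fun _ => b) κ φ
        (fun _ => c) F (fun _ => ξ) H (fun _ => α) dF Λ y = 0) :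
    BetasVanish univ γ κ φ F H dF Λ y := by
  have h4 : gram (0 : Bil n) = 0 := by ext i j; simp [gram_apply]
  have hΦ : betaPhiLoc univ γ κ φ (F y) (H y) Λ y = 0 := by
    simpa [eulerLagrange, raise, trBilin, h4, mPair] using h 0 1 0 0 (by simp)
  have hr := fun i j => hγ.ricciCoord_symm hy i j
  refine ⟨betaGLoc_eq_zero_of_basis hκ hγ.symm hr fun i j => ?_, hΦ, fun w => ?_, fun w => ?_⟩
  · -- the variation `b` has `b^{pq} = δ^p_i δ^q_j + δ^p_j δ^q_i`
    let b : Bil n := (γ y (ee i)).smulRight (γ y (ee j)) + (γ y (ee j)).smulRight (γ y (ee i))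
    have hb : raise γ (fun _ => b) y = Matrix.single i j 1 + Matrix.single j i 1 := by
      have : gram b = gram (γ y) * (Matrix.single i j 1 + Matrix.single j i 1) * gram (γ y) := by
        ext p q
        have e : ∀ i j : Fin n, (gram (γ y) * Matrix.single i j (1 : ℝ) * gram (γ y)) p q =
            γ y (ee i) (ee p) * γ y (ee j) (ee q) := fun i j => by
          rw [hγ.symm y (ee i)]
          simp [Matrix.mul_apply, Matrix.single_apply, gram_apply, ite_and]
        rw [mul_add, add_mul, Matrix.add_apply, e, e]
        simp [b, gram_apply]
      have hu := (hγ.det_ne y hy).isUnit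
      rw [raise, this, mul_assoc, mul_assoc, Matrix.mul_nonsing_inv _ hu, mul_one,
        Matrix.nonsing_inv_mul_cancel_left _ _ hu]
    have h1 := h b 0 0 0 (fun u v => by simp [b]; ring)
    have hs := betaGLoc_symm (φ := φ) (F := F) (H := H) hκ hγ.symm hr (ee j) (ee i)
    rw [eulerLagrange, hb, hΦ] at h1
    simp [Matrix.single_apply, add_mul, sum_add_distrib, ite_and, mPair, hs] at h1
    linarith
  · obtain ⟨N, hN⟩ := exists_negDiv_eq (γ y) (fun l i j => christoffel univ γ l i j y)
      (fderivWithin ℝ (fun z => exp (-2 * φ z) • H z) univ y) (exp (-2 * φ y) • H y)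
    have hB : betaBLoc univ γ φ H y = ⇑(((1 / 2) * exp (2 * φ y)) • N) := by
      funext w
      exact congrArg ((1 / 2) * exp (2 * φ y) * ·) (hN w)
    have h1 := h 0 0 0 (wedge (ContinuousLinearMap.mul ℝ ℝ) (ofLin (γ y (w 0))) (ofLin (γ y (w 1))))
      (by simp)
    have h2 : ![w 0, w 1] = w := by ext i : 1; fin_cases i <;> rfl
    rw [eulerLagrange, hB, hγ.mPair_lower_two hy, h2] at h1
    rw [hB]
    simpa [raise, trBilin, h4, mPair] using h1
  · obtain ⟨N, hN⟩ : ∃ N : Alt n 1 V, ∀ w, betaTLoc univ γ φ (F y) (H y) (dF y) y w = N w := by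
      obtain ⟨N, hN⟩ := exists_negDiv_eq (γ y) (fun l i j => christoffel univ γ l i j y) (dF y)
        (exp (-2 * φ y) • F y)
      refine ⟨(1 / 2 : ℝ) • (exp (2 * φ y) • N + ofLin (LinearMap.toContinuousLinearMap
        (isLinearMap_pairing_curryLeft (γ y) (LinearMap.lsmul ℝ V) (H y) (F y)).mk')), fun w => ?_⟩
      rw [betaTLoc, hN, ContinuousAlternatingMap.smul_apply, ContinuousAlternatingMap.add_apply,
        ofLin_apply]
      rfl
    rw [hN]
    refine hκ' _ fun v => ?_
    have h1 := h 0 0 (ofLin ((γ y (w 0)).smulRight v)) 0 (by simp)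
    have h2 : ![w 0] = w := by ext i : 1; fin_cases i; rfl
    rw [eulerLagrange, funext hN, hγ.mPair_lower_one hy, h2] at h1
    simpa [raise, trBilin, h4, mPair] using h1

end

/-- At interior points, derivatives may be taken without constraint. -/
lemma betasVanish_iff_univ {s : Set (Euc n)} (hy : y ∈ interior s) :
    BetasVanish s γ κ φ F H dF Λ y ↔ BetasVanish univ γ κ φ F H dF Λ y := by
  have h : fderivWithin ℝ (fun z => exp (-2 * φ z) • H z) s y =
      fderivWithin ℝ (fun z => exp (-2 * φ z) • H z) univ y := by
    rw [fderivWithin_univ, fderivWithin_of_mem_nhds (mem_interior_iff_mem_nhds.1 hy)]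
  simp only [BetasVanish, betaGLoc, betaPhiLoc, betaBLoc, betaTLoc, ricciForm, hessForm,
    ricciCoord_eq_univ hy, scalarLoc_eq_univ hy, christoffel_eq_univ hy, dForm_eq_univ hy,
    fderivWithin_dForm_eq_univ hy, h]

section

variable {s : Set (Euc n)} (hs : UniqueDiffOn ℝ s) (hy : y ∈ s)

include hs hy

lemma smoothAt_pd {f : Euc n → ℝ} (hf : ContDiffWithinAt ℝ ∞ f s y) (i : Fin n) :
    ContDiffWithinAt ℝ ∞ (pd s f i) s y :=
  (hf.fderivWithin_right hs (by simp) hy).clm_apply contDiffWithinAt_const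

variable (hγ : ContDiffWithinAt ℝ ∞ γ s y) (hd : (gram (γ y)).det ≠ 0)

include hγ hd

omit hs hy in
lemma smoothAt_gram_inv (i j : Fin n) : ContDiffWithinAt ℝ ∞ (fun z => gi (γ z) i j) s y :=
  smoothAt_matrix_inv (fun _ _ => (hγ.clm_apply contDiffWithinAt_const).clm_apply
    contDiffWithinAt_const) hd i j

lemma smoothAt_christoffel (l i j : Fin n) : ContDiffWithinAt ℝ ∞ (christoffel s γ l i j) s y := by
  have h : ∀ i j r, ContDiffWithinAt ℝ ∞ (pd s (fun z => γ z (ee i) (ee j)) r) s y := fun i j r =>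
    smoothAt_pd hs hy ((hγ.clm_apply contDiffWithinAt_const).clm_apply contDiffWithinAt_const) r
  exact contDiffWithinAt_const.mul (ContDiffWithinAt.sum fun r _ =>
    (smoothAt_gram_inv hγ hd l r).mul (((h _ _ _).add (h _ _ _)).sub (h _ _ _)))

lemma smoothAt_ricciCoord (i j : Fin n) : ContDiffWithinAt ℝ ∞ (ricciCoord s γ i j) s y := by
  have h := smoothAt_christoffel hs hy hγ hd
  exact (ContDiffWithinAt.sum fun l _ => (smoothAt_pd hs hy (h _ _ _) l).sub
    (smoothAt_pd hs hy (h _ _ _) j)).add (ContDiffWithinAt.sum fun l _ =>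
      ContDiffWithinAt.sum fun r _ => ((h _ _ _).mul (h _ _ _)).sub ((h _ _ _).mul (h _ _ _)))

lemma smoothAt_covForm {k : ℕ} {σ : Euc n → Alt n k V}
    {dσ : Euc n → Euc n →L[ℝ] Alt n k V} (hσ : ContDiffWithinAt ℝ ∞ σ s y)
    (hdσ : ContDiffWithinAt ℝ ∞ dσ s y) (u : Euc n) (w : Fin k → Euc n) :
    ContDiffWithinAt ℝ ∞ (fun z => covForm (fun l i j => christoffel s γ l i j z) (dσ z) (σ z) u w)
      s y := by
  simp only [covForm_eq_sum]
  exact (smoothAt_form_apply (hdσ.clm_apply contDiffWithinAt_const) w).sub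
    (ContDiffWithinAt.sum fun a _ => ContDiffWithinAt.sum fun l _ => (ContDiffWithinAt.sum fun i _ =>
      ContDiffWithinAt.sum fun j _ => ((smoothAt_christoffel hs hy hγ hd _ _ _).mul
        contDiffWithinAt_const).mul contDiffWithinAt_const).smul (smoothAt_form_apply hσ _))

lemma smoothAt_negDiv {k : ℕ} {σ : Euc n → Alt n (k + 1) V}
    {dσ : Euc n → Euc n →L[ℝ] Alt n (k + 1) V} (hσ : ContDiffWithinAt ℝ ∞ σ s y)
    (hdσ : ContDiffWithinAt ℝ ∞ dσ s y) (w : Fin k → Euc n) :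
    ContDiffWithinAt ℝ ∞ (fun z => negDiv (γ z) (fun l i j => christoffel s γ l i j z) (dσ z) (σ z) w)
      s y :=
  (ContDiffWithinAt.sum fun i _ => ContDiffWithinAt.sum fun l _ =>
    (smoothAt_gram_inv hγ hd i l).smul (smoothAt_covForm hs hy hγ hd hσ hdσ (ee i) _)).neg

/-- By continuity, the beta functions vanish at limits of points where they vanish; this covers
the boundary of a manifold, on which no condition results from variations in the interior. -/
lemma betasVanish_of_mem_closure (κc : V →L[ℝ] V →L[ℝ] ℝ) (hκc : ∀ u v, κ u v = κc u v)
    (hφ : ContDiffWithinAt ℝ ∞ φ s y) (hF : ContDiffWithinAt ℝ ∞ F s y)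
    (hH : ContDiffWithinAt ℝ ∞ H s y) (hdF : ContDiffWithinAt ℝ ∞ dF s y)
    (hcl : y ∈ closure {z ∈ s | BetasVanish s γ κ φ F H dF Λ z}) :
    BetasVanish s γ κ φ F H dF Λ y := by
  have key : ∀ f : Euc n → ℝ, ContDiffWithinAt ℝ ∞ f s y →
      (∀ z, BetasVanish s γ κ φ F H dF Λ z → f z = 0) → f y = 0 := fun f hf h0 =>
    (hf.continuousWithinAt.mono fun z hz => hz.1).eq_const_of_mem_closure hcl fun z hz => h0 z hz.2
  have keyV : ∀ f : Euc n → V, ContDiffWithinAt ℝ ∞ f s y →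
      (∀ z, BetasVanish s γ κ φ F H dF Λ z → f z = 0) → f y = 0 := fun f hf h0 =>
    (hf.continuousWithinAt.mono fun z hz => hz.1).eq_const_of_mem_closure hcl fun z hz => h0 z hz.2
  have hG := smoothAt_gram_inv hγ hd
  have hdφ : ContDiffWithinAt ℝ ∞ (dForm s φ) s y :=
    (ContinuousLinearMap.contDiff (ofLinCLM (n := n) (V := ℝ))).contDiffAt.comp_contDiffWithinAt y
      (hφ.fderivWithin_right hs (by simp) hy)
  have hddφ := hdφ.fderivWithin_right (m := ∞) hs (by simp) hy
  have hcurl : ∀ (X : Euc n) (w : Fin 2 → Euc n),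
      ContDiffWithinAt ℝ ∞ (fun z => (H z).curryLeft X w) s y :=
    fun X w => smoothAt_form_apply hH _
  have hexp : ∀ c : ℝ, ContDiffWithinAt ℝ ∞ (fun z => exp (c * φ z)) s y := fun c =>
    (contDiffWithinAt_const.mul hφ).exp
  refine ⟨fun X Y => key (fun z => betaGLoc s γ κ φ (F z) (H z) z X Y) ?_ fun z hz => hz.1 X Y,
    key (fun z => betaPhiLoc s γ κ φ (F z) (H z) Λ z) ?_ fun z hz => hz.2.1,
    fun w => key (fun z => betaBLoc s γ φ H z w) ?_ fun z hz => hz.2.2.1 w,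
    fun w => keyV (fun z => betaTLoc s γ φ (F z) (H z) (dF z) z w) ?_ fun z hz => hz.2.2.2 w⟩
  · refine ((((ContDiffWithinAt.sum fun i _ => ContDiffWithinAt.sum fun j _ =>
      contDiffWithinAt_const.mul (smoothAt_ricciCoord hs hy hγ hd i j)).add
      (contDiffWithinAt_const.mul (smoothAt_mPair κc hκc hG (fun w => ?_) fun w => ?_))).sub
      (contDiffWithinAt_const.mul (smoothAt_formInner hG (hcurl X) (hcurl Y)))).add
      (smoothAt_covForm hs hy hγ hd hdφ hddφ X _)).add
      (smoothAt_covForm hs hy hγ hd hdφ hddφ Y _)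
    · exact smoothAt_form_apply hF _
    · exact smoothAt_form_apply hF _
  · have c1 : ContDiffWithinAt ℝ ∞ (scalarLoc s γ) s y :=
      ContDiffWithinAt.sum fun i _ => ContDiffWithinAt.sum fun j _ =>
        (hG i j).mul (smoothAt_ricciCoord hs hy hγ hd i j)
    have c2 : ContDiffWithinAt ℝ ∞ (fun z => pairing (γ z) κ (F z) (F z)) s y :=
      smoothAt_mPair κc hκc hG (smoothAt_form_apply hF) (smoothAt_form_apply hF)
    have c3 : ∀ {k : ℕ} {σ : Euc n → Alt n k ℝ}, ContDiffWithinAt ℝ ∞ σ s y →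
        ContDiffWithinAt ℝ ∞ (fun z => formInner (γ z) (σ z) (σ z)) s y := fun hσ =>
      smoothAt_formInner hG (smoothAt_form_apply hσ) (smoothAt_form_apply hσ)
    have c4 := (smoothAt_negDiv hs hy hγ hd hdφ hddφ ![]).neg
    exact ((((c1.add (contDiffWithinAt_const.mul c2)).sub (contDiffWithinAt_const.mul (c3 hH))).add
      (contDiffWithinAt_const.mul c4)).sub (contDiffWithinAt_const.mul (c3 hdφ))).sub
      contDiffWithinAt_const
  · have h1 := (hexp (-2)).smul hH
    exact (contDiffWithinAt_const.mul (hexp 2)).mul (smoothAt_negDiv hs hy hγ hd h1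
      (h1.fderivWithin_right hs (by simp) hy) w)
  · exact contDiffWithinAt_const.smul (((hexp 2).smul (smoothAt_negDiv hs hy hγ hd
      ((hexp (-2)).smul hF) hdF w)).add (smoothAt_mPair (ContinuousLinearMap.lsmul ℝ ℝ)
        (fun _ _ => rfl) hG (hcurl _) (smoothAt_form_apply hF)))

end

end Extraction

namespace PrincipalBundle

open Set Filter Topology

variable {d : ℕ} {G : Type*} [TopologicalSpace G] [ChartedSpace (Euc d) G] [Group G]
  [LieGroup 𝓘(ℝ, Euc d) ∞ G]
  {m n : ℕ} {HP H : Type*} [TopologicalSpace HP] [TopologicalSpace H]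
  {IP : ModelWithCorners ℝ (Euc m) HP} {I : ModelWithCorners ℝ (Euc n) H}
  {P M : Type*} [TopologicalSpace P] [ChartedSpace HP P] [IsManifold IP ∞ P]
  [TopologicalSpace M] [ChartedSpace H M] [IsManifold I ∞ M]
  {Q : PrincipalBundle (d := d) G IP I P M} {V : Type*} [NormedAddCommGroup V] [NormedSpace ℝ V]
  {k : ℕ}

/-! ### Local sections and horizontal lifts -/

variable (Q) in
/-- A smooth section `s` of the bundle over the open set `U`, and the corresponding fibre coordinate
`τ`, defined by `q = s(proj q) · τ(q)`. -/
structure IsSection (U : Set M) (s : M → P) (τ : P → G) : Prop where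
  isOpen : IsOpen U
  smooth : ContMDiffOn I IP ∞ s U
  smooth_coord : ContMDiffOn IP IE d ∞ τ (Q.proj ⁻¹' U)
  proj_section : ∀ x ∈ U, Q.proj (s x) = x
  act_section : ∀ q, Q.proj q ∈ U → Q.act (s (Q.proj q)) (τ q) = q
  coord_act : ∀ q a, Q.proj q ∈ U → τ (Q.act q a) = τ q * a

variable (Q) in
lemma exists_section (p : P) : ∃ (U : Set M) (s : M → P) (τ : P → G), Q.IsSection U s τ ∧
    Q.proj p ∈ U ∧ s (Q.proj p) = p ∧ τ p = 1 := by
  obtain ⟨e, hx, he, hes, hea⟩ := Q.locally_trivial (Q.proj p)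
  have hsrc : ∀ q, q ∈ e.source ↔ Q.proj q ∈ e.baseSet := fun q => e.mem_source
  have hp : p ∈ e.source := (hsrc p).2 hx
  set s : M → P := fun x => e.toOpenPartialHomeomorph.symm (x, (e p).2) with hs
  have hproj : ∀ x ∈ e.baseSet, Q.proj (s x) = x := fun x hx => e.proj_symm_apply' hx
  have hes2 : ∀ x ∈ e.baseSet, e (s x) = (x, (e p).2) := fun x hx => e.apply_symm_apply' hx
  refine ⟨e.baseSet, s, fun q => (e p).2⁻¹ * (e q).2, ⟨e.open_baseSet, ?_, ?_, hproj, ?_, ?_⟩, hx,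
    ?_, inv_mul_cancel _⟩
  · refine hes.comp (contMDiffOn_id.prodMk contMDiffOn_const) fun x hx => ?_
    exact e.mem_target.2 hx
  · have h2 : ContMDiffOn IP IE d ∞ (fun q => (e q).2) (Q.proj ⁻¹' e.baseSet) :=
      contMDiff_snd.comp_contMDiffOn (he.mono fun q hq => (hsrc q).2 hq)
    exact contMDiffOn_const.mul h2
  · intro q hq
    have hsq : s (Q.proj q) ∈ e.source := (hsrc _).2 (by rw [hproj _ hq]; exact hq)
    have haq : Q.act (s (Q.proj q)) ((e p).2⁻¹ * (e q).2) ∈ e.source :=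
      (hsrc _).2 (by rw [Q.proj_act, hproj _ hq]; exact hq)
    refine e.toOpenPartialHomeomorph.injOn haq ((hsrc q).2 hq) ?_
    refine Prod.ext ?_ ?_
    · exact (e.coe_fst haq).trans (((Q.proj_act _ _).trans (hproj _ hq)).trans
        (e.coe_fst ((hsrc q).2 hq)).symm)
    · refine (hea _ hsq _).trans ?_
      rw [hes2 _ hq]
      exact mul_inv_cancel_left _ _
  · intro q a hq
    rw [hea q ((hsrc q).2 hq) a, mul_assoc]
  · have : (Q.proj p, (e p).2) = e p := Prod.ext (e.coe_fst hp).symm rfl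
    change e.toOpenPartialHomeomorph.symm (Q.proj p, (e p).2) = p
    rw [this]
    exact e.toOpenPartialHomeomorph.left_inv hp

/-! #### The derivatives of the projection and of the action -/

variable (Q) in
/-- The derivative of the projection. -/
def dproj (p : P) : Euc m →L[ℝ] Euc n := mfderiv IP I Q.proj p

variable (Q) in
/-- The fundamental vectors `ξ ↦ d/dt (p · exp(tξ))`. -/
def fund (p : P) : Euc d →L[ℝ] Euc m := mfderiv IE d IP (Q.act p) 1

variable (Q) in
/-- The derivative of the right translation by `a`. -/
def dact (a : G) (p : P) : Lin m := mfderiv IP IP (fun q => Q.act q a) p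

/-- The derivative of a section. -/
def dsec (I : ModelWithCorners ℝ (Euc n) H) (IP : ModelWithCorners ℝ (Euc m) HP) (s : M → P)
    (x : M) : Euc n →L[ℝ] Euc m := mfderiv I IP s x

/-- The connection form at a point, as a linear map between the model spaces. -/
def conn (A : Form IP P (Euc d) 1) (p : P) : Euc m →L[ℝ] Euc d := toLin (A p)

variable (Q) in
/-- The horizontal lift at a point, as a linear map between the model spaces. -/
def hl (A : Form IP P (Euc d) 1) (p : P) : Euc n →L[ℝ] Euc m := Q.hlift A p

lemma conn_apply (A : Form IP P (Euc d) 1) (p : P) (v : Euc m) :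
    conn A p v = (A p : Alt m 1 (Euc d)) ![v] :=
  toLin_apply (A p : Alt m 1 (Euc d)) v

lemma mdifferentiableAt_proj (p : P) : MDifferentiableAt IP I Q.proj p :=
  Q.smooth_proj.mdifferentiableAt (by simp)

lemma contMDiff_act_left (p : P) : ContMDiff IE d IP ∞ (Q.act p) :=
  Q.smooth_act.comp (contMDiff_const.prodMk contMDiff_id)

lemma contMDiff_act_right (a : G) : ContMDiff IP IP ∞ (fun q => Q.act q a) :=
  Q.smooth_act.comp (contMDiff_id.prodMk contMDiff_const)

lemma hasMFDerivAt_proj {p q : P} (h : q = p) :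
    HasMFDerivAt IP I Q.proj q (Q.dproj p : Euc m →L[ℝ] Euc n) := by
  subst h; exact (mdifferentiableAt_proj q).hasMFDerivAt

lemma hasMFDerivAt_fund (p : P) : HasMFDerivAt IE d IP (Q.act p) 1 (Q.fund p : Euc d →L[ℝ] Euc m) :=
  ((contMDiff_act_left p).mdifferentiableAt (by simp)).hasMFDerivAt

lemma hasMFDerivAt_dact (a : G) (p : P) :
    HasMFDerivAt IP IP (fun q => Q.act q a) p (Q.dact a p : Lin m) :=
  ((contMDiff_act_right a).mdifferentiableAt (by simp)).hasMFDerivAt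

lemma dproj_fund (p : P) (ξ : Euc d) : Q.dproj p (Q.fund p ξ) = 0 := by
  have h := (hasMFDerivAt_proj (Q := Q) (Q.act_one p)).comp 1 (hasMFDerivAt_fund p)
  have e : Q.proj ∘ Q.act p = fun _ : G => Q.proj p := by funext a; exact Q.proj_act p a
  rw [e] at h
  have h2 := hasMFDerivAt_unique h (hasMFDerivAt_const (Q.proj p) (1 : G))
  exact congrArg (fun f : Euc d →L[ℝ] Euc n => f ξ) h2

lemma dproj_dact (a : G) (p : P) (v : Euc m) :
    Q.dproj (Q.act p a) (Q.dact a p v) = Q.dproj p v := by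
  have h := (hasMFDerivAt_proj (Q := Q) (rfl : Q.act p a = _)).comp p (hasMFDerivAt_dact a p)
  have e : Q.proj ∘ (fun q => Q.act q a) = Q.proj := by funext q; exact Q.proj_act q a
  rw [e] at h
  exact congrArg (fun f : Euc m →L[ℝ] Euc n => f v)
    (hasMFDerivAt_unique h (hasMFDerivAt_proj (Q := Q) rfl))

lemma hasMFDerivAt_act {p q : P} {a : G} (hq : q = p) (ha : a = 1) :
    HasMFDerivAt (IP.prod IE d) IP (fun r : P × G => Q.act r.1 r.2) (q, a)
      ((ContinuousLinearMap.id ℝ (Euc m)).coprod (Q.fund p) : Euc m × Euc d →L[ℝ] Euc m) := by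
  subst hq ha
  have hd : MDifferentiableAt (IP.prod IE d) IP (fun r : P × G => Q.act r.1 r.2) (q, 1) :=
    Q.smooth_act.mdifferentiableAt (by simp)
  refine hd.hasMFDerivAt.congr_mfderiv ?_
  refine ContinuousLinearMap.ext fun v => ?_
  refine (mfderiv_prod_eq_add_apply hd).trans ?_
  have e : (fun z : P => Q.act z 1) = id := by funext z; exact Q.act_one z
  have e1 : (mfderiv IP IP (fun z : P => Q.act z 1) q : Lin m) =
      ContinuousLinearMap.id ℝ (Euc m) := by
    rw [e]; exact mfderiv_id
  have e2 := congrArg (fun f : Lin m => f (v : Euc m × Euc d).1) e1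
  exact congrArg (fun w : Euc m => w + Q.fund q (v : Euc m × Euc d).2) e2

section Sections

variable {U : Set M} {s : M → P} {τ : P → G} (hs : Q.IsSection U s τ)

include hs

lemma IsSection.mdifferentiableAt {x : M} (hx : x ∈ U) : MDifferentiableAt I IP s x :=
  (hs.smooth.contMDiffAt (hs.isOpen.mem_nhds hx)).mdifferentiableAt (by simp)

lemma IsSection.hasMFDerivAt {x : M} (hx : x ∈ U) :
    HasMFDerivAt I IP s x (dsec I IP s x : Euc n →L[ℝ] Euc m) :=
  (hs.mdifferentiableAt hx).hasMFDerivAt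

lemma IsSection.isOpen_preimage : IsOpen (Q.proj ⁻¹' U) :=
  hs.isOpen.preimage Q.smooth_proj.continuous

lemma IsSection.dproj_mfderiv {x : M} (hx : x ∈ U) (u : Euc n) :
    Q.dproj (s x) (dsec I IP s x u) = u := by
  have h := (hasMFDerivAt_proj (Q := Q) (rfl : s x = _)).comp x (hs.hasMFDerivAt hx)
  have e : Q.proj ∘ s =ᶠ[𝓝 x] id :=
    eventually_of_mem (hs.isOpen.mem_nhds hx) fun z hz => hs.proj_section z hz
  have h2 := hasMFDerivAt_unique (h.congr_of_eventuallyEq e.symm) (hasMFDerivAt_id x)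
  exact congrArg (fun f : Lin n => f u) h2

/-- A tangent vector is the sum of a vector tangent to the section and a vertical vector. -/
lemma IsSection.decompose {p : P} (hp : Q.proj p ∈ U) (hsp : s (Q.proj p) = p) (hτ : τ p = 1)
    (v : Euc m) : ∃ ξ : Euc d, v = dsec I IP s (Q.proj p) (Q.dproj p v) + Q.fund p ξ := by
  have h1 := (hs.hasMFDerivAt hp).comp p (hasMFDerivAt_proj (Q := Q) (rfl : p = _))
  have h2 : MDifferentiableAt IP IE d τ p :=
    (hs.smooth_coord.contMDiffAt (hs.isOpen_preimage.mem_nhds hp)).mdifferentiableAt (by simp)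
  have h3 := (hasMFDerivAt_act (Q := Q) (p := p) hsp hτ).comp p (h1.prodMk h2.hasMFDerivAt)
  have e : ((fun r : P × G => Q.act r.1 r.2) ∘ fun q => ((s ∘ Q.proj) q, τ q)) =ᶠ[𝓝 p] id :=
    eventually_of_mem (hs.isOpen_preimage.mem_nhds hp) fun q hq => hs.act_section q hq
  have h4 := hasMFDerivAt_unique (h3.congr_of_eventuallyEq e.symm) (hasMFDerivAt_id p)
  refine ⟨(mfderiv IP IE d τ p : Euc m →L[ℝ] Euc d) v, ?_⟩
  exact (congrArg (fun f : Lin m => f v) h4).symm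

end Sections

section Connection

variable {A : Form IP P (Euc d) 1} (hA : Q.IsConnection A)

include hA

lemma connection_fund (p : P) (ξ : Euc d) : conn A p (Q.fund p ξ) = ξ := by
  have h := hA.fundamental p ξ
  have e : ∀ q, q = p → ∀ w : Euc m, A q ![w] = A p ![w] := by rintro q rfl w; rfl
  exact ((conn_apply A p _).trans (e _ (Q.act_one p) (Q.fund p ξ)).symm).trans h

lemma connection_dact (a : G) (p : P) (v : Euc m) :
    conn A (Q.act p a) (Q.dact a p v) = Ad a⁻¹ (conn A p v) :=
  ((conn_apply A (Q.act p a) _).trans (hA.equivariant p a v)).trans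
    (congrArg (Ad a⁻¹) (conn_apply A p v).symm)

lemma eq_zero_of_horizontal_of_vertical {p : P} {v : Euc m} (h1 : Q.dproj p v = 0)
    (h2 : conn A p v = 0) : v = 0 := by
  obtain ⟨U, s, τ, hs, hp, hsp, hτ⟩ := Q.exists_section p
  obtain ⟨ξ, hξ⟩ := hs.decompose hp hsp hτ v
  rw [h1, map_zero, zero_add] at hξ
  rw [hξ, connection_fund hA] at h2
  rw [hξ, h2, map_zero]

lemma bijective_dproj_connection (p : P) : Function.Bijective ((Q.dproj p).prod (conn A p)) := by
  constructor
  · rw [injective_iff_map_eq_zero]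
    intro v hv
    have := Prod.ext_iff.1 hv
    exact eq_zero_of_horizontal_of_vertical hA this.1 this.2
  · rintro ⟨u, ξ⟩
    obtain ⟨U, s, τ, hs, hp, hsp, hτ⟩ := Q.exists_section p
    have h1 := hs.dproj_mfderiv hp u
    rw [hsp] at h1
    obtain ⟨w, hw⟩ : ∃ w, w = dsec I IP s (Q.proj p) u := ⟨_, rfl⟩
    rw [← hw] at h1
    refine ⟨w + Q.fund p (ξ - conn A p w), Prod.ext ?_ ?_⟩
    · change Q.dproj p (w + _) = u
      rw [map_add, dproj_fund, add_zero]; exact h1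
    · change conn A p (w + _) = ξ
      rw [map_add, connection_fund hA]
      abel

lemma dproj_connection_hlift (p : P) (u : Euc n) :
    Q.dproj p (Q.hl A p u) = u ∧ conn A p (Q.hl A p u) = 0 := by
  set T := (Q.dproj p).prod (conn A p) with hT
  have hb := bijective_dproj_connection hA p
  set e := ContinuousLinearEquiv.ofBijective T (LinearMap.ker_eq_bot.2 hb.1)
    (LinearMap.range_eq_top.2 hb.2) with he
  have hTe : T = (e : Euc m →L[ℝ] Euc n × Euc d) := by ext1 v; rfl
  have h1 : T.inverse = (e.symm : Euc n × Euc d →L[ℝ] Euc m) := by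
    rw [hTe, ContinuousLinearMap.inverse_equiv]
  have h2 : Q.hl A p u = e.symm (u, 0) := by
    have : Q.hl A p u = T.inverse (u, 0) := rfl
    rw [this, h1]; rfl
  have h3 : T (e.symm (u, 0)) = (u, 0) := e.apply_symm_apply (u, 0)
  rw [h2]
  exact ⟨congrArg Prod.fst h3, congrArg Prod.snd h3⟩

lemma hlift_unique {p : P} {u : Euc n} {v : Euc m} (h1 : Q.dproj p v = u)
    (h2 : conn A p v = 0) : Q.hl A p u = v := by
  obtain ⟨h3, h4⟩ := dproj_connection_hlift hA p u
  refine sub_eq_zero.1 (eq_zero_of_horizontal_of_vertical hA (p := p) ?_ ?_)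
  · rw [map_sub, h3, h1, sub_self]
  · rw [map_sub, h4, h2, sub_self]

lemma hlift_act (a : G) (p : P) (u : Euc n) : Q.hl A (Q.act p a) u = Q.dact a p (Q.hl A p u) := by
  obtain ⟨h3, h4⟩ := dproj_connection_hlift hA p u
  refine hlift_unique hA ?_ ?_
  · rw [dproj_dact, h3]
  · rw [connection_dact hA, h4, map_zero]

/-- The horizontal lift along a section. -/
lemma IsSection.hlift_eq {U : Set M} {s : M → P} {τ : P → G} (hs : Q.IsSection U s τ) {x : M}
    (hx : x ∈ U) (u : Euc n) :
    Q.hl A (s x) u = dsec I IP s x u - Q.fund (s x) (conn A (s x) (dsec I IP s x u)) := by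
  refine hlift_unique hA ?_ ?_
  · rw [map_sub, hs.dproj_mfderiv hx, dproj_fund, sub_zero]
  · rw [map_sub, connection_fund hA, sub_self]

end Connection

variable {U : Set M} {s : M → P} {τ : P → G} (hs : Q.IsSection U s τ) {A : Form IP P (Euc d) 1}
  (hA : Q.IsConnection A) {y : Euc n}

/-- The gauge potential: the components of the connection form, pulled back by a section, in the
chart at `z`. -/
def gauge (I : ModelWithCorners ℝ (Euc n) H) [IsManifold I ∞ M] (A : Form IP P (Euc d) 1)
    (s : M → P) (z x : M) : Euc n →L[ℝ] Euc d :=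
  (conn A (s x)).comp ((dsec I IP s x).comp (fr I z x))

/-- The components in the chart at `z` of a family of forms along a section. -/
def secForm (σ : Q.PForm V k) (s : M → P) (z : M) (y : Euc n) : Alt n k V :=
  Q.locP z σ (s (ich I z y))

variable (Q) in
/-- The value of a family of forms, as a form on the model space. -/
def valForm (σ : Q.PForm V k) (p : P) : Alt n k V := σ p

lemma locP_of_proj_eq (σ : Q.PForm V k) {p : P} {x : M} (h : Q.proj p = x) (z : M) :
    Q.locP z σ p = (Q.valForm σ p).compContinuousLinearMap (fr I z x) := by
  subst h; rfl

lemma locP_self (σ : Q.PForm V k) {p : P} {x : M} (h : Q.proj p = x) :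
    Q.locP x σ p = Q.valForm σ p := by
  rw [locP_of_proj_eq σ h, fr_self]
  ext w; rfl

variable (Q) in
/-- The derivative of the components of a family of forms. -/
def dlocP (z : M) (σ : Q.PForm V k) (p : P) : Euc m →L[ℝ] Alt n k V :=
  mfderiv IP 𝓘(ℝ, Alt n k V) (Q.locP z σ) p

lemma valForm_act {σ : Q.PForm (Euc d) k} (hσ : Q.IsAdForm σ) (p : P) (a : G) :
    Q.valForm σ (Q.act p a) = (Ad a⁻¹).compContinuousAlternatingMap (Q.valForm σ p) := by
  ext w : 1
  exact hσ.equivariant p a w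

lemma locP_act {σ : Q.PForm (Euc d) k} {p : P} {a : G}
    (hσ : Q.valForm σ (Q.act p a) = (Ad a⁻¹).compContinuousAlternatingMap (Q.valForm σ p))
    (z : M) : Q.locP z σ (Q.act p a) = (Ad a⁻¹).compContinuousAlternatingMap (Q.locP z σ p) := by
  rw [locP_of_proj_eq σ (Q.proj_act p a), locP_of_proj_eq σ rfl, hσ]
  rfl

lemma hasMFDerivAt_locP {σ : Q.PForm (Euc d) k} (hσ : Q.IsAdForm σ) {z : M} {p q : P} (h : q = p)
    (hp : Q.proj p ∈ (chartAt H z).source) :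
    HasMFDerivAt IP 𝓘(ℝ, Alt n k (Euc d)) (Q.locP z σ) q
      (Q.dlocP z σ p : Euc m →L[ℝ] Alt n k (Euc d)) := by
  subst h
  exact (((hσ.smooth z).contMDiffAt (((chartAt H z).open_source.preimage
    Q.smooth_proj.continuous).mem_nhds hp)).mdifferentiableAt (by simp)).hasMFDerivAt

lemma dlocP_fund {σ : Q.PForm (Euc d) k} (hσ : Q.IsAdForm σ) {z : M} {p : P}
    (hp : Q.proj p ∈ (chartAt H z).source) (ξ : Euc d) :
    Q.dlocP z σ p (Q.fund p ξ) = -(adRep G ξ).compContinuousAlternatingMap (Q.locP z σ p) := by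
  have h1 := (hasMFDerivAt_locP hσ (Q.act_one p) hp).comp 1 (hasMFDerivAt_fund p)
  let L : (Lin d) →L[ℝ] Alt n k (Euc d) :=
    (compContinuousAlternatingMapCLM ℝ (Euc n) (Euc d) (Euc d) (Fin k)).flip (Q.locP z σ p)
  have h2 := HasMFDerivAt.comp (f := fun a : G => (Ad a⁻¹ : Lin d)) (g := L) (1 : G)
    L.hasMFDerivAt (hasMFDerivAt_Ad_inv (G := G) (d := d))
  have e : Q.locP z σ ∘ Q.act p = L ∘ fun a : G => (Ad a⁻¹ : Lin d) := by
    funext a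
    exact locP_act (valForm_act hσ p a) z
  rw [e] at h1
  have h3 := hasMFDerivAt_unique h1 h2
  have h4 := congrArg (fun f : Euc d →L[ℝ] Alt n k (Euc d) => f ξ) h3
  refine h4.trans ?_
  change L (-(adRep G ξ)) = _
  rw [map_neg]
  rfl

section Sections

include hs

lemma IsSection.smooth_comp {E : Type*} [NormedAddCommGroup E] [NormedSpace ℝ E] {f : P → E}
    {z : M} (hf : ContMDiffOn IP 𝓘(ℝ, E) ∞ f (Q.proj ⁻¹' (chartAt H z).source)) :
    SmoothOn (fun y => f (s (ich I z y))) (dom I z U) := by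
  have h : ContMDiffOn I 𝓘(ℝ, E) ∞ (f ∘ s) (U ∩ (chartAt H z).source) :=
    hf.comp (hs.smooth.mono inter_subset_left) fun x hx => by
      rw [mem_preimage, mem_preimage, hs.proj_section x hx.1]; exact hx.2
  refine (smooth_comp_symm h z).mono fun y hy => ⟨hy.1, hy.2, ?_⟩
  exact symm_mem_source hy.1

lemma IsSection.smooth_secForm {σ : Q.PForm (Euc d) k} (hσ : Q.IsAdForm σ) (z : M) :
    SmoothOn (secForm σ s z) (dom I z U) :=
  hs.smooth_comp (hσ.smooth z)

/-- The derivatives of an adjoint form along the horizontal lifts, in a gauge. -/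
lemma IsSection.dlocP_hl {A : Form IP P (Euc d) 1} (hA : Q.IsConnection A)
    {σ : Q.PForm (Euc d) k} (hσ : Q.IsAdForm σ) {z x : M}
    (hy : y ∈ (ch I z).target) (hx : ich I z y = x) (hxU : x ∈ U) :
    (Q.dlocP z σ (s x)).comp ((Q.hl A (s x)).comp (fr I z x)) =
      fderivWithin ℝ (secForm σ s z) (range I) y +
        oneTensor (adRep G) (ofLin (gauge I A s z x)) (secForm σ s z y) := by
  subst hx
  set x := ich I z y with hx
  have hxz : x ∈ (chartAt H z).source := symm_mem_source hy
  have hp : Q.proj (s x) ∈ (chartAt H z).source := by rwa [hs.proj_section x hxU]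
  have h1 : HasMFDerivAt I 𝓘(ℝ, Alt n k (Euc d)) (Q.locP z σ ∘ s) x
      ((Q.dlocP z σ (s x)).comp (dsec I IP s x) : Euc n →L[ℝ] Alt n k (Euc d)) :=
    (hasMFDerivAt_locP hσ rfl hp).comp x (hs.hasMFDerivAt hxU)
  have h2 : fderivWithin ℝ (secForm σ s z) (range I) y =
      ((Q.dlocP z σ (s x)).comp (dsec I IP s x)).comp (fr I z x) := by
    have h3 := fderivWithin_comp_symm hy h1.mdifferentiableAt
    have h4 := h1.mfderiv
    refine Eq.trans h3 ?_
    exact congrArg (fun f : Euc n →L[ℝ] Alt n k (Euc d) => f.comp (fr I z x)) h4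
  rw [h2]
  ext1 u
  rw [ContinuousLinearMap.comp_apply, ContinuousLinearMap.comp_apply, hs.hlift_eq hA hxU, map_sub,
    dlocP_fund hσ hp, sub_neg_eq_add]
  refine congrArg₂ (· + ·) rfl ?_
  ext w : 1
  have h := oneTensor_apply (adRep G) (ofLin (gauge I A s z x)) (secForm σ s z y) u w
  rw [ofLin_apply] at h
  exact h.symm

end Sections

lemma hasMFDerivAt_dsec_comp {s : M → P} {z x : M} {p₁ : P}
    (hy : y ∈ (ch I z).target) (hx : ich I z y = x)
    (hsx : MDifferentiableAt I IP s x) (hp : s x ∈ (chartAt HP p₁).source) :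
    fderivWithin ℝ (fun y => ch IP p₁ (s (ich I z y))) (range I) y =
      (coframe IP p₁ (s x)).comp ((dsec I IP s x).comp (fr I z x)) := by
  subst hx
  exact (hasFDerivWithinAt_in_charts hy hsx hp).fderivWithin
    (I.uniqueDiffOn y (extChartAt_target_subset_range z hy))

include hs in
lemma IsSection.isOpen_inter_chart (p₁ : P) : IsOpen (U ∩ s ⁻¹' (chartAt HP p₁).source) :=
  hs.smooth.continuousOn.isOpen_inter_preimage hs.isOpen (chartAt HP p₁).open_source

include hs in
lemma IsSection.smooth_chart (z : M) (p₁ : P) : SmoothOn (fun y => ch IP p₁ (s (ich I z y)))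
      ((ch I z).target ∩ ich I z ⁻¹' (U ∩ s ⁻¹' (chartAt HP p₁).source)) := by
  refine smooth_comp_symm (f := fun x => ch IP p₁ (s x)) ?_ z
  exact (contMDiffOn_extChartAt (x := p₁) (n := ∞)).comp (hs.smooth.mono inter_subset_left)
    fun x hx => hx.2

lemma smooth_fderivWithin_range {E : Type*} [NormedAddCommGroup E] [NormedSpace ℝ E]
    {W : Set M} (hW : IsOpen W) {z : M} {f : Euc n → E}
    (hf : SmoothOn f (dom I z W)) :
    SmoothOn (fderivWithin ℝ f (range I)) (dom I z W) := fun y hy =>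
  (((hf y hy).mono_of_mem_nhdsWithin (dom_mem_nhds hy.1 hW hy.2)).fderivWithin_right
    I.uniqueDiffOn (by simp) (extChartAt_target_subset_range z hy.1)).mono
    (inter_subset_left.trans (extChartAt_target_subset_range z))

/-- Smoothness on the chart domain may be checked on the preimages of the charts of `P`. -/
lemma IsSection.smooth_of_charts (hs : Q.IsSection U s τ) {E : Type*} [NormedAddCommGroup E]
    [NormedSpace ℝ E] {z : M} {f : Euc n → E}
    (hf : ∀ p₁ : P, SmoothOn f ((ch I z).target ∩ ich I z ⁻¹' (U ∩ s ⁻¹' (chartAt HP p₁).source))) :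
    SmoothOn f (dom I z U) := by
  intro y hy
  set p₁ := s (ich I z y) with hp
  have hy' : y ∈ (ch I z).target ∩ ich I z ⁻¹' (U ∩ s ⁻¹' (chartAt HP p₁).source) :=
    ⟨hy.1, hy.2, mem_chart_source HP p₁⟩
  refine (hf p₁ y hy').mono_of_mem_nhdsWithin ?_
  exact nhdsWithin_mono _ (inter_subset_left.trans (extChartAt_target_subset_range z))
    (dom_mem_nhds hy.1 (hs.isOpen_inter_chart p₁) hy'.2)

lemma conn_frame (A : Form IP P (Euc d) 1) {p p₁ : P} (hp : p ∈ (chartAt HP p₁).source) :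
    toLin (locForm p₁ A (ch IP p₁ p)) = (conn A p).comp (fr IP p₁ p) := by
  have e : ich IP p₁ (ch IP p₁ p) = p := (ch IP p₁).left_inv (by simpa using hp)
  ext1 v
  rw [toLin_apply, ContinuousLinearMap.comp_apply, conn_apply]
  have : ∀ q, q = p → (A q).compContinuousLinearMap (frame IP p₁ q) ![v] =
      (A p : Alt m 1 (Euc d)) ![fr IP p₁ p v] := by
    rintro q rfl
    rw [ContinuousAlternatingMap.compContinuousLinearMap_apply]
    refine congrArg (A q : Alt m 1 (Euc d)) ?_
    funext j; rw [Subsingleton.elim j 0]; rfl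
  exact this _ e

lemma IsSection.smooth_locForm_comp (hs : Q.IsSection U s τ) {σ : Form IP P V k}
    (hσ : SmoothForm σ) (z : M) (p₁ : P) :
    SmoothOn (fun y => locForm p₁ σ (ch IP p₁ (s (ich I z y))))
      ((ch I z).target ∩ ich I z ⁻¹' (U ∩ s ⁻¹' (chartAt HP p₁).source)) :=
  (hσ p₁).comp (hs.smooth_chart z p₁) fun y hy => (ch IP p₁).map_source (by simpa using hy.2.2)

include hs hA in
lemma IsSection.smooth_gauge (z : M) : SmoothOn (fun y => gauge I A s z (ich I z y))
      (dom I z U) := by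
  refine hs.smooth_of_charts fun p₁ => ?_
  refine ((smooth_toLin (hs.smooth_locForm_comp hA.smooth z p₁)).clm_comp
    (smooth_fderivWithin_range (hs.isOpen_inter_chart p₁) (hs.smooth_chart z p₁))).congr
    fun y hy => ?_
  rw [conn_frame A hy.2.2, hasMFDerivAt_dsec_comp hy.1 rfl (hs.mdifferentiableAt hy.2.1) hy.2.2]
  ext1 v
  simp only [ContinuousLinearMap.comp_apply, fr_coframe hy.2.2]
  rfl

/-- The horizontal lift in charts, as the inverse of the projection and the connection form. -/
lemma hl_in_charts (hA : Q.IsConnection A) {p p₁ : P} {z : M} (hp : p ∈ (chartAt HP p₁).source)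
    (hz : Q.proj p ∈ (chartAt H z).source) :
    (((coframe I z (Q.proj p)).comp ((Q.dproj p).comp (fr IP p₁ p))).prod
      ((conn A p).comp (fr IP p₁ p))).IsInvertible ∧
    (coframe IP p₁ p).comp ((Q.hl A p).comp (fr I z (Q.proj p))) =
      (((coframe I z (Q.proj p)).comp ((Q.dproj p).comp (fr IP p₁ p))).prod
        ((conn A p).comp (fr IP p₁ p))).inverse.comp (ContinuousLinearMap.inl ℝ (Euc n) (Euc d)) := by
  set T := ((coframe I z (Q.proj p)).comp ((Q.dproj p).comp (fr IP p₁ p))).prod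
    ((conn A p).comp (fr IP p₁ p)) with hT
  have hTv : ∀ v, T v = (coframe I z (Q.proj p) (Q.dproj p (fr IP p₁ p v)),
      conn A p (fr IP p₁ p v)) := fun v => rfl
  have hb := bijective_dproj_connection hA p
  have hTb : Function.Bijective T := by
    constructor
    · rw [injective_iff_map_eq_zero]
      intro v hv
      rw [hTv, Prod.mk_eq_zero] at hv
      have h1 : Q.dproj p (fr IP p₁ p v) = 0 := by
        exact (fr_coframe hz _).symm.trans ((congrArg (fr I z (Q.proj p)) hv.1).trans (map_zero _))
      have h2 := eq_zero_of_horizontal_of_vertical hA h1 hv.2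
      exact (coframe_fr hp v).symm.trans ((congrArg (coframe IP p₁ p) h2).trans (map_zero _))
    · rintro ⟨u, ξ⟩
      obtain ⟨v, hv⟩ := hb.2 (fr I z (Q.proj p) u, ξ)
      have hv1 := congrArg Prod.fst hv
      have hv2 := congrArg Prod.snd hv
      refine ⟨coframe IP p₁ p v, ?_⟩
      rw [hTv, fr_coframe hp]
      refine Prod.ext ?_ hv2
      exact (congrArg (coframe I z (Q.proj p)) hv1).trans (coframe_fr hz u)
  set e := ContinuousLinearEquiv.ofBijective T (LinearMap.ker_eq_bot.2 hTb.1)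
    (LinearMap.range_eq_top.2 hTb.2) with he
  have hTe : T = (e : Euc m →L[ℝ] Euc n × Euc d) := by ext1 v; rfl
  refine ⟨⟨e, hTe.symm⟩, ?_⟩
  have h1 : T.inverse = (e.symm : Euc n × Euc d →L[ℝ] Euc m) := by
    rw [hTe, ContinuousLinearMap.inverse_equiv]
  ext1 u
  rw [h1]
  change coframe IP p₁ p (Q.hl A p (fr I z (Q.proj p) u)) = e.symm (u, 0)
  rw [ContinuousLinearEquiv.eq_symm_apply]
  change T _ = _
  obtain ⟨h3, h4⟩ := dproj_connection_hlift hA p (fr I z (Q.proj p) u)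
  rw [hTv, fr_coframe hp, h3, h4, coframe_fr hz]

lemma locP_curvature (A : Form IP P (Euc d) 1) {p p₁ : P} (hp : p ∈ (chartAt HP p₁).source)
    (z : M) : Q.locP z (Q.curvature A) p =
      (locForm p₁ (extD A) (ch IP p₁ p)).compContinuousLinearMap
        ((coframe IP p₁ p).comp ((Q.hl A p).comp (fr I z (Q.proj p)))) := by
  have e : ich IP p₁ (ch IP p₁ p) = p := (ch IP p₁).left_inv (by simpa using hp)
  have : ∀ q, q = p → (extD A q).compContinuousLinearMap (frame IP p₁ q) =
      (extD A p : Alt m 2 (Euc d)).compContinuousLinearMap (fr IP p₁ p) := by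
    rintro q rfl; rfl
  unfold locForm
  refine Eq.trans ?_ (congrArg (fun α : Alt m 2 (Euc d) => α.compContinuousLinearMap
    ((coframe IP p₁ p).comp ((Q.hl A p).comp (fr I z (Q.proj p))))) (this _ e)).symm
  ext w : 1
  change (extD A p : Alt m 2 (Euc d)) (fun j => Q.hl A p (fr I z (Q.proj p) (w j))) =
    (extD A p : Alt m 2 (Euc d))
    (fun j => fr IP p₁ p (coframe IP p₁ p (Q.hl A p (fr I z (Q.proj p) (w j)))))
  simp only [fr_coframe hp]

include hs hA in
/-- The curvature along a section is smooth. -/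
lemma IsSection.smooth_curvature (z : M) : SmoothOn (secForm (Q.curvature A) s z) (dom I z U) := by
  refine hs.smooth_of_charts fun p₁ => ?_
  set D := (ch I z).target ∩ ich I z ⁻¹' (U ∩ s ⁻¹' (chartAt HP p₁).source) with hD
  have hW : IsOpen (Q.proj ⁻¹' (chartAt H z).source) :=
    (chartAt H z).open_source.preimage Q.smooth_proj.continuous
  -- the projection and its derivative in the charts at `p₁` and `z`
  have hpr : SmoothOn (fun q => ch I z (Q.proj (ich IP p₁ q)))
      ((ch IP p₁).target ∩ ich IP p₁ ⁻¹' (Q.proj ⁻¹' (chartAt H z).source)) :=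
    smooth_comp_symm (f := fun q => ch I z (Q.proj q))
      ((contMDiffOn_extChartAt (x := z) (n := ∞)).comp Q.smooth_proj.contMDiffOn fun q hq => hq) p₁
  have hmaps : MapsTo (fun y => ch IP p₁ (s (ich I z y))) D
      ((ch IP p₁).target ∩ ich IP p₁ ⁻¹' (Q.proj ⁻¹' (chartAt H z).source)) := by
    intro y hy
    refine ⟨(ch IP p₁).map_source (by simpa using hy.2.2), ?_⟩
    rw [mem_preimage, (ch IP p₁).left_inv (by simpa using hy.2.2), mem_preimage,
      hs.proj_section _ hy.2.1]
    exact symm_mem_source hy.1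
  have h1 := (smooth_fderivWithin_range hW hpr).comp (hs.smooth_chart z p₁) hmaps
  have h2 := smooth_toLin (hs.smooth_locForm_comp hA.smooth z p₁)
  have hz : ∀ y ∈ D, Q.proj (s (ich I z y)) ∈ (chartAt H z).source := fun y hy => by
    rw [hs.proj_section _ hy.2.1]; exact symm_mem_source hy.1
  have h1' : SmoothOn (fun y => (coframe I z (Q.proj (s (ich I z y)))).comp
      ((Q.dproj (s (ich I z y))).comp (fr IP p₁ (s (ich I z y))))) D := by
    refine h1.congr fun y hy => ?_
    have e : ich IP p₁ (ch IP p₁ (s (ich I z y))) =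
      s (ich I z y) := (ch IP p₁).left_inv (by simpa using hy.2.2)
    have h3 := (hasFDerivWithinAt_in_charts (hmaps hy).1
      (mdifferentiableAt_proj (Q := Q) _) (by rw [e]; exact hz y hy)).fderivWithin
      (IP.uniqueDiffOn _ (extChartAt_target_subset_range p₁ (hmaps hy).1))
    have h4 : ∀ q, q = s (ich I z y) →
        (coframe I z (Q.proj q)).comp ((mfderiv IP I Q.proj q : Euc m →L[ℝ] Euc n).comp
          (frame IP p₁ q : Lin m)) =
        (coframe I z (Q.proj (s (ich I z y)))).comp
      ((Q.dproj (s (ich I z y))).comp (fr IP p₁ (s (ich I z y)))) := by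
      rintro q rfl; rfl
    exact (h3.trans (h4 _ e)).symm
  have h2' : SmoothOn (fun y => (conn A (s (ich I z y))).comp (fr IP p₁ (s (ich I z y)))) D :=
    h2.congr fun y hy => (conn_frame A hy.2.2).symm
  have h3 : SmoothOn (fun y => (coframe IP p₁ (s (ich I z y))).comp
      ((Q.hl A (s (ich I z y))).comp (fr I z (Q.proj (s (ich I z y)))))) D := by
    refine ContDiffOn.congr (f := fun y => ((((coframe I z (Q.proj (s (ich I z y)))).comp
      ((Q.dproj (s (ich I z y))).comp (fr IP p₁ (s (ich I z y))))).prod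
      ((conn A (s (ich I z y))).comp
      (fr IP p₁ (s (ich I z y)))))).inverse.comp
      (ContinuousLinearMap.inl ℝ (Euc n) (Euc d))) ?_
      fun y hy => (hl_in_charts hA hy.2.2 (hz y hy)).2
    refine ContDiffOn.clm_comp (fun y hy => ?_) contDiffOn_const
    obtain ⟨e, he⟩ := (hl_in_charts hA hy.2.2 (hz y hy)).1
    have h5 := contDiffAt_map_inverse (n := ∞) e
    rw [he] at h5
    have h6 : ContDiffOn ℝ ∞ (fun y => ((coframe I z (Q.proj (s (ich I z y)))).comp
      ((Q.dproj (s (ich I z y))).comp (fr IP p₁ (s (ich I z y))))).prod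
      ((conn A (s (ich I z y))).comp
      (fr IP p₁ (s (ich I z y))))) D := contDiffOn_clm_apply.2 fun v =>
        (h1'.clm_apply contDiffOn_const).prodMk (h2'.clm_apply contDiffOn_const)
    exact ContDiffAt.comp_contDiffWithinAt y h5 (h6 y hy)
  refine ContDiffOn.congr (f := fun y =>
    (locForm p₁ (extD A) (ch IP p₁ (s (ich I z y)))).compContinuousLinearMap
      ((coframe IP p₁ (s (ich I z y))).comp
      ((Q.hl A (s (ich I z y))).comp (fr I z (Q.proj (s (ich I z y))))))) ?_ fun y hy => ?_
  · exact fun y hy => ContDiffWithinAt.form_comp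
      (hs.smooth_locForm_comp hA.smooth.extD z p₁ y hy) (h3 y hy)
  · exact locP_curvature A hy.2.2 z

/-! #### The exterior covariant derivative in a gauge -/

lemma valForm_extCov (A : Form IP P (Euc d) 1) (σ : Q.PForm (Euc d) k) {p : P} {x : M}
    (h : Q.proj p = x) : Q.valForm (Q.extCov A σ) p =
      alternatizeUncurryFin ((Q.dlocP x σ p).comp (Q.hl A p)) := by
  subst h; rfl

section Sections

include hs

lemma IsSection.locP_eq (σ : Q.PForm V k) {x : M} (hx : x ∈ U) (z : M) :
    Q.locP z σ (s x) = (Q.valForm σ (s x)).compContinuousLinearMap (fr I z x) :=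
  locP_of_proj_eq σ (hs.proj_section x hx) z

lemma IsSection.secForm_eq_comp (σ : Q.PForm V k) {z x : M}
    (hy : y ∈ transDom I z x) (hyU : ich I z y ∈ U) :
    secForm σ s z y = (secForm σ s x (chartTrans I z x y)).compContinuousLinearMap
      (fderivWithin ℝ (chartTrans I z x) (range I) y) := by
  unfold secForm
  rw [chartTrans_symm hy, hs.locP_eq σ hyU, hs.locP_eq σ hyU]
  have h : fr I z (ich I z y) = (fr I x (ich I z y)).comp
      (fderivWithin ℝ (chartTrans I z x) (range I) y) := (frame_comp_fderivWithin hy).symm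
  rw [h]
  rfl

include hA

lemma IsSection.valForm_extCov {σ : Q.PForm (Euc d) k} (hσ : Q.IsAdForm σ) {x : M} (hx : x ∈ U) :
    Q.valForm (Q.extCov A σ) (s x) = extDerivWithin (secForm σ s x) (range I) (ch I x x) +
        wedge (adRep G) (ofLin (gauge I A s x x)) (secForm σ s x (ch I x x)) := by
  rw [PrincipalBundle.valForm_extCov A σ (hs.proj_section x hx)]
  have h := hs.dlocP_hl hA hσ (mem_extChartAt_target (I := I) x) (extChartAt_to_inv x) hx
  rw [fr_self, ContinuousLinearMap.comp_id] at h
  rw [h, alternatizeUncurryFin_add]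
  rfl

/-- In a gauge, the exterior covariant derivative is `dσ + [Â ∧ σ]`. -/
lemma IsSection.secForm_extCov {σ : Q.PForm (Euc d) k} (hσ : Q.IsAdForm σ) {z : M}
    (hy : y ∈ dom I z U) :
    secForm (Q.extCov A σ) s z y = extDerivWithin (secForm σ s z) (range I) y +
      wedge (adRep G) (ofLin (gauge I A s z (ich I z y))) (secForm σ s z y) := by
  obtain ⟨x, hx⟩ : ∃ x, ich I z y = x := ⟨_, rfl⟩
  have hxU : x ∈ U := hx ▸ hy.2
  have hd : y ∈ transDom I z x := ⟨hy.1, by rw [mem_preimage, hx]; exact mem_chart_source _ _⟩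
  have ey : chartTrans I z x y = ch I x x := by unfold chartTrans; rw [Function.comp_apply, hx]
  have hfr : fderivWithin ℝ (chartTrans I z x) (range I) y = fr I z x := by
    have h := frame_eq_fderivWithin hy.1
    rw [hx] at h
    exact h.symm
  have hyx : ch I x x ∈ dom I x U :=
    ⟨mem_extChartAt_target x, by rw [mem_preimage, extChartAt_to_inv]; exact hxU⟩
  have hT := dom_mem_nhds hy.1 hs.isOpen hy.2
  have h := extDerivWithin_eq_comp (R := range I) (R' := range I) (f := chartTrans I z x)
    (x := y) (α := secForm σ s x) (σ := secForm σ s z) I.uniqueDiffOn I.range_subset_closure_interior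
    (extChartAt_target_subset_range z hy.1) (by
      rw [ey]
      exact ((hs.smooth_secForm hσ x _ hyx).differentiableWithinAt (by simp)).mono_of_mem_nhdsWithin
        (dom_mem_nhds hyx.1 hs.isOpen hyx.2)) (smoothAt_chartTrans hd)
    (eventually_of_mem (transDom_mem_nhds hd) fun w hw =>
      extChartAt_target_subset_range x (chartTrans_mem hw))
    (by
      filter_upwards [transDom_mem_nhds hd, hT] with w hw hwT
      exact hs.secForm_eq_comp σ hw hwT.2)
  rw [h, hs.secForm_eq_comp _ hd hy.2, hs.secForm_eq_comp σ hd hy.2, hfr, ey, hx]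
  have e : secForm (Q.extCov A σ) s x (ch I x x) = Q.valForm (Q.extCov A σ) (s x) := by
    unfold secForm
    rw [extChartAt_to_inv, locP_self _ (hs.proj_section x hxU)]
  rw [e, hs.valForm_extCov hA hσ hxU]
  have h2 := wedge_comp (adRep G) (ofLin (gauge I A s x x)) (secForm σ s x (ch I x x)) (fr I z x)
  have h3 : (ofLin (gauge I A s x x)).compContinuousLinearMap (fr I z x) =
      ofLin (gauge I A s z x) := by
    ext w
    rw [ContinuousAlternatingMap.compContinuousLinearMap_apply, ofLin_apply, ofLin_apply]
    unfold gauge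
    rw [fr_self]
    rfl
  rw [h3] at h2
  rw [← h2]
  rfl

lemma IsSection.smooth_extCov {σ : Q.PForm (Euc d) k} (hσ : Q.IsAdForm σ) (z : M) :
    SmoothOn (secForm (Q.extCov A σ) s z) (dom I z U) :=
  ((smooth_extDerivWithin hs.isOpen (hs.smooth_secForm hσ z)).add
    (smooth_wedge _ (smooth_ofLin (hs.smooth_gauge hA z))
      (hs.smooth_secForm hσ z))).congr fun _ hy => hs.secForm_extCov hA hσ hy

end Sections

/-! #### Equivariance -/

lemma valForm_extCov_act {A : Form IP P (Euc d) 1} (hA : Q.IsConnection A)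
    {σ : Q.PForm (Euc d) k} (hσ : Q.IsAdForm σ) (p : P) (a : G) :
    Q.valForm (Q.extCov A σ) (Q.act p a) =
      (Ad a⁻¹).compContinuousAlternatingMap (Q.valForm (Q.extCov A σ) p) := by
  have hz : Q.proj p ∈ (chartAt H (Q.proj p)).source := mem_chart_source _ _
  have hz' : Q.proj (Q.act p a) ∈ (chartAt H (Q.proj p)).source := by rwa [Q.proj_act]
  rw [valForm_extCov A σ (Q.proj_act p a), valForm_extCov A σ (rfl : Q.proj p = _),
    ← alternatizeUncurryFin_clm]
  congr 1
  let L := compContinuousAlternatingMapCLM ℝ (Euc n) (Euc d) (Euc d) (Fin k) (Ad a⁻¹)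
  have h1 := (hasMFDerivAt_locP hσ (rfl : Q.act p a = _) hz').comp p (hasMFDerivAt_dact a p)
  have h2 := HasMFDerivAt.comp (f := Q.locP (Q.proj p) σ) (g := L) p
    L.hasMFDerivAt (hasMFDerivAt_locP hσ (rfl : p = _) hz)
  have e : Q.locP (Q.proj p) σ ∘ (fun q => Q.act q a) = L ∘ Q.locP (Q.proj p) σ := by
    funext q
    exact locP_act (valForm_act hσ q a) _
  rw [e] at h1
  have h3 := hasMFDerivAt_unique h1 h2
  ext1 u
  rw [ContinuousLinearMap.comp_apply, hlift_act hA]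
  exact congrArg (fun f : Euc m →L[ℝ] Alt n k (Euc d) => f (Q.hl A p u)) h3

lemma locForm_conn_apply (A : Form IP P (Euc d) 1) {p p₁ : P} (hp : p ∈ (chartAt HP p₁).source)
    (w : Fin 1 → Euc m) :
    locForm p₁ A (ch IP p₁ p) w = conn A p (fr IP p₁ p (w 0)) := by
  have h := congrArg (fun f : Euc m →L[ℝ] Euc d => f (w 0)) (conn_frame A hp)
  simp only [toLin_apply] at h
  have e : w = ![w 0] := by funext j; rw [Subsingleton.elim j 0]; rfl
  rw [e]
  exact h

lemma extD_connection_act {A : Form IP P (Euc d) 1} (hA : Q.IsConnection A) (p : P) (a : G) :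
    (extD A (Q.act p a) : Alt m 2 (Euc d)).compContinuousLinearMap (Q.dact a p) =
      (Ad a⁻¹).compContinuousAlternatingMap (extD A p : Alt m 2 (Euc d)) := by
  set p₁ := Q.act p a with hp₁
  set f : Euc m → Euc m := fun y => ch IP p₁ (Q.act (ich IP p y) a) with hf
  set y₀ := ch IP p p with hy₀
  have hy₀t : y₀ ∈ (ch IP p).target := mem_extChartAt_target p
  have hsy : ich IP p y₀ = p := extChartAt_to_inv p
  have hfy : f y₀ = ch IP p₁ p₁ := by rw [hf]; simp only [hsy]; rfl
  set W : Set P := (fun q => Q.act q a) ⁻¹' (chartAt HP p₁).source with hW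
  have hWo : IsOpen W := (chartAt HP p₁).open_source.preimage (contMDiff_act_right a).continuous
  have hpW : ich IP p y₀ ∈ W := by rw [hsy]; exact mem_chart_source HP p₁
  have hT := dom_mem_nhds hy₀t hWo hpW
  have hfd : SmoothOn f (dom IP p W) := smooth_comp_symm (f := fun q => ch IP p₁ (Q.act q a))
      ((contMDiffOn_extChartAt (x := p₁) (n := ∞)).comp (contMDiff_act_right a).contMDiffOn
        fun q hq => hq) p
  have hder : ∀ y ∈ dom IP p W,
      fderivWithin ℝ f (range IP) y = (coframe IP p₁ (Q.act (ich IP p y) a)).comp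
        ((Q.dact a (ich IP p y)).comp (fr IP p (ich IP p y))) :=
    fun y hy => (hasFDerivWithinAt_in_charts hy.1
      ((contMDiff_act_right a).mdifferentiableAt (by simp)) hy.2).fderivWithin
      (IP.uniqueDiffOn y (extChartAt_target_subset_range p hy.1))
  let L := compContinuousAlternatingMapCLM ℝ (Euc m) (Euc d) (Euc d) (Fin 1) (Ad a⁻¹)
  have h := extDerivWithin_eq_comp (R := range IP) (R' := range IP) (f := f)
    (x := y₀) (α := locForm p₁ A) (σ := fun y => L (locForm p A y)) IP.uniqueDiffOn
    IP.range_subset_closure_interior (extChartAt_target_subset_range p hy₀t) (by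
      rw [hfy]
      exact hA.smooth.differentiableWithinAt (mem_extChartAt_target p₁))
    ((hfd y₀ ⟨hy₀t, hpW⟩).mono_of_mem_nhdsWithin hT)
    (eventually_of_mem hT fun w hw => extChartAt_target_subset_range p₁
      ((ch IP p₁).map_source (by rw [extChartAt_source]; exact hw.2)))
    (by
      filter_upwards [hT] with w hw
      obtain ⟨q, hq⟩ : ∃ q, ich IP p w = q := ⟨_, rfl⟩
      have hqs : q ∈ (chartAt HP p).source := hq ▸ symm_mem_source hw.1
      have hwq : w = ch IP p q := by rw [← hq, (ch IP p).right_inv hw.1]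
      rw [hder w hw]
      have hfw : f w = ch IP p₁ (Q.act q a) := by rw [hf]; simp only [hq]
      have hqa : Q.act q a ∈ (chartAt HP p₁).source := hq ▸ hw.2
      ext v : 1
      rw [hfw, hq, ContinuousAlternatingMap.compContinuousLinearMap_apply, locForm_conn_apply A hqa]
      change Ad a⁻¹ (locForm p A w v) = conn A (Q.act q a) (fr IP p₁ (Q.act q a)
        (coframe IP p₁ (Q.act q a) (Q.dact a q (fr IP p q (v 0)))))
      rw [fr_coframe hqa, connection_dact hA, hwq, locForm_conn_apply A hqs])
  have h2 : extDerivWithin (fun y => L (locForm p A y)) (range IP) y₀ =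
      (Ad a⁻¹).compContinuousAlternatingMap (extDerivWithin (locForm p A) (range IP) y₀) := by
    unfold extDerivWithin
    rw [← alternatizeUncurryFin_clm]
    congr 1
    exact (L.hasFDerivAt.comp_hasFDerivWithinAt y₀
      (hA.smooth.differentiableWithinAt hy₀t).hasFDerivWithinAt).fderivWithin
      (IP.uniqueDiffOn y₀ (extChartAt_target_subset_range p hy₀t))
  rw [h2, hder y₀ ⟨hy₀t, hpW⟩, hfy, hsy, coframe_self, fr_self] at h
  exact h.symm

lemma valForm_curvature_act {A : Form IP P (Euc d) 1} (hA : Q.IsConnection A) (p : P) (a : G) :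
    Q.valForm (Q.curvature A) (Q.act p a) =
      (Ad a⁻¹).compContinuousAlternatingMap (Q.valForm (Q.curvature A) p) := by
  have h := extD_connection_act hA p a
  have h1 : Q.valForm (Q.curvature A) (Q.act p a) =
    (extD A (Q.act p a) : Alt m 2 (Euc d)).compContinuousLinearMap
      ((Q.dact a p).comp (Q.hl A p)) := by
    ext w : 1
    change (extD A (Q.act p a) : Alt m 2 (Euc d)) (fun j => Q.hl A (Q.act p a) (w j)) =
      (extD A (Q.act p a) : Alt m 2 (Euc d)) (fun j => Q.dact a p (Q.hl A p (w j)))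
    simp only [hlift_act hA]
  rw [h1]
  exact congrArg (fun α : Alt m 2 (Euc d) => α.compContinuousLinearMap (Q.hl A p)) h

lemma wedge_lieBr_Ad (a : G) (α : Alt n 1 (Euc d)) (β : Alt n k (Euc d)) :
    wedge (lieBr G) ((Ad a).compContinuousAlternatingMap α) ((Ad a).compContinuousAlternatingMap β) =
      (Ad a).compContinuousAlternatingMap (wedge (lieBr G) α β) := by
  ext w : 1
  rw [ContinuousLinearMap.compContinuousAlternatingMap_coe, Function.comp_apply, wedge_apply,
    wedge_apply, map_sum]
  refine sum_ext fun i => ?_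
  rw [map_zsmul, Ad_lieBr]
  rfl

lemma wedge_killing_Ad (a : G) (α : Alt n 1 (Euc d)) (β : Alt n k (Euc d)) :
    wK G ((Ad a).compContinuousAlternatingMap α)
      ((Ad a).compContinuousAlternatingMap β) = wK G α β := by
  ext w : 1
  rw [wedge_apply, wedge_apply]
  refine sum_ext fun i => ?_
  congr 1
  exact killing_Ad a _ _

section Fields

variable {ϑ : Q.PForm (Euc d) 1} (hϑ : Q.IsAdForm ϑ)

lemma valForm_fieldF (A : Form IP P (Euc d) 1) (ϑ : Q.PForm (Euc d) 1) (p : P) :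
    Q.valForm (Q.fieldF A ϑ) p = Q.valForm (Q.curvature A) p + Q.valForm (Q.extCov A ϑ) p +
      (1 / 2 : ℝ) • wedge (lieBr G) (Q.valForm ϑ p) (Q.valForm ϑ p) := rfl

include hA hϑ

lemma valForm_fieldF_act (p : P) (a : G) : Q.valForm (Q.fieldF A ϑ) (Q.act p a) =
      (Ad a⁻¹).compContinuousAlternatingMap (Q.valForm (Q.fieldF A ϑ) p) := by
  rw [valForm_fieldF, valForm_fieldF, valForm_curvature_act hA, valForm_extCov_act hA hϑ,
    valForm_act hϑ, wedge_lieBr_Ad]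
  ext w
  simp

/-- The Chern-Simons form does not depend on the point of the fibre. -/
lemma valForm_chernSimons_act (p : P) (a : G) :
    Q.valForm (Q.chernSimons A ϑ) (Q.act p a) = Q.valForm (Q.chernSimons A ϑ) p := by
  have h : ∀ q, Q.valForm (Q.chernSimons A ϑ) q =
      wK G (Q.valForm ϑ q) (Q.valForm (Q.extCov A ϑ) q) + (1 / 3 : ℝ) •
      wK G (Q.valForm ϑ q) (wedge (lieBr G) (Q.valForm ϑ q) (Q.valForm ϑ q)) :=
    fun q => rfl
  rw [h, h, valForm_act hϑ, valForm_extCov_act hA hϑ, wedge_lieBr_Ad, wedge_killing_Ad,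
    wedge_killing_Ad]

lemma valForm_wedgeKilling_curvature_act (p : P) (a : G) :
    Q.valForm (Q.wedgeKilling ϑ (Q.curvature A)) (Q.act p a) =
      Q.valForm (Q.wedgeKilling ϑ (Q.curvature A)) p := by
  have h : ∀ q, Q.valForm (Q.wedgeKilling ϑ (Q.curvature A)) q =
      wK G (Q.valForm ϑ q) (Q.valForm (Q.curvature A) q) := fun q => rfl
  rw [h, h, valForm_act hϑ, valForm_curvature_act hA, wedge_killing_Ad]

end Fields

/-! #### Expansion of the field strengths -/

lemma isAdForm_add_smul {σ σ' : Q.PForm (Euc d) k} (hσ : Q.IsAdForm σ) (hσ' : Q.IsAdForm σ')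
    (ε : ℝ) : Q.IsAdForm (σ + ε • σ') where
  equivariant p a w := by
    change σ (Q.act p a) w + ε • σ' (Q.act p a) w = Ad a⁻¹ (σ p w + ε • σ' p w)
    rw [map_add, map_smul]
    exact congrArg₂ (· + ·) (hσ.equivariant p a w) (congrArg (ε • ·) (hσ'.equivariant p a w))
  smooth x₀ := (hσ.smooth x₀).add 
    ((contDiff_const_smul (𝕜 := ℝ) (F := Alt n k (Euc d)) ε).contMDiff.comp_contMDiffOn
      (hσ'.smooth x₀))

lemma valForm_extCov_add_smul (A : Form IP P (Euc d) 1) {σ σ' : Q.PForm (Euc d) k}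
    (hσ : Q.IsAdForm σ) (hσ' : Q.IsAdForm σ') (ε : ℝ) (p : P) :
    Q.valForm (Q.extCov A (σ + ε • σ')) p =
      Q.valForm (Q.extCov A σ) p + ε • Q.valForm (Q.extCov A σ') p := by
  have hz : Q.proj p ∈ (chartAt H (Q.proj p)).source := mem_chart_source _ _
  rw [valForm_extCov A _ (rfl : Q.proj p = _), valForm_extCov A _ (rfl : Q.proj p = _),
    valForm_extCov A _ (rfl : Q.proj p = _), ← ContinuousAlternatingMap.alternatizeUncurryFin_smul,
    ← alternatizeUncurryFin_add]
  congr 1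
  have h1 := hasMFDerivAt_locP hσ (rfl : p = _) hz
  have h2 := hasMFDerivAt_locP hσ' (rfl : p = _) hz
  have h3 := hasMFDerivAt_locP (isAdForm_add_smul hσ hσ' ε) (rfl : p = _) hz
  have e : Q.locP (Q.proj p) (σ + ε • σ') = Q.locP (Q.proj p) σ + ε • Q.locP (Q.proj p) σ' := by
    funext q; ext w; rfl
  rw [e] at h3
  have h4 := hasMFDerivAt_unique h3 (h1.add (h2.const_smul ε))
  refine ContinuousLinearMap.ext fun u => ?_
  exact congrArg (fun f : Euc m →L[ℝ] Alt n k (Euc d) => f (Q.hl A p u)) h4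

variable {ϑ η : Q.PForm (Euc d) 1}

lemma valForm_fieldF_add_smul (A : Form IP P (Euc d) 1) (hϑ : Q.IsAdForm ϑ) (hη : Q.IsAdForm η)
    (ε : ℝ) (p : P) :
    Q.valForm (Q.fieldF A (ϑ + ε • η)) p = Q.valForm (Q.fieldF A ϑ) p +
      ε • (Q.valForm (Q.extCov A η) p + wedge (lieBr G) (Q.valForm ϑ p) (Q.valForm η p)) +
      (ε ^ 2 / 2) • wedge (lieBr G) (Q.valForm η p) (Q.valForm η p) := by
  rw [valForm_fieldF, valForm_fieldF, valForm_extCov_add_smul A hϑ hη]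
  have e : Q.valForm (ϑ + ε • η) p = Q.valForm ϑ p + ε • Q.valForm η p := rfl
  rw [e, wedge_add_smul_left, wedge_add_smul_right, wedge_add_smul_right,
    wedge_comm_of_skew lieBr_skew (Q.valForm η p) (Q.valForm ϑ p)]
  module

/-- The first variation of the terms of `H'₀` that depend on `ϑ`. -/
lemma hasDerivAt_chernSimons (hϑ : Q.IsAdForm ϑ) (hη : Q.IsAdForm η) (p : P) (w : Fin 3 → Euc n) :
    HasDerivAt (fun ε : ℝ => (1 / 2) * Q.valForm (Q.chernSimons A (ϑ + ε • η)) p w +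
        Q.valForm (Q.wedgeKilling (ϑ + ε • η) (Q.curvature A)) p w)
      ((1 / 2) * (wK G (Q.valForm ϑ p) (Q.valForm (Q.extCov A η) p) w -
        wK G (Q.valForm η p) (Q.valForm (Q.extCov A ϑ) p) w) +
        wK G (Q.valForm η p) (Q.valForm (Q.fieldF A ϑ) p) w) 0 := by
  set t := Q.valForm ϑ p with ht
  set h := Q.valForm η p with hh
  set Dt := Q.valForm (Q.extCov A ϑ) p with hDt
  set Dh := Q.valForm (Q.extCov A η) p with hDh
  set R := Q.valForm (Q.curvature A) p with hR
  have hswap := wedge_wedge_swap (κ := killingCLM G) (b := lieBr G) killingCLM_comm lieBr_skew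
    (fun x y z => killing_lieBr (G := G) x y z) t h
  have hsw := wedge_comm_of_skew (b := lieBr G) lieBr_skew h t
  have e1 : ∀ ε : ℝ, Q.valForm (Q.chernSimons A (ϑ + ε • η)) p =
      wK G (t + ε • h) (Dt + ε • Dh) + (1 / 3 : ℝ) •
        wK G (t + ε • h) (wedge (lieBr G) (t + ε • h) (t + ε • h)) := fun ε => by
    rw [hDt, hDh, ← valForm_extCov_add_smul A hϑ hη]
    rfl
  have e2 : ∀ ε : ℝ, Q.valForm (Q.wedgeKilling (ϑ + ε • η) (Q.curvature A)) p =
      wK G (t + ε • h) R := fun ε => rfl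
  have e3 : Q.valForm (Q.fieldF A ϑ) p = R + (1 : ℝ) • Dt + (1 / 2 : ℝ) • wedge (lieBr G) t t := by
    rw [one_smul]; rfl
  simp only [e1, e2, e3, wedge_add_smul_left, wedge_add_smul_right, hsw,
    ContinuousAlternatingMap.add_apply, ContinuousAlternatingMap.smul_apply, smul_eq_mul, hswap]
  have := hasDerivAt_cubic ((1 / 2) * (wK G t Dt w + 1 / 3 * wK G t (wedge (lieBr G) t t) w) +
      wK G t R w)
    ((1 / 2) * (wK G h Dt w + wK G t Dh w + wK G h (wedge (lieBr G) t t) w) + wK G h R w)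
    ((1 / 2) * (wK G h Dh w + (1 / 3) * (2 * wK G h (wedge (lieBr G) t h) w +
      wK G t (wedge (lieBr G) h h) w)))
    ((1 / 6) * wK G h (wedge (lieBr G) h h) w)
  refine (this.congr_deriv (by ring)).congr_of_eventuallyEq (Eventually.of_forall fun ε => ?_)
  simp only
  ring

/-! ### The Lagrangian in a chart and a gauge -/

variable (Q) in
/-- Tuples `(g, B, φ, ϑ)` of fields, or of variations `(h, C, ν, η)` of the fields. -/
abbrev Fields : Type _ := Bilin I M × Form I M ℝ 2 × (M → ℝ) × Q.PForm (Euc d) 1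

/-- Smoothness of a tuple of fields, symmetry of its bilinear form and equivariance of its
Lie algebra valued form. -/
structure IsSmoothFields (f : Q.Fields) : Prop where
  smooth_bilin : SmoothBilin f.1
  symm_bilin : SymmBilin f.1
  smooth_two : SmoothForm f.2.1
  smooth_scalar : ContMDiff I 𝓘(ℝ, ℝ) ∞ f.2.2.1
  isAdForm : Q.IsAdForm f.2.2.2

/-- The integrand of the action. -/
def lagrangian (A : Form IP P (Euc d) 1) (H₀ : Form I M ℝ 3) (Λ : ℝ) (f : Q.Fields) (x : M) : ℝ :=
  exp (-2 * f.2.2.1 x) * (scalarCurv f.1 x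
      + (1 / 2) * adInner (G := G) f.1 x (Q.descend (Q.fieldF A f.2.2.2) x)
        (Q.descend (Q.fieldF A f.2.2.2) x)
      - (1 / 2) * formInner (f.1 x) (Q.fieldH0 A H₀ f.2.1 f.2.2.2 x)
        (Q.fieldH0 A H₀ f.2.1 f.2.2.2 x)
      + 4 * formInner (f.1 x) (dFun (I := I) f.2.2.1 x) (dFun (I := I) f.2.2.1 x) - 2 * Λ)

/-- The components of the three-form field in the chart at `z`. -/
def locH (A : Form IP P (Euc d) 1) (H₀ : Form I M ℝ 3) (z : M) (f : Q.Fields) (y : Euc n) :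
    Alt n 3 ℝ :=
  locForm z (Q.fieldH0 A H₀ f.2.1 f.2.2.2) y

/-- The components of the gauge field strength in the chart at `z`, along a section. -/
def locF (A : Form IP P (Euc d) 1) (s : M → P) (z : M) (f : Q.Fields) (y : Euc n) :
    Alt n 2 (Euc d) :=
  secForm (Q.fieldF A f.2.2.2) s z y

lemma smooth_add_smul {a b : Euc n → V} {S : Set (Euc n)} (ha : SmoothOn a S)
    (hb : SmoothOn b S) (ε : ℝ) : SmoothOn (fun y => a y + ε • b y) S :=
  ha.add (contDiffOn_const.smul hb)

lemma smoothBilin_add_smul {g h : Bilin I M} (hg : SmoothBilin g) (hh : SmoothBilin h) (ε : ℝ) :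
    SmoothBilin (g + ε • h) := fun x₀ =>
  smooth_add_smul (hg x₀) (hh x₀) ε

lemma symmBilin_add_smul {g h : Bilin I M} (hg : SymmBilin g) (hh : SymmBilin h) (ε : ℝ) :
    SymmBilin (g + ε • h) := fun x X Y => by
  change g x X Y + ε • h x X Y = g x Y X + ε • h x Y X
  rw [hg x X Y, hh x X Y]

lemma smoothForm_add_smul {σ σ' : Form I M V k} (hσ : SmoothForm σ) (hσ' : SmoothForm σ') (ε : ℝ) :
    SmoothForm (σ + ε • σ') := fun x₀ =>
  smooth_add_smul (hσ x₀) (hσ' x₀) ε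

lemma IsSmoothFields.add_smul {f v : Q.Fields} (hf : IsSmoothFields f) (hv : IsSmoothFields v)
    (ε : ℝ) : IsSmoothFields (f + ε • v) where
  smooth_bilin := smoothBilin_add_smul hf.smooth_bilin hv.smooth_bilin ε
  symm_bilin := symmBilin_add_smul hf.symm_bilin hv.symm_bilin ε
  smooth_two := smoothForm_add_smul hf.smooth_two hv.smooth_two ε
  smooth_scalar := hf.smooth_scalar.add
    ((contDiff_const_smul (𝕜 := ℝ) (F := ℝ) ε).contMDiff.comp hv.smooth_scalar)
  isAdForm := isAdForm_add_smul hf.isAdForm hv.isAdForm ε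

lemma scalarCurv_eq_scalarLoc_univ' {g : Bilin I M} (hs : SmoothBilin g) (hsym : SymmBilin g)
    {z : M} (hy : y ∈ interior (ch I z).target)
    (hd : (gram (locBilin z g y)).det ≠ 0) :
    scalarCurv g (ich I z y) = scalarLoc univ (locBilin z g) y := by
  set W := (chartAt H z).source ∩
    ch I z ⁻¹' {y | y ∈ (ch I z).target → (gram (locBilin z g y)).det ≠ 0} with hW
  have hdet : ContinuousOn (fun x => (gram (locBilin z g (ch I z x))).det)
      (chartAt H z).source := by
    have h1 : ContinuousOn (fun y => (gram (locBilin z g y)).det) (ch I z).target :=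
      fun y hy => (smoothAt_det fun i j => ((hs z y hy).clm_apply
        contDiffWithinAt_const).clm_apply contDiffWithinAt_const).continuousWithinAt
    rw [← extChartAt_source I]
    exact h1.comp (continuousOn_extChartAt z) (ch I z).mapsTo
  have hWo : IsOpen W := by
    have := hdet.isOpen_inter_preimage (chartAt H z).open_source isOpen_ne (t := {r | r ≠ 0})
    convert this using 1
    ext x
    simp only [hW, mem_inter_iff, mem_preimage, mem_ofPred_eq]
    refine and_congr_right fun hx => ⟨fun h => h ((ch I z).map_source (by simpa using hx)),
      fun h _ => h⟩
  refine scalarCurv_eq_scalarLoc_univ hWo hs hsym (fun x hx => ?_) ⟨hy, ?_⟩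
  · have hxs : x ∈ (ch I z).source := by simpa using hx.1.1
    have h1 := hx.1.2 ((ch I z).map_source hxs)
    have h2 : (gram (locBilin z g (ch I z x))).det = _ :=
      det_gram_pullBilin (g (ich I z (ch I z x))) _
    rw [h2, (ch I z).left_inv hxs] at h1
    exact right_ne_zero_of_mul h1
  · refine ⟨symm_mem_source (interior_subset hy), fun _ => ?_⟩
    rwa [(ch I z).right_inv (interior_subset hy)]

lemma pairing_killing_Ad (b : Bil n) (a : G) (α β : Alt n k (Euc d)) :
    pairing b (killing G) ((Ad a).compContinuousAlternatingMap α)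
      ((Ad a).compContinuousAlternatingMap β) = pairing b (killing G) α β := by
  unfold pairing
  simp only [ContinuousLinearMap.compContinuousAlternatingMap_coe, Function.comp_apply, killing_Ad]

section Sections

include hs

lemma IsSection.pt_eq {x : M} (hx : x ∈ U) : Q.pt x = Q.act (s x) (τ (Q.pt x)) := by
  have h : Q.proj (Q.pt x) = x := Function.surjInv_eq Q.proj_surjective x
  have h2 := hs.act_section (Q.pt x) (by rwa [h])
  rw [h] at h2
  exact h2.symm

lemma IsSection.descend_eq {σ : Q.PForm V k}
    (hσ : ∀ p a, Q.valForm σ (Q.act p a) = Q.valForm σ p) {x : M} (hx : x ∈ U) :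
    (Q.descend σ x : Alt n k V) = Q.valForm σ (s x) := by
  have h : Q.valForm σ (Q.pt x) = Q.valForm σ (s x) := by rw [hs.pt_eq hx, hσ]
  exact h

lemma IsSection.adInner_fieldF {A : Form IP P (Euc d) 1} (hA : Q.IsConnection A)
    {ϑ : Q.PForm (Euc d) 1} (hϑ : Q.IsAdForm ϑ) (g : Bilin I M) {x : M} (hx : x ∈ U) :
    adInner (G := G) g x (Q.descend (Q.fieldF A ϑ) x) (Q.descend (Q.fieldF A ϑ) x) =
      pairing (g x : Bil n) (killing G) (Q.valForm (Q.fieldF A ϑ) (s x))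
        (Q.valForm (Q.fieldF A ϑ) (s x)) := by
  have h : Q.valForm (Q.fieldF A ϑ) (Q.pt x) = _ :=
    (congrArg (Q.valForm (Q.fieldF A ϑ)) (hs.pt_eq hx)).trans
      (valForm_fieldF_act hA hϑ (s x) (τ (Q.pt x)))
  refine Eq.trans (b := pairing (g x : Bil n) (killing G)
    (Q.valForm (Q.fieldF A ϑ) (Q.pt x)) (Q.valForm (Q.fieldF A ϑ) (Q.pt x))) rfl ?_
  rw [h]
  exact pairing_killing_Ad (g x : Bil n) _ _ _

variable {H₀ : Form I M ℝ 3}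
  (hH₀ : SmoothForm H₀) {f v : Q.Fields} (hf : IsSmoothFields f) (hv : IsSmoothFields v)

include hA hf

lemma IsSection.locF_eq {z : M} (hy : y ∈ dom I z U) :
    locF A s z f y = secForm (Q.curvature A) s z y + secForm (Q.extCov A f.2.2.2) s z y +
      (1 / 2 : ℝ) • wedge (lieBr G) (secForm f.2.2.2 s z y) (secForm f.2.2.2 s z y) := by
  unfold locF secForm
  rw [hs.locP_eq _ hy.2, hs.locP_eq _ hy.2, hs.locP_eq _ hy.2, hs.locP_eq _ hy.2, valForm_fieldF,
    ← wedge_comp]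
  rfl

lemma IsSection.locH_eq {z : M} (hy : y ∈ dom I z U) :
    locH A H₀ z f y = locForm z H₀ y + extDerivWithin (locForm z f.2.1) (range I) y -
      ((1 / 2 : ℝ) • Q.valForm (Q.chernSimons A f.2.2.2) (s (ich I z y)) +
        Q.valForm (Q.wedgeKilling f.2.2.2 (Q.curvature A)) (s (ich I z y))).compContinuousLinearMap
        (fr I z (ich I z y)) := by
  rw [← locForm_extD hf.smooth_two hy.1,
    ← hs.descend_eq (valForm_chernSimons_act hA hf.isAdForm) hy.2,
    ← hs.descend_eq (valForm_wedgeKilling_curvature_act hA hf.isAdForm) hy.2]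
  ext w
  unfold locH locForm fieldH0
  simp only [ContinuousAlternatingMap.compContinuousLinearMap_apply]
  exact sub_sub _ _ _

lemma IsSection.locH_eq_wedge {z : M} (hy : y ∈ dom I z U) :
    locH A H₀ z f y = locForm z H₀ y + extDerivWithin (locForm z f.2.1) (range I) y -
    ((1 / 2 : ℝ) • (wK G (secForm f.2.2.2 s z y)
      (secForm (Q.extCov A f.2.2.2) s z y) + (1 / 3 : ℝ) • wK G
      (secForm f.2.2.2 s z y) (wedge (lieBr G) (secForm f.2.2.2 s z y) (secForm f.2.2.2 s z y))) +
      wK G (secForm f.2.2.2 s z y) (secForm (Q.curvature A) s z y)) := by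
  rw [hs.locH_eq hA hf hy]
  unfold secForm
  rw [hs.locP_eq f.2.2.2 hy.2, hs.locP_eq (Q.extCov A _) hy.2, hs.locP_eq (Q.curvature A) hy.2,
    ← wedge_comp, ← wedge_comp, ← wedge_comp, ← wedge_comp]
  rfl

/-- The Lagrangian in a chart and a gauge, where the metric is nondegenerate. -/
lemma IsSection.lagrangian_eq (Λ : ℝ) {z : M} (hy : y ∈ coordDom I z U)
    (hd : (gram (locBilin z f.1 y)).det ≠ 0) :
    lagrangian A H₀ Λ f (ich I z y) =
      lagr univ (locBilin z f.1) (killing G) (fun y => f.2.2.1 (ich I z y))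
        (locF A s z f y) (locH A H₀ z f y) Λ y := by
  have hyt := interior_subset hy.1
  have hx : ich I z y ∈ U := hy.2
  have hfr := mat_frame_det_ne_zero (I := I) (symm_mem_source hyt)
  unfold lagrangian lagr
  have e1 : pairing (locBilin z f.1 y) (killing G) (locF A s z f y) (locF A s z f y) =
      adInner (G := G) f.1 (ich I z y) (Q.descend (Q.fieldF A f.2.2.2) (ich I z y))
        (Q.descend (Q.fieldF A f.2.2.2) (ich I z y)) := by
    rw [hs.adInner_fieldF hA hf.isAdForm f.1 hx]
    unfold locF secForm
    rw [hs.locP_eq _ hx]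
    exact pairing_pullBilin _ _ hfr _ _ _
  have e2 : formInner (locBilin z f.1 y) (locH A H₀ z f y) (locH A H₀ z f y) =
      formInner (f.1 (ich I z y) : Bil n) (Q.fieldH0 A H₀ f.2.1 f.2.2.2 (ich I z y))
        (Q.fieldH0 A H₀ f.2.1 f.2.2.2 (ich I z y)) :=
    pairing_pullBilin _ _ hfr _ _ _
  have e3 : formInner (locBilin z f.1 y) (locForm z (dFun (I := I) f.2.2.1) y)
        (locForm z (dFun (I := I) f.2.2.1) y) =
      formInner (f.1 (ich I z y) : Bil n) (dFun (I := I) f.2.2.1 (ich I z y))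
        (dFun (I := I) f.2.2.1 (ich I z y)) :=
    pairing_pullBilin _ _ hfr _ _ _
  rw [locForm_dFun hyt (hf.smooth_scalar.mdifferentiableAt (by simp)),
    dForm_eq_univ (coordDom_interior z U hy)] at e3
  rw [e1, e2, e3, scalarCurv_eq_scalarLoc_univ' hf.smooth_bilin hf.symm_bilin hy.1 hd]

/-! #### The first variation -/

include hv

omit hs hA in
lemma extDerivWithin_add_smul (ε : ℝ) {z : M}
    (hy : y ∈ (ch I z).target) : extDerivWithin (locForm z (f + ε • v).2.1) (range I) y =
      extDerivWithin (locForm z f.2.1) (range I) y +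
        ε • extDerivWithin (locForm z v.2.1) (range I) y := by
  have huniq := I.uniqueDiffOn y (extChartAt_target_subset_range z hy)
  have dC := hv.smooth_two.differentiableWithinAt hy
  rw [← extDerivWithin_fun_smul _ _ huniq, ← extDerivWithin_fun_add huniq
    (hf.smooth_two.differentiableWithinAt hy) (dC.fun_const_smul _)]
  rfl

lemma IsSection.locF_add_smul (ε : ℝ) {z : M} (hy : y ∈ dom I z U) :
    locF A s z (f + ε • v) y = locF A s z f y + ε • (secForm (Q.extCov A v.2.2.2) s z y +
        wedge (lieBr G) (secForm f.2.2.2 s z y) (secForm v.2.2.2 s z y)) +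
      (ε ^ 2 / 2) • wedge (lieBr G) (secForm v.2.2.2 s z y) (secForm v.2.2.2 s z y) := by
  unfold locF secForm
  rw [hs.locP_eq _ hy.2, hs.locP_eq _ hy.2, hs.locP_eq _ hy.2, hs.locP_eq _ hy.2,
    hs.locP_eq _ hy.2, ← wedge_comp, ← wedge_comp]
  have h := valForm_fieldF_add_smul A hf.isAdForm hv.isAdForm ε (s (ich I z y))
  have e : Q.valForm (Q.fieldF A (f + ε • v).2.2.2) (s (ich I z y)) = _ := h
  rw [e]
  rfl

lemma IsSection.hasDerivAt_locF {z : M} (hy : y ∈ dom I z U) (w : Fin 2 → Euc n) :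
    HasDerivAt (fun ε : ℝ => locF A s z (f + ε • v) y w) ((secForm (Q.extCov A v.2.2.2) s z y +
        wedge (lieBr G) (secForm f.2.2.2 s z y) (secForm v.2.2.2 s z y)) w) 0 := by
  simp only [hs.locF_add_smul hA hf hv _ hy]
  have h1 := (((hasDerivAt_id (0 : ℝ)).smul_const ((secForm (Q.extCov A v.2.2.2) s z y +
        wedge (lieBr G) (secForm f.2.2.2 s z y) (secForm v.2.2.2 s z y)) w)).const_add
        (locF A s z f y w)).add (((hasDerivAt_pow 2 (0 : ℝ)).div_const 2).smul_const
        (wedge (lieBr G) (secForm v.2.2.2 s z y) (secForm v.2.2.2 s z y) w))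
  refine (h1.congr_deriv ?_).congr_of_eventuallyEq (Eventually.of_forall fun ε => ?_)
  · simp
  · rfl

/-- The Leibniz rule for the exterior derivative of `κ(η ∧ ϑ)`. -/
lemma IsSection.extDerivWithin_wedge {z : M} (hy : y ∈ dom I z U) :
    extDerivWithin (fun y => wK G (secForm v.2.2.2 s z y) (secForm f.2.2.2 s z y)) (range I) y =
    wK G (secForm f.2.2.2 s z y) (secForm (Q.extCov A v.2.2.2) s z y) -
      wK G (secForm v.2.2.2 s z y) (secForm (Q.extCov A f.2.2.2) s z y) := by
  have huniq := I.uniqueDiffOn y (extChartAt_target_subset_range z hy.1)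
  have hT := dom_mem_nhds hy.1 hs.isOpen hy.2
  have dd : ∀ {E : Type _} [NormedAddCommGroup E] [NormedSpace ℝ E] {q : Euc n → E}, SmoothOn q
      (dom I z U) → DifferentiableWithinAt ℝ q (range I) y := fun hq =>
    ((hq y hy).differentiableWithinAt (by simp)).mono_of_mem_nhdsWithin hT
  have c1 := hs.smooth_secForm hv.isAdForm z
  have c2 := hs.smooth_secForm hf.isAdForm z
  have hw := dd (smooth_wedge (killingCLM G) c1 c2)
  set a := gauge I A s z (ich I z y) with ha
  rw [hs.secForm_extCov hA hv.isAdForm hy, hs.secForm_extCov hA hf.isAdForm hy]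
  ext w
  rw [extDerivWithin_apply hw huniq]
  have hsum := sum_wedge_derivatives (killingCLM_comm (G := G)) (secForm v.2.2.2 s z y)
    (secForm f.2.2.2 s z y)
    (fderivWithin ℝ (secForm v.2.2.2 s z) (range I) y +
      oneTensor (adRep G) (ofLin a) (secForm v.2.2.2 s z y))
    (fderivWithin ℝ (secForm f.2.2.2 s z) (range I) y +
      oneTensor (adRep G) (ofLin a) (secForm f.2.2.2 s z y)) w
  rw [alternatizeUncurryFin_add, alternatizeUncurryFin_add] at hsum
  refine Eq.trans (sum_ext fun i => ?_) hsum
  rw [← Int.cast_smul_eq_zsmul ℝ, Int.cast_pow, Int.cast_neg, Int.cast_one]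
  refine congrArg (fun r : ℝ => (-1 : ℝ) ^ (i : ℕ) • r) ?_
  have hd1 : ∀ r : Fin 1 → Euc n, HasFDerivWithinAt (fun y => secForm v.2.2.2 s z y r)
      ((ContinuousAlternatingMap.apply ℝ (Euc n) (Euc d) r).comp
        (fderivWithin ℝ (secForm v.2.2.2 s z) (range I) y)) (range I) y := fun r =>
    (ContinuousAlternatingMap.apply ℝ (Euc n) (Euc d) r).hasFDerivAt.comp_hasFDerivWithinAt y
      (dd c1).hasFDerivWithinAt
  have hd2 : ∀ r : Fin 1 → Euc n, HasFDerivWithinAt (fun y => secForm f.2.2.2 s z y r)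
      ((ContinuousAlternatingMap.apply ℝ (Euc n) (Euc d) r).comp
        (fderivWithin ℝ (secForm f.2.2.2 s z) (range I) y)) (range I) y := fun r =>
    (ContinuousAlternatingMap.apply ℝ (Euc n) (Euc d) r).hasFDerivAt.comp_hasFDerivWithinAt y
      (dd c2).hasFDerivWithinAt
  have hd3 : ∀ r r' : Fin 1 → Euc n, HasFDerivWithinAt
      (fun y => killingCLM G (secForm v.2.2.2 s z y r) (secForm f.2.2.2 s z y r')) _ (range I) y :=
    fun r r' => ((killingCLM G).hasFDerivAt.comp_hasFDerivWithinAt y (hd1 r)).clm_apply (hd2 r')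
  have hd4 := ((hd3 ![i.removeNth w 0] ![i.removeNth w 1]).fun_sub
    (hd3 ![i.removeNth w 1] ![i.removeNth w 0])).fderivWithin huniq
  simp only [wedge_apply_two]
  rw [hd4]
  have hk : ∀ x y : Euc d, killingCLM G (adRep G (a (w i)) x) y +
      killingCLM G x (adRep G (a (w i)) y) = 0 := fun x y => killing_adRep _ x y
  have ho : ∀ (σ : Alt n 1 (Euc d)) (r : Fin 1 → Euc n),
      oneTensor (adRep G) (ofLin a) σ (w i) r = adRep G (a (w i)) (σ r) := fun σ r => by
    rw [oneTensor_apply, ofLin_apply]; rfl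
  simp only [Function.comp_apply, sub_apply, add_apply, ContinuousLinearMap.comp_apply,
    ContinuousLinearMap.flip_apply, ContinuousAlternatingMap.apply_apply,
    ContinuousAlternatingMap.add_apply, map_add, ho]
  linear_combination (-1 : ℝ) * hk (secForm v.2.2.2 s z y ![i.removeNth w 0])
    (secForm f.2.2.2 s z y ![i.removeNth w 1]) + hk (secForm v.2.2.2 s z y ![i.removeNth w 1])
    (secForm f.2.2.2 s z y ![i.removeNth w 0])

/-- The first variation of the three-form field is `dC' - κ(η ∧ F')`, with
`C' = C - ½ κ(η ∧ ϑ)`. -/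
lemma IsSection.hasDerivAt_locH {z : M} (hy : y ∈ dom I z U) (w : Fin 3 → Euc n) :
    HasDerivAt (fun ε : ℝ => locH A H₀ z (f + ε • v) y w)
      ((extDerivWithin (fun y => locForm z v.2.1 y -
          (1 / 2 : ℝ) • wK G (secForm v.2.2.2 s z y) (secForm f.2.2.2 s z y))
          (range I) y -
        wK G (secForm v.2.2.2 s z y) (locF A s z f y)) w) 0 := by
  have huniq := I.uniqueDiffOn y (extChartAt_target_subset_range z hy.1)
  have hT := dom_mem_nhds hy.1 hs.isOpen hy.2
  have c1 := hs.smooth_secForm hv.isAdForm z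
  have c2 := hs.smooth_secForm hf.isAdForm z
  have dw : DifferentiableWithinAt ℝ (fun y => wK G (secForm v.2.2.2 s z y)
      (secForm f.2.2.2 s z y)) (range I) y :=
    ((smooth_wedge (killingCLM G) c1 c2 y hy).differentiableWithinAt (by simp)).mono_of_mem_nhdsWithin hT
  have dC := hv.smooth_two.differentiableWithinAt hy.1
  have e1 : extDerivWithin (fun y => locForm z v.2.1 y -
      (1 / 2 : ℝ) • wK G (secForm v.2.2.2 s z y) (secForm f.2.2.2 s z y))
      (range I) y = extDerivWithin (locForm z v.2.1) (range I) y + (-(1 / 2) : ℝ) •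
      (wK G (secForm f.2.2.2 s z y) (secForm (Q.extCov A v.2.2.2) s z y) -
      wK G (secForm v.2.2.2 s z y) (secForm (Q.extCov A f.2.2.2) s z y)) := by
    rw [← hs.extDerivWithin_wedge hA hf hv hy, ← extDerivWithin_fun_smul _ _ huniq,
      ← extDerivWithin_fun_add huniq dC (dw.fun_const_smul _)]
    simp only [neg_smul, sub_eq_add_neg]
  obtain ⟨p, hp⟩ : ∃ p, s (ich I z y) = p := ⟨_, rfl⟩
  set w' : Fin 3 → Euc n := fun j => fr I z (ich I z y) (w j) with hw'
  have h1 := hasDerivAt_chernSimons (A := A) hf.isAdForm hv.isAdForm p w'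
  have h2 := ((((hasDerivAt_id (0 : ℝ)).smul_const
    (extDerivWithin (locForm z v.2.1) (range I) y w)).const_add (locForm z H₀ y w +
      extDerivWithin (locForm z f.2.1) (range I) y w))).sub h1
  refine (h2.congr_deriv ?_).congr_of_eventuallyEq (Eventually.of_forall fun ε => ?_)
  · have e3 : ∀ {l : ℕ} (σ : Q.PForm (Euc d) l), secForm σ s z y =
        (Q.valForm σ p).compContinuousLinearMap (fr I z (ich I z y)) := by
      intro l σ
      rw [← hp]
      exact hs.locP_eq σ hy.2 z
    rw [e1]
    unfold locF
    rw [e3, e3, e3, e3, e3, ← wedge_comp, ← wedge_comp, ← wedge_comp]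
    rw [one_smul]
    change _ = (extDerivWithin (locForm z v.2.1) (range I) y w + -(1 / 2) *
      (wK G (Q.valForm f.2.2.2 p) (Q.valForm (Q.extCov A v.2.2.2) p) w' -
        wK G (Q.valForm v.2.2.2 p) (Q.valForm (Q.extCov A f.2.2.2) p) w')) -
      wK G (Q.valForm v.2.2.2 p) (Q.valForm (Q.fieldF A f.2.2.2) p) w'
    ring
  · have e4 := hs.locH_eq (H₀ := H₀) hA (hf.add_smul hv ε) hy
    rw [extDerivWithin_add_smul hf hv ε hy.1, hp] at e4
    change locH A H₀ z (f + ε • v) y w = _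
    rw [e4]
    change (locForm z H₀ y w + (extDerivWithin (locForm z f.2.1) (range I) y w + ε • extDerivWithin (locForm z v.2.1) (range I) y w)) -
      ((1 / 2) * Q.valForm (Q.chernSimons A (f.2.2.2 + ε • v.2.2.2)) p w' +
        Q.valForm (Q.wedgeKilling (f.2.2.2 + ε • v.2.2.2) (Q.curvature A)) p w') = _
    simp only [Pi.sub_apply, id, smul_eq_mul]
    ring

end Sections

variable {H₀ : Form I M ℝ 3} (hH₀ : SmoothForm H₀) {f u v : Q.Fields} (hf : IsSmoothFields f)
  (hu : IsSmoothFields u) (hv : IsSmoothFields v) {z : M} {Λ : ℝ} (hy : y ∈ coordDom I z U)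
  (hd : ∀ x, (gram (f.1 x : Bil n)).det ≠ 0)

/-! ### The Lagrangian density -/

/-- The Lagrangian density in the chart at `z`, in the gauge given by the section `s`. -/
def density (A : Form IP P (Euc d) 1) (H₀ : Form I M ℝ 3) (Λ : ℝ) (s : M → P) (z : M)
    (f : Q.Fields) (y : Euc n) : ℝ :=
  lagr univ (locBilin z f.1) (killing G) (fun y => f.2.2.1 (ich I z y))
    (locF A s z f y) (locH A H₀ z f y) Λ y * sqrtDet (locBilin z f.1 y)

lemma contDiffAt_lagr_param {E : Type*} [NormedAddCommGroup E] [NormedSpace ℝ E]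
    {γ : E → Euc n → Bil n} {φ : E → Euc n → ℝ} {p : E × Euc n}
    {F : E × Euc n → Alt n 2 V} {H : E × Euc n → Alt n 3 ℝ}
    (hγ : ContDiffAt ℝ ∞ (uncurry γ) p) (hd : (gram (γ p.1 p.2)).det ≠ 0)
    (hφ : ContDiffAt ℝ ∞ (uncurry φ) p) {κ : V →ₗ[ℝ] V →ₗ[ℝ] ℝ} (κc : V →L[ℝ] V →L[ℝ] ℝ)
    (hκ : ∀ u v, κ u v = κc u v) (hF : ContDiffAt ℝ ∞ F p) (hH : ContDiffAt ℝ ∞ H p) (Λ : ℝ) :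
    ContDiffAt ℝ ∞ (fun q => lagr univ (γ q.1) κ (φ q.1) (F q) (H q) Λ q.2 *
      sqrtDet (γ q.1 q.2)) p := by
  have hi := contDiffAt_inv_param hγ hd
  have hp := contDiffAt_pd_param hφ
  have h1 : ContDiffAt ℝ ∞ (fun q => pairing (γ q.1 q.2) κ (F q) (F q)) p :=
    contDiffWithinAt_univ.1 <| smoothAt_mPair κc hκ (fun i j => (hi i j).contDiffWithinAt)
      (fun w => smoothAt_form_apply hF w) fun w => smoothAt_form_apply hF w
  have h2 : ContDiffAt ℝ ∞ (fun q => formInner (γ q.1 q.2) (H q) (H q)) p :=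
    contDiffWithinAt_univ.1 <| smoothAt_mPair (ContinuousLinearMap.mul ℝ ℝ)
      (fun _ _ => rfl) (fun i j => (hi i j).contDiffWithinAt)
      (fun w => smoothAt_form_apply hH w) fun w => smoothAt_form_apply hH w
  have h3 : ContDiffAt ℝ ∞ (fun q : E × Euc n => formInner (γ q.1 q.2) (dForm univ (φ q.1) q.2)
      (dForm univ (φ q.1) q.2)) p :=
    ContDiffAt.congr_of_eventuallyEq (ContDiffAt.sum (s := Finset.univ) fun i _ =>
      (hp i).mul (ContDiffAt.sum (s := Finset.univ) fun l _ => (hi i l).mul (hp l)))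
      (Eventually.of_forall fun q => formInner_dForm (γ q.1) _ q.2)
  exact ((contDiffAt_const.mul hφ).exp.mul (((((contDiffAt_scalarLoc_param hγ hd).add
    (contDiffAt_const.mul h1)).sub (contDiffAt_const.mul h2)).add
    (contDiffAt_const.mul h3)).sub contDiffAt_const)).mul (contDiffAt_sqrtDet_param hγ hd)

lemma smooth_family {W : Type*} [NormedAddCommGroup W] [NormedSpace ℝ W] {a b c : Euc n → W}
    {Ω : Set (Euc n)} (ha : SmoothOn a Ω) (hb : SmoothOn b Ω) (hc : SmoothOn c Ω) :
    SmoothOn (fun r : (ℝ × ℝ) × Euc n => a r.2 + r.1.1 • b r.2 + r.1.2 • c r.2) (univ ×ˢ Ω) := by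
  have h : MapsTo (Prod.snd : (ℝ × ℝ) × Euc n → Euc n) (univ ×ˢ Ω) Ω := fun r hr => hr.2
  exact ((ha.comp contDiffOn_snd h).add ((contDiff_fst.fst.contDiffOn).smul
    (hb.comp contDiffOn_snd h))).add ((contDiff_fst.snd.contDiffOn).smul (hc.comp contDiffOn_snd h))

lemma secForm_add_smul (σ σ' : Q.PForm V k) (ε : ℝ) (s : M → P) (z : M) (y : Euc n) :
    secForm (σ + ε • σ') s z y = secForm σ s z y + ε • secForm σ' s z y := rfl

include hs hA hf hu hv in
lemma IsSection.smooth_secForm_family (z : M) :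
    SmoothOn (fun r : (ℝ × ℝ) × Euc n => secForm (f + r.1.1 • u + r.1.2 • v).2.2.2 s z r.2)
      (univ ×ˢ (dom I z U)) ∧
    SmoothOn (fun r : (ℝ × ℝ) × Euc n =>
      secForm (Q.extCov A (f + r.1.1 • u + r.1.2 • v).2.2.2) s z r.2)
      (univ ×ˢ (dom I z U)) := by
  refine ⟨(smooth_family (hs.smooth_secForm hf.isAdForm z)
    (hs.smooth_secForm hu.isAdForm z) (hs.smooth_secForm hv.isAdForm z)).congr fun r _ =>
    (secForm_add_smul (f.2.2.2 + r.1.1 • u.2.2.2) v.2.2.2 _ _ _ _).trans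
      (congrArg (· + _) (secForm_add_smul _ _ _ _ _ _)), (smooth_family (hs.smooth_extCov hA hf.isAdForm z)
    (hs.smooth_extCov hA hu.isAdForm z) (hs.smooth_extCov hA hv.isAdForm z)).congr
    fun r hr => ?_⟩
  unfold secForm
  have h1 := valForm_extCov_add_smul A (hf.add_smul hu r.1.1).isAdForm hv.isAdForm r.1.2
    (s (ich I z r.2))
  have h2 := valForm_extCov_add_smul A hf.isAdForm hu.isAdForm r.1.1 (s (ich I z r.2))
  have h3 : Q.valForm (Q.extCov A (f + r.1.1 • u + r.1.2 • v).2.2.2)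
    (s (ich I z r.2)) = _ := h1.trans (congrArg (· + _) h2)
  rw [hs.locP_eq _ hr.2.2, hs.locP_eq _ hr.2.2, hs.locP_eq _ hr.2.2, hs.locP_eq _ hr.2.2, h3]
  rfl

include hs hA hf hu hv in
lemma IsSection.smooth_locF_family (z : M) :
    SmoothOn (fun r : (ℝ × ℝ) × Euc n => locF A s z (f + r.1.1 • u + r.1.2 • v) r.2)
      (univ ×ˢ (dom I z U)) := by
  obtain ⟨h1, h2⟩ := hs.smooth_secForm_family hA hf hu hv z
  refine ((((hs.smooth_curvature hA z).comp contDiffOn_snd fun r hr => hr.2).add h2).add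
    ((contDiffOn_const (c := (1 / 2 : ℝ))).smul (smooth_wedge (lieBr G) h1 h1))).congr
    fun r hr => ?_
  exact hs.locF_eq hA ((hf.add_smul hu r.1.1).add_smul hv r.1.2) hr.2

include hs hA hf hu hv hH₀ in
lemma IsSection.smooth_locH_family (z : M) :
    SmoothOn (fun r : (ℝ × ℝ) × Euc n => locH A H₀ z (f + r.1.1 • u + r.1.2 • v) r.2)
      (univ ×ˢ (dom I z U)) := by
  obtain ⟨h1, h2⟩ := hs.smooth_secForm_family hA hf hu hv z
  have h3 : ∀ {w : Q.Fields}, IsSmoothFields w → SmoothOn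
      (extDerivWithin (locForm z w.2.1) (range I))
      (dom I z U) := fun hw =>
    smooth_extDerivWithin hs.isOpen ((hw.smooth_two z).mono inter_subset_left)
  have h4 := smooth_family (h3 hf) (h3 hu) (h3 hv)
  have h5 := ((hH₀ z).mono (inter_subset_left (t := ich I z ⁻¹' U))).comp
    (contDiffOn_snd (E := ℝ × ℝ)) fun r (hr : r ∈ univ ×ˢ _) => hr.2
  refine ((h5.add h4).sub (((contDiffOn_const (c := (1 / 2 : ℝ))).smul ((smooth_wedge (killingCLM G) h1 h2).add
      ((contDiffOn_const (c := (1 / 3 : ℝ))).smul (smooth_wedge (killingCLM G) h1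
        (smooth_wedge (lieBr G) h1 h1))))).add (smooth_wedge (killingCLM G) h1
        ((hs.smooth_curvature hA z).comp contDiffOn_snd fun r hr => hr.2)))).congr fun r hr => ?_
  have hw := hf.add_smul hu r.1.1
  rw [hs.locH_eq_wedge hA (hw.add_smul hv r.1.2) hr.2,
    extDerivWithin_add_smul hw hv _ hr.2.1, extDerivWithin_add_smul hf hu _ hr.2.1]
  rfl

lemma add_zero_smul_field (f u : Q.Fields) : f + (0 : ℝ) • u = f := by
  have h : ∀ {W : Type} [NormedAddCommGroup W] [NormedSpace ℝ W] (a b : W), a + (0 : ℝ) • b = a := by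
    intros; simp
  exact Prod.ext (funext fun x => h (W := Bil n) (f.1 x) (u.1 x))
    (Prod.ext (funext fun x => h (W := Alt n 2 ℝ) (f.2.1 x) (u.2.1 x))
    (Prod.ext (funext fun x => h (W := ℝ) (f.2.2.1 x) (u.2.2.1 x))
    (funext fun p => h (W := Alt n 1 (Euc d)) (f.2.2.2 p) (u.2.2.2 p))))

lemma add_zero_smul_fields (f u v : Q.Fields) : f + (0 : ℝ) • u + (0 : ℝ) • v = f := by
  rw [add_zero_smul_field, add_zero_smul_field]

include hs hA hf in
lemma IsSection.smooth_locF (z : M) : SmoothOn (locF A s z f) (dom I z U) := by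
  have h := (hs.smooth_locF_family hA hf hf hf z).comp
    (contDiff_const (c := ((0, 0) : ℝ × ℝ)).prodMk contDiff_id).contDiffOn fun y hy => ⟨mem_univ _, hy⟩
  exact h.congr fun y _ => congrArg (locF A s z · y) (add_zero_smul_fields f f f).symm

include hs hA hf hH₀ in
lemma IsSection.smooth_locH (z : M) : SmoothOn (locH A H₀ z f) (dom I z U) := by
  have h := (hs.smooth_locH_family hA hH₀ hf hf hf z).comp
    (contDiff_const (c := ((0, 0) : ℝ × ℝ)).prodMk contDiff_id).contDiffOn fun y hy => ⟨mem_univ _, hy⟩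
  exact h.congr fun y _ => congrArg (locH A H₀ z · y) (add_zero_smul_fields f f f).symm

include hf in
lemma IsSmoothFields.scalar : SmoothOn (fun y => f.2.2.1 (ich I z y)) (ch I z).target := by
  have := smooth_comp_symm (hf.smooth_scalar.contMDiffOn (s := univ)) z
  rwa [preimage_univ, inter_univ] at this

include hs hA hf hu hv hH₀ hy in
/-- The Lagrangian density is a smooth function of the point and the parameters of a variation. -/
lemma IsSection.contDiffAt_density (Λ : ℝ) (hd : (gram (locBilin z f.1 y)).det ≠ 0) :
    ContDiffAt ℝ ∞ (fun r : (ℝ × ℝ) × Euc n =>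
      density A H₀ Λ s z (f + r.1.1 • u + r.1.2 • v) r.2) (0, y) := by
  have hN : univ ×ˢ (dom I z U) ∈
      𝓝 ((0 : ℝ × ℝ), y) := prod_mem_nhds univ_mem (Filter.mem_of_superset
    ((isOpen_coordDom z hs.isOpen).mem_nhds hy) (coordDom_subset z U))
  have hN' : univ ×ˢ (ch I z).target ∈ 𝓝 ((0 : ℝ × ℝ), y) :=
    Filter.mem_of_superset hN (prod_mono_right inter_subset_left)
  have hF := (hs.smooth_locF_family hA hf hu hv z).contDiffAt hN
  have hH := (hs.smooth_locH_family hA hH₀ hf hu hv z).contDiffAt hN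
  have hφ : ContDiffAt ℝ ∞ (uncurry fun (q : ℝ × ℝ) (y : Euc n) =>
      (f + q.1 • u + q.2 • v).2.2.1 (ich I z y)) (0, y) :=
    (smooth_family hf.scalar hu.scalar hv.scalar).contDiffAt hN'
  have hγ : ContDiffAt ℝ ∞ (uncurry fun (q : ℝ × ℝ) =>
      locBilin z (f + q.1 • u + q.2 • v).1) (0, y) :=
    (smooth_family (hf.smooth_bilin z) (hu.smooth_bilin z) (hv.smooth_bilin z)).contDiffAt hN'
  have hd' : (gram (locBilin z (f + (0 : ℝ) • u + (0 : ℝ) • v).1 y)).det ≠ 0 := by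
    rwa [add_zero_smul_fields]
  have h := contDiffAt_lagr_param (γ := fun q : ℝ × ℝ => locBilin z (f + q.1 • u + q.2 • v).1)
    (φ := fun (q : ℝ × ℝ) (y : Euc n) => (f + q.1 • u + q.2 • v).2.2.1 (ich I z y))
    (F := fun r : (ℝ × ℝ) × Euc n => locF A s z (f + r.1.1 • u + r.1.2 • v) r.2)
    (H := fun r : (ℝ × ℝ) × Euc n => locH A H₀ z (f + r.1.1 • u + r.1.2 • v) r.2)
    hγ hd' hφ (killingCLM G) killingCLM_apply hF hH Λ
  unfold density
  exact h

/-! ### The first variation -/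

/-- The integrand of the first variation of the action: the derivative of the Lagrangian density,
relative to the density of the volume measure. -/
def variation (A : Form IP P (Euc d) 1) (H₀ : Form I M ℝ 3) (Λ : ℝ) (f v : Q.Fields) (x : M) : ℝ :=
  deriv (fun ε : ℝ => lagrangian A H₀ Λ (f + ε • v) x * sqrtDet ((f + ε • v).1 x : Bil n)) 0 /
    sqrtDet (f.1 x : Bil n)

/-- The fields `χ v`. -/
def scaleFields (χ : M → ℝ) (v : Q.Fields) : Q.Fields :=
  (fun x => χ x • v.1 x, fun x => χ x • v.2.1 x, fun x => χ x * v.2.2.1 x,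
    fun p => χ (Q.proj p) • v.2.2.2 p)

/-- The variation `C - ½ κ(η ∧ ϑ)` of a potential of the three-form field. -/
def locC (s : M → P) (z : M) (f v : Q.Fields) (y : Euc n) : Alt n 2 ℝ := locForm z v.2.1 y -
    (1 / 2 : ℝ) • wK G (secForm v.2.2.2 s z y) (secForm f.2.2.2 s z y)

/-- The covariant derivatives, for the connection `A + ϑ`, of a form in a chart and a gauge. -/
def covLoc (R : Set (Euc n)) (A : Form IP P (Euc d) 1) (s : M → P) (z : M) (f : Q.Fields)
    (X : Euc n → Alt n k (Euc d)) (y : Euc n) : Euc n →L[ℝ] Alt n k (Euc d) :=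
  fderivWithin ℝ X R y + oneTensor (adRep G) (ofLin (gauge I A s z (ich I z y))) (X y) +
    oneTensor (lieBr G) (secForm f.2.2.2 s z y) (X y)

/-- The field strength, multiplied by `e^{-2φ}`. -/
def expF (A : Form IP P (Euc d) 1) (s : M → P) (z : M) (f : Q.Fields) (y : Euc n) :
    Alt n 2 (Euc d) :=
  exp (-2 * f.2.2.1 (ich I z y)) • locF A s z f y

/-- The contraction of the beta functions with a variation, in a chart and a gauge. -/
def locEL (A : Form IP P (Euc d) 1) (H₀ : Form I M ℝ 3) (Λ : ℝ) (s : M → P) (z : M)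
    (f v : Q.Fields) (y : Euc n) : ℝ :=
  eulerLagrange (locBilin z f.1) (locBilin z v.1) (killing G)
    (fun y => f.2.2.1 (ich I z y)) (fun y => v.2.2.1 (ich I z y))
    (locF A s z f) (secForm v.2.2.2 s z) (locH A H₀ z f) (locC s z f v)
    (covLoc univ A s z f (expF A s z f)) Λ y

/-- The boundary term of the first variation, in a chart and a gauge. -/
def locBdry (A : Form IP P (Euc d) 1) (H₀ : Form I M ℝ 3) (s : M → P) (z : M) (f v : Q.Fields)
    (i : Fin n) (y : Euc n) : ℝ :=
  boundaryVec (locBilin z f.1) (locBilin z v.1) (killing G)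
    (fun y => f.2.2.1 (ich I z y)) (fun y => v.2.2.1 (ich I z y))
    (locF A s z f) (secForm v.2.2.2 s z) (locH A H₀ z f) (locC s z f v) i y

/-- Metric compatibility of the covariant derivatives with the Killing form. -/
lemma hasDerivAt_killing_covLoc {k l : ℕ} (A : Form IP P (Euc d) 1) (s : M → P) (z : M)
    (f : Q.Fields) {X : Euc n → Alt n k (Euc d)} {X' : Euc n → Alt n l (Euc d)} (hX : DifferentiableAt ℝ X y) (hX' : DifferentiableAt ℝ X' y) (e : Euc n)
    (w : Fin k → Euc n) (w' : Fin l → Euc n) :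
    HasDerivAt (fun t : ℝ => killing G (X (y + t • e) w) (X' (y + t • e) w'))
      (killing G (covLoc univ A s z f X y e w) (X' y w') +
        killing G (X y w) (covLoc univ A s z f X' y e w')) 0 := by
  have h1 : HasDerivAt (fun t : ℝ => X (y + t • e) w) _ 0 :=
    (ContinuousAlternatingMap.apply ℝ (Euc n) (Euc d) w).hasFDerivAt.comp_hasDerivAt (0 : ℝ)
      (hasDerivAt_line hX e)
  have h2 : HasDerivAt (fun t : ℝ => X' (y + t • e) w') _ 0 :=
    (ContinuousAlternatingMap.apply ℝ (Euc n) (Euc d) w').hasFDerivAt.comp_hasDerivAt (0 : ℝ)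
      (hasDerivAt_line hX' e)
  refine ((((killingCLM G).hasFDerivAt.comp_hasDerivAt (0 : ℝ) h1).clm_apply h2)).congr_deriv ?_
  set a := gauge I A s z (ich I z y) e
  set b := secForm f.2.2.2 s z y ![e]
  have k1 := killing_adRep (G := G) a (X y w) (X' y w')
  have k2 := killing_lieBr (G := G) (X y w) b (X' y w')
  rw [lieBr_skew, map_neg, LinearMap.neg_apply] at k2
  simp only [covLoc, add_apply, ContinuousAlternatingMap.add_apply, oneTensor_apply, ofLin_apply,
    fderivWithin_univ, map_add, LinearMap.add_apply, Function.comp_apply, zero_smul, add_zero,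
    ContinuousAlternatingMap.apply_apply, ← killingCLM_apply, Matrix.cons_val_zero]
  linear_combination k2 - k1

include hs hA hf hy in
lemma IsSection.density_eq (Λ : ℝ) (hd : (gram (locBilin z f.1 y)).det ≠ 0) :
    density A H₀ Λ s z f y = lagrangian A H₀ Λ f (ich I z y) * sqrtDet (locBilin z f.1 y) := by
  rw [density, hs.lagrangian_eq hA hf Λ hy hd]

include hs hf hd in
lemma IsSection.isLocMetric (z : M) : IsLocMetric (coordDom I z U) (locBilin z f.1) :=
  isLocMetric_locBilin hs.isOpen hf.smooth_bilin hf.symm_bilin fun x _ => hd x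

include hs hA hH₀ hf hv hd in
lemma IsSection.smooth_locBdry (z : M) (i : Fin n) :
    SmoothOn (locBdry A H₀ s z f v i) (coordDom I z U) := by
  have hT := coordDom_subset (I := I) z U
  have hT' : coordDom I z U ⊆ (ch I z).target := hT.trans inter_subset_left
  have c1 := hs.smooth_secForm hv.isAdForm z
  exact (hs.isLocMetric hf hd z).smooth_boundaryVec ((hv.smooth_bilin z).mono hT')
    (hf.scalar.mono hT')
    (hv.scalar.mono hT') ((hs.smooth_locF hA hf z).mono hT) (c1.mono hT)
    ((hs.smooth_locH hA hH₀ hf z).mono hT) ((((hv.smooth_two z).mono inter_subset_left).sub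
      ((contDiffOn_const (c := (1 / 2 : ℝ))).smul
        (smooth_wedge (killingCLM G) c1 (hs.smooth_secForm hf.isAdForm z)))).mono hT)
    (killingCLM G) killingCLM_apply i

include hs hA hH₀ hf hv hd hy in
lemma IsSection.hasDerivAt_density_locEL (Λ : ℝ) :
    HasDerivAt (fun ε : ℝ => density A H₀ Λ s z (f + ε • v) y)
      (locEL A H₀ Λ s z f v y * sqrtDet (locBilin z f.1 y) +
        ∑ i, fd (locBdry A H₀ s z f v i) y (ee i)) 0 := by
  have hT := coordDom_subset (I := I) z U
  have hT' : coordDom I z U ⊆ (ch I z).target := hT.trans inter_subset_left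
  have hN := (isOpen_coordDom z hs.isOpen).mem_nhds hy
  have hR : range I ∈ 𝓝 y := mem_interior_iff_mem_nhds.1 (coordDom_interior z U hy)
  have c1 := hs.smooth_secForm hv.isAdForm z
  have cF := (hs.smooth_locF hA hf z).mono hT
  have cC := (((hv.smooth_two z).mono inter_subset_left).sub
      ((contDiffOn_const (c := (1 / 2 : ℝ))).smul
        (smooth_wedge (killingCLM G) c1 (hs.smooth_secForm hf.isAdForm z)))).mono hT
  have hf0 := add_zero_smul_field f v
  have hφ := (hf.scalar (z := z)).mono hT'
  have hF : ∀ w, HasDerivAt (fun ε : ℝ => locF A s z (f + ε • v) y w) (alternatizeUncurryFin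
        (covLoc univ A s z f (secForm v.2.2.2 s z) y) w) 0 := fun w =>
    (hs.hasDerivAt_locF hA hf hv (hT hy) w).congr_deriv (by
      rw [hs.secForm_extCov hA hv.isAdForm (hT hy), extDerivWithin, fderivWithin_of_mem_nhds hR,
        covLoc, fderivWithin_univ, alternatizeUncurryFin_add, alternatizeUncurryFin_add]
      rfl)
  have hH : ∀ w, HasDerivAt (fun ε : ℝ => locH A H₀ z (f + ε • v) y w)
      ((alternatizeUncurryFin (fd (locC s z f v) y) -
        wK G (secForm v.2.2.2 s z y) (locF A s z f y)) w) 0 := fun w =>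
    (hs.hasDerivAt_locH hA hf hv (hT hy) w).congr_deriv (by
      rw [extDerivWithin, fderivWithin_of_mem_nhds hR]; rfl)
  have dF : DifferentiableAt ℝ (expF A s z f) y :=
    ((IsLocMetric.smooth_exp_smul hφ cF).contDiffAt hN).differentiableAt (by simp)
  have hL := fun (i : Fin n) w w' => hasDerivAt_killing_covLoc A s z f dF
    (((c1.mono hT).contDiffAt hN).differentiableAt (by simp)) (ee i) w w'
  have h := (hs.isLocMetric hf hd z).first_variation (h := locBilin z v.1)
    (φ := fun y => f.2.2.1 (ich I z y))
    (ν := fun y => v.2.2.1 (ich I z y)) (F := locF A s z f)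
    (η := secForm v.2.2.2 s z) (H := locH A H₀ z f) (C := locC s z f v) (κ := killing G)
    ((hv.smooth_bilin z).mono hT') (fun _ _ _ => hv.symm_bilin _ _ _) hφ
    (hv.scalar.mono hT') cF (c1.mono hT)
    ((hs.smooth_locH hA hH₀ hf z).mono hT) cC (killingCLM G) killingCLM_apply killing_comm hy
    (dη := covLoc univ A s z f (secForm v.2.2.2 s z) y)
    (dF := covLoc univ A s z f (expF A s z f))
    (fun i w w' => hL i w w')
    (Fε := fun ε => locF A s z (f + ε • v) y) (congrArg (locF A s z · y) hf0) hF
    (Hε := fun ε => locH A H₀ z (f + ε • v) y) (congrArg (locH A H₀ z · y) hf0) hH Λ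
  exact h

/-! ### Cutting off variations -/

lemma isSmoothFields_scale {χ : M → ℝ} (hχ : ContMDiff I 𝓘(ℝ, ℝ) ∞ χ) {v : Q.Fields}
    (hv : IsSmoothFields v) : IsSmoothFields (scaleFields χ v) := by
  have h : ∀ {W : Type} [NormedAddCommGroup W] [NormedSpace ℝ W] {a : Euc n → W} (z : M),
      SmoothOn a (ch I z).target → SmoothOn (fun y => χ (ich I z y) • a y) (ch I z).target := by
    intro W _ _ a z ha
    exact ((smooth_comp_symm (hχ.contMDiffOn (s := univ)) z).mono
      (fun y hy => ⟨hy, mem_univ _⟩)).smul ha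
  refine ⟨fun z => h z (hv.smooth_bilin z), fun x X Y => congrArg (χ x * ·) (hv.symm_bilin x X Y),
    fun z => h z (hv.smooth_two z), hχ.mul hv.smooth_scalar, ⟨fun p a w => ?_, fun z =>
      (hχ.comp Q.smooth_proj).contMDiffOn.smul (hv.isAdForm.smooth z)⟩⟩
  exact (congrArg (· • (v.2.2.2 (Q.act p a) : Alt n 1 (Euc d)) w)
    (congrArg χ (Q.proj_act p a))).trans ((congrArg (χ (Q.proj p) • ·)
      (hv.isAdForm.equivariant p a w)).trans (map_smul (Ad a⁻¹) _ _).symm)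

variable (Q) in
lemma exists_section_at (x : M) : ∃ (U : Set M) (s : M → P) (τ : P → G), Q.IsSection U s τ ∧
    x ∈ U := by
  obtain ⟨U, s, τ, hs, hx, -⟩ := Q.exists_section (Q.pt x)
  rw [show Q.proj (Q.pt x) = x from Function.surjInv_eq Q.proj_surjective x] at hx
  exact ⟨U, s, τ, hs, hx⟩

lemma boundaryVec_eq_zero {γ h : Euc n → Bil n} {κ : V →ₗ[ℝ] V →ₗ[ℝ] ℝ}
    {φ ν : Euc n → ℝ} {F : Euc n → Alt n 2 V} {η : Euc n → Alt n 1 V}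
    {H : Euc n → Alt n 3 ℝ} {C : Euc n → Alt n 2 ℝ}
    (hh : h =ᶠ[𝓝 y] 0) (hν : ν y = 0) (hη : η y = 0) (hC : C y = 0) (i : Fin n) :
    boundaryVec γ h κ φ ν F η H C i y = 0 := by
  have h0 : h y = 0 := hh.self_of_nhds
  have h1 : ∀ a b j, pd univ (fun z => h z (ee a) (ee b)) j y = 0 := fun a b j => by
    have : (fun z => h z (ee a) (ee b)) =ᶠ[𝓝 y] fun _ => 0 := hh.mono fun z hz => by simp [hz]
    rw [pd_univ, this.fderiv_eq]; simp
  have h2 : gram (0 : Bil n) = 0 := by ext i j; simp [gram_apply]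
  simp [boundaryVec, IsLocMetric.gravVec, palatiniVec, varChr, covBilin, h1, h0, hν, hη, hC, raise,
    trBilin, contractVec, mPair, h2]

/-- A tuple of fields that vanishes at a point. -/
def VanishesAt (v : Q.Fields) (x : M) : Prop :=
  v.1 x = 0 ∧ v.2.1 x = 0 ∧ v.2.2.1 x = 0 ∧ ∀ p, Q.proj p = x → v.2.2.2 p = 0

include hs in
lemma IsSection.loc_eq_zero (f : Q.Fields) (hy : ich I z y ∈ U) (h : VanishesAt v (ich I z y)) :
    locBilin z v.1 y = 0 ∧ secForm v.2.2.2 s z y = 0 ∧ locC s z f v y = 0 := by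
  have h2 : secForm v.2.2.2 s z y = 0 := by
    unfold secForm locP
    rw [h.2.2.2 _ (hs.proj_section _ hy)]
    rfl
  have h3 : locForm z v.2.1 y = 0 := by unfold locForm; rw [h.2.1]; rfl
  refine ⟨?_, h2, ?_⟩
  · unfold locBilin; rw [h.1]; rfl
  · rw [locC, h2, h3]
    ext w
    simp [wedge_apply]

include hs hy in
lemma IsSection.locEL_eq_zero (A : Form IP P (Euc d) 1) (H₀ : Form I M ℝ 3) (Λ : ℝ)
    (f : Q.Fields) (h : VanishesAt v (ich I z y)) :
    locEL A H₀ Λ s z f v y = 0 := by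
  obtain ⟨h1, h2, h3⟩ := hs.loc_eq_zero f hy.2 h
  have h4 : gram (0 : Bil n) = 0 := by ext i j; simp [gram_apply]
  have h5 := h.2.2.1
  rw [locEL, eulerLagrange, h5]
  simp [raise, trBilin, h1, h2, h3, h4, mPair]

include hs hy in
lemma IsSection.locBdry_eq_zero (A : Form IP P (Euc d) 1) (H₀ : Form I M ℝ 3) (f : Q.Fields)
    (h : ∀ᶠ y' in 𝓝 y, VanishesAt v (ich I z y')) (i : Fin n) :
    locBdry A H₀ s z f v i y = 0 := by
  obtain ⟨-, h2, h3⟩ := hs.loc_eq_zero f hy.2 h.self_of_nhds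
  refine boundaryVec_eq_zero ?_ h.self_of_nhds.2.2.1 h2 h3 i
  filter_upwards [h] with y' h'
  unfold locBilin; rw [h'.1]; rfl

lemma sqrtDet_locBilin (g : Bilin I M) (z : M) (y : Euc n) :
    sqrtDet (locBilin z g y) = |(fr I z (ich I z y)).det| * sqrtDet (g (ich I z y) : Bil n) :=
  sqrtDet_pullBilin _ (fr I z (ich I z y))

include hs hA hH₀ hf hv hy hd in
lemma IsSection.hasDerivAt_density (Λ : ℝ) :
    HasDerivAt (fun ε : ℝ => density A H₀ Λ s z (f + ε • v) y)
      (variation A H₀ Λ f v (ich I z y) * sqrtDet (locBilin z f.1 y)) 0 := by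
  have h1 := hs.hasDerivAt_density_locEL hA hH₀ hf hv hy hd Λ
  set D := locEL A H₀ Λ s z f v y * sqrtDet (locBilin z f.1 y) + _ with hD
  have hd0 := (hs.isLocMetric hf hd z).det_ne y hy
  have hs0 : sqrtDet (locBilin z f.1 y) ≠ 0 := (Real.sqrt_pos.2 (abs_pos.2 hd0)).ne'
  rw [sqrtDet_locBilin] at hs0
  have hc := left_ne_zero_of_mul hs0
  have hs1 := right_ne_zero_of_mul hs0
  have hev : ∀ᶠ ε in 𝓝 (0 : ℝ), (gram (locBilin z (f + ε • v).1 y)).det ≠ 0 := by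
    have hc : Continuous fun ε : ℝ => (gram (locBilin z f.1 y + ε • locBilin z v.1 y)).det :=
      Continuous.matrix_det (continuous_matrix fun i j => by
        simp only [gram_apply, add_apply, smul_apply]; fun_prop)
    refine hc.continuousAt.eventually_ne ?_
    rwa [add_zero_bilin]
  have h2 : HasDerivAt (fun ε : ℝ => lagrangian A H₀ Λ (f + ε • v) (ich I z y) *
      sqrtDet ((f + ε • v).1 (ich I z y) : Bil n))
      (D / |(fr I z (ich I z y)).det|) 0 := by
    refine (h1.div_const _).congr_of_eventuallyEq ?_
    filter_upwards [hev] with ε hε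
    rw [hs.density_eq hA (hf.add_smul hv ε) hy Λ hε, sqrtDet_locBilin, eq_div_iff hc]
    ring
  refine h1.congr_deriv ?_
  rw [variation, h2.deriv, sqrtDet_locBilin]
  field_simp

include hs hA hH₀ hf hv hy hd in
lemma IsSection.variation_eq (Λ : ℝ) :
    variation A H₀ Λ f v (ich I z y) * sqrtDet (locBilin z f.1 y) =
      locEL A H₀ Λ s z f v y * sqrtDet (locBilin z f.1 y) +
        ∑ i, fd (locBdry A H₀ s z f v i) y (ee i) :=
  (hs.hasDerivAt_density hA hH₀ hf hv hy hd Λ).unique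
    (hs.hasDerivAt_density_locEL hA hH₀ hf hv hy hd Λ)

include hA hH₀ hf hv hd in
lemma variation_scale_add (Λ : ℝ) {χ χ' : M → ℝ} (hχ : ContMDiff I 𝓘(ℝ, ℝ) ∞ χ)
    (hχ' : ContMDiff I 𝓘(ℝ, ℝ) ∞ χ') {x : M} (hx : x ∈ I.interior M) :
    variation A H₀ Λ f (scaleFields (χ + χ') v) x =
      variation A H₀ Λ f (scaleFields χ v) x + variation A H₀ Λ f (scaleFields χ' v) x := by
  obtain ⟨U, s, τ, hs, hxU⟩ := Q.exists_section_at x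
  obtain ⟨y, rfl⟩ : ∃ y, y = ch I x x := ⟨_, rfl⟩
  have hy := mem_coordDom hx hxU (mem_chart_source H x)
  have h1 := isSmoothFields_scale hχ hv
  have h2 := isSmoothFields_scale hχ' hv
  have h3 := isSmoothFields_scale (hχ.add hχ') hv
  have hd0 := (hs.isLocMetric hf hd x).det_ne _ hy
  obtain ⟨D, hD⟩ : ∃ D, HasFDerivAt (𝕜 := ℝ) (fun r : (ℝ × ℝ) × Euc n => density A H₀ Λ s x
      (f + r.1.1 • scaleFields χ v + r.1.2 • scaleFields χ' v) r.2) D (0, ch I x x) :=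
    ⟨_, ((hs.contDiffAt_density hA hH₀ hf h1 h2 hy Λ hd0).differentiableAt (by simp)).hasFDerivAt⟩
  have hl : ∀ a b : ℝ, HasDerivAt
      (fun ε : ℝ => ((((ε * a, ε * b) : ℝ × ℝ), ch I x x) : (ℝ × ℝ) × Euc n))
      (((a, b) : ℝ × ℝ), (0 : Euc n)) 0 := fun a b => by
    have := (((hasDerivAt_id (0 : ℝ)).mul_const a).prodMk
      ((hasDerivAt_id (0 : ℝ)).mul_const b)).prodMk (hasDerivAt_const (0 : ℝ) (ch I x x))
    simpa using this
  have hK : ∀ a b : ℝ, HasDerivAt (fun ε : ℝ => density A H₀ Λ s x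
      (f + (ε * a) • scaleFields χ v + (ε * b) • scaleFields χ' v) (ch I x x))
      (D ((a, b), 0)) 0 := fun a b => by
    have h0 : ((((0 * a, 0 * b) : ℝ × ℝ), ch I x x) : (ℝ × ℝ) × Euc n) = (0, ch I x x) := by simp
    exact HasFDerivAt.comp_hasDerivAt (0 : ℝ) (h0 ▸ hD) (hl a b)
  have e1 := hK 1 0
  have e2 := hK 0 1
  have e3 := hK 1 1
  have hsum : ∀ ε : ℝ, f + ε • scaleFields χ v + ε • scaleFields χ' v =
      f + ε • scaleFields (χ + χ') v := fun ε => by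
    have h : ∀ {W : Type} [NormedAddCommGroup W] [NormedSpace ℝ W] (a b : W) (r r' : ℝ),
      a + ε • r • b + ε • r' • b = a + ε • (r + r') • b := by intros; module
    exact Prod.ext (funext fun x => h (W := Bil n) (f.1 x) (v.1 x) _ _)
      (Prod.ext (funext fun x => h (W := Alt n 2 ℝ) (f.2.1 x) (v.2.1 x) _ _)
      (Prod.ext (funext fun x => h (W := ℝ) (f.2.2.1 x) (v.2.2.1 x) _ _)
      (funext fun p => h (W := Alt n 1 (Euc d)) (f.2.2.2 p) (v.2.2.2 p) _ _)))
  simp only [mul_one, mul_zero, add_zero_smul_field, hsum] at e1 e2 e3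
  have e4 := (hs.hasDerivAt_density hA hH₀ hf h3 hy hd Λ).unique e3
  have e5 := (hs.hasDerivAt_density hA hH₀ hf h1 hy hd Λ).unique e1
  have e6 := (hs.hasDerivAt_density hA hH₀ hf h2 hy hd Λ).unique e2
  have e7 : (((1, 1) : ℝ × ℝ), (0 : Euc n)) = ((1, 0), 0) + ((0, 1), 0) := by simp
  rw [e7, map_add, ← e5, ← e6, ← add_mul] at e4
  simp only [extChartAt_to_inv] at e4
  exact mul_right_cancel₀ (Real.sqrt_pos.2 (abs_pos.2 hd0)).ne' e4

/-! ### Differentiation of the action -/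

section Action

variable [T2Space M] [SecondCountableTopology M] [MeasurableSpace M] [BorelSpace M]

/-- Integrals over a part of the domain of a chart, in coordinates. -/
lemma setIntegral_vol {g : Bilin I M} {z : M} {S : Set M} (hS : MeasurableSet S)
    (hz : S ⊆ (chartAt H z).source) (hg : ContinuousOn (locBilin z g) (ch I z).target)
    {f : M → ℝ} (hf : IntegrableOn (fun y => f (ich I z y) * sqrtDet (locBilin z g y))
      (dom I z S)) :
    IntegrableOn f S (vol g) ∧ ∫ x in S, f x ∂(vol g) = ∫ y in dom I z S,
        f (ich I z y) * sqrtDet (locBilin z g y) := by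
  have hTS := measurable_dom (I := I) z hS
  set T := dom I z S with hT
  have hdm : AEMeasurable (fun y => Real.toNNReal (sqrtDet (locBilin z g y)))
      ((volume : Measure (Euc n)).restrict T) := by
    refine AEMeasurable.real_toNNReal (ContinuousOn.aemeasurable ?_ hTS)
    refine Real.continuous_sqrt.comp_continuousOn (continuous_abs.comp_continuousOn ?_)
    exact (Continuous.matrix_det (continuous_matrix fun i j => by
      simp only [gram_apply]; fun_prop) : Continuous fun b : Bil n =>
        (gram b).det).comp_continuousOn (hg.mono inter_subset_left)
  obtain ⟨ν, hν⟩ : ∃ ν, ν = ((volume : Measure (Euc n)).restrict T).withDensity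
      fun y => (Real.toNNReal (sqrtDet (locBilin z g y)) : ENNReal) := ⟨_, rfl⟩
  have hνT : ∀ᵐ y ∂ν, y ∈ T := by
    rw [hν]
    exact (withDensity_absolutelyContinuous _ _).ae_le (ae_restrict_mem hTS)
  have hνc : ν = (coordVol g z).restrict T := by
    rw [hν, coordVol, restrict_withDensity hTS, Measure.restrict_restrict hTS,
      inter_eq_left.2 inter_subset_left]
    rfl
  have haν : AEMeasurable ich I z ν :=
    hνc ▸ (aemeasurable_symm_coordVol g z).mono_measure Measure.restrict_le_self
  have hm : (vol g).restrict S = ν.map ich I z := by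
    rw [vol_restrict g z hS hz]
    refine Measure.ext fun S' hS' => ?_
    have e : ich I z ⁻¹' S' ∩ T = (ch I z).target ∩ ich I z ⁻¹' (S' ∩ S) := by
      ext y; simp [hT]; tauto
    rw [Measure.restrict_apply hS', chartVol_apply g z (hS'.inter hS),
      Measure.map_apply_of_aemeasurable haν hS', hνc, Measure.restrict_apply' hTS, e, coordVol,
      withDensity_apply _ (measurable_dom z (hS'.inter hS)), Measure.restrict_restrict
      (measurable_dom z (hS'.inter hS)), inter_eq_left.2 inter_subset_left]
  have he : ∀ y, Real.toNNReal (sqrtDet (locBilin z g y)) • f (ich I z y) =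
      f (ich I z y) * sqrtDet (locBilin z g y) := fun y => by
    rw [NNReal.smul_def, smul_eq_mul, Real.coe_toNNReal (sqrtDet _) (Real.sqrt_nonneg _), mul_comm]
  have hfi : Integrable (f ∘ ich I z) ν := by
    rw [hν, integrable_withDensity_iff_integrable_smul₀ hdm]
    exact hf.congr (Eventually.of_forall fun y => (he y).symm)
  have hext : AEMeasurable (ch I z) (ν.map ich I z) := by
    rw [← hm]
    exact ((continuousOn_extChartAt z).mono (by rwa [extChartAt_source])).aemeasurable hS
  have hid : (ν.map ich I z).map (ch I z) = ν := by
    rw [AEMeasurable.map_map_of_aemeasurable hext haν,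
      Measure.map_congr (hνT.mono fun y hy => (ch I z).right_inv hy.1 :
        ch I z ∘ ich I z =ᵐ[ν] id), Measure.map_id]
  have hfm : AEStronglyMeasurable f (ν.map ich I z) := by
    have h1 : AEStronglyMeasurable (f ∘ ich I z)
      ((ν.map ich I z).map (ch I z)) := by rw [hid]; exact hfi.1
    refine (h1.comp_aemeasurable hext).congr ?_
    rw [← hm]
    filter_upwards [ae_restrict_mem hS] with x hx
    exact congrArg f ((ch I z).left_inv (by simpa using hz hx))
  refine ⟨?_, ?_⟩
  · rw [IntegrableOn, hm, integrable_map_measure hfm haν]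
    exact hfi
  · rw [hm, integral_map haν hfm, hν]
    refine (integral_withDensity_eq_integral_smul₀ hdm _).trans ?_
    exact integral_congr_ae (Eventually.of_forall he)

include hs hA hH₀ hf hv hd in
lemma IsSection.contDiffAt_density_line (hy : y ∈ coordDom I z U) (Λ : ℝ) :
    ContDiffAt ℝ ∞ (fun r : ℝ × Euc n => density A H₀ Λ s z (f + r.1 • v) r.2) (0, y) := by
  have h := hs.contDiffAt_density hA hH₀ hf hv hv hy Λ ((hs.isLocMetric hf hd z).det_ne y hy)
  have hg : ContDiffAt ℝ ∞ (fun r : ℝ × Euc n => (((r.1, (0 : ℝ)), r.2) : (ℝ × ℝ) × Euc n))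
    (0, y) := by fun_prop
  have h2 := ContDiffAt.comp (𝕜 := ℝ) (0, y) (g := fun r : (ℝ × ℝ) × Euc n =>
    density A H₀ Λ s z (f + r.1.1 • v + r.1.2 • v) r.2) h hg
  refine h2.congr_of_eventuallyEq (Eventually.of_forall fun r => ?_)
  simp only [Function.comp_apply]
  rw [add_zero_smul_field]

include hs hA hH₀ hf hv hd in
/-- Differentiation of the action over a part of the domain of a chart. -/
lemma IsSection.hasDerivAt_integral (Λ : ℝ) {T : Set M} (hT : MeasurableSet T)
    (hz : T ⊆ (chartAt H z).source) {C : Set (Euc n)} (hC : IsCompact C)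
    (hCU : C ⊆ coordDom I z U)
    (hTC : dom I z T ⊆ C) :
    ((∀ᶠ ε in 𝓝 (0 : ℝ),
        IntegrableOn (lagrangian A H₀ Λ (f + ε • v)) T (vol (I := I) (f + ε • v).1)) ∧
      IntegrableOn (variation A H₀ Λ f v) T (vol (I := I) f.1) ∧
      HasDerivAt (fun ε : ℝ => ∫ x in T, lagrangian A H₀ Λ (f + ε • v) x
        ∂(vol (I := I) (f + ε • v).1)) (∫ x in T, variation A H₀ Λ f v x ∂(vol (I := I) f.1)) 0) ∧
    IntegrableOn (fun y => variation A H₀ Λ f v (ich I z y) *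
      sqrtDet (locBilin z f.1 y)) (dom I z T) := by
  obtain ⟨h1, h2, h3⟩ := hasDerivAt_setIntegral hC (measurable_dom (I := I) z hT) hTC
    (f := fun ε y => density A H₀ Λ s z (f + ε • v) y)
    (fun y hy => (hs.contDiffAt_density_line hA hH₀ hf hv hd (hCU hy) Λ).of_le (by simp))
    (fun y hy => hs.hasDerivAt_density hA hH₀ hf hv (hCU hy) hd Λ)
  have hcont : ∀ {f : Q.Fields}, IsSmoothFields f → ContinuousOn (locBilin z f.1) (ch I z).target :=
    fun hf => (hf.smooth_bilin z).continuousOn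
  obtain ⟨k1, k2⟩ := setIntegral_vol hT hz (hcont hf) h2
  have hev : ∀ᶠ ε in 𝓝 (0 : ℝ), ∀ y ∈ C, (gram (locBilin z (f + ε • v).1 y)).det ≠ 0 := by
    refine hC.eventually_forall_of_forall_eventually fun y hy => ?_
    have hb : ∀ {W : Type} [NormedAddCommGroup W] [NormedSpace ℝ W] {a b : Euc n → W},
        ContinuousAt a y → ContinuousAt b y →
        ContinuousAt (fun r : ℝ × Euc n => a r.2 + r.1 • b r.2) (0, y) := by
      intro W _ _ a b ha hb
      exact (ha.comp_of_eq continuousAt_snd rfl).add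
        (continuousAt_fst.smul (hb.comp_of_eq continuousAt_snd rfl))
    have ht := mem_interior_iff_mem_nhds.1 (hCU hy).1
    have hc := (Continuous.matrix_det (A := fun b : Bil n => gram b)
        (continuous_matrix fun i j => by simp only [gram_apply]; fun_prop)).continuousAt.comp
      (hb (W := Bil n) (a := locBilin z f.1) (b := locBilin z v.1)
        ((hcont hf).continuousAt ht) ((hcont hv).continuousAt ht))
    have h0 : (gram (locBilin z f.1 y + (0 : ℝ) • locBilin z v.1 y)).det ≠ 0 := by
      rw [add_zero_bilin]
      exact (hs.isLocMetric hf hd z).det_ne y (hCU hy)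
    have he : ∀ r : ℝ × Euc n, locBilin z (f + r.1 • v).1 r.2 =
      locBilin z f.1 r.2 + r.1 • locBilin z v.1 r.2 := fun _ => rfl
    simp only [he]
    exact ContinuousAt.eventually_ne (g := fun r : ℝ × Euc n =>
        (gram (locBilin z f.1 r.2 + r.1 • locBilin z v.1 r.2)).det) hc h0
  have hden : ∀ᶠ ε in 𝓝 (0 : ℝ), IntegrableOn (lagrangian A H₀ Λ (f + ε • v)) T
      (vol (I := I) (f + ε • v).1) ∧ ∫ x in T, lagrangian A H₀ Λ (f + ε • v) x
        ∂(vol (I := I) (f + ε • v).1) = ∫ y in dom I z T, density A H₀ Λ s z (f + ε • v) y := by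
    filter_upwards [h1, hev] with ε h1 hε
    have he := fun y hy => hs.density_eq hA (H₀ := H₀) (hf.add_smul hv ε) (hCU (hTC hy)) Λ
      (hε y (hTC hy))
    have hm := measurable_dom (I := I) z hT
    obtain ⟨a, b⟩ := setIntegral_vol hT hz (hcont (hf.add_smul hv ε)) (h1.congr_fun he hm)
    exact ⟨a, b.trans (setIntegral_congr_fun hm he).symm⟩
  refine ⟨⟨hden.mono fun _ h => h.1, k1, ?_⟩, h2⟩
  rw [k2]
  exact h3.congr_of_eventuallyEq (hden.mono fun _ h => h.2)

/-- Points of the interior have compact neighbourhoods that are seen in one chart. -/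
lemma exists_compact_chart {x : M} (hx : x ∈ I.interior M) (hU : IsOpen U) (hxU : x ∈ U) :
    ∃ C : Set (Euc n), IsCompact C ∧ C ⊆ coordDom I x U ∧ ich I x '' C ∈ 𝓝 x := by
  obtain ⟨C, hC, hxC, hCU⟩ := exists_compact_subset (isOpen_coordDom x hU)
    (mem_coordDom hx hxU (mem_chart_source H x))
  refine ⟨C, hC, hCU, ?_⟩
  filter_upwards [(continuousAt_extChartAt (I := I) x).preimage_mem_nhds
    (mem_interior_iff_mem_nhds.1 hxC), extChartAt_source_mem_nhds (I := I) x] with x' h1 h2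
  exact ⟨_, h1, (ch I x).left_inv h2⟩

lemma isCompact_symm_image {C : Set (Euc n)} (hC : IsCompact C)
    (hCU : C ⊆ coordDom I z U) : IsCompact (ich I z '' C) :=
  hC.image_of_continuousOn ((continuousOn_extChartAt_symm z).mono fun _ h =>
    (coordDom_subset z U (hCU h)).1)

include hA hH₀ hf hv hd in
/-- Differentiation of the action over a compact region of the interior. -/
lemma hasDerivAt_action (Λ : ℝ) {K : Set M} (hK : IsCompact K) (hKI : K ⊆ I.interior M) :
    IntegrableOn (variation A H₀ Λ f v) K (vol (I := I) f.1) ∧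
      HasDerivAt (fun ε : ℝ => ∫ x in K, lagrangian A H₀ Λ (f + ε • v) x
        ∂(vol (I := I) (f + ε • v).1)) (∫ x in K, variation A H₀ Λ f v x ∂(vol (I := I) f.1)) 0 := by
  obtain ⟨J, hJ⟩ : ∃ J : Set M → Prop, ∀ T, J T ↔ ((∀ᶠ ε in 𝓝 (0 : ℝ),
        IntegrableOn (lagrangian A H₀ Λ (f + ε • v)) T (vol (I := I) (f + ε • v).1)) ∧
      IntegrableOn (variation A H₀ Λ f v) T (vol (I := I) f.1) ∧
      HasDerivAt (fun ε : ℝ => ∫ x in T, lagrangian A H₀ Λ (f + ε • v) x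
        ∂(vol (I := I) (f + ε • v).1)) (∫ x in T, variation A H₀ Λ f v x ∂(vol (I := I) f.1)) 0) :=
    ⟨_, fun _ => Iff.rfl⟩
  suffices h : ∃ S, K ⊆ S ∧ MeasurableSet S ∧ ∀ T ⊆ S, MeasurableSet T → J T by
    obtain ⟨S, hKS, -, h⟩ := h
    exact ((hJ K).1 (h K hKS hK.measurableSet)).2
  refine hK.induction_on (p := fun K => ∃ S, K ⊆ S ∧ MeasurableSet S ∧
    ∀ T ⊆ S, MeasurableSet T → J T) ?_ ?_ ?_ fun x hx => ?_
  · refine ⟨∅, subset_rfl, .empty, fun T hT _ => ?_⟩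
    rw [subset_empty_iff.1 hT, hJ]
    simpa using hasDerivAt_const (0 : ℝ) (0 : ℝ)
  · rintro K K' hKK ⟨S, h, h'⟩
    exact ⟨S, hKK.trans h, h'⟩
  · rintro K K' ⟨S, h1, h2, h3⟩ ⟨S', h1', h2', h3'⟩
    refine ⟨S ∪ S', union_subset_union h1 h1', h2.union h2', fun T hT hTm => ?_⟩
    obtain ⟨a1, a2, a3⟩ := (hJ _).1 (h3 (T ∩ S) inter_subset_right (hTm.inter h2))
    obtain ⟨b1, b2, b3⟩ := (hJ _).1 (h3' (T \ S) (fun x hx => (hT hx.1).resolve_left hx.2)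
      (hTm.diff h2))
    have hdis : Disjoint (T ∩ S) (T \ S) := disjoint_sdiff_right.mono_left inter_subset_right
    rw [hJ, ← inter_union_sdiff T S]
    refine ⟨a1.and b1 |>.mono fun ε h => h.1.union h.2, a2.union b2, ?_⟩
    rw [setIntegral_union hdis (hTm.diff h2) a2 b2]
    refine (a3.add b3).congr_of_eventuallyEq ?_
    filter_upwards [a1, b1] with ε h h'
    exact setIntegral_union hdis (hTm.diff h2) h h'
  · obtain ⟨U, s, τ, hs, hxU⟩ := Q.exists_section_at x
    obtain ⟨C, hC, hCU, hCx⟩ := exists_compact_chart (hKI hx) hs.isOpen hxU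
    refine ⟨_, mem_nhdsWithin_of_mem_nhds hCx, _, subset_rfl,
      (isCompact_symm_image hC hCU).measurableSet, fun T hT hTm => (hJ T).2 ?_⟩
    have hCt : C ⊆ (ch I x).target := fun _ h => (coordDom_subset x U (hCU h)).1
    refine (hs.hasDerivAt_integral (z := x) hA hH₀ hf hv hd Λ hTm ?_ hC hCU ?_).1
    · intro x' hx'
      obtain ⟨y, hy, rfl⟩ := hT hx'
      exact symm_mem_source (hCt hy)
    · rintro y ⟨hy, hyT⟩
      obtain ⟨y', hy', h⟩ := hT hyT
      rwa [← (ch I x).symm.injOn (hCt hy') hy h]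

end Action

/-! ### Criticality and the contraction of the beta functions -/

section Criticality

variable [T2Space M] [SecondCountableTopology M] [MeasurableSpace M] [BorelSpace M]

/-- The fundamental lemma of the calculus of variations. -/
lemma eq_zero_of_forall_setIntegral {g : Bilin I M} {x : M} (hx : x ∈ I.interior M)
    (hγ : IsLocMetric (coordDom I x univ) (locBilin x g)) {e : M → ℝ}
    (he : ContinuousAt e x) {W : Set M} (hW : W ∈ 𝓝 x)
    (h : ∀ χ : M → ℝ, ContMDiff I 𝓘(ℝ, ℝ) ∞ χ → HasCompactSupport χ → tsupport χ ⊆ W →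
      IntegrableOn (fun x' => χ x' * e x') (tsupport χ) (vol g) ∧
        ∫ x' in tsupport χ, χ x' * e x' ∂(vol g) = 0) : e x = 0 := by
  wlog hpos : 0 < e x generalizing e
  · by_contra hne
    have := this (e := fun x' => -e x') he.neg (fun χ h1 h2 h3 => by
      have := h χ h1 h2 h3
      simp only [mul_neg, integral_neg, this.2, neg_zero, and_true]
      exact this.1.neg) (by linarith [lt_of_le_of_ne (not_lt.1 hpos) hne])
    exact hne (neg_eq_zero.1 this)
  obtain ⟨χ, -, hχ⟩ := (SmoothBumpFunction.nhds_basis_tsupport (I := I) x).mem_iff.1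
    (inter_mem hW (he.eventually_const_lt hpos))
  obtain ⟨h1, h2⟩ := h χ χ.contMDiff χ.hasCompactSupport (hχ.trans inter_subset_left)
  have h3 : ∀ x' ∈ tsupport χ, 0 ≤ χ x' * e x' := fun x' hx' =>
    mul_nonneg χ.nonneg (le_of_lt (hχ hx').2)
  have hm : MeasurableSet (tsupport χ) := (isClosed_tsupport _).measurableSet
  have h4 := (setIntegral_pos_iff_support_of_nonneg_ae (ae_restrict_of_forall_mem hm h3) h1).not.1
    h2.not_gt
  have hO : IsOpen (Function.support χ ∩ (chartAt H x).source) :=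
    χ.continuous.isOpen_support.inter (chartAt H x).open_source
  have h5 : chartVol g x (Function.support χ ∩ (chartAt H x).source) = 0 := by
    refine le_antisymm ?_ bot_le
    refine ((le_iSup (fun x => chartVol g x) x) _).trans ((measure_mono ?_).trans (not_lt.1 h4))
    rintro x' ⟨hx', -⟩
    have hx2 := subset_tsupport _ hx'
    exact ⟨mul_ne_zero hx' (ne_of_gt (hχ hx2).2), hx2⟩
  rw [chartVol_apply g x hO.measurableSet] at h5
  have hΩ := isOpen_coordDom (I := I) x hO
  have hne : (coordDom I x (Function.support χ ∩ (chartAt H x).source)).Nonempty :=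
    ⟨_, mem_coordDom hx ⟨by simp, mem_chart_source H x⟩ (mem_chart_source H x)⟩
  have hsub : coordDom I x (Function.support χ ∩ (chartAt H x).source) ⊆ coordDom I x univ :=
    inter_subset_inter_right _ (preimage_mono (subset_univ _))
  have h6 := (setLIntegral_eq_zero_iff' hΩ.measurableSet
    ((hγ.smooth_sqrtDet.continuousOn.mono hsub).aemeasurable hΩ.measurableSet).ennreal_ofReal).1
    (le_antisymm ((lintegral_mono_set (inter_subset_inter_left _ interior_subset)).trans h5.le)
      bot_le)
  refine absurd (measure_mono_null (fun y hy => ?_) h6) (hΩ.measure_pos volume hne).ne'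
  simp only [mem_compl_iff, mem_ofPred_eq, Classical.not_imp]
  exact ⟨hy, (ENNReal.ofReal_pos.2 (Real.sqrt_pos.2 (abs_pos.2 (hγ.det_ne y (hsub hy))))).ne'⟩

include hs hA hH₀ hf hv hd

lemma IsSection.continuousOn_locEL : ContinuousOn (locEL A H₀ Λ s z f v) (coordDom I z U) := by
  have hΩ := isOpen_coordDom (I := I) z hs.isOpen
  have hγ := hs.isLocMetric hf hd z
  have h1 : ContinuousOn (fun y => fd (fun r : ℝ × Euc n =>
      density A H₀ Λ s z (f + r.1 • v) r.2) (0, y) (1, 0)) (coordDom I z U) := fun y hy =>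
    ((((hs.contDiffAt_density_line hA hH₀ hf hv hd hy Λ).fderiv_right (m := 0)
      (by simp)).continuousAt.comp_of_eq (by fun_prop) rfl).clm_apply
        continuousAt_const).continuousWithinAt
  have h2 : ContinuousOn (fun y => ∑ i, fd (locBdry A H₀ s z f v i) y (ee i))
      (coordDom I z U) := continuousOn_finsetSum _ fun i _ =>
    ((hs.smooth_locBdry hA hH₀ hf hv hd z i).continuousOn_fderiv_of_isOpen hΩ
      (by simp)).clm_apply continuousOn_const
  refine ((h1.sub h2).div hγ.smooth_sqrtDet.continuousOn fun y hy =>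
    (Real.sqrt_pos.2 (abs_pos.2 (hγ.det_ne y hy))).ne').congr fun y hy => ?_
  have h3 := (hs.contDiffAt_density_line hA hH₀ hf hv hd hy Λ).differentiableAt (by simp)
  have h4 : HasDerivAt (fun ε : ℝ => (ε, y)) ((1 : ℝ), (0 : Euc n)) 0 :=
    (hasDerivAt_id _).prodMk (hasDerivAt_const _ _)
  have h5 : HasDerivAt (fun ε : ℝ => density A H₀ Λ s z (f + ε • v) y)
      (fd (fun r : ℝ × Euc n => density A H₀ Λ s z (f + r.1 • v) r.2) (0, y) (1, 0)) 0 :=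
    HasFDerivAt.comp_hasDerivAt (0 : ℝ) (f := fun ε : ℝ => (ε, y)) h3.hasFDerivAt h4
  refine eq_div_of_mul_eq (Real.sqrt_pos.2 (abs_pos.2 (hγ.det_ne y hy))).ne' ?_
  refine eq_sub_of_add_eq ?_
  exact (hs.hasDerivAt_density_locEL hA hH₀ hf hv hy hd Λ).unique h5

/-- Where a variation vanishes, it does not contribute to the first variation. -/
lemma IsSection.variation_eq_zero (hy : y ∈ coordDom I z U)
    (h : ∀ᶠ y' in 𝓝 y, VanishesAt v (ich I z y')) :
    variation A H₀ Λ f v (ich I z y) * sqrtDet (locBilin z f.1 y) = 0 := by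
  have hev := h.eventually_nhds.and ((isOpen_coordDom (I := I) z hs.isOpen).mem_nhds hy)
  have hb : ∀ i, locBdry A H₀ s z f v i =ᶠ[𝓝 y] fun _ => 0 := fun i => hev.mono fun y' h' =>
    hs.locBdry_eq_zero h'.2 A H₀ f h'.1 i
  rw [hs.variation_eq hA hH₀ hf hv hy hd, hs.locEL_eq_zero hy A H₀ Λ f h.self_of_nhds]
  simp [(hb _).fderiv_eq]

/-- The first variation, for variations that are supported in the domain of a chart. -/
lemma IsSection.integral_variation {L : Set M} (hL : IsCompact L) (hLI : L ⊆ I.interior M)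
    (hLz : L ⊆ (chartAt H z).source) (hLU : L ⊆ U) (h0 : ∀ x, x ∉ L → VanishesAt v x) :
    IntegrableOn (fun x => locEL A H₀ Λ s z f v (ch I z x)) L (vol (I := I) f.1) ∧
      ∫ x in L, variation A H₀ Λ f v x ∂(vol (I := I) f.1) =
        ∫ x in L, locEL A H₀ Λ s z f v (ch I z x) ∂(vol (I := I) f.1) := by
  have hcont := (hf.smooth_bilin z).continuousOn
  have hTL : dom I z L = ch I z '' L := by
    refine Subset.antisymm (fun y hy => ⟨_, hy.2, (ch I z).right_inv hy.1⟩) ?_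
    rintro _ ⟨x, hx, rfl⟩
    have hxs : x ∈ (ch I z).source := by simpa using hLz hx
    exact ⟨(ch I z).map_source hxs, by rwa [mem_preimage, (ch I z).left_inv hxs]⟩
  have hC : IsCompact (ch I z '' L) := hL.image_of_continuousOn
    ((continuousOn_extChartAt z).mono (by rwa [extChartAt_source]))
  have hCΩ : ch I z '' L ⊆ coordDom I z U := by
    rintro _ ⟨x, hx, rfl⟩
    exact mem_coordDom (hLI hx) (hLU hx) (hLz hx)
  obtain ⟨-, h1⟩ := hs.hasDerivAt_integral hA hH₀ hf hv hd Λ hL.measurableSet hLz hC hCΩ hTL.subset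
  have h2 := (setIntegral_vol hL.measurableSet hLz hcont h1).2
  rw [hTL] at h1 h2
  have hΩ := isOpen_coordDom (I := I) z hs.isOpen
  have hvan : ∀ y ∈ coordDom I z U, y ∉ ch I z '' L →
      ∀ᶠ y' in 𝓝 y, VanishesAt v (ich I z y') := fun y hy hyL => by
    filter_upwards [hC.isClosed.isOpen_compl.mem_nhds hyL, hΩ.mem_nhds hy] with y' h1 h2
    refine h0 _ fun h => h1 ⟨_, h, (ch I z).right_inv (interior_subset h2.1)⟩
  have hb : ∀ i, IntegrableOn (fun y => fd (locBdry A H₀ s z f v i) y (ee i))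
      (ch I z '' L) ∧ ∫ y in ch I z '' L, fd (locBdry A H₀ s z f v i) y (ee i) = 0 := fun i => by
    have hz0 : ∀ y ∈ coordDom I z U, y ∉ ch I z '' L →
        locBdry A H₀ s z f v i =ᶠ[𝓝 y] fun _ => 0 := fun y hy hyL => by
      filter_upwards [(hvan y hy hyL).eventually_nhds, hΩ.mem_nhds hy] with y' h h'
      exact hs.locBdry_eq_zero h' A H₀ f h i
    obtain ⟨a, b⟩ := integral_fderiv_eq_zero_of_compact hΩ hC hCΩ
      ((hs.smooth_locBdry hA hH₀ hf hv hd z i).of_le (by simp))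
      (fun y hy hyL => (hz0 y hy hyL).self_of_nhds) (ee i)
    refine ⟨a.mono_set hCΩ, (setIntegral_eq_of_subset_of_forall_sdiff_eq_zero hΩ.measurableSet
      hCΩ fun y hy => ?_).symm.trans b⟩
    rw [(hz0 y hy.1 hy.2).fderiv_eq]; simp
  have h3 : EqOn (fun y => variation A H₀ Λ f v (ich I z y) *
      sqrtDet (locBilin z f.1 y) - ∑ i, fd (locBdry A H₀ s z f v i) y (ee i))
      (fun y => locEL A H₀ Λ s z f v (ch I z (ich I z y)) *
        sqrtDet (locBilin z f.1 y)) (ch I z '' L) := fun y hy => by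
    have hy' := hCΩ hy
    simp only [(ch I z).right_inv (interior_subset hy'.1),
      hs.variation_eq hA hH₀ hf hv hy' hd Λ, add_sub_cancel_right]
  have hbi := integrable_finsetSum Finset.univ fun i _ => (hb i).1
  obtain ⟨k1, k2⟩ := setIntegral_vol hL.measurableSet hLz hcont
    (f := fun x => locEL A H₀ Λ s z f v (ch I z x))
    (by rw [hTL]; exact IntegrableOn.congr_fun (h1.sub hbi) h3 hC.measurableSet)
  refine ⟨k1, ?_⟩
  rw [k2, hTL, ← setIntegral_congr_fun hC.measurableSet h3, integral_sub h1 hbi,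
    integral_finsetSum _ fun i _ => (hb i).1, sum_eq_zero fun i _ => (hb i).2, sub_zero, h2]

omit hA hH₀ hf hv hd in
lemma IsSection.locEL_scale (χ : M → ℝ) (hy : ich I z y ∈ U) :
    locEL A H₀ Λ s z f (scaleFields χ v) y = χ (ich I z y) * locEL A H₀ Λ s z f v y := by
  obtain ⟨c, hc⟩ : ∃ c, c = χ (ich I z y) := ⟨_, rfl⟩
  have h1 : locBilin z (scaleFields χ v).1 y = c • locBilin z v.1 y := by rw [hc]; rfl
  have h2 : secForm (scaleFields χ v).2.2.2 s z y = c • secForm v.2.2.2 s z y := by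
    rw [hc, ← hs.proj_section _ hy]; rfl
  have h3 : locC s z f (scaleFields χ v) y = c • locC s z f v y := by
    have h : locForm z (scaleFields χ v).2.1 y = c • locForm z v.2.1 y := by rw [hc]; rfl
    have h' : ∀ a b : Alt n 1 (Euc d), wK G (c • a) b = c • wK G a b := fun a b => by
      ext w
      refine (wedge_apply_two ..).trans (Eq.trans ?_ (congrArg (c * ·) (wedge_apply_two ..).symm))
      simp [mul_sub]
    rw [locC, locC, h, h2, h', smul_sub, smul_comm c]
  have h4 : (scaleFields χ v).2.2.1 (ich I z y) = c * v.2.2.1 (ich I z y) := by rw [hc]; rfl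
  have h5 : gram (c • locBilin z v.1 y) = c • gram (locBilin z v.1 y) := by ext i j; simp [gram_apply]
  rw [← hc, locEL, locEL, eulerLagrange, eulerLagrange, h2, h3, h4]
  have h6 : ∀ (G' : Matrix (Fin n) (Fin n) ℝ) (α : (Fin 2 → Euc n) → ℝ),
      mPair G' (LinearMap.mul ℝ ℝ) α ⇑(c • locC s z f v y) =
        c * mPair G' (LinearMap.mul ℝ ℝ) α (locC s z f v y) := fun _ _ => mPair_smul_right ..
  have h7 : ∀ (G' : Matrix (Fin n) (Fin n) ℝ) (α : (Fin 1 → Euc n) → Euc d),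
      mPair G' (killing G) α ⇑(c • secForm v.2.2.2 s z y) =
        c * mPair G' (killing G) α (secForm v.2.2.2 s z y) := fun _ _ => mPair_smul_right ..
  rw [h6, h7]
  simp only [raise, trBilin, h1, h5, smul_apply, Matrix.mul_smul, Matrix.smul_mul,
    Matrix.smul_apply, smul_eq_mul, mul_left_comm _ c, mul_assoc c, ← mul_sum]
  ring

omit hA hH₀ hf hv hd hs in
lemma vanishesAt_scale {χ : M → ℝ} {x : M} (h : χ x = 0 ∨ VanishesAt v x) :
    VanishesAt (scaleFields χ v) x := by
  have h' : ∀ {W : Type} [NormedAddCommGroup W] [NormedSpace ℝ W] (w : W),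
      (VanishesAt v x → w = 0) → χ x • w = 0 := by
    intro W _ _ w hw
    exact smul_eq_zero.2 (h.imp_right hw)
  refine ⟨h' (W := Bil n) _ (·.1), h' (W := Alt n 2 ℝ) _ (·.2.1), h' (W := ℝ) _ (·.2.2.1), ?_⟩
  rintro p rfl
  exact h' (W := Alt n 1 (Euc d)) _ (·.2.2.2 p rfl)

lemma IsSection.integral_variation_scale {χ : M → ℝ} (hχ : ContMDiff I 𝓘(ℝ, ℝ) ∞ χ)
    (hc : HasCompactSupport χ) (hW : tsupport χ ⊆ I.interior M ∩ (chartAt H z).source ∩ U) :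
    IntegrableOn (fun x => χ x * locEL A H₀ Λ s z f v (ch I z x)) (tsupport χ) (vol (I := I) f.1) ∧
      ∫ x in tsupport χ, variation A H₀ Λ f (scaleFields χ v) x ∂(vol (I := I) f.1) =
        ∫ x in tsupport χ, χ x * locEL A H₀ Λ s z f v (ch I z x) ∂(vol (I := I) f.1) := by
  have hm : MeasurableSet (tsupport χ) := (isClosed_tsupport _).measurableSet
  have he : EqOn (fun x => locEL A H₀ Λ s z f (scaleFields χ v) (ch I z x))
      (fun x => χ x * locEL A H₀ Λ s z f v (ch I z x)) (tsupport χ) := fun x hx => by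
    have hx' := (ch I z).left_inv (x := x) (by simpa using (hW hx).1.2)
    simp only [hs.locEL_scale χ (show ich I z (ch I z x) ∈ U by rw [hx']; exact (hW hx).2), hx']
  obtain ⟨h1, h2⟩ := hs.integral_variation hA hH₀ hf (isSmoothFields_scale hχ hv) (Λ := Λ) hd hc
    (fun x hx => (hW hx).1.1) (fun x hx => (hW hx).1.2) (fun x hx => (hW hx).2)
    fun x hx => vanishesAt_scale (.inl (image_eq_zero_of_notMem_tsupport hx))
  exact ⟨h1.congr_fun he hm, h2.trans (setIntegral_congr_fun hm he)⟩

lemma IsSection.continuousAt_locEL {x : M} (hx : x ∈ I.interior M ∩ (chartAt H z).source ∩ U) :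
    ContinuousAt (fun x => locEL A H₀ Λ s z f v (ch I z x)) x :=
  ((hs.continuousOn_locEL hA hH₀ hf hv hd).continuousAt ((isOpen_coordDom z hs.isOpen).mem_nhds
    (mem_coordDom hx.1.1 hx.2 hx.1.2))).comp (continuousAt_extChartAt' (by simpa using hx.1.2))

omit hA hH₀ hf hv hd in
lemma IsSection.chart_mem_nhds {x : M} (hx : x ∈ I.interior M ∩ (chartAt H z).source ∩ U) :
    I.interior M ∩ (chartAt H z).source ∩ U ∈ 𝓝 x :=
  inter_mem (inter_mem ((ModelWithCorners.isOpen_interior (n := ∞) (by simp)).mem_nhds hx.1.1)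
    ((chartAt H z).open_source.mem_nhds hx.1.2)) (hs.isOpen.mem_nhds hx.2)

/-- The contraction of the beta functions with a variation does not depend on the chart and on the
gauge, because the first variation of the action does not. -/
lemma IsSection.locEL_eq_locEL {U' : Set M} {s' : M → P} {τ' : P → G} {z' : M}
    (hs' : Q.IsSection U' s' τ') {x : M} (hx : x ∈ I.interior M ∩ (chartAt H z).source ∩ U)
    (hx' : x ∈ I.interior M ∩ (chartAt H z').source ∩ U') :
    locEL A H₀ Λ s z f v (ch I z x) = locEL A H₀ Λ s' z' f v (ch I z' x) := by
  refine sub_eq_zero.1 (eq_zero_of_forall_setIntegral (g := f.1) (e := fun x =>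
    locEL A H₀ Λ s z f v (ch I z x) - locEL A H₀ Λ s' z' f v (ch I z' x)) hx.1.1
    (isLocMetric_locBilin isOpen_univ hf.smooth_bilin hf.symm_bilin fun x _ => hd x)
    ((hs.continuousAt_locEL hA hH₀ hf hv hd hx).sub (hs'.continuousAt_locEL hA hH₀ hf hv hd hx'))
    (inter_mem (hs.chart_mem_nhds hx) (hs'.chart_mem_nhds hx')) fun χ hχ hc hW => ?_)
  obtain ⟨a, b⟩ := hs.integral_variation_scale hA hH₀ hf hv hd (Λ := Λ) hχ hc
    (hW.trans inter_subset_left)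
  obtain ⟨a', b'⟩ := hs'.integral_variation_scale hA hH₀ hf hv hd (Λ := Λ) hχ hc
    (hW.trans inter_subset_right)
  simp only [mul_sub]
  exact ⟨a.sub a', by rw [integral_sub a a', ← b, ← b', sub_self]⟩

omit hs hA hH₀ hf hv hd in
/-- Criticality of a tuple of fields. -/
def Critical (A : Form IP P (Euc d) 1) (H₀ : Form I M ℝ 3) (Λ : ℝ) (f : Q.Fields) : Prop :=
  ∀ K : Set M, IsCompact K → K ⊆ I.interior M → ∀ v : Q.Fields, IsSmoothFields v →
    (∀ x, x ∉ K → VanishesAt v x) → HasDerivAt (fun ε : ℝ => ∫ x in K, lagrangian A H₀ Λ (f + ε • v) x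
      ∂(vol (I := I) (f + ε • v).1)) 0 0

lemma IsSection.locEL_eq_zero_of_critical (hcr : Critical A H₀ Λ f)
    (hy : y ∈ coordDom I z U) : locEL A H₀ Λ s z f v y = 0 := by
  have hyt := (coordDom_subset z U hy).1
  have hx : ich I z y ∈ I.interior M ∩ (chartAt H z).source ∩ U :=
    ⟨⟨symm_mem_interior hy, symm_mem_source hyt⟩, hy.2⟩
  have h := eq_zero_of_forall_setIntegral (g := f.1) (e := fun x =>
    locEL A H₀ Λ s z f v (ch I z x)) hx.1.1
    (isLocMetric_locBilin isOpen_univ hf.smooth_bilin hf.symm_bilin fun x _ => hd x)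
    (hs.continuousAt_locEL hA hH₀ hf hv hd hx) (hs.chart_mem_nhds hx) fun χ hχ hc hW => ?_
  · simpa only [(ch I z).right_inv hyt] using h
  obtain ⟨a, b⟩ := hs.integral_variation_scale hA hH₀ hf hv hd (Λ := Λ) hχ hc hW
  have hsm := isSmoothFields_scale hχ hv
  have hI : tsupport χ ⊆ I.interior M := fun x hx => (hW hx).1.1
  exact ⟨a, b.symm.trans ((hasDerivAt_action hA hH₀ hf hsm hd Λ hc hI).2.unique
    (hcr _ hc hI _ hsm fun x hx => vanishesAt_scale (.inl (image_eq_zero_of_notMem_tsupport hx))))⟩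

omit hv hs in
/-- If the contraction of the beta functions with every variation vanishes at every interior point,
then the fields are critical: a partition of unity splits a variation into variations that are
supported in domains of charts. -/
lemma critical_of_locEL_eq_zero (h : ∀ x ∈ I.interior M, ∃ U s τ, Q.IsSection U s τ ∧ x ∈ U ∧
      ∀ v : Q.Fields, IsSmoothFields v → locEL A H₀ Λ s x f v (ch I x x) = 0) :
    Critical A H₀ Λ f := by
  intro K hK hKI v hv hvK
  obtain ⟨hvi, hder⟩ := hasDerivAt_action hA hH₀ hf hv hd Λ hK hKI
  refine hder.congr_deriv ?_
  have hloc : ∀ x : K, ∃ W : Set M, IsOpen W ∧ x.1 ∈ W ∧ ∃ U s τ, Q.IsSection U s τ ∧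
      W = I.interior M ∩ (chartAt H x.1).source ∩ U := fun x => by
    obtain ⟨U, s, τ, hs, hxU⟩ := Q.exists_section_at x.1
    exact ⟨_, ((ModelWithCorners.isOpen_interior (n := ∞) (by simp)).inter
      (chartAt H x.1).open_source).inter hs.isOpen, ⟨⟨hKI x.2, mem_chart_source H x.1⟩, hxU⟩,
      U, s, τ, hs, rfl⟩
  choose W hWo hxW hW using hloc
  obtain ⟨t, ht⟩ := hK.elim_finite_subcover W hWo fun x hx => mem_iUnion.2 ⟨⟨x, hx⟩, hxW _⟩
  have : LocallyCompactSpace H := I.locallyCompactSpace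
  have : LocallyCompactSpace M := ChartedSpace.locallyCompactSpace H M
  obtain ⟨ρ, hρ⟩ := SmoothPartitionOfUnity.exists_isSubordinate I hK.isClosed (fun i : t => W i)
    (fun i => hWo i) (by simpa [iUnion_subtype] using ht)
  have hone : ∀ x ∈ K, ∑ i, ρ i x = 1 := fun x hx => by
    rw [← finsum_eq_sum_of_fintype]; exact ρ.sum_eq_one hx
  have hsum : scaleFields (fun x => ∑ i, ρ i x) v = v := by
    have h' : ∀ {W : Type} [NormedAddCommGroup W] [NormedSpace ℝ W] (x : M) (w : W),
        (x ∉ K → w = 0) → (∑ i, ρ i x) • w = w := by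
      intro W _ _ x w hw
      by_cases hx : x ∈ K
      · rw [hone x hx, one_smul]
      · rw [hw hx, smul_zero]
    exact Prod.ext (funext fun x => h' (W := Bil n) x _ fun h => (hvK x h).1)
      (Prod.ext (funext fun x => h' (W := Alt n 2 ℝ) x _ fun h => (hvK x h).2.1)
      (Prod.ext (funext fun x => h' (W := ℝ) x _ fun h => (hvK x h).2.2.1)
      (funext fun p => h' (W := Alt n 1 (Euc d)) (Q.proj p) _ fun h => (hvK _ h).2.2.2 p rfl)))
  have hadd : ∀ (t' : Finset t) (x : M), x ∈ I.interior M →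
      ContMDiff I 𝓘(ℝ, ℝ) ∞ (fun x => ∑ i ∈ t', ρ i x) ∧
      variation A H₀ Λ f (scaleFields (fun x => ∑ i ∈ t', ρ i x) v) x =
        ∑ i ∈ t', variation A H₀ Λ f (scaleFields (ρ i) v) x := by
    classical
    intro t' x hx
    induction t' using Finset.induction_on with
    | empty =>
      have hz : ContMDiff I 𝓘(ℝ, ℝ) ∞ (fun _ : M => (0 : ℝ)) := contMDiff_const
      have := variation_scale_add hA hH₀ hf hv hd Λ hz hz hx
      refine ⟨by simpa using hz, ?_⟩
      rw [show ((fun _ : M => (0 : ℝ)) + fun _ => 0) = fun _ => 0 by ext; simp] at this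
      simpa using this
    | insert i t' hi ih =>
      have := variation_scale_add hA hH₀ hf hv hd Λ (ρ i).contMDiff ih.1 hx
      simp only [Finset.sum_insert hi]
      exact ⟨(ρ i).contMDiff.add ih.1, this.trans (by rw [ih.2])⟩
  have hEL : ∀ i : t, IntegrableOn (variation A H₀ Λ f (scaleFields (ρ i) v)) K (vol (I := I) f.1) ∧
      ∫ x in K, variation A H₀ Λ f (scaleFields (ρ i) v) x ∂(vol (I := I) f.1) = 0 := fun i => by
    have hsm := isSmoothFields_scale (ρ i).contMDiff hv
    obtain ⟨U, s, τ, hs, hWU⟩ := hW i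
    have hLW : K ∩ tsupport (ρ i) ⊆ W i := inter_subset_right.trans (hρ i)
    rw [hWU] at hLW
    have hv0 : ∀ x, x ∉ K ∩ tsupport (ρ i) → VanishesAt (scaleFields (ρ i) v) x := fun x hx =>
      vanishesAt_scale ((not_and_or.1 hx).symm.imp image_eq_zero_of_notMem_tsupport (hvK x))
    have hL := hK.inter_right (isClosed_tsupport (ρ i))
    refine ⟨(hasDerivAt_action hA hH₀ hf hsm hd Λ hK hKI).1, ?_⟩
    rw [setIntegral_eq_of_subset_of_forall_sdiff_eq_zero hK.measurableSet
      (inter_subset_left (s := K) (t := tsupport (ρ i))) fun x hx => ?_,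
      (hs.integral_variation (z := i.1.1) hA hH₀ hf hsm hd hL (inter_subset_left.trans hKI)
        (fun x hx => (hLW hx).1.2) (fun x hx => (hLW hx).2) hv0).2]
    · refine setIntegral_eq_zero_of_forall_eq_zero fun x hx => ?_
      obtain ⟨U', s', τ', hs', hxU', h0⟩ := h x (hKI hx.1)
      exact (hs.locEL_eq_locEL hA hH₀ hf hsm hd hs' (hLW hx)
        ⟨⟨hKI hx.1, mem_chart_source H x⟩, hxU'⟩).trans (h0 _ hsm)
    · obtain ⟨U', s', τ', hs', hxU'⟩ := Q.exists_section_at x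
      have hy := mem_coordDom (hKI hx.1) hxU' (mem_chart_source H x)
      have h1 := hs'.variation_eq_zero hA hH₀ hf hsm hd (Λ := Λ) hy (by
        filter_upwards [((continuousOn_extChartAt_symm x).continuousAt
          (mem_interior_iff_mem_nhds.1 hy.1)).preimage_mem_nhds (hL.isClosed.isOpen_compl.mem_nhds
            (by rw [extChartAt_to_inv]; exact hx.2))] with y' h'
        exact hv0 _ h')
      rw [extChartAt_to_inv] at h1
      exact (mul_eq_zero.1 h1).resolve_right
        (Real.sqrt_pos.2 (abs_pos.2 ((hs'.isLocMetric hf hd x).det_ne _ hy))).ne'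
  rw [← hsum, setIntegral_congr_fun hK.measurableSet fun x hx => (hadd Finset.univ x (hKI hx)).2,
    integral_finsetSum _ fun i _ => (hEL i).1, sum_eq_zero fun i _ => (hEL i).2]

end Criticality

/-! ### Variations with prescribed values at a point -/

lemma contDiff_pullBilin (b : Bil n) : ContDiff ℝ ∞ fun D : Lin n => pullBilin b D := by
  refine contDiff_clm_apply_iff.2 fun u => contDiff_clm_apply_iff.2 fun v => ?_
  change ContDiff ℝ ∞ fun D : Lin n => b (D u) (D v)
  fun_prop

lemma contDiff_compContinuousLinearMap (α : Alt n k V) :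
    ContDiff ℝ ∞ fun D : Lin n => α.compContinuousLinearMap D :=
  contDiff_iff_contDiffAt.2 fun _ => ContDiffWithinAt.form_comp (α := fun _ => α) (f := fun D => D)
    contDiffWithinAt_const contDiffWithinAt_id

/-- The fields with constant components in the chart at `z` and in a gauge, multiplied by a cutoff
function. -/
def testFields (χ : M → ℝ) (z : M) (τ : P → G) (b : Bil n)
    (α : Alt n 2 ℝ) (c : ℝ) (ξ : Alt n 1 (Euc d)) : Q.Fields :=
  (fun x => (χ x • pullBilin b (coframe I z x) : Bil n),
    fun x => (χ x • α.compContinuousLinearMap (coframe I z x) : Alt n 2 ℝ), fun x => χ x * c,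
    fun p => (χ (Q.proj p) • (Ad (τ p)⁻¹).compContinuousAlternatingMap
      (ξ.compContinuousLinearMap (coframe I z (Q.proj p))) : Alt n 1 (Euc d)))

section

variable {χ : M → ℝ} (hχ : ContMDiff I 𝓘(ℝ, ℝ) ∞ χ) (hχU : tsupport χ ⊆ (chartAt H z).source ∩ U)
  {b : Bil n} (hb : ∀ u v, b u v = b v u)
  (α : Alt n 2 ℝ) (c : ℝ) (ξ : Alt n 1 (Euc d))

include hs in
lemma IsSection.coord_section {x : M} (hx : x ∈ U) : τ (s x) = 1 := by
  have h1 : Q.proj (s x) ∈ U := by rwa [hs.proj_section x hx]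
  have h2 := hs.act_section (s x) h1
  rw [hs.proj_section x hx] at h2
  have h3 := hs.coord_act (s x) (τ (s x)) h1
  rw [h2] at h3
  exact left_eq_mul.1 h3

omit hs in
/-- An equivariant family of forms is smooth if it is smooth along local sections. -/
lemma isAdForm_of_secForm {σ : Q.PForm (Euc d) k}
    (heq : ∀ p a, Q.valForm σ (Q.act p a) = (Ad a⁻¹).compContinuousAlternatingMap (Q.valForm σ p))
    (h : ∀ x, ∃ (U : Set M) (s : M → P) (τ : P → G), Q.IsSection U s τ ∧ ∃ W, IsOpen W ∧ x ∈ U ∩ W ∧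
      ∀ x₀, SmoothOn (secForm σ s x₀)
        ((ch I x₀).target ∩ ich I x₀ ⁻¹' (U ∩ W))) : Q.IsAdForm σ where
  equivariant p a w := congrArg (· w) (heq p a)
  smooth x₀ p hp := by
    obtain ⟨U, s, τ, hs, W, hW, hx, hsm⟩ := h (Q.proj p)
    have hN : Q.proj ⁻¹' (U ∩ W ∩ (chartAt H x₀).source) ∈ 𝓝 p :=
      (((hs.isOpen.inter hW).inter (chartAt H x₀).open_source).preimage
        Q.smooth_proj.continuous).mem_nhds ⟨hx, hp⟩
    have h1 : ContMDiffOn IP 𝓘(ℝ, Alt n k (Euc d)) ∞ (fun q => secForm σ s x₀ (ch I x₀ (Q.proj q)))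
        (Q.proj ⁻¹' (U ∩ W ∩ (chartAt H x₀).source)) :=
      (hsm x₀).contMDiffOn.comp ((contMDiffOn_extChartAt (x := x₀) (n := ∞)).comp
        Q.smooth_proj.contMDiffOn fun q hq => hq.2)
        fun q hq => mem_source_of_mem_preimage inter_subset_right hq |>.imp_right fun h => h.1
    have h2 : ContMDiffOn IP 𝓘(ℝ, Lin d) ∞ (fun q => (Ad (τ q)⁻¹ : Lin d))
        (Q.proj ⁻¹' (U ∩ W ∩ (chartAt H x₀).source)) :=
      ((contMDiff_Ad.comp (contMDiff_inv IE d ∞)).comp_contMDiffOn hs.smooth_coord).mono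
        fun q hq => hq.1.1
    have h3 := (ContinuousLinearMap.contMDiff (F := (Alt n k (Euc d)) →L[ℝ]
      Alt n k (Euc d)) (n := ∞) (compContinuousAlternatingMapCLM ℝ
      (Euc n) (Euc d) (Euc d) (Fin k))).comp_contMDiffOn h2
    refine ((((h3.clm_apply h1).congr fun q hq => ?_).contMDiffAt hN)).contMDiffWithinAt
    have h4 := congrArg (Q.locP x₀ σ) (hs.act_section q hq.1.1)
    rw [locP_act (heq _ _)] at h4
    refine h4.symm.trans ?_
    simp only [secForm, Function.comp_apply]
    rw [(ch I x₀).left_inv (by simpa using hq.2)]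
    rfl

lemma coframe_comp_fr {x₀ : M} (hy : y ∈ transDom I x₀ z) :
    (coframe I z (ich I x₀ y)).comp (fr I x₀ (ich I x₀ y)) =
      fderivWithin ℝ (chartTrans I x₀ z) (range I) y :=
  (coframe_comp_frame (symm_mem_source hy.1) hy.2).trans (tangentCoordChange_eq_fderivWithin hy)

include hχ hχU in
lemma smooth_bump {E : Type*} [NormedAddCommGroup E] [NormedSpace ℝ E] {x₀ : M}
    {Φ : (Lin n) → E} (hΦ : ContDiff ℝ ∞ Φ) : SmoothOn (fun y =>
      χ (ich I x₀ y) • Φ ((coframe I z (ich I x₀ y)).comp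
        (fr I x₀ (ich I x₀ y)))) (ch I x₀).target := by
  have hc : ∀ y ∈ (ch I x₀).target, y ∉ transDom I x₀ z →
      ∀ᶠ y' in 𝓝[(ch I x₀).target] y, χ (ich I x₀ y') = 0 := by
    intro y hy h
    have h1 : ich I x₀ y ∉ tsupport χ := fun h2 => h ⟨hy, (hχU h2).1⟩
    exact ((continuousOn_extChartAt_symm x₀ y hy).eventually
      ((isClosed_tsupport χ).isOpen_compl.mem_nhds h1)).mono fun y' h' => image_eq_zero_of_notMem_tsupport h'
  have hχ' := (smooth_comp_symm (hχ.contMDiffOn (s := univ)) x₀).mono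
    (fun y (hy : y ∈ (ch I x₀).target) => ⟨hy, mem_univ _⟩)
  intro y hy
  by_cases h : y ∈ transDom I x₀ z
  · have hN : transDom I x₀ z ∈ 𝓝[(ch I x₀).target] y :=
      nhdsWithin_mono _ (extChartAt_target_subset_range x₀) (transDom_mem_nhds h)
    refine (hχ' y hy).smul ((ContDiffWithinAt.congr (f := fun y' => Φ (fderivWithin ℝ
      (chartTrans I x₀ z) (range I) y')) (s := transDom I x₀ z) ?_
      (fun y' hy' => congrArg Φ (coframe_comp_fr hy')) (congrArg Φ (coframe_comp_fr h))).mono_of_mem_nhdsWithin hN)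
    exact hΦ.contDiffAt.comp_contDiffWithinAt y (smooth_fderivWithin_chartTrans x₀ z y h)
  · refine (contDiffWithinAt_const (c := (0 : E))).congr_of_eventuallyEq
      ((hc y hy h).mono fun y' hy' => ?_) ?_
    · simp only [hy', zero_smul]
    · simp only [(hc y hy h).self_of_nhdsWithin hy, zero_smul]

include hs hχ hχU in
lemma IsSection.isAdForm_testFields : Q.IsAdForm (testFields (Q := Q) χ z τ b α c ξ).2.2.2 := by
  have h0 : ∀ x, x ∉ U → χ x = 0 := fun x hx =>
    image_eq_zero_of_notMem_tsupport fun h => hx (hχU h).2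
  refine isAdForm_of_secForm (fun p a => ?_) fun x => ?_
  · ext w : 1
    have e1 := Q.proj_act p a
    change χ (Q.proj (Q.act p a)) • Ad (τ (Q.act p a))⁻¹ (ξ.compContinuousLinearMap
      (coframe I z (Q.proj (Q.act p a))) w) = Ad a⁻¹ (χ (Q.proj p) • Ad (τ p)⁻¹
      (ξ.compContinuousLinearMap (coframe I z (Q.proj p)) w))
    rw [e1]
    by_cases hp : Q.proj p ∈ U
    · rw [hs.coord_act p a hp, mul_inv_rev, Ad_mul, map_smul]; rfl
    · rw [h0 _ hp, zero_smul, zero_smul, map_zero]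
  · by_cases hx : x ∈ U
    · refine ⟨U, s, τ, hs, univ, isOpen_univ, ⟨hx, mem_univ _⟩, fun x₀ => ((smooth_bump
        (x₀ := x₀) hχ hχU (contDiff_compContinuousLinearMap ξ)).mono inter_subset_left).congr
        fun y hy => ?_⟩
      unfold secForm
      rw [locP_of_proj_eq _ (hs.proj_section _ hy.2.1)]
      ext w : 1
      change χ (Q.proj (s _)) • Ad (τ (s _))⁻¹ (ξ fun i => coframe I z (Q.proj (s _)) _) = _
      rw [hs.proj_section _ hy.2.1, hs.coord_section hy.2.1, inv_one, Ad_one]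
      rfl
    · obtain ⟨U', s', τ', hs', hx'⟩ := Q.exists_section_at x
      refine ⟨U', s', τ', hs', (tsupport χ)ᶜ, (isClosed_tsupport χ).isOpen_compl,
        ⟨hx', fun h => hx (hχU h).2⟩, fun x₀ => (contDiffOn_const (c := 0)).congr fun y hy => ?_⟩
      unfold secForm
      rw [locP_of_proj_eq _ (hs'.proj_section _ hy.2.1)]
      ext w : 1
      change χ (Q.proj (s' _)) • (_ : Euc d) = _
      rw [hs'.proj_section _ hy.2.1, image_eq_zero_of_notMem_tsupport hy.2.2, zero_smul]
      rfl

include hs hχ hχU hb in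
lemma IsSection.isSmoothFields_testFields : IsSmoothFields (testFields (Q := Q) χ z τ b α c ξ) where
  smooth_bilin _ := (smooth_bump hχ hχU (contDiff_pullBilin b)).congr fun _ _ => rfl
  symm_bilin x _ _ := congrArg (χ x * ·) (hb _ _)
  smooth_two _ := (smooth_bump hχ hχU (contDiff_compContinuousLinearMap α)).congr fun _ _ => rfl
  smooth_scalar := hχ.mul contMDiff_const
  isAdForm := hs.isAdForm_testFields hχ hχU α c ξ

include hs in
lemma IsSection.loc_testFields (hy : y ∈ coordDom I z U) (h1 : χ (ich I z y) = 1) :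
    locBilin z (testFields (Q := Q) χ z τ b α c ξ).1 y = b ∧
      locForm z (testFields (Q := Q) χ z τ b α c ξ).2.1 y = α ∧
      secForm (testFields (Q := Q) χ z τ b α c ξ).2.2.2 s z y = ξ := by
  obtain ⟨x, hx⟩ : ∃ x, ich I z y = x := ⟨_, rfl⟩
  have hT := coordDom_subset z U hy
  have hxU : x ∈ U := hx ▸ hT.2
  have hc : ∀ v, coframe I z x (fr I z x v) = v := coframe_fr (hx ▸ symm_mem_source hT.1)
  rw [hx] at h1
  refine ⟨?_, ?_, ?_⟩
  · ext1 u; ext1 v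
    unfold locBilin
    rw [hx]
    change χ x • b (coframe I z x (fr I z x u)) (coframe I z x (fr I z x v)) = _
    rw [hc, hc, h1, one_smul]
  · ext w : 1
    unfold locForm
    rw [hx]
    change χ x • α (fun i => coframe I z x (fr I z x (w i))) = _
    simp only [hc, h1, one_smul]
  · unfold secForm
    rw [hx, locP_of_proj_eq _ (hs.proj_section x hxU)]
    ext w : 1
    change χ (Q.proj (s x)) • Ad (τ (s x))⁻¹ (ξ fun i => coframe I z (Q.proj (s x)) (fr I z x (w i))) = _
    rw [hs.proj_section x hxU, hs.coord_section hxU, inv_one, Ad_one, h1, one_smul]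
    simp only [hc]
    rfl

end

/-! ### The Euler-Lagrange equations -/

section

/-- The beta functions of a tuple of fields vanish at a point of a chart, with derivatives taken
within the set `R`. -/
def LocBetas (R : Set (Euc n)) (A : Form IP P (Euc d) 1) (H₀ : Form I M ℝ 3) (Λ : ℝ) (s : M → P)
    (z : M) (f : Q.Fields) (y : Euc n) : Prop :=
  BetasVanish R (locBilin z f.1) (killing G) (fun y => f.2.2.1 (ich I z y))
    (locF A s z f) (locH A H₀ z f) (covLoc R A s z f (expF A s z f)) Λ y

lemma locBetas_iff_univ (hy : y ∈ interior (range I)) :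
    LocBetas (range I) A H₀ Λ s z f y ↔ LocBetas univ A H₀ Λ s z f y := by
  have h : covLoc (range I) A s z f (expF A s z f) y = covLoc univ A s z f (expF A s z f) y := by
    rw [covLoc, covLoc, fderivWithin_univ, fderivWithin_of_mem_nhds (mem_interior_iff_mem_nhds.1 hy)]
  unfold LocBetas
  rw [betasVanish_iff_univ hy]
  unfold BetasVanish
  rw [h]

lemma locEL_eq_zero_of_locBetas (h : LocBetas univ A H₀ Λ s z f y) (v : Q.Fields) :
    locEL A H₀ Λ s z f v y = 0 := by
  obtain ⟨h1, h2, h3, h4⟩ := h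
  rw [locEL, eulerLagrange, h2, funext h3, funext h4, sum_eq_zero fun i _ =>
    sum_eq_zero fun j _ => by rw [h1, mul_zero]]
  simp [mPair]

include hs hA hH₀ hf hd

lemma IsSection.locBetas_univ_of_critical [T2Space M] [SecondCountableTopology M]
    [MeasurableSpace M] [BorelSpace M] (hκ : ∀ u : Euc d, (∀ v, killing G u v = 0) → u = 0)
    (hcr : Critical A H₀ Λ f) (hy : y ∈ coordDom I z U) :
    LocBetas univ A H₀ Λ s z f y := by
  refine (hs.isLocMetric hf hd z).betasVanish hy killing_comm hκ fun b c ξ α hb => ?_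
  have hT := coordDom_subset z U hy
  obtain ⟨χ, -, hχ⟩ := (SmoothBumpFunction.nhds_basis_tsupport (I := I)
    (ich I z y)).mem_iff.1 (((chartAt H z).open_source.inter hs.isOpen).mem_nhds
      ⟨symm_mem_source hT.1, hT.2⟩)
  have hv := hs.isSmoothFields_testFields χ.contMDiff hχ hb (α + (1 / 2 : ℝ) • wK G ξ
    (secForm f.2.2.2 s z y)) c ξ
  obtain ⟨e1, e2, e3⟩ := hs.loc_testFields (χ := χ) (b := b) (α + (1 / 2 : ℝ) • wK G ξ
    (secForm f.2.2.2 s z y)) c ξ hy χ.eq_one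
  have h := hs.locEL_eq_zero_of_critical hA hH₀ hf hv hd hcr hy
  have e4 : (testFields (Q := Q) χ z τ b (α + (1 / 2 : ℝ) • wK G ξ
    (secForm f.2.2.2 s z y)) c ξ).2.2.1 (ich I z y) = c :=
    (congrArg (· * c) χ.eq_one).trans (one_mul c)
  simp only [locEL, eulerLagrange, raise, trBilin, locC, e1, e2, e3] at h
  rw [e4, add_sub_cancel_right] at h
  exact h

/-- The beta functions vanish up to the boundary. -/
lemma IsSection.locBetas_of_critical [T2Space M] [SecondCountableTopology M]
    [MeasurableSpace M] [BorelSpace M] (hκ : ∀ u : Euc d, (∀ v, killing G u v = 0) → u = 0)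
    (hcr : Critical A H₀ Λ f)
    (hy : y ∈ dom I z U) :
    LocBetas (range I) A H₀ Λ s z f y := by
  have hyR := extChartAt_target_subset_range z hy.1
  have hN := dom_mem_nhds hy.1 hs.isOpen hy.2
  have c1 := (hs.smooth_locF hA hf z y hy).mono_of_mem_nhdsWithin hN
  have c2 := (hs.smooth_locH hA hH₀ hf z y hy).mono_of_mem_nhdsWithin hN
  have c3 := ((hf.scalar (z := z) y hy.1).mono inter_subset_left).mono_of_mem_nhdsWithin hN
  have c4 := ((hf.smooth_bilin z y hy.1).mono inter_subset_left).mono_of_mem_nhdsWithin hN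
  have c5 : ContDiffWithinAt ℝ ∞ (expF A s z f) (range I) y :=
    (contDiffWithinAt_const.mul c3).exp.smul c1
  have hE : SmoothOn (expF A s z f) (dom I z U) :=
    ((contDiffOn_const.mul ((hf.scalar (z := z)).mono inter_subset_left)).exp).smul
      (hs.smooth_locF hA hf z)
  have c6 : ContDiffWithinAt ℝ ∞ (covLoc (range I) A s z f (expF A s z f)) (range I) y :=
    ((c5.fderivWithin_right I.uniqueDiffOn (by simp) hyR).add
      ((smooth_oneTensor (adRep G) (smooth_ofLin (hs.smooth_gauge hA z)) hE y
        hy).mono_of_mem_nhdsWithin hN)).add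
      ((smooth_oneTensor (lieBr G) (hs.smooth_secForm hf.isAdForm z) hE y
        hy).mono_of_mem_nhdsWithin hN)
  have hdet : (gram (locBilin z f.1 y)).det ≠ 0 := by
    exact (det_gram_pullBilin (f.1 (ich I z y)) (frame I z _)).trans_ne
      (mul_ne_zero (pow_ne_zero 2 (mat_frame_det_ne_zero (symm_mem_source hy.1))) (hd _))
  have hsub : coordDom I z U ⊆ {y' ∈ range I | LocBetas (range I) A H₀ Λ s z f y'} := fun y' hy' =>
    ⟨interior_subset (coordDom_interior z U hy'), (locBetas_iff_univ (coordDom_interior z U hy')).2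
        (hs.locBetas_univ_of_critical hA hH₀ hf hd hκ hcr hy')⟩
  refine betasVanish_of_mem_closure I.uniqueDiffOn hyR c4 hdet (killingCLM G) killingCLM_apply c3 c1
    c2 c6 (closure_mono hsub ?_)
  obtain ⟨O, hO, hyO, hON⟩ := mem_nhdsWithin.1 hN
  refine mem_closure_iff.2 fun t ht hyt => ?_
  obtain ⟨y', ⟨h1, h2⟩, h3⟩ := mem_closure_iff.1 (I.range_subset_closure_interior hyR) (t ∩ O)
    (ht.inter hO) ⟨hyt, hyO⟩
  refine ⟨y', h1, mem_interior.2 ⟨O ∩ interior (range I), fun w hw => (hON ⟨hw.1, interior_subset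
    hw.2⟩).1, hO.inter isOpen_interior, h2, h3⟩, (hON ⟨h2, interior_subset h3⟩).2⟩

end

/-! ### The beta functions on the manifold -/

variable (Q) in
/-- The field strength `e^{-2φ} F'`. -/
def expField (A : Form IP P (Euc d) 1) (f : Q.Fields) : Q.PForm (Euc d) 2 := fun q =>
  exp (-2 * f.2.2.1 (Q.proj q)) • Q.fieldF A f.2.2.2 q

section

include hs in
lemma IsSection.secForm_expField (z : M) (hy : ich I z y ∈ U) :
    secForm (Q.expField A f) s z y = expF A s z f y := by
  unfold expF
  exact congrArg (fun x => exp (-2 * f.2.2.1 x) • locF A s z f y) (hs.proj_section _ hy)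

include hA hf in
lemma isAdForm_expField : Q.IsAdForm (Q.expField A f) := by
  refine isAdForm_of_secForm (fun p a => ?_) fun x => ?_
  · refine (congrArg₂ (fun x (α : Alt n 2 (Euc d)) => exp (-2 * f.2.2.1 x) • α)
      (Q.proj_act p a) (valForm_fieldF_act hA hf.isAdForm p a)).trans ?_
    ext w : 1
    exact (map_smul (Ad a⁻¹) _ _).symm
  · obtain ⟨U, s, τ, hs, hx⟩ := Q.exists_section_at x
    refine ⟨U, s, τ, hs, univ, isOpen_univ, ⟨hx, mem_univ _⟩, fun z => ?_⟩
    rw [inter_univ]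
    exact (((contDiffOn_const.mul ((hf.scalar (z := z)).mono inter_subset_left)).exp).smul
      (hs.smooth_locF hA hf z)).congr fun y hy => hs.secForm_expField z hy.2

section

variable {p : P} (hpU : Q.proj p ∈ U) (hsp : s (Q.proj p) = p)

include hsp in
lemma locF_self : locF A s (Q.proj p) f (ch I (Q.proj p) (Q.proj p)) =
    Q.valForm (Q.fieldF A f.2.2.2) p := by
  unfold locF secForm
  rw [extChartAt_to_inv, hsp]
  exact locP_self _ rfl

include hs hA hf hpU hsp

/-- The pairings of the contractions of the field strength do not depend on the gauge. -/
lemma IsSection.pairing_curryLeft_fieldF (X Y : Euc n) :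
    pairing (f.1 (Q.proj p) : Bil n) (killing G) ((Q.valForm (Q.fieldF A f.2.2.2) p).curryLeft X)
      ((Q.valForm (Q.fieldF A f.2.2.2) p).curryLeft Y) =
    adInner (G := G) f.1 (Q.proj p) ((Q.descend (Q.fieldF A f.2.2.2) (Q.proj p)).curryLeft X)
      ((Q.descend (Q.fieldF A f.2.2.2) (Q.proj p)).curryLeft Y) := by
  have h : Q.valForm (Q.fieldF A f.2.2.2) (Q.pt (Q.proj p)) = _ :=
    (congrArg (Q.valForm (Q.fieldF A f.2.2.2)) (hs.pt_eq hpU)).trans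
      (valForm_fieldF_act hA hf.isAdForm (s (Q.proj p)) (τ (Q.pt (Q.proj p))))
  rw [hsp] at h
  refine Eq.symm (Eq.trans (b := pairing (f.1 (Q.proj p) : Bil n) (killing G)
    ((Q.valForm (Q.fieldF A f.2.2.2) (Q.pt (Q.proj p))).curryLeft X)
    ((Q.valForm (Q.fieldF A f.2.2.2) (Q.pt (Q.proj p))).curryLeft Y)) rfl ?_)
  rw [h]
  exact pairing_killing_Ad (f.1 (Q.proj p) : Bil n) (τ (Q.pt (Q.proj p)))⁻¹
    ((Q.valForm (Q.fieldF A f.2.2.2) p).curryLeft X)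
    ((Q.valForm (Q.fieldF A f.2.2.2) p).curryLeft Y)

lemma IsSection.covLoc_expF : covLoc (range I) A s (Q.proj p) f (expF A s (Q.proj p) f)
    (ch I (Q.proj p) (Q.proj p)) = Q.covDer A (Q.expField A f) p +
      oneTensor (lieBr G) (f.2.2.2 p) (Q.expField A f p) := by
  have hy := mem_extChartAt_target (I := I) (Q.proj p)
  have h := hs.dlocP_hl hA (isAdForm_expField hA hf) hy (extChartAt_to_inv (Q.proj p)) hpU
  have hU : ich I (Q.proj p) (ch I (Q.proj p) (Q.proj p)) ∈ U := by rwa [extChartAt_to_inv]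
  have e : secForm (Q.expField A f) s (Q.proj p) =ᶠ[𝓝[range I] (ch I (Q.proj p) (Q.proj p))]
      expF A s (Q.proj p) f :=
    Filter.eventuallyEq_of_mem (dom_mem_nhds hy hs.isOpen hU) fun y hy => hs.secForm_expField _ hy.2
  rw [hsp, fr_self, ContinuousLinearMap.comp_id, e.fderivWithin_eq (hs.secForm_expField _ hU)] at h
  have e1 : secForm (Q.expField A f) s (Q.proj p) (ch I (Q.proj p) (Q.proj p)) =
      Q.valForm (Q.expField A f) p := by
    unfold secForm
    rw [extChartAt_to_inv, hsp]
    exact locP_self _ rfl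
  have e2 : secForm f.2.2.2 s (Q.proj p) (ch I (Q.proj p) (Q.proj p)) = Q.valForm f.2.2.2 p := by
    unfold secForm
    rw [extChartAt_to_inv, hsp]
    exact locP_self _ rfl
  unfold covLoc
  rw [extChartAt_to_inv, ← hs.secForm_expField _ hU, ← h, e1, e2]
  rfl

/-- The beta functions in the chart and gauge at a point are those of the manifold. -/
lemma IsSection.locBetas_iff :
    LocBetas (range I) A H₀ Λ s (Q.proj p) f (ch I (Q.proj p) (Q.proj p)) ↔
      (∀ X Y, Q.betaG0 A H₀ f.1 f.2.1 f.2.2.1 f.2.2.2 (Q.proj p) X Y = 0) ∧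
      Q.betaPhi0 A H₀ Λ f.1 f.2.1 f.2.2.1 f.2.2.2 (Q.proj p) = 0 ∧
      (∀ X Y, Q.betaB0 A H₀ f.1 f.2.1 f.2.2.1 f.2.2.2 (Q.proj p) X Y = 0) ∧
      ∀ X, Q.betaTheta A H₀ f.1 f.2.1 f.2.2.1 f.2.2.2 p X = 0 := by
  set x := Q.proj p with hx
  set φ := f.2.2.1 with hφ
  have hy := mem_extChartAt_target (I := I) x
  have e1 : locBilin x f.1 (ch I x x) = f.1 x := locBilin_self f.1 x
  have e2 : locF A s x f (ch I x x) = Q.valForm (Q.fieldF A f.2.2.2) p := locF_self hsp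
  have e3 : locH A H₀ x f (ch I x x) = Q.fieldH0 A H₀ f.2.1 f.2.2.2 x :=
    locForm_self (Q.fieldH0 A H₀ f.2.1 f.2.2.2) x
  have e4 : φ (ich I x (ch I x x)) = φ x := congrArg φ (extChartAt_to_inv x)
  have hdφ : ∀ y ∈ (ch I x).target, locForm x (dFun (I := I) φ) y =
      dForm (range I) (fun y => φ (ich I x y)) y := fun y hy =>
    locForm_dFun hy (hf.smooth_scalar.mdifferentiable (by simp) _)
  have e5 : dForm (range I) (fun y => φ (ich I x y)) (ch I x x) =
      dFun (I := I) φ x := (hdφ _ hy).symm.trans (locForm_self (dFun (I := I) φ) x)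
  have e6 : fderivWithin ℝ (dForm (range I) fun y => φ (ich I x y)) (range I)
      (ch I x x) = fderivWithin ℝ (locForm x (dFun (I := I) φ)) (range I)
      (ch I x x) :=
    Filter.EventuallyEq.fderivWithin_eq (Filter.eventuallyEq_of_mem (extChartAt_target_mem_nhdsWithin x)
      fun y hy => (hdφ y hy).symm) (hdφ _ hy).symm
  have hG : ∀ X Y : Euc n, betaGLoc (range I) (locBilin x f.1) (killing G)
      (fun y => φ (ich I x y)) (locF A s x f (ch I x x))
      (locH A H₀ x f (ch I x x)) (ch I x x) X Y = Q.betaG0 A H₀ f.1 f.2.1 φ f.2.2.2 x X Y := by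
    intro X Y
    have h1 : ∀ X Y : Euc n, hessForm (range I) (locBilin x f.1)
        (fun y => φ (ich I x y)) (ch I x x) X Y =
        nabla f.1 (dFun (I := I) φ) x X ![Y] := fun X Y => congrArg₂ (fun a b =>
      covForm (chris f.1 x) a b X ![Y]) e6 e5
    rw [betaGLoc, h1, h1, e1, e2, e3]
    exact congrArg (fun t => ricci f.1 x X Y + (1 / 2) * t - _ + _ + _)
      (hs.pairing_curryLeft_fieldF hA hf hpU hsp X Y)
  have hΦ : betaPhiLoc (range I) (locBilin x f.1) (killing G)
      (fun y => φ (ich I x y)) (locF A s x f (ch I x x))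
      (locH A H₀ x f (ch I x x)) Λ (ch I x x) = Q.betaPhi0 A H₀ Λ f.1 f.2.1 φ f.2.2.2 x := by
    have h1 := hs.adInner_fieldF hA hf.isAdForm f.1 hpU
    rw [hsp] at h1
    rw [betaPhiLoc, betaPhi0, e1, e2, e3, e5, e6, h1, scalarCurv_eq_scalarLoc]
    rfl
  have hB : ∀ w : Fin 2 → Euc n, betaBLoc (range I) (locBilin x f.1)
      (fun y => φ (ich I x y)) (locH A H₀ x f) (ch I x x) w =
      Q.betaB0 A H₀ f.1 f.2.1 φ f.2.2.2 x (w 0) (w 1) := by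
    intro w
    have h2 : ![w 0, w 1] = w := by ext i : 1; fin_cases i <;> rfl
    rw [betaBLoc, e1, e3, e4]
    refine Eq.trans ?_ (congrArg (fun w => (1 / 2) * exp (2 * φ x) * codiff f.1 (k := 2)
      (fun z => exp (-2 * φ z) • Q.fieldH0 A H₀ f.2.1 f.2.2.2 z) x w) h2.symm)
    rfl
  have hT : ∀ w : Fin 1 → Euc n, betaTLoc (range I) (locBilin x f.1)
      (fun y => φ (ich I x y)) (locF A s x f (ch I x x))
      (locH A H₀ x f (ch I x x))
      (covLoc (range I) A s x f (expF A s x f) (ch I x x)) (ch I x x) w =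
      Q.betaTheta A H₀ f.1 f.2.1 φ f.2.2.2 p (w 0) := by
    intro w
    have h2 : ![w 0] = w := by ext i : 1; fin_cases i; rfl
    rw [betaTLoc, hs.covLoc_expF hA hf hpU hsp, e1, e2, e3, e4, ← h2]
    rfl
  unfold LocBetas BetasVanish
  exact and_congr (forall₂_congr fun X Y => Eq.congr_left (hG X Y)) (and_congr (Eq.congr_left hΦ)
    (and_congr ⟨fun h X Y => (hB ![X, Y]).symm.trans (h _), fun h w => (hB w).trans (h _ _)⟩
      ⟨fun h X => (hT ![X]).symm.trans (h _), fun h w => (hT w).trans (h _)⟩))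

end

/-- The Euler-Lagrange equations of the action `S₀`, for a structure group with nondegenerate
Killing form. -/
lemma critical_iff [T2Space M] [SecondCountableTopology M] [MeasurableSpace M] [BorelSpace M]
    (hA : Q.IsConnection A) (hH₀ : SmoothForm H₀) (hf : IsSmoothFields f)
    (hd : ∀ x, (gram (f.1 x : Bil n)).det ≠ 0)
    (hκ : ∀ u : Euc d, (∀ v, killing G u v = 0) → u = 0) :
    Critical A H₀ Λ f ↔ (∀ x X Y, Q.betaG0 A H₀ f.1 f.2.1 f.2.2.1 f.2.2.2 x X Y = 0) ∧
      (∀ x X Y, Q.betaB0 A H₀ f.1 f.2.1 f.2.2.1 f.2.2.2 x X Y = 0) ∧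
      (∀ x, Q.betaPhi0 A H₀ Λ f.1 f.2.1 f.2.2.1 f.2.2.2 x = 0) ∧
      ∀ p X, Q.betaTheta A H₀ f.1 f.2.1 f.2.2.1 f.2.2.2 p X = 0 := by
  constructor
  · intro hcr
    refine ⟨fun x => ?_, fun x => ?_, fun x => ?_, fun p => ?_⟩
    rotate_left 3
    on_goal 2 => obtain ⟨p, rfl⟩ := Q.proj_surjective x
    on_goal 3 => obtain ⟨p, rfl⟩ := Q.proj_surjective x
    on_goal 4 => obtain ⟨p, rfl⟩ := Q.proj_surjective x
    all_goals
      obtain ⟨U, s, τ, hs, hpU, hsp, -⟩ := Q.exists_section p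
      have h := (hs.locBetas_iff hA hf hpU hsp).1 (hs.locBetas_of_critical hA hH₀ hf hd hκ hcr
        ⟨mem_extChartAt_target _, by rwa [mem_preimage, extChartAt_to_inv]⟩)
    exacts [h.2.2.2, h.1, h.2.2.1, h.2.1]
  · rintro ⟨h1, h2, h3, h4⟩
    refine critical_of_locEL_eq_zero hA hH₀ hf hd fun x hx => ?_
    obtain ⟨p, rfl⟩ := Q.proj_surjective x
    obtain ⟨U, s, τ, hs, hpU, hsp, -⟩ := Q.exists_section p
    exact ⟨U, s, τ, hs, hpU, fun v _ => locEL_eq_zero_of_locBetas ((locBetas_iff_univ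
      (coordDom_interior _ U (mem_coordDom hx hpU (mem_chart_source H _)))).1
      ((hs.locBetas_iff hA hf hpU hsp).2 ⟨h1 _, h3 _, h2 _, h4 p⟩)) v⟩

end

lemma criticalS0_iff [MeasurableSpace M] {A : Form IP P (Euc d) 1} {H₀ : Form I M ℝ 3} {Λ : ℝ}
    {f : Q.Fields} : Q.IsCriticalS0 A H₀ Λ f.1 f.2.1 f.2.2.1 f.2.2.2 ↔ Critical A H₀ Λ f := by
  constructor
  · intro h K hK hKI v hv h0
    exact h K hK hKI v.1 v.2.1 v.2.2.1 v.2.2.2 hv.smooth_bilin hv.symm_bilin hv.smooth_two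
      hv.smooth_scalar hv.isAdForm (fun x hx => ⟨(h0 x hx).1, (h0 x hx).2.1, (h0 x hx).2.2.1⟩)
      fun p hp => (h0 _ hp).2.2.2 p rfl
  · intro h K hK hKI b C ν η h1 h2 h3 h4 h5 h6 h7
    exact h K hK hKI (b, C, ν, η) ⟨h1, h2, h3, h4, h5⟩ fun x hx =>
      ⟨(h6 x hx).1, (h6 x hx).2.1, (h6 x hx).2.2, fun p hp => h7 p (hp ▸ hx)⟩

end PrincipalBundle

/-! ### The trivial structure group -/

section Trivial

open PrincipalBundle

instance : Unique (Euc 0) := ⟨⟨0⟩, fun _ => Subsingleton.elim _ _⟩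

instance : ChartedSpace (Euc 0) PUnit.{1} := ChartedSpace.ofDiscreteTopology

instance : LieGroup IE 0 ∞ PUnit.{1} where
  toIsManifold := IsManifold.of_discreteTopology _
  contMDiff_mul := contMDiff_const (c := 1)
  contMDiff_inv := contMDiff_const (c := 1)

variable {m : ℕ} {HP : Type*} [TopologicalSpace HP] {IP : ModelWithCorners ℝ (Euc m) HP}
  {P : Type*} [TopologicalSpace P] [ChartedSpace HP P] [IsManifold IP ∞ P]

variable (IP P) in
/-- The principal bundle `P → P` with trivial structure group. For it, the action `S₀` is the
action `S`. -/
def trivialBundle : PrincipalBundle (d := 0) PUnit.{1} IP IP P P where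
  proj := id
  act p _ := p
  act_one _ := rfl
  act_mul _ _ _ := rfl
  proj_act _ _ := rfl
  smooth_proj := contMDiff_id
  smooth_act := contMDiff_fst
  locally_trivial x := ⟨
    { (Homeomorph.prodPUnit P).symm.toOpenPartialHomeomorph with
      baseSet := univ
      open_baseSet := isOpen_univ
      source_eq := rfl
      target_eq := by simp
      proj_toFun := fun _ _ => rfl }, Set.mem_univ x,
    (contMDiff_id.prodMk contMDiff_const).contMDiffOn, contMDiff_fst.contMDiffOn, fun _ _ _ => rfl⟩

instance {k : ℕ} : Subsingleton (Alt m k (Euc 0)) :=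
  ⟨fun _ _ => ContinuousAlternatingMap.ext fun _ => Subsingleton.elim _ _⟩

lemma add_half_eq {c : ℝ} (h : c = 0) (a : ℝ) : a + 1 / 2 * c = a := by rw [h, mul_zero, add_zero]

lemma adInner_trivial (g : Bilin IP P) (x : P) {k : ℕ} (α β : Alt m k (Euc 0)) :
    adInner (G := PUnit.{1}) g x α β = 0 := by
  simp [adInner, pairing, Subsingleton.elim _ (0 : Euc 0)]

lemma wedge_trivial {k : ℕ} (α : Alt m 1 (Euc 0)) (β : Alt m k (Euc 0)) :
    wedge (killingCLM PUnit.{1}) α β = 0 := by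
  ext w
  simp [wedge_apply, Subsingleton.elim _ (0 : Euc 0)]

lemma fieldH0_trivial (A : Form IP P (Euc 0) 1) (H : Form IP P ℝ 3) (B : Form IP P ℝ 2)
    (ϑ : (trivialBundle IP P).PForm (Euc 0) 1) :
    (trivialBundle IP P).fieldH0 A H B ϑ = fieldH H B := by
  funext x
  have h : ∀ (a : Alt m 3 ℝ) (α : Alt m 1 (Euc 0))
      (β γ δ : Alt m 2 (Euc 0)), a - (1 / 2 : ℝ) • (wedge (killingCLM PUnit.{1}) α β +
        (1 / 3 : ℝ) • wedge (killingCLM PUnit.{1}) α γ) - wedge (killingCLM PUnit.{1}) α δ = a := by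
    intro a α β γ δ
    simp [wedge_trivial]
  exact h _ _ _ _ _

lemma criticalS_iff [MeasurableSpace P] {A : Form IP P (Euc 0) 1} {H : Form IP P ℝ 3} {Λ : ℝ}
    {g : Bilin IP P} {B : Form IP P ℝ 2} {φ : P → ℝ} :
    IsCriticalS H Λ g B φ ↔ Critical (Q := trivialBundle IP P) A H Λ (g, B, φ, 0) := by
  have e : ∀ (K : Set P) (f : (trivialBundle IP P).Fields), ∫ x in K, lagrangian A H Λ f x ∂(vol f.1) =
      actionS H Λ K f.1 f.2.1 f.2.2.1 := by
    intro K f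
    refine integral_congr_ae (Filter.Eventually.of_forall fun x => ?_)
    have h := add_half_eq (adInner_trivial f.1 x ((trivialBundle IP P).descend
      ((trivialBundle IP P).fieldF A f.2.2.2) x) ((trivialBundle IP P).descend
      ((trivialBundle IP P).fieldF A f.2.2.2) x))
    simp only [lagrangian, fieldH0_trivial]
    exact congrArg (fun t => exp (-2 * f.2.2.1 x) * (t - _ + _ - 2 * Λ)) (h _)
  constructor
  · intro h K hK hKI v hv h0
    simp only [e]
    exact h K hK hKI v.1 v.2.1 v.2.2.1 hv.smooth_bilin hv.symm_bilin hv.smooth_two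
      hv.smooth_scalar (fun x hx => ⟨(h0 x hx).1, (h0 x hx).2.1, (h0 x hx).2.2.1⟩)
  · intro h K hK hKI b C ν h1 h2 h3 h4 h6
    have := h K hK hKI (b, C, ν, 0) ⟨h1, h2, h3, h4, fun _ _ _ => Subsingleton.elim _ _,
      fun _ => contMDiff_of_subsingleton.contMDiffOn⟩ fun x hx =>
      ⟨(h6 x hx).1, (h6 x hx).2.1, (h6 x hx).2.2, fun p hp => rfl⟩
    simp only [e] at this
    exact this

variable [T2Space P] [SecondCountableTopology P] [MeasurableSpace P] [BorelSpace P]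

lemma isCriticalS_iff_betas {H : Form IP P ℝ 3} {Λ : ℝ} {g : Bilin IP P} {B : Form IP P ℝ 2}
    {φ : P → ℝ} (hH : SmoothForm H) (hg : IsMetric g) (hB : SmoothForm B)
    (hφ : ContMDiff IP 𝓘(ℝ, ℝ) ∞ φ) : IsCriticalS H Λ g B φ ↔ (∀ x X Y, betaG H g B φ x X Y = 0) ∧
      (∀ x X Y, betaB H g B φ x X Y = 0) ∧ ∀ x, betaPhi H Λ g B φ x = 0 := by
  have h := critical_iff (Q := trivialBundle IP P) (A := 0) (H₀ := H) (Λ := Λ)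
    (f := (g, B, φ, 0)) ⟨fun _ => contDiff_of_subsingleton.contDiffOn,
      fun _ _ => Subsingleton.elim _ _, fun _ _ _ => Subsingleton.elim _ _⟩ hH ⟨hg.smooth, hg.symm,
      hB, hφ, fun _ _ _ => Subsingleton.elim _ _, fun _ => contMDiff_of_subsingleton.contMDiffOn⟩
    (fun x => det_gram_ne_zero (hg.nondegenerate x)) fun _ _ => Subsingleton.elim _ _
  have e1 : ∀ x X Y, (trivialBundle IP P).betaG0 0 H g B φ 0 x X Y = betaG H g B φ x X Y := by
    intro x X Y
    simp only [betaG0, fieldH0_trivial]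
    exact congrArg (fun t => t - _ + _ + _) (add_half_eq (adInner_trivial g x _ _) _)
  have e2 : ∀ x, (trivialBundle IP P).betaPhi0 0 H Λ g B φ 0 x = betaPhi H Λ g B φ x := by
    intro x
    simp only [betaPhi0, fieldH0_trivial]
    exact congrArg (fun t => t - _ + _ - _ - 2 * Λ) (add_half_eq (adInner_trivial g x _ _) _)
  have e3 : ∀ x X Y, (trivialBundle IP P).betaB0 0 H g B φ 0 x X Y = betaB H g B φ x X Y := by
    intro x X Y
    simp only [betaB0, betaB, fieldH0_trivial]
  refine criticalS_iff.trans (h.trans (and_congr (forall_congr' fun x => forall₂_congr fun X Y => by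
    exact ⟨(e1 x X Y).symm.trans, (e1 x X Y).trans⟩) (and_congr (forall_congr' fun x =>
    forall₂_congr fun X Y => by exact ⟨(e3 x X Y).symm.trans, (e3 x X Y).trans⟩) ?_)))
  exact (and_iff_left fun _ _ => Subsingleton.elim _ _).trans
    (forall_congr' fun x => ⟨(e2 x).symm.trans, (e2 x).trans⟩)

end Trivial

end StringEOM

end

theorem theorem2 {m n d : ℕ} {HP H : Type*} [TopologicalSpace HP] [TopologicalSpace H]
    (IP : ModelWithCorners ℝ (StringEOM.Euc m) HP) (I : ModelWithCorners ℝ (StringEOM.Euc n) H)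
    (G : Type*) [TopologicalSpace G] [ChartedSpace (StringEOM.Euc d) G] [Group G]
    [LieGroup 𝓘(ℝ, StringEOM.Euc d) ∞ G]
    [LieAlgebra.IsSemisimple ℝ (StringEOM.LieAlg (d := d) G)]
    (P : Type*) [TopologicalSpace P] [ChartedSpace HP P] [IsManifold IP ∞ P] [T2Space P]
    [SecondCountableTopology P] [MeasurableSpace P] [BorelSpace P]
    (M : Type*) [TopologicalSpace M] [ChartedSpace H M] [IsManifold I ∞ M] [T2Space M]
    [SecondCountableTopology M] [MeasurableSpace M] [BorelSpace M]
    (𝓟 : StringEOM.PrincipalBundle (d := d) G IP I P M)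
    (A : StringEOM.Form IP P (StringEOM.Euc d) 1) (hA : 𝓟.IsConnection A) :
    (∀ (H3 : StringEOM.Form IP P ℝ 3) (Λ : ℝ) (g : StringEOM.Bilin IP P)
        (B : StringEOM.Form IP P ℝ 2) (φ : P → ℝ),
      StringEOM.SmoothForm H3 → StringEOM.IsMetric g → StringEOM.SmoothForm B →
      ContMDiff IP 𝓘(ℝ, ℝ) ∞ φ →
      (StringEOM.IsCriticalS H3 Λ g B φ ↔
        (∀ x X Y, StringEOM.betaG H3 g B φ x X Y = 0) ∧
        (∀ x X Y, StringEOM.betaB H3 g B φ x X Y = 0) ∧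
        (∀ x, StringEOM.betaPhi H3 Λ g B φ x = 0))) ∧
    (∀ (H₀ : StringEOM.Form I M ℝ 3) (Λ₀ : ℝ) (g₀ : StringEOM.Bilin I M)
        (B₀ : StringEOM.Form I M ℝ 2) (φ₀ : M → ℝ) (ϑ : 𝓟.PForm (StringEOM.Euc d) 1),
      StringEOM.SmoothForm H₀ → StringEOM.IsMetric g₀ → StringEOM.SmoothForm B₀ →
      ContMDiff I 𝓘(ℝ, ℝ) ∞ φ₀ → 𝓟.IsAdForm ϑ →
      (𝓟.IsCriticalS0 A H₀ Λ₀ g₀ B₀ φ₀ ϑ ↔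
        (∀ x X Y, 𝓟.betaG0 A H₀ g₀ B₀ φ₀ ϑ x X Y = 0) ∧
        (∀ x X Y, 𝓟.betaB0 A H₀ g₀ B₀ φ₀ ϑ x X Y = 0) ∧
        (∀ x, 𝓟.betaPhi0 A H₀ Λ₀ g₀ B₀ φ₀ ϑ x = 0) ∧
        (∀ p X, 𝓟.betaTheta A H₀ g₀ B₀ φ₀ ϑ p X = 0))) := by
  refine ⟨fun H3 Λ g B φ hH hg hB hφ => StringEOM.isCriticalS_iff_betas hH hg hB hφ,
    fun H₀ Λ₀ g₀ B₀ φ₀ ϑ hH hg hB hφ hϑ => ?_⟩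
  exact (StringEOM.PrincipalBundle.criticalS0_iff (f := (g₀, B₀, φ₀, ϑ))).trans
    (StringEOM.PrincipalBundle.critical_iff hA hH ⟨hg.smooth, hg.symm, hB, hφ, hϑ⟩
      (fun x => StringEOM.det_gram_ne_zero (hg.nondegenerate x))
      fun _ h => StringEOM.killing_nondegenerate h)
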